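/- Let $d\in\mathbb N$, $\varepsilon>0$, $D=d+2d^2$ and $\Omega_n=\begin{pmatrix}0&\mathrm{Id}_n\\-\mathrm{Id}_n&0\end{pmatrix}$. Let $h:\mathbb R\times\mathbb R^{2d}\to\mathbb R$ be measurable in $t$ and smooth in $z=(x,\xi)$, such that * (exponential growth) for all $t$ and $\mathbf k\in\mathbb N^{2d}$ there are constants $C,\beta$ with $|\partial_z^{\mathbf k}h(t,z)|\le C\exp(\beta\|z\|_2)$ for all $z$; * (subquadratic growth) for all $|\mathbf k|\ge2$ there is $C_{\mathbf k}\in L^1_{\rm loc}(\mathbb R)$ with $|\partial_z^{\mathbf k}h(t,z)|\le C_{\mathbf k}(t)$ for all $t,z$. Let $\mathcal H(t)=\mathrm{op}(h(t,\cdot))$ be the semiclassical Weyl quantization on $L^2(\mathbb R^d)$, given by $\langle\varphi,\mathrm{op}(a)\psi\rangle=\int_{\mathbb R^{2d}}a(z)\,\mathcal W_{\varphi,\psi}(z)\,dz$ for all Schwartz functions $\varphi$, where $\mathcal W_{\varphi,\psi}(x,\xi)=(2\pi\varepsilon)^{-d}\int\overline{\varphi(x+\tfrac y2)}\,\psi(x-\tfrac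 y2)\,e^{i\xi\cdot y/\varepsilon}dy$. Let $\mathcal M\subset L^2(\mathbb R^d)$ be the set of Gaussians $\exp\big(\tfrac i\varepsilon(\tfrac12(x-q)^\top C(x-q)+p^\top(x-q)+\zeta)\big)$ with $q,p\in\mathbb R^d$, $C=C^\top\in\mathbb C^{d\times d}$, $\Im C>0$, $\zeta\in\mathbb C$. Let $\mathcal P_u$ be the orthogonal projection onto $\mathcal T_u\mathcal M=\{\varphi u:\varphi\text{ a complex polynomial of degree}\le2\}$. A variational approximation on an interval $I$ is a curve $u:I\to\mathcal M$ with $u(t)$ in the domain of $\mathcal H(t)$ for every $t\in I$, solving the Dirac–Frenkel equation $i\varepsilon\,\partial_tu=\mathcal P_{u}(\mathcal H(t)u)$. We say that $u$ has Hagedorn parameters $(q,p,Q,P)$ if $Q,P\in\mathbb C^{d\times d}$ are invertible, $Y=\begin{pmatrix}\Re Q&\Im Q\\\Re P&\Im P\end{pmatrix}$ satisfies $Y^\top\Omega_dY=\Omega_d$, and for some $S\in\mathbb R$ and some choice of the square root $$u(x)=\frac{(\varepsilon\pi)^{-d/4}}{\det(Q)^{1/2}}\exp\Big(\frac i\varepsilon\Big(\frac12(x-q)^\top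 PQ^{-1}(x-q)+p^\top(x-q)+S\Big)\Big).$$ The canonical coordinates are $\bar z=(\bar q,\bar p)\in\mathbb R^{2D}$ with $\bar q=(q,\sqrt{\varepsilon/2}\,\mathrm{vec}\,\Re Q,\sqrt{\varepsilon/2}\,\mathrm{vec}\,\Im Q)$ and $\bar p=(p,\sqrt{\varepsilon/2}\,\mathrm{vec}\,\Re P,\sqrt{\varepsilon/2}\,\mathrm{vec}\,\Im P)$. With $Y_\varepsilon=\sqrt{\varepsilon/2}\,Y$ and $z=(q,p)$, the averaged Hamiltonian $\bar h(t,\cdot):\mathbb R^{2D}\to\mathbb R$ is $$\bar h(t,\bar z)=(2\pi)^{-d}\int_{\mathbb R^{2d}}h(t,Y_\varepsilon\zeta+z)\,e^{-\frac12\zeta^\top\zeta}\,d\zeta .$$ Both evolution equations are understood in integrated (Carathéodory) form: the right-hand side along the curve is locally integrable in time on $I$ and the curve is its integral; in particular they hold pointwise at interior times near which the right-hand side is continuous in $t$. **Claim.** For every $t$, the integral defining $\bar h(t,\cdot)$ converges absolutely and $\bar h(t,\cdot)$ is differentiable. If $u$ has Hagedorn parameters with canonical coordinates $\bar z$, then $u$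 is in the domain of $\mathcal H(t)$ and $\bar h(t,\bar z)=\langle u,\mathcal H(t)u\rangle=\langle h(t,\cdot)\rangle_u$. Let $I\subset\mathbb R$ be an interval and $t_0\in I$. 1. Let $u$ be a variational approximation on $I$ and let $(q_0,p_0,Q_0,P_0)$ be Hagedorn parameters of $u(t_0)$. Then there are curves $q,p,Q,P$ on $I$ with these values at $t_0$ such that $(q(t),p(t),Q(t),P(t))$ are Hagedorn parameters of $u(t)$ for all $t\in I$ and the canonical coordinates satisfy $$\dot{\bar z}(t)=\Omega_D\nabla_{\bar z}\bar h(t,\bar z(t)).$$ 2. Conversely, let $\bar z$ solve this system on $I$, with parameters $(q,p,Q,P)$, let $t\mapsto\bar h(t,\bar z(t))$ be locally integrable on $I$, and let $u_0$ have Hagedorn parameters $(q,p,Q,P)(t_0)$. Then there is a variational approximation $u$ on $I$ with $u(t_0)=u_0$ such that $u(t)$ has Hagedorn parameters $(q,p,Q,P)(t)$ for all $t\in I$. -/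

import Mathlib

open MeasureTheory Complex
open scoped Matrix ContDiff ComplexConjugate

noncomputable section

namespace GaussianWavePacket

/-! ### Spaces -/

/-- Position space `ℝ^d`. -/
abbrev Pos (d : ℕ) : Type := EuclideanSpace ℝ (Fin d)

/-- Classical phase space `ℝ^{2d}` with points `(x, ξ)`. -/
abbrev Phase (d : ℕ) : Type := EuclideanSpace ℝ (Fin d ⊕ Fin d)

/-- The Hilbert space `L²(ℝ^d, ℂ)`; its inner product is conjugate-linear in the first slot. -/
abbrev Hilb (d : ℕ) : Type := Lp ℂ 2 (volume : Measure (Pos d))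

/-- Indices of the `D = d + 2 d²` entries of `(q, vec Re Q, vec Im Q)`; an entry of `vec` is
indexed by the pair (column, row). -/
abbrev Coord (d : ℕ) : Type := Fin d ⊕ ((Fin d × Fin d) ⊕ (Fin d × Fin d))

/-- The parameter space `ℝ^{2D}` with points `(𝐪, 𝐩)`. -/
abbrev Param (d : ℕ) : Type := EuclideanSpace ℝ (Coord d ⊕ Coord d)

/-- The standard symplectic matrix `Ω = (0, 1; -1, 0)`. -/
def Omega (l : Type) [DecidableEq l] : Matrix (l ⊕ l) (l ⊕ l) ℝ :=
  Matrix.fromBlocks 0 1 (-1) 0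

/-! ### Gaussian wave packets -/

/-- `exp (i/ε (½ (x-q)ᵀ C (x-q) + pᵀ (x-q) + ζ))`. -/
def gaussian {d : ℕ} (ε : ℝ) (q p : Pos d) (C : Matrix (Fin d) (Fin d) ℂ) (ζ : ℂ) (x : Pos d) :
    ℂ :=
  let y : Fin d → ℂ := fun i => ((x i - q i : ℝ) : ℂ)
  cexp (I / (ε : ℂ) * ((1 / 2 : ℂ) * (y ⬝ᵥ C *ᵥ y) + (fun i => ((p i : ℝ) : ℂ)) ⬝ᵥ y + ζ))

/-- The manifold `𝓜` of complex Gaussians with symmetric width matrix `C`, `Im C > 0`. -/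
def gaussianManifold (d : ℕ) (ε : ℝ) : Set (Hilb d) :=
  {u | ∃ (q p : Pos d) (C : Matrix (Fin d) (Fin d) ℂ) (ζ : ℂ),
    Cᵀ = C ∧ (C.map Complex.im).PosDef ∧ ⇑u =ᵐ[volume] gaussian ε q p C ζ}

/-- The tangent space `{φ u : φ a complex polynomial of degree at most 2}`. -/
def tangentSpace {d : ℕ} (u : Hilb d) : Submodule ℂ (Hilb d) where
  carrier := {f | ∃ φ : MvPolynomial (Fin d) ℂ, φ.totalDegree ≤ 2 ∧
    ⇑f =ᵐ[volume] fun x => MvPolynomial.eval (fun i => ((x i : ℝ) : ℂ)) φ * u x}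
  add_mem' := by
    rintro f g ⟨φ, hφ, hf⟩ ⟨ψ, hψ, hg⟩
    refine ⟨φ + ψ, (MvPolynomial.totalDegree_add _ _).trans (max_le hφ hψ), ?_⟩
    filter_upwards [Lp.coeFn_add f g, hf, hg] with x h1 h2 h3
    rw [h1, Pi.add_apply, h2, h3, map_add, add_mul]
  zero_mem' := by
    refine ⟨0, by simp, ?_⟩
    filter_upwards [Lp.coeFn_zero ℂ 2 (volume : Measure (Pos d))] with x h1
    rw [h1]; simp
  smul_mem' := by
    rintro c f ⟨φ, hφ, hf⟩
    refine ⟨c • φ, (MvPolynomial.totalDegree_smul_le _ _).trans hφ, ?_⟩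
    filter_upwards [Lp.coeFn_smul c f, hf] with x h1 h2
    rw [h1, Pi.smul_apply, h2, MvPolynomial.smul_eval, smul_eq_mul, mul_assoc]

instance finiteDimensional_tangentSpace {d : ℕ} (u : Hilb d) :
    FiniteDimensional ℂ (tangentSpace u) := by
  let ev : MvPolynomial (Fin d) ℂ → Pos d → ℂ := fun φ x =>
    MvPolynomial.eval (fun i => ((x i : ℝ) : ℂ)) φ * u x
  have hadd : ∀ φ ψ, ev (φ + ψ) = ev φ + ev ψ := by
    intro φ ψ; funext x; simp [ev, add_mul]
  have hsmul : ∀ (c : ℂ) φ, ev (c • φ) = c • ev φ := by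
    intro c φ; funext x; simp [ev, MvPolynomial.smul_eval, mul_assoc]
  let V : Submodule ℂ (MvPolynomial.restrictTotalDegree (Fin d) ℂ 2) :=
    { carrier := {φ | MemLp (ev φ) 2 (volume : Measure (Pos d))}
      add_mem' := by
        intro φ ψ hφ hψ
        have := MemLp.add hφ hψ
        rwa [← hadd] at this
      zero_mem' := by
        have h0 : ev 0 = 0 := by funext x; simp [ev]
        show MemLp (ev 0) 2 (volume : Measure (Pos d))
        rw [h0]; exact MemLp.zero
      smul_mem' := by
        intro c φ hφ
        have := MemLp.const_smul hφ c
        rwa [← hsmul] at this }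
  let L : V →ₗ[ℂ] Hilb d :=
    { toFun := fun φ => MemLp.toLp (ev (φ : MvPolynomial.restrictTotalDegree (Fin d) ℂ 2)) φ.2
      map_add' := by
        intro φ ψ
        rw [← MemLp.toLp_add]
        exact MemLp.toLp_congr _ _ (by rw [← hadd]; rfl)
      map_smul' := by
        intro c φ
        rw [RingHom.id_apply, ← MemLp.toLp_const_smul]
        exact MemLp.toLp_congr _ _ (by rw [← hsmul]; rfl) }
  refine Submodule.finiteDimensional_of_le (S₂ := LinearMap.range L) ?_
  rintro f ⟨φ, hφ, hf⟩
  have hm : MemLp (ev φ) 2 (volume : Measure (Pos d)) := (memLp_congr_ae hf).1 (Lp.memLp f)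
  refine ⟨⟨⟨φ, (MvPolynomial.mem_restrictTotalDegree _ _ _).2 hφ⟩, hm⟩, ?_⟩
  exact Lp.ext ((MemLp.coeFn_toLp hm).trans hf.symm)

/-! ### Hagedorn's parametrization and the canonical coordinates -/

/-- `Y = (Re Q, Im Q; Re P, Im P)`. -/
def widthY {d : ℕ} (Q P : Matrix (Fin d) (Fin d) ℂ) :
    Matrix (Fin d ⊕ Fin d) (Fin d ⊕ Fin d) ℝ :=
  Matrix.fromBlocks (Q.map Complex.re) (Q.map Complex.im) (P.map Complex.re) (P.map Complex.im)

/-- `u` is the normalized wave packet with Hagedorn parameters `(q, p, Q, P)`, for some real phase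
`S` and some branch `δ` of `det(Q)^{1/2}`. -/
def HasHagedornParameters {d : ℕ} (ε : ℝ) (u : Hilb d) (q p : Pos d)
    (Q P : Matrix (Fin d) (Fin d) ℂ) : Prop :=
  IsUnit Q ∧ IsUnit P ∧ (widthY Q P)ᵀ * Omega (Fin d) * widthY Q P = Omega (Fin d) ∧
    ∃ (S : ℝ) (δ : ℂ), δ ^ 2 = Q.det ∧
      ⇑u =ᵐ[volume] fun x =>
        (((ε * Real.pi) ^ (-(d : ℝ) / 4) : ℝ) : ℂ) / δ * gaussian ε q p (P * Q⁻¹) (S : ℂ) x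

/-- `(q, √(ε/2) vec Re Q, √(ε/2) vec Im Q)`. -/
def vectorize {d : ℕ} (ε : ℝ) (q : Pos d) (Q : Matrix (Fin d) (Fin d) ℂ) : Coord d → ℝ :=
  Sum.elim (fun i => q i)
    (Sum.elim (fun k => √(ε / 2) * (Q k.2 k.1).re) (fun k => √(ε / 2) * (Q k.2 k.1).im))

/-- The canonical coordinates `(𝐪, 𝐩)` of the parameters `(q, p, Q, P)`. -/
def canonicalCoords {d : ℕ} (ε : ℝ) (q p : Pos d) (Q P : Matrix (Fin d) (Fin d) ℂ) : Param d :=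
  WithLp.toLp 2 (Sum.elim (vectorize ε q Q) (vectorize ε p P))

/-- The phase space centre `z = (q, p)` read off from the canonical coordinates. -/
def center {d : ℕ} (Z : Param d) : Phase d :=
  WithLp.toLp 2 (Sum.elim (fun i => Z (Sum.inl (Sum.inl i))) (fun i => Z (Sum.inr (Sum.inl i))))

/-- The scaled width matrix `√(ε/2) Y` read off from the canonical coordinates. -/
def scaledWidth {d : ℕ} (Z : Param d) : Matrix (Fin d ⊕ Fin d) (Fin d ⊕ Fin d) ℝ :=
  Matrix.fromBlocks
    (Matrix.of fun i j => Z (Sum.inl (Sum.inr (Sum.inl (j, i)))))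
    (Matrix.of fun i j => Z (Sum.inl (Sum.inr (Sum.inr (j, i)))))
    (Matrix.of fun i j => Z (Sum.inr (Sum.inr (Sum.inl (j, i)))))
    (Matrix.of fun i j => Z (Sum.inr (Sum.inr (Sum.inr (j, i)))))

/-- The integrand `a(Y_ε ζ + z) exp(-½ ζᵀ ζ)` of a Gaussian average. -/
def averageIntegrand {d : ℕ} (a : Phase d → ℝ) (Z : Param d) (ζ : Phase d) : ℝ :=
  a (WithLp.toLp 2 (scaledWidth Z *ᵥ ⇑ζ) + center Z) * Real.exp (-(1 / 2) * ‖ζ‖ ^ 2)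

/-- The Gaussian average `(2π)^{-d} ∫ a(Y_ε ζ + z) exp(-½ ζᵀ ζ) dζ` as a function on `ℝ^{2D}`. -/
def average {d : ℕ} (a : Phase d → ℝ) (Z : Param d) : ℝ :=
  ((2 * Real.pi) ^ d)⁻¹ * ∫ ζ : Phase d, averageIntegrand a Z ζ

/-! ### Weyl quantization -/

/-- The cross-Wigner function
`W(φ, ψ)(x, ξ) = (2πε)^{-d} ∫ conj φ(x + y/2) ψ(x - y/2) exp(i ξ·y / ε) dy`. -/
def crossWigner {d : ℕ} (ε : ℝ) (φ ψ : Pos d → ℂ) (z : Phase d) : ℂ :=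
  let x : Pos d := WithLp.toLp 2 fun i => z (Sum.inl i)
  let ξ : Pos d := WithLp.toLp 2 fun i => z (Sum.inr i)
  (((2 * Real.pi * ε) ^ d : ℝ) : ℂ)⁻¹ *
    ∫ y : Pos d, conj (φ (x + (1 / 2 : ℝ) • y)) * ψ (x - (1 / 2 : ℝ) • y) *
      cexp (I * ((inner ℝ ξ y : ℝ) : ℂ) / (ε : ℂ))

/-- `f = op(a) ψ` in the weak sense: `⟨φ, f⟩ = ∫ a(z) W(φ, ψ)(z) dz` for all Schwartz `φ`. -/
def IsWeylImage {d : ℕ} (ε : ℝ) (a : Phase d → ℝ) (ψ f : Hilb d) : Prop :=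
  ∀ φ : SchwartzMap (Pos d) ℂ,
    Integrable (fun z : Phase d => (a z : ℂ) * crossWigner ε φ ψ z) volume ∧
      inner ℂ (φ.toLp 2 volume) f = ∫ z : Phase d, (a z : ℂ) * crossWigner ε φ ψ z

/-- The states on which the Weyl quantization `op(a)` is defined with values in `L²`. -/
def weylDomain {d : ℕ} (ε : ℝ) (a : Phase d → ℝ) : Set (Hilb d) :=
  {ψ | ∃ f, IsWeylImage ε a ψ f}

open Classical in
/-- The Weyl quantization `op(a) ψ` (zero outside the domain); the image is unique, as shown below. -/
def weylOp {d : ℕ} (ε : ℝ) (a : Phase d → ℝ) (ψ : Hilb d) : Hilb d :=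
  if hψ : ∃ f, IsWeylImage ε a ψ f then hψ.choose else 0

theorem IsWeylImage.unique {d : ℕ} {ε : ℝ} {a : Phase d → ℝ} {ψ f g : Hilb d}
    (hf : IsWeylImage ε a ψ f) (hg : IsWeylImage ε a ψ g) : f = g := by
  have hd : DenseRange (fun φ : SchwartzMap (Pos d) ℂ => φ.toLp 2 (volume : Measure (Pos d))) :=
    SchwartzMap.denseRange_toLpCLM (F := ℂ) (by norm_num)
  have hc : ∀ v : Hilb d, inner ℂ v f = inner ℂ v g := by
    intro v
    have hcont : ∀ w : Hilb d, Continuous fun v : Hilb d => inner ℂ v w := fun w => by fun_prop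
    refine congrFun (DenseRange.equalizer hd (hcont f) (hcont g) ?_) v
    funext φ
    exact (hf φ).2.trans (hg φ).2.symm
  exact ext_inner_left ℂ hc

/-- The value of `weylOp` is the weak image, whenever there is one. -/
theorem weylOp_eq {d : ℕ} {ε : ℝ} {a : Phase d → ℝ} {ψ f : Hilb d}
    (hf : IsWeylImage ε a ψ f) : weylOp ε a ψ = f := by
  have hψ : ∃ f, IsWeylImage ε a ψ f := ⟨f, hf⟩
  rw [weylOp, dif_pos hψ]
  exact hψ.choose_spec.unique hf

/-! ### Assumptions on the symbol -/

/-- The symbol is smooth in `z`, each `h(t, ·)` has derivatives of at most exponential growth, and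
`h` is subquadratic with bounds that are locally integrable in time. Bounds on all partial
derivatives of order `n` are expressed by the norm of the `n`-th derivative. -/
structure IsAdmissibleSymbol {d : ℕ} (h : ℝ → Phase d → ℝ) : Prop where
  measurable : ∀ z, Measurable fun t => h t z
  smooth : ∀ t, ContDiff ℝ ∞ (h t)
  expGrowth : ∀ (t : ℝ) (n : ℕ), ∃ C β : ℝ, ∀ z,
    ‖iteratedFDeriv ℝ n (h t) z‖ ≤ C * Real.exp (β * ‖z‖)
  subquadratic : ∀ n : ℕ, 2 ≤ n → ∃ C : ℝ → ℝ, LocallyIntegrable C volume ∧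
    ∀ t z, ‖iteratedFDeriv ℝ n (h t) z‖ ≤ C t

/-! ### Evolution equations -/

/-- `y` solves `ẏ = F(t, y)` on `I` in the sense of Carathéodory: it is the integral of its
right-hand side. Where the right-hand side is continuous in time, this is the pointwise
differential equation. -/
def IsCaratheodorySolution {E : Type*} [NormedAddCommGroup E] [NormedSpace ℝ E]
    (I : Set ℝ) (F : ℝ → E → E) (y : ℝ → E) : Prop :=
  ∀ s ∈ I, ∀ t ∈ I, IntervalIntegrable (fun τ => F τ (y τ)) volume s t ∧
    y t - y s = ∫ τ in s..t, F τ (y τ)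

/-- At an interior time near which the right-hand side is continuous, a Carathéodory solution is
differentiable and satisfies the differential equation. -/
theorem IsCaratheodorySolution.hasDerivAt {E : Type*} [NormedAddCommGroup E] [NormedSpace ℝ E]
    [CompleteSpace E] {I : Set ℝ} {F : ℝ → E → E} {y : ℝ → E} (hy : IsCaratheodorySolution I F y)
    {t : ℝ} (hI : I ∈ nhds t) (hF : ∀ᶠ s in nhds t, ContinuousAt (fun τ => F τ (y τ)) s) :
    HasDerivAt y (F t (y t)) t := by
  have ht : t ∈ I := mem_of_mem_nhds hI
  have h1 : HasDerivAt (fun s => y t + ∫ τ in t..s, F τ (y τ)) (F t (y t)) t := by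
    refine HasDerivAt.const_add _ (intervalIntegral.integral_hasDerivAt_right
      (hy t ht t ht).1 ?_ hF.self_of_nhds)
    obtain ⟨U, hU, hUo, htU⟩ := eventually_nhds_iff.1 hF
    exact ContinuousAt.stronglyMeasurableAtFilter hUo hU t htU
  refine h1.congr_of_eventuallyEq ?_
  filter_upwards [hI] with s hs
  rw [← (hy t ht s hs).2]
  abel

/-- The right-hand side of the Dirac-Frenkel equation `i ε ∂ₜ u = 𝒫_u (op(h(t)) u)`, solved for
the time derivative. -/
def diracFrenkelField {d : ℕ} (ε : ℝ) (h : ℝ → Phase d → ℝ) (t : ℝ) (u : Hilb d) : Hilb d :=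
  (I * (ε : ℂ))⁻¹ • (tangentSpace u).starProjection (weylOp ε (h t) u)

/-- `u` is a variational Gaussian approximation on `I`: a curve in `𝓜` that solves the
Dirac-Frenkel equation. -/
structure IsDiracFrenkelSolution {d : ℕ} (ε : ℝ) (h : ℝ → Phase d → ℝ) (I : Set ℝ)
    (u : ℝ → Hilb d) : Prop where
  mem_manifold : ∀ t ∈ I, u t ∈ gaussianManifold d ε
  mem_domain : ∀ t ∈ I, u t ∈ weylDomain ε (h t)
  equation : IsCaratheodorySolution I (diracFrenkelField ε h) u

/-- The canonical Hamiltonian vector field `Ω_D ∇ 𝐡(t, Z)` of the averaged Hamiltonian. -/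
def hamiltonField {d : ℕ} (h : ℝ → Phase d → ℝ) (t : ℝ) (Z : Param d) : Param d :=
  WithLp.toLp 2 (Omega (Coord d) *ᵥ ⇑(gradient (average (h t)) Z))

end GaussianWavePacket

end

noncomputable section

namespace GaussianWavePacket

/-! ### Calculus of primitives of integrable functions -/

section Primitive

variable {E F G : Type*} [NormedAddCommGroup E] [NormedSpace ℝ E]
  [NormedAddCommGroup F] [NormedSpace ℝ F] [NormedAddCommGroup G] [NormedSpace ℝ G]

/-- `y` is a primitive of `g` on `I`. -/
def IsPrimitiveOn (I : Set ℝ) (g y : ℝ → E) : Prop :=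
  ∀ s ∈ I, ∀ t ∈ I, IntervalIntegrable g volume s t ∧ y t - y s = ∫ τ in s..t, g τ

theorem intervalIntegrable_bilin (B : E →L[ℝ] F →L[ℝ] G) {f : ℝ → E} {g : ℝ → F} {s t : ℝ}
    (hf : IntervalIntegrable f volume s t) (hg : ContinuousOn g (Set.uIcc s t)) :
    IntervalIntegrable (fun τ => B (f τ) (g τ)) volume s t := by
  obtain ⟨C, hC⟩ := isCompact_uIcc.exists_bound_of_continuousOn hg
  have hg' : AEStronglyMeasurable g (volume.restrict (Set.uIoc s t)) :=
    (hg.mono Set.uIoc_subset_uIcc).aestronglyMeasurable measurableSet_uIoc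
  rw [intervalIntegrable_iff] at hf ⊢
  refine Integrable.mono' ((hf.norm.const_mul ‖B‖).mul_const C)
    (B.aestronglyMeasurable_comp₂ hf.aestronglyMeasurable hg') ?_
  refine (ae_restrict_mem measurableSet_uIoc).mono fun τ hτ => ?_
  refine (B.le_opNorm₂ _ _).trans ?_
  exact mul_le_mul_of_nonneg_left (hC τ (Set.uIoc_subset_uIcc hτ)) (by positivity)

namespace IsPrimitiveOn

variable {I : Set ℝ} {g y : ℝ → E}

theorem congr {g' y' : ℝ → E} (h : IsPrimitiveOn I g y) (hI : I.OrdConnected)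
    (hg : ∀ t ∈ I, g t = g' t) (hy : ∀ t ∈ I, y t = y' t) : IsPrimitiveOn I g' y' := by
  intro s hs t ht
  have hsub : Set.EqOn g g' (Set.uIcc s t) := fun τ hτ => hg τ (hI.uIcc_subset hs ht hτ)
  refine ⟨(h s hs t ht).1.congr fun τ hτ => hsub (Set.uIoc_subset_uIcc hτ), ?_⟩
  rw [← hy s hs, ← hy t ht, (h s hs t ht).2, intervalIntegral.integral_congr hsub]

theorem of_base (hI : I.OrdConnected) {t₀ : ℝ} (h₀ : t₀ ∈ I)
    (hg : ∀ t ∈ I, IntervalIntegrable g volume t₀ t)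
    (hy : ∀ t ∈ I, y t = y t₀ + ∫ τ in t₀..t, g τ) : IsPrimitiveOn I g y := by
  intro s hs t ht
  refine ⟨(hg s hs).symm.trans (hg t ht), ?_⟩
  rw [hy t ht, hy s hs, ← intervalIntegral.integral_add_adjacent_intervals (hg s hs).symm (hg t ht),
    intervalIntegral.integral_symm t₀ s]
  abel

theorem continuousOn (h : IsPrimitiveOn I g y) (hI : I.OrdConnected) : ContinuousOn y I := by
  by_cases hne : ∃ a b, a ∈ I ∧ b ∈ I ∧ a < b
  · intro x hx
    obtain ⟨U, hU, hxU, hUc⟩ : ∃ a b, (a ∈ I ∧ b ∈ I) ∧ x ∈ Set.Icc a b ∧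
        Set.Icc a b ∈ nhdsWithin x I := by
      by_cases h1 : ∃ a ∈ I, a < x
      · obtain ⟨a, ha, hax⟩ := h1
        by_cases h2 : ∃ b ∈ I, x < b
        · obtain ⟨b, hb, hxb⟩ := h2
          exact ⟨a, b, ⟨ha, hb⟩, ⟨hax.le, hxb.le⟩,
            mem_nhdsWithin_of_mem_nhds (Icc_mem_nhds hax hxb)⟩
        · push Not at h2
          refine ⟨a, x, ⟨ha, hx⟩, ⟨hax.le, le_rfl⟩, ?_⟩
          filter_upwards [self_mem_nhdsWithin, mem_nhdsWithin_of_mem_nhds (Ioi_mem_nhds hax)]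
            with t ht hat using ⟨le_of_lt hat, h2 t ht⟩
      · push Not at h1
        by_cases h2 : ∃ b ∈ I, x < b
        · obtain ⟨b, hb, hxb⟩ := h2
          refine ⟨x, b, ⟨hx, hb⟩, ⟨le_rfl, hxb.le⟩, ?_⟩
          filter_upwards [self_mem_nhdsWithin, mem_nhdsWithin_of_mem_nhds (Iio_mem_nhds hxb)]
            with t ht htb using ⟨h1 t ht, le_of_lt htb⟩
        · push Not at h2
          refine ⟨x, x, ⟨hx, hx⟩, ⟨le_rfl, le_rfl⟩, ?_⟩
          filter_upwards [self_mem_nhdsWithin] with t ht using ⟨h1 t ht, h2 t ht⟩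
    have hab : U ≤ hU := hUc.1.1.trans hUc.1.2
    have hc := intervalIntegral.continuousOn_primitive_interval' (h U hxU.1 hU hxU.2).1
      (Set.left_mem_uIcc)
    rw [Set.uIcc_of_le hab] at hc
    have hc' : ContinuousOn y (Set.Icc U hU) := by
      refine (hc.const_add (y U)).congr fun t ht => ?_
      have := (h U hxU.1 t (hI.out hxU.1 hxU.2 ht)).2
      simp only [← this]; abel
    exact (hc' x hUc.1).mono_of_mem_nhdsWithin hUc.2
  · push Not at hne
    have : I.Subsingleton := fun a ha b hb => le_antisymm (hne b a hb ha) (hne a b ha hb)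
    exact this.continuousOn _

theorem clm [CompleteSpace E] [CompleteSpace F] (h : IsPrimitiveOn I g y) (L : E →L[ℝ] F) :
    IsPrimitiveOn I (fun t => L (g t)) (fun t => L (y t)) := by
  intro s hs t ht
  refine ⟨⟨L.integrable_comp (h s hs t ht).1.1, L.integrable_comp (h s hs t ht).1.2⟩, ?_⟩
  rw [L.intervalIntegral_comp_comm (h s hs t ht).1, ← (h s hs t ht).2, map_sub]

theorem prodMk [CompleteSpace E] [CompleteSpace F] {g₂ y₂ : ℝ → F} (h : IsPrimitiveOn I g y)
    (h₂ : IsPrimitiveOn I g₂ y₂) :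
    IsPrimitiveOn I (fun t => (g t, g₂ t)) (fun t => (y t, y₂ t)) := by
  intro s hs t ht
  have hi : IntervalIntegrable (fun t => (g t, g₂ t)) volume s t :=
    ⟨(h s hs t ht).1.1.prodMk (h₂ s hs t ht).1.1, (h s hs t ht).1.2.prodMk (h₂ s hs t ht).1.2⟩
  refine ⟨hi, ?_⟩
  ext1
  · exact (h s hs t ht).2.trans ((ContinuousLinearMap.fst ℝ E F).intervalIntegral_comp_comm hi)
  · exact (h₂ s hs t ht).2.trans ((ContinuousLinearMap.snd ℝ E F).intervalIntegral_comp_comm hi)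

theorem pi [CompleteSpace E] {ι : Type*} [Fintype ι] {g y : ℝ → ι → E}
    (h : ∀ i, IsPrimitiveOn I (fun t => g t i) (fun t => y t i)) : IsPrimitiveOn I g y := by
  intro s hs t ht
  have hi : IntervalIntegrable g volume s t :=
    ⟨Integrable.of_eval fun i => (h i s hs t ht).1.1,
      Integrable.of_eval fun i => (h i s hs t ht).1.2⟩
  refine ⟨hi, funext fun i => ?_⟩
  exact (h i s hs t ht).2.trans
    ((ContinuousLinearMap.proj (R := ℝ) (φ := fun _ : ι => E) i).intervalIntegral_comp_comm hi)

theorem comp [CompleteSpace E] [CompleteSpace F] (h : IsPrimitiveOn I g y) (hI : I.OrdConnected)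
    {f : E → F} {f' : E → E →L[ℝ] F} (hf : ∀ t ∈ I, HasFDerivAt f (f' (y t)) (y t))
    (hf' : ContinuousOn (fun t => f' (y t)) I) :
    IsPrimitiveOn I (fun t => f' (y t) (g t)) (fun t => f (y t)) := by
  have hint : ∀ s ∈ I, ∀ t ∈ I, IntervalIntegrable (fun t => f' (y t) (g t)) volume s t := by
    intro s hs t ht
    exact intervalIntegrable_bilin (ContinuousLinearMap.id ℝ (E →L[ℝ] F)).flip (h s hs t ht).1
      (hf'.mono (hI.uIcc_subset hs ht))
  have hyc := h.continuousOn hI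
  have key : ∀ a ∈ I, ∀ b ∈ I, a ≤ b → f (y b) - f (y a) = ∫ τ in a..b, f' (y τ) (g τ) := by
    intro a ha b hb hab
    have hsub : Set.Icc a b ⊆ I := hI.out ha hb
    have hfc : ContinuousOn (fun t => f (y t)) (Set.Icc a b) := fun t ht =>
      ((hf t (hsub ht)).continuousAt.comp_continuousWithinAt ((hyc t (hsub ht)).mono hsub))
    have hGc : ContinuousOn (fun t => ∫ τ in a..t, f' (y τ) (g τ)) (Set.Icc a b) := by
      have := intervalIntegral.continuousOn_primitive_interval' (hint a ha b hb) Set.left_mem_uIcc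
      rwa [Set.uIcc_of_le hab] at this
    have hNc : ContinuousOn (fun t => ∫ τ in a..t, ‖g τ‖) (Set.Icc a b) := by
      have := intervalIntegral.continuousOn_primitive_interval' (h a ha b hb).1.norm
        Set.left_mem_uIcc
      rwa [Set.uIcc_of_le hab] at this
    have claim : ∀ η > 0, ‖f (y b) - f (y a) - ∫ τ in a..b, f' (y τ) (g τ)‖ ≤
        2 * η * ∫ τ in a..b, ‖g τ‖ := by
      intro η hη
      let S : Set ℝ := {t | ‖f (y t) - f (y a) - ∫ τ in a..t, f' (y τ) (g τ)‖ ≤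
        2 * η * ∫ τ in a..t, ‖g τ‖}
      have hS : Set.Icc a b ⊆ S := by
        refine IsClosed.Icc_subset_of_forall_exists_gt ?_ ?_ ?_
        · have := isClosed_Icc.isClosed_le (((hfc.sub (continuousOn_const (c := f (y a)))).sub hGc).norm)
            (hNc.const_mul (2 * η))
          convert this using 1
          ext t; simp [S, and_comm]
        · simp [S]
        · rintro x ⟨hxS, hxab⟩ z hz
          have hxI : x ∈ I := hsub ⟨hxab.1, hxab.2.le⟩
          have hIx : nhdsWithin x (Set.Ioc x b) ≤ nhdsWithin x I :=
            nhdsWithin_mono _ fun t ht => hsub ⟨hxab.1.trans ht.1.le, ht.2⟩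
          have hyx : Filter.Tendsto y (nhdsWithin x (Set.Ioc x b)) (nhds (y x)) :=
            (hyc x hxI).mono_left hIx
          have e1 : ∀ᶠ t in nhdsWithin x (Set.Ioc x b),
              ‖f (y t) - f (y x) - f' (y x) (y t - y x)‖ ≤ η * ‖y t - y x‖ :=
            hyx.eventually (((hasFDerivAt_iff_isLittleO.1 (hf x hxI)).bound hη))
          have e2 : ∀ᶠ t in nhdsWithin x (Set.Ioc x b), ‖f' (y x) - f' (y t)‖ ≤ η := by
            have := ((hf' x hxI).mono_left hIx)
            have h2 := (Metric.tendsto_nhds.1 this) η hη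
            filter_upwards [h2] with t ht
            rw [← dist_eq_norm, dist_comm]; exact ht.le
          rw [nhdsWithin_Ioc_eq_nhdsGT hxab.2] at e1 e2
          obtain ⟨u, hu, hsu⟩ := (mem_nhdsGT_iff_exists_Ioc_subset (a := x)).1 (e1.and e2)
          have hxu : x < u := hu
          have hxz : x < z := hz
          let t := min (min u z) b
          have hxt : x < t := lt_min (lt_min hxu hxz) hxab.2
          have htb : t ≤ b := min_le_right _ _
          have htu : t ≤ u := (min_le_left _ _).trans (min_le_left _ _)
          have htz : t ≤ z := (min_le_left _ _).trans (min_le_right _ _)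
          have htI : t ∈ I := hsub ⟨hxab.1.trans hxt.le, htb⟩
          refine ⟨t, ?_, hxt, htz⟩
          have h1 := (hsu ⟨hxt, htu⟩).1
          have hgx := h x hxI t htI
          have hN : ‖y t - y x‖ ≤ ∫ τ in x..t, ‖g τ‖ := by
            rw [hgx.2]; exact intervalIntegral.norm_integral_le_integral_norm hxt.le
          have h3 : ‖f' (y x) (y t - y x) - ∫ τ in x..t, f' (y τ) (g τ)‖ ≤
              η * ∫ τ in x..t, ‖g τ‖ := by
            rw [hgx.2, ← (f' (y x)).intervalIntegral_comp_comm hgx.1,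
              ← intervalIntegral.integral_sub
                (⟨(f' (y x)).integrable_comp hgx.1.1, (f' (y x)).integrable_comp hgx.1.2⟩) (hint x hxI t htI),
              ← intervalIntegral.integral_const_mul]
            refine intervalIntegral.norm_integral_le_of_norm_le hxt.le ?_ (hgx.1.norm.const_mul η)
            refine Filter.Eventually.of_forall fun τ hτ => ?_
            rw [← sub_apply]
            refine (ContinuousLinearMap.le_opNorm _ _).trans ?_
            exact mul_le_mul_of_nonneg_right (hsu ⟨hτ.1, hτ.2.trans htu⟩).2 (norm_nonneg _)
          have hxa := h a ha x hxI
          show ‖f (y t) - f (y a) - ∫ τ in a..t, f' (y τ) (g τ)‖ ≤ 2 * η * ∫ τ in a..t, ‖g τ‖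
          rw [← intervalIntegral.integral_add_adjacent_intervals (hint a ha x hxI)
            (hint x hxI t htI), ← intervalIntegral.integral_add_adjacent_intervals hxa.1.norm
            hgx.1.norm]
          have hxS' : ‖f (y x) - f (y a) - ∫ τ in a..x, f' (y τ) (g τ)‖ ≤
            2 * η * ∫ τ in a..x, ‖g τ‖ := hxS
          have e : f (y t) - f (y a) - ((∫ τ in a..x, f' (y τ) (g τ)) +
              ∫ τ in x..t, f' (y τ) (g τ)) =
              (f (y x) - f (y a) - ∫ τ in a..x, f' (y τ) (g τ)) +
              (f (y t) - f (y x) - f' (y x) (y t - y x)) +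
              (f' (y x) (y t - y x) - ∫ τ in x..t, f' (y τ) (g τ)) := by abel
          rw [e]
          refine (norm_add₃_le).trans ?_
          have := h1.trans (mul_le_mul_of_nonneg_left hN hη.le)
          linarith
      exact hS ⟨hab, le_rfl⟩
    have hlim : Filter.Tendsto (fun η : ℝ => 2 * η * ∫ τ in a..b, ‖g τ‖)
        (nhdsWithin 0 (Set.Ioi 0)) (nhds 0) := by
      have : Continuous fun η : ℝ => 2 * η * ∫ τ in a..b, ‖g τ‖ := by fun_prop
      have h0 := this.tendsto 0
      simp only [mul_zero, zero_mul] at h0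
      exact h0.mono_left nhdsWithin_le_nhds
    have := ge_of_tendsto hlim (Filter.eventually_of_mem self_mem_nhdsWithin claim)
    exact sub_eq_zero.1 (norm_le_zero_iff.1 this)
  intro s hs t ht
  refine ⟨hint s hs t ht, ?_⟩
  rcases le_total s t with hst | hst
  · exact key s hs t ht hst
  · rw [intervalIntegral.integral_symm, ← key t ht s hs hst]; abel

theorem bilin [CompleteSpace E] [CompleteSpace F] [CompleteSpace G] {g₂ y₂ : ℝ → F}
    (h : IsPrimitiveOn I g y) (h₂ : IsPrimitiveOn I g₂ y₂) (hI : I.OrdConnected)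
    (B : E →L[ℝ] F →L[ℝ] G) :
    IsPrimitiveOn I (fun t => B (g t) (y₂ t) + B (y t) (g₂ t)) (fun t => B (y t) (y₂ t)) := by
  have hB : IsBoundedBilinearMap ℝ fun p : E × F => B p.1 p.2 := B.isBoundedBilinearMap
  have hp := (h.prodMk h₂).comp hI (f := fun p : E × F => B p.1 p.2) (f' := fun p => hB.deriv p)
    (fun t _ => hB.hasFDerivAt _) ?_
  · refine hp.congr hI (fun t _ => ?_) fun t _ => rfl
    rw [hB.deriv_apply]; exact add_comm _ _
  · have : Continuous fun p : E × F => hB.deriv p := hB.isBoundedLinearMap_deriv.continuous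
    exact this.comp_continuousOn ((h.prodMk h₂).continuousOn hI)

theorem mul {A : Type*} [NormedRing A] [NormedAlgebra ℝ A] [CompleteSpace A] {g y g₂ y₂ : ℝ → A}
    (h : IsPrimitiveOn I g y) (h₂ : IsPrimitiveOn I g₂ y₂) (hI : I.OrdConnected) :
    IsPrimitiveOn I (fun t => g t * y₂ t + y t * g₂ t) (fun t => y t * y₂ t) :=
  h.bilin h₂ hI (ContinuousLinearMap.mul ℝ A)

theorem add {g₂ y₂ : ℝ → E} (h : IsPrimitiveOn I g y) (h₂ : IsPrimitiveOn I g₂ y₂) :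
    IsPrimitiveOn I (fun t => g t + g₂ t) (fun t => y t + y₂ t) := by
  intro s hs t ht
  refine ⟨(h s hs t ht).1.add (h₂ s hs t ht).1, ?_⟩
  rw [intervalIntegral.integral_add (h s hs t ht).1 (h₂ s hs t ht).1, ← (h s hs t ht).2,
    ← (h₂ s hs t ht).2]
  exact add_sub_add_comm _ _ _ _

theorem exp_comp {g y : ℝ → ℂ} (h : IsPrimitiveOn I g y) (hI : I.OrdConnected) :
    IsPrimitiveOn I (fun t => Complex.exp (y t) * g t) (fun t => Complex.exp (y t)) := by
  have hy := h.continuousOn hI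
  have := h.comp hI (f := Complex.exp)
    (f' := fun z => (ContinuousLinearMap.toSpanSingleton ℂ (Complex.exp z)).restrictScalars ℝ)
    (fun t _ => (Complex.hasDerivAt_exp (y t)).hasFDerivAt.restrictScalars ℝ) ?_
  · refine this.congr hI (fun t _ => ?_) fun t _ => rfl
    simp [mul_comm]
  · have hc : Continuous fun z : ℂ =>
        (ContinuousLinearMap.toSpanSingleton ℂ (Complex.exp z)).restrictScalars ℝ := by
      have h1 : Continuous fun z : ℂ => Complex.exp z •
          ((ContinuousLinearMap.id ℂ ℂ).restrictScalars ℝ) := by fun_prop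
      convert h1 using 2 with z
      ext x
      simp [mul_comm]
    exact hc.comp_continuousOn hy

theorem eq_of_zero (h : IsPrimitiveOn I (fun _ => (0 : E)) y) {s t : ℝ} (hs : s ∈ I) (ht : t ∈ I) :
    y t = y s := by
  have := (h s hs t ht).2
  simpa [sub_eq_zero] using this

end IsPrimitiveOn

/-- A scalar linear equation is solved by the exponential of the primitive of its coefficient. -/
theorem IsPrimitiveOn.eq_mul_exp {I : Set ℝ} (hI : I.OrdConnected) {v y : ℝ → ℂ}
    (hv : ∀ s ∈ I, ∀ t ∈ I, IntervalIntegrable v volume s t)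
    (hy : IsPrimitiveOn I (fun t => v t * y t) y) {s t : ℝ} (hs : s ∈ I) (ht : t ∈ I) :
    y t = y s * Complex.exp (∫ τ in s..t, v τ) := by
  have hp : IsPrimitiveOn I (fun t => -v t) (fun t => -∫ τ in s..t, v τ) := by
    refine IsPrimitiveOn.of_base hI hs (fun t ht => (hv s hs t ht).neg) fun t _ => ?_
    simp
  have := (hy.mul (hp.exp_comp hI) hI).congr hI (g' := fun _ => 0) (fun t _ => by ring)
    (fun t _ => rfl)
  have h2 := this.eq_of_zero hs ht
  simp only [intervalIntegral.integral_same, neg_zero, Complex.exp_zero, mul_one] at h2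
  rw [← h2, mul_assoc, ← Complex.exp_add]
  simp

/-- Linear differential equations with locally integrable coefficients have solutions. -/
theorem exists_linear_solution [CompleteSpace E] {I : Set ℝ} (hI : I.OrdConnected) {t₀ : ℝ}
    (h₀ : t₀ ∈ I) {A : ℝ → E →L[ℝ] E} (hA : ∀ t ∈ I, IntervalIntegrable A volume t₀ t) (y₀ : E) :
    ∃ y : ℝ → E, y t₀ = y₀ ∧ IsPrimitiveOn I (fun t => A t (y t)) y := by
  let Y : ℕ → ℝ → E := fun n => n.rec (fun _ => y₀) fun _ f t => ∫ τ in t₀..t, A τ (f τ)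
  have hYs : ∀ n t, Y (n + 1) t = ∫ τ in t₀..t, A τ (Y n τ) := fun _ _ => rfl
  have hsub : ∀ t ∈ I, Set.uIcc t₀ t ⊆ I := fun t ht => hI.uIcc_subset h₀ ht
  have hint : ∀ f : ℝ → E, ContinuousOn f I → ∀ t ∈ I,
      IntervalIntegrable (fun τ => A τ (f τ)) volume t₀ t := fun f hf t ht =>
    intervalIntegrable_bilin (ContinuousLinearMap.id ℝ (E →L[ℝ] E)) (hA t ht) (hf.mono (hsub t ht))
  have hYc : ∀ n, ContinuousOn (Y n) I := by
    intro n
    induction n with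
    | zero => exact continuousOn_const
    | succ n ih =>
      refine (IsPrimitiveOn.of_base (y := Y (n + 1)) hI h₀ (hint _ ih) fun t _ => ?_).continuousOn hI
      simp [hYs]
  let M : ℝ → ℝ := fun t => ∫ τ in t₀..t, ‖A τ‖
  have hM : IsPrimitiveOn I (fun τ => ‖A τ‖) M :=
    IsPrimitiveOn.of_base hI h₀ (fun t ht => (hA t ht).norm) fun t _ => by simp [M]
  have hMc := hM.continuousOn hI
  have hMp : ∀ n : ℕ, IsPrimitiveOn I (fun τ => M τ ^ n / n.factorial * ‖A τ‖)
      (fun t => M t ^ (n + 1) / (n + 1).factorial) := by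
    intro n
    have := hM.comp hI (f := fun x => x ^ (n + 1) / (n + 1).factorial)
      (f' := fun x => ContinuousLinearMap.toSpanSingleton ℝ (x ^ n / n.factorial)) ?_ ?_
    · exact this.congr hI (fun t _ => by simp [mul_comm]) fun t _ => rfl
    · intro t _
      have h1 := ((hasDerivAt_pow (n + 1) (M t)).div_const ((n + 1).factorial : ℝ)).hasFDerivAt
      have e : ((n + 1 : ℕ) : ℝ) * M t ^ (n + 1 - 1) / ((n + 1).factorial : ℝ) =
          M t ^ n / n.factorial := by
        rw [Nat.factorial_succ]; push_cast
        have : (n.factorial : ℝ) ≠ 0 := by positivity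
        have : (n + 1 : ℝ) ≠ 0 := by positivity
        field_simp
      rwa [e] at h1
    · have hc : Continuous fun x : ℝ =>
          ContinuousLinearMap.toSpanSingleton ℝ (x ^ n / (n.factorial : ℝ)) := by
        have h1 : Continuous fun x : ℝ => (x ^ n / (n.factorial : ℝ)) •
          (ContinuousLinearMap.id ℝ ℝ) := by fun_prop
        convert h1 using 2 with z
        ext; simp
      exact hc.comp_continuousOn hMc
  have hbound : ∀ n, ∀ t ∈ I, ‖Y n t‖ ≤ ‖y₀‖ * (|M t| ^ n / n.factorial) := by
    intro n
    induction n with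
    | zero => intro t _; simp [Y]
    | succ n ih =>
      intro t ht
      rw [hYs]
      have hMI : IntervalIntegrable (fun τ => ‖y₀‖ * (|M τ| ^ n / n.factorial * ‖A τ‖)) volume t₀ t :=
        (((hA t ht).norm.continuousOn_mul
          (((hMc.mono (hsub t ht)).abs.pow n).div_const _)).const_mul _)
      refine (intervalIntegral.norm_integral_le_abs_of_norm_le (g := fun τ =>
        ‖y₀‖ * (|M τ| ^ n / n.factorial * ‖A τ‖)) ?_ hMI).trans ?_
      · refine (ae_restrict_mem measurableSet_uIoc).mono fun τ hτ => ?_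
        have := ih τ (hsub t ht (Set.uIoc_subset_uIcc hτ))
        calc ‖A τ (Y n τ)‖ ≤ ‖A τ‖ * ‖Y n τ‖ := (A τ).le_opNorm _
          _ ≤ ‖A τ‖ * (‖y₀‖ * (|M τ| ^ n / n.factorial)) := by gcongr
          _ = _ := by ring
      · rw [intervalIntegral.integral_const_mul, abs_mul, abs_of_nonneg (norm_nonneg y₀)]
        refine mul_le_mul_of_nonneg_left (le_of_eq ?_) (norm_nonneg _)
        have hval := (hMp n t₀ h₀ t ht).2
        have hM0 : M t₀ = 0 := by simp [M]
        simp only [hM0, ne_eq, Nat.add_eq_zero_iff, one_ne_zero, and_false, not_false_eq_true,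
          zero_pow, zero_div, sub_zero] at hval
        have hsign : ∫ τ in t₀..t, |M τ| ^ n / n.factorial * ‖A τ‖ =
            (if t₀ ≤ t then 1 else (-1) ^ n) * ∫ τ in t₀..t, M τ ^ n / n.factorial * ‖A τ‖ := by
          rw [← intervalIntegral.integral_const_mul]
          refine intervalIntegral.integral_congr fun τ hτ => ?_
          split_ifs with hle
          · rw [Set.uIcc_of_le hle] at hτ
            have : 0 ≤ M τ := intervalIntegral.integral_nonneg hτ.1 fun _ _ => norm_nonneg _
            rw [abs_of_nonneg this, one_mul]
          · rw [Set.uIcc_of_ge (not_le.1 hle).le] at hτ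
            have : M τ ≤ 0 := by
              simp only [M]
              rw [intervalIntegral.integral_symm]
              have := intervalIntegral.integral_nonneg (μ := volume) hτ.2
                fun (u : ℝ) _ => norm_nonneg (A u)
              linarith
            rw [abs_of_nonpos this, neg_pow]; ring
        rw [hsign, ← hval, abs_mul, abs_div, abs_pow, Nat.abs_cast]
        split_ifs <;> simp
  have hsum : ∀ t ∈ I, Summable fun n => Y n t := fun t ht =>
    Summable.of_norm_bounded ((Real.summable_pow_div_factorial |M t|).mul_left ‖y₀‖)
      fun n => hbound n t ht
  let y : ℝ → E := fun t => ∑' n, Y n t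
  have hy₀ : y t₀ = y₀ := by
    have : y t₀ = Y 0 t₀ := tsum_eq_single 0 fun n hn => by
      obtain ⟨m, rfl⟩ := Nat.exists_eq_succ_of_ne_zero hn
      simp [Nat.succ_eq_add_one, hYs]
    exact this
  have hmain : ∀ t ∈ I, IntervalIntegrable (fun τ => A τ (y τ)) volume t₀ t ∧
      y t = y t₀ + ∫ τ in t₀..t, A τ (y τ) := by
    intro t ht
    obtain ⟨B, hB⟩ := isCompact_uIcc.exists_bound_of_continuousOn (hMc.mono (hsub t ht))
    have hbB : ∀ n, ∀ τ ∈ Set.uIcc t₀ t, ‖Y n τ‖ ≤ ‖y₀‖ * (B ^ n / n.factorial) := fun n τ hτ =>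
      (hbound n τ (hsub t ht hτ)).trans (by
        have : |M τ| ≤ B := hB τ hτ
        gcongr)
    have hsB : Summable fun n : ℕ => ‖y₀‖ * (B ^ n / n.factorial) :=
      (Real.summable_pow_div_factorial B).mul_left ‖y₀‖
    have hyc : ContinuousOn y (Set.uIcc t₀ t) :=
      continuousOn_tsum (fun n => (hYc n).mono (hsub t ht)) hsB hbB
    have hyi : IntervalIntegrable (fun τ => A τ (y τ)) volume t₀ t :=
      intervalIntegrable_bilin (ContinuousLinearMap.id ℝ (E →L[ℝ] E)) (hA t ht) hyc
    refine ⟨hyi, ?_⟩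
    have hs := intervalIntegral.hasSum_integral_of_dominated_convergence (μ := volume) (a := t₀)
      (b := t) (F := fun n τ => A τ (Y n τ)) (f := fun τ => A τ (y τ))
      (fun n τ => ‖A τ‖ * (‖y₀‖ * (B ^ n / n.factorial)))
      (fun n => ((intervalIntegrable_iff.1 (hint _ (hYc n) t ht)).aestronglyMeasurable))
      (fun n => Filter.Eventually.of_forall fun τ hτ => ((A τ).le_opNorm _).trans
        (mul_le_mul_of_nonneg_left (hbB n τ (Set.uIoc_subset_uIcc hτ)) (norm_nonneg _)))
      (Filter.Eventually.of_forall fun τ _ => hsB.mul_left _)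
      (by
        simp only [tsum_mul_left]
        exact (hA t ht).norm.mul_const _)
      (Filter.Eventually.of_forall fun τ hτ => (A τ).hasSum
        (hsum τ (hsub t ht (Set.uIoc_subset_uIcc hτ))).hasSum)
    rw [← hs.tsum_eq, hy₀]
    exact (hsum t ht).tsum_eq_zero_add
  exact ⟨y, hy₀, IsPrimitiveOn.of_base hI h₀ (fun t ht => (hmain t ht).1) fun t ht => (hmain t ht).2⟩

end Primitive

/-! ### Pointwise representation of Bochner integrals of `L²`-valued functions -/

theorem setIntegral_norm_le_L2 {X : Type*} [MeasurableSpace X] {μ : Measure X} {B : Set X}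
    (hB : MeasurableSet B) (hμ : μ B ≠ ⊤) (f : Lp ℂ 2 μ) :
    ∫ x in B, ‖f x‖ ∂μ ≤ √(μ.real B) * ‖f‖ := by
  have hf : MemLp (fun x => ‖f x‖) 2 μ := (Lp.memLp f).norm
  let g : Lp ℝ 2 μ := hf.toLp _
  have h1 : ∫ x in B, ‖f x‖ ∂μ = ∫ x in B, g x ∂μ :=
    setIntegral_congr_ae hB (hf.coeFn_toLp.mono fun x hx _ => hx.symm)
  rw [h1, ← L2.inner_indicatorConstLp_one hB hμ g]
  refine (real_inner_le_norm _ _).trans ?_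
  have h2 : ‖g‖ = ‖f‖ := by
    rw [Lp.norm_toLp, eLpNorm_norm, Lp.norm_def]
  rw [h2, norm_indicatorConstLp (by norm_num) (by norm_num)]
  simp [Real.sqrt_eq_rpow]

theorem integral_coeFn_ae_eq {X : Type*} [MeasurableSpace X] {μ : Measure X} [SigmaFinite μ]
    {T : Type*} [MeasurableSpace T] {ν : Measure T} [SFinite ν] {F : T → Lp ℂ 2 μ} {f : T → X → ℂ}
    (hF : Integrable F ν) (hf : AEStronglyMeasurable (Function.uncurry f) (ν.prod μ))
    (hFf : ∀ᵐ τ ∂ν, F τ =ᵐ[μ] f τ) : ⇑(∫ τ, F τ ∂ν) =ᵐ[μ] fun x => ∫ τ, f τ x ∂ν := by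
  have hprod : ∀ B : Set X, MeasurableSet B → μ B < ⊤ →
      Integrable (Function.uncurry f) (ν.prod (μ.restrict B)) := by
    intro B hB hμ
    have hm : AEStronglyMeasurable (Function.uncurry f) (ν.prod (μ.restrict B)) := by
      have : ν.prod (μ.restrict B) = (ν.prod μ).restrict (Set.univ ×ˢ B) := by
        rw [← Measure.prod_restrict, Measure.restrict_univ]
      rw [this]; exact hf.restrict
    rw [integrable_prod_iff hm]
    constructor
    · filter_upwards [hFf] with τ hτ
      have : IntegrableOn (F τ) B μ := by
        have h2 : MemLp (F τ) 2 (μ.restrict B) := (Lp.memLp (F τ)).restrict B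
        have : IsFiniteMeasure (μ.restrict B) := ⟨by simpa using hμ⟩
        exact h2.integrable (by norm_num)
      exact this.congr (ae_restrict_of_ae hτ)
    · refine Integrable.mono' (hF.norm.const_mul (√(μ.real B)))
        hm.norm.integral_prod_right' ?_
      filter_upwards [hFf] with τ hτ
      rw [Real.norm_of_nonneg (integral_nonneg fun _ => norm_nonneg _)]
      refine le_trans (le_of_eq ?_) (setIntegral_norm_le_L2 hB hμ.ne (F τ))
      exact integral_congr_ae (ae_restrict_of_ae (hτ.mono fun x hx => by
        simp only [Function.uncurry, hx]))
  refine ae_eq_of_forall_setIntegral_eq_of_sigmaFinite ?_ ?_ ?_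
  · intro B hB hμ
    have h2 : MemLp (∫ τ, F τ ∂ν : Lp ℂ 2 μ) 2 (μ.restrict B) := (Lp.memLp _).restrict B
    have : IsFiniteMeasure (μ.restrict B) := ⟨by simpa using hμ⟩
    exact h2.integrable (by norm_num)
  · intro B hB hμ
    exact (hprod B hB hμ).integral_prod_right
  · intro B hB hμ
    rw [← L2.inner_indicatorConstLp_one (𝕜 := ℂ) hB hμ.ne, ← integral_inner hF,
      ← integral_integral_swap (hprod B hB hμ)]
    refine integral_congr_ae ?_
    filter_upwards [hFf] with τ hτ
    rw [L2.inner_indicatorConstLp_one hB hμ.ne]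
    exact integral_congr_ae (ae_restrict_of_ae hτ)

/-! ### The cross-Wigner function of Schwartz functions -/

section Wigner

open SchwartzMap LineDeriv

variable {d : ℕ}

/-- The position component of a phase space point. -/
def posL : Phase d →L[ℝ] Pos d :=
  (ContinuousLinearMap.fst ℝ _ _).comp
    (EuclideanSpace.sumEquivProd (𝕜 := ℝ) (ι := Fin d) (κ := Fin d)).toContinuousLinearMap

/-- The momentum component of a phase space point. -/
def momL : Phase d →L[ℝ] Pos d :=
  (ContinuousLinearMap.snd ℝ _ _).comp
    (EuclideanSpace.sumEquivProd (𝕜 := ℝ) (ι := Fin d) (κ := Fin d)).toContinuousLinearMap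

@[simp] theorem posL_apply (z : Phase d) (i : Fin d) : posL z i = z (Sum.inl i) := rfl

@[simp] theorem momL_apply (z : Phase d) (i : Fin d) : momL z i = z (Sum.inr i) := rfl

theorem norm_posL_le (z : Phase d) : ‖posL z‖ ≤ ‖z‖ := by
  rw [EuclideanSpace.norm_eq, EuclideanSpace.norm_eq]
  refine Real.sqrt_le_sqrt ?_
  rw [Fintype.sum_sum_type]
  simp only [posL_apply]
  exact le_add_of_nonneg_right (Finset.sum_nonneg fun _ _ => by positivity)

/-- The oscillating factor of the cross-Wigner function. -/
def wignerPhase (ε : ℝ) (z : Phase d) (s : Pos d) : ℂ :=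
  cexp (((2 / ε * inner ℝ (momL z) (s - posL z) : ℝ) : ℂ) * I)

@[simp] theorem norm_wignerPhase (ε : ℝ) (z : Phase d) (s : Pos d) : ‖wignerPhase ε z s‖ = 1 :=
  Complex.norm_exp_ofReal_mul_I _

theorem crossWigner_eq {ε : ℝ} (φ ψ : Pos d → ℂ) (z : Phase d) :
    crossWigner ε φ ψ z = ((((Real.pi * ε) ^ d : ℝ) : ℂ)⁻¹) *
      ∫ s, conj (φ s) * ψ ((2 : ℝ) • posL z - s) * wignerPhase ε z s := by
  let G : Pos d → ℂ := fun s => conj (φ s) * ψ ((2 : ℝ) • posL z - s) * wignerPhase ε z s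
  have h1 : crossWigner ε φ ψ z = (((2 * Real.pi * ε) ^ d : ℝ) : ℂ)⁻¹ *
      ∫ y : Pos d, G (posL z + (1 / 2 : ℝ) • y) := by
    simp only [crossWigner]
    refine congrArg (fun w : ℂ => _ * w) (integral_congr_ae (Filter.Eventually.of_forall fun y => ?_))
    have e1 : (2 : ℝ) • posL z - (posL z + (1 / 2 : ℝ) • y) = posL z - (1 / 2 : ℝ) • y := by
      module
    have e2 : posL z + (1 / 2 : ℝ) • y - posL z = (1 / 2 : ℝ) • y := by module
    simp only [G, wignerPhase, e1, e2]
    congr 2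
    rw [inner_smul_right]
    push_cast
    have : inner ℝ (momL z) y = inner ℝ (WithLp.toLp 2 fun i => z (Sum.inr i)) y := rfl
    rw [this]
    ring
  rw [h1, Measure.integral_comp_smul volume (fun y => G (posL z + y)),
    integral_add_left_eq_self G (posL z)]
  simp only [finrank_euclideanSpace, Fintype.card_fin, real_smul, G]
  rw [← mul_assoc]
  congr 1
  rw [abs_of_pos (by positivity)]
  push_cast
  rw [← mul_inv]
  congr 1
  rw [← mul_pow]
  congr 1
  ring

theorem schwartz_integrable_comp {ε : ℝ} (φ ψ : 𝓢(Pos d, ℂ)) (z : Phase d) :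
    Integrable fun s => conj (φ s) * ψ ((2 : ℝ) • posL z - s) * wignerPhase ε z s := by
  have hc : Continuous fun s => wignerPhase ε z s :=
    by unfold wignerPhase; fun_prop
  refine Integrable.mono' ((φ.integrable (μ := volume)).norm.mul_const
    (SchwartzMap.seminorm ℝ 0 0 ψ)) ?_ (Filter.Eventually.of_forall fun s => ?_)
  · exact (((Complex.continuous_conj.comp φ.continuous).mul
      (ψ.continuous.comp (by fun_prop))).mul hc).aestronglyMeasurable
  · rw [norm_mul, norm_mul, norm_wignerPhase, mul_one, RCLike.norm_conj]
    exact mul_le_mul_of_nonneg_left (ψ.norm_le_seminorm ℝ _) (norm_nonneg _)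

theorem continuous_crossWigner {ε : ℝ} (φ ψ : 𝓢(Pos d, ℂ)) :
    Continuous (crossWigner ε φ ψ : Phase d → ℂ) := by
  have : (crossWigner ε φ ψ : Phase d → ℂ) = fun z => ((((Real.pi * ε) ^ d : ℝ) : ℂ)⁻¹) *
      ∫ s, conj (φ s) * ψ ((2 : ℝ) • posL z - s) * wignerPhase ε z s :=
    funext fun z => crossWigner_eq _ _ _
  rw [this]
  refine continuous_const.mul (continuous_of_dominated
    (bound := fun s => ‖φ s‖ * SchwartzMap.seminorm ℝ 0 0 ψ)
    (fun z => (schwartz_integrable_comp φ ψ z).aestronglyMeasurable) (fun z => ?_)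
    ((φ.integrable (μ := volume)).norm.mul_const _) (Filter.Eventually.of_forall fun s => ?_))
  · refine Filter.Eventually.of_forall fun s => ?_
    rw [norm_mul, norm_mul, norm_wignerPhase, mul_one, RCLike.norm_conj]
    exact mul_le_mul_of_nonneg_left (ψ.norm_le_seminorm ℝ _) (norm_nonneg _)
  · have hc : Continuous fun z => wignerPhase ε z s :=
      by unfold wignerPhase; fun_prop
    exact (continuous_const.mul (ψ.continuous.comp (by fun_prop))).mul hc

theorem exists_norm_crossWigner_le {ε : ℝ} (φ ψ : 𝓢(Pos d, ℂ)) :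
    ∃ C, ∀ z : Phase d, ‖crossWigner ε φ ψ z‖ ≤ C := by
  refine ⟨‖(((Real.pi * ε) ^ d : ℝ) : ℂ)⁻¹‖ *
    ∫ s, ‖φ s‖ * SchwartzMap.seminorm ℝ 0 0 ψ, fun z => ?_⟩
  rw [crossWigner_eq, norm_mul]
  refine mul_le_mul_of_nonneg_left (norm_integral_le_of_norm_le
    ((φ.integrable (μ := volume)).norm.mul_const _)
    (Filter.Eventually.of_forall fun s => ?_)) (norm_nonneg _)
  rw [norm_mul, norm_mul, norm_wignerPhase, mul_one, RCLike.norm_conj]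
  exact mul_le_mul_of_nonneg_left (ψ.norm_le_seminorm ℝ _) (norm_nonneg _)

/-- Multiplication of a Schwartz function by a coordinate. -/
def coordMul (j : Fin d) (ψ : 𝓢(Pos d, ℂ)) : 𝓢(Pos d, ℂ) :=
  smulLeftCLM ℂ (fun x : Pos d => x j) ψ

@[simp] theorem coordMul_apply (j : Fin d) (ψ : 𝓢(Pos d, ℂ)) (x : Pos d) :
    coordMul j ψ x = (x j : ℂ) * ψ x := by
  have h : Function.HasTemperateGrowth (fun x : Pos d => x j) :=
    (EuclideanSpace.proj j : Pos d →L[ℝ] ℝ).hasTemperateGrowth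
  rw [coordMul, smulLeftCLM_apply_apply h, real_smul]

/-- The partial derivative of a Schwartz function. -/
def coordDeriv (j : Fin d) (ψ : 𝓢(Pos d, ℂ)) : 𝓢(Pos d, ℂ) :=
  ∂_{(EuclideanSpace.single j (1 : ℝ) : Pos d)} ψ

theorem coordDeriv_apply (j : Fin d) (ψ : 𝓢(Pos d, ℂ)) (x : Pos d) :
    coordDeriv j ψ x = fderiv ℝ ψ x (EuclideanSpace.single j 1) :=
  SchwartzMap.lineDerivOp_apply_eq_fderiv _ _ _

theorem pos_mul_crossWigner {ε : ℝ} (φ ψ : 𝓢(Pos d, ℂ)) (z : Phase d) (j : Fin d) :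
    (z (Sum.inl j) : ℂ) * crossWigner ε φ ψ z =
      1 / 2 * (crossWigner ε (coordMul j φ) ψ z + crossWigner ε φ (coordMul j ψ) z) := by
  simp only [crossWigner_eq]
  rw [← mul_add, ← integral_add (schwartz_integrable_comp _ _ z) (schwartz_integrable_comp _ _ z),
    mul_left_comm, mul_left_comm (1 / 2 : ℂ),
    ← integral_const_mul (z (Sum.inl j) : ℂ), ← integral_const_mul (1 / 2 : ℂ)]
  refine congrArg (fun w : ℂ => _ * w) (integral_congr_ae (Filter.Eventually.of_forall fun s => ?_))
  simp only [coordMul_apply, map_mul, conj_ofReal, PiLp.sub_apply, PiLp.smul_apply, posL_apply,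
    smul_eq_mul]
  push_cast
  ring

theorem hasFDerivAt_wignerPhase_right {ε : ℝ} (z : Phase d) (s : Pos d) (j : Fin d) :
    HasLineDerivAt ℝ (wignerPhase ε z) (2 / ε * z (Sum.inr j) * I * wignerPhase ε z s) s
      (EuclideanSpace.single j 1) := by
  unfold wignerPhase HasLineDerivAt
  have h1 : HasDerivAt (fun t : ℝ => ((2 / ε * inner ℝ (momL z)
      (s + t • EuclideanSpace.single j (1 : ℝ) - posL z) : ℝ) : ℂ))
      ((2 / ε * z (Sum.inr j) : ℝ) : ℂ) 0 := by
    have h2 : (fun t : ℝ => 2 / ε * inner ℝ (momL z)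
      (s + t • EuclideanSpace.single j (1 : ℝ) - posL z)) = fun t : ℝ =>
        2 / ε * inner ℝ (momL z) (s - posL z) + t * (2 / ε * z (Sum.inr j)) := by
      funext t
      have : s + t • EuclideanSpace.single j (1 : ℝ) - posL z =
        (s - posL z) + t • EuclideanSpace.single j (1 : ℝ) := by abel
      rw [this, inner_add_right, inner_smul_right, EuclideanSpace.inner_single_right]
      simp; ring
    refine HasDerivAt.ofReal_comp ?_
    rw [h2]
    simpa using ((hasDerivAt_id (0 : ℝ)).mul_const (2 / ε * z (Sum.inr j))).const_add
      (2 / ε * inner ℝ (momL z) (s - posL z))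
  have h3 := (h1.mul_const I).cexp
  refine h3.congr_deriv ?_
  simp; ring

theorem mom_mul_crossWigner {ε : ℝ} (hε : ε ≠ 0) (φ ψ : 𝓢(Pos d, ℂ)) (z : Phase d) (j : Fin d) :
    (z (Sum.inr j) : ℂ) * crossWigner ε φ ψ z =
      I * ε / 2 * (crossWigner ε (coordDeriv j φ) ψ z - crossWigner ε φ (coordDeriv j ψ) z) := by
  simp only [crossWigner_eq]
  rw [← mul_sub, ← integral_sub (schwartz_integrable_comp _ _ z) (schwartz_integrable_comp _ _ z),
    mul_left_comm, mul_left_comm (I * ε / 2 : ℂ)]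
  congr 1
  let v : Pos d := EuclideanSpace.single j (1 : ℝ)
  let x₂ : Pos d := (2 : ℝ) • posL z
  have hline : ∀ s, HasLineDerivAt ℝ (fun s => conj (φ s) * ψ (x₂ - s))
      (conj (coordDeriv j φ s) * ψ (x₂ - s) - conj (φ s) * coordDeriv j ψ (x₂ - s)) s v := by
    intro s
    have h1 : HasDerivAt (fun t : ℝ => conj (φ (s + t • v))) (conj (coordDeriv j φ s)) 0 := by
      have := ((φ.hasFDerivAt s).hasLineDerivAt v)
      rw [coordDeriv_apply]
      exact HasDerivAt.star this
    have h2 : HasDerivAt (fun t : ℝ => ψ (x₂ - (s + t • v))) (-coordDeriv j ψ (x₂ - s)) 0 := by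
      have h3 := ((ψ.hasFDerivAt (x₂ - s)).hasLineDerivAt (-v))
      rw [coordDeriv_apply, ← map_neg]
      refine HasDerivAt.congr_of_eventuallyEq (f := fun t : ℝ => ψ ((x₂ - s) + t • (-v))) h3
        (Filter.Eventually.of_forall fun t => ?_)
      show ψ (x₂ - (s + t • v)) = ψ (x₂ - s + t • (-v))
      rw [smul_neg]; congr 1; abel
    have h4 := h1.mul h2
    unfold HasLineDerivAt
    refine h4.congr_deriv ?_
    simp; ring
  have hint := integral_bilinear_hasLineDerivAt_right_eq_neg_left_of_integrable (μ := volume)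
    (B := ContinuousLinearMap.mul ℝ ℂ) (v := v)
    (f := fun s => conj (φ s) * ψ (x₂ - s))
    (f' := fun s => conj (coordDeriv j φ s) * ψ (x₂ - s) - conj (φ s) * coordDeriv j ψ (x₂ - s))
    (g := wignerPhase ε z) (g' := fun s => 2 / ε * z (Sum.inr j) * I * wignerPhase ε z s)
    ?_ ?_ ?_ (fun s _ => hline s) (fun s _ => hasFDerivAt_wignerPhase_right z s j)
  · simp only [ContinuousLinearMap.mul_apply'] at hint
    have e1 : ∫ s, conj (φ s) * ψ (x₂ - s) * (2 / ε * z (Sum.inr j) * I * wignerPhase ε z s) =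
        2 / ε * I * (z (Sum.inr j) * ∫ s, conj (φ s) * ψ (x₂ - s) * wignerPhase ε z s) := by
      rw [← integral_const_mul, ← integral_const_mul]
      congr 1; ext s; ring
    have e2 : ∫ s, (conj (coordDeriv j φ s) * ψ (x₂ - s) * wignerPhase ε z s -
        conj (φ s) * coordDeriv j ψ (x₂ - s) * wignerPhase ε z s) =
        ∫ s, (conj (coordDeriv j φ s) * ψ (x₂ - s) - conj (φ s) * coordDeriv j ψ (x₂ - s)) *
          wignerPhase ε z s := by
      congr 1; ext s; ring
    rw [e1] at hint
    rw [e2, ← neg_eq_iff_eq_neg.2 hint]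
    have : (ε : ℂ) ≠ 0 := by exact_mod_cast hε
    have h2 : I * I = -1 := I_mul_I
    field_simp
    linear_combination ((z (Sum.inr j) : ℂ) *
      ∫ s, conj (φ s) * ψ (x₂ - s) * wignerPhase ε z s) * h2
  · refine ((schwartz_integrable_comp (ε := ε) (coordDeriv j φ) ψ z).sub
      (schwartz_integrable_comp (ε := ε) φ (coordDeriv j ψ) z)).congr
      (Filter.Eventually.of_forall fun s => ?_)
    simp [x₂, ContinuousLinearMap.mul_apply']
  · refine ((schwartz_integrable_comp (ε := ε) φ ψ z).const_mul (2 / ε * z (Sum.inr j) * I)).congr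
      (Filter.Eventually.of_forall fun s => ?_)
    simp [x₂, ContinuousLinearMap.mul_apply']; ring
  · exact schwartz_integrable_comp φ ψ z

/-- The cross-Wigner function of Schwartz functions decays rapidly. -/
theorem crossWigner_decay {ε : ℝ} (hε : ε ≠ 0) (k : ℕ) : ∀ φ ψ : 𝓢(Pos d, ℂ),
    ∃ C, ∀ z : Phase d, (1 + ‖z‖) ^ k * ‖crossWigner ε φ ψ z‖ ≤ C := by
  induction k with
  | zero => intro φ ψ; simpa using exists_norm_crossWigner_le φ ψ
  | succ k ih =>
    intro φ ψ
    have hj : ∀ j : Fin d ⊕ Fin d, ∃ C, ∀ z : Phase d,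
        (1 + ‖z‖) ^ k * (‖z j‖ * ‖crossWigner ε φ ψ z‖) ≤ C := by
      have key : ∀ (j : Fin d ⊕ Fin d) (c : ℂ) (φ' ψ' : 𝓢(Pos d, ℂ)) (σ : ℂ), ‖σ‖ = 1 →
          (∀ z : Phase d, (z j : ℂ) * crossWigner ε φ ψ z =
            c * (crossWigner ε φ' ψ z + σ * crossWigner ε φ ψ' z)) →
          ∃ C, ∀ z : Phase d, (1 + ‖z‖) ^ k * (‖z j‖ * ‖crossWigner ε φ ψ z‖) ≤ C := by
        intro j c φ' ψ' σ hσ h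
        obtain ⟨C₁, h₁⟩ := ih φ' ψ
        obtain ⟨C₂, h₂⟩ := ih φ ψ'
        refine ⟨‖c‖ * (C₁ + C₂), fun z => ?_⟩
        have e : ‖z j‖ * ‖crossWigner ε φ ψ z‖ =
            ‖c‖ * ‖crossWigner ε φ' ψ z + σ * crossWigner ε φ ψ' z‖ := by
          rw [← norm_mul, ← h, norm_mul, norm_real]
        rw [e, mul_left_comm]
        refine mul_le_mul_of_nonneg_left ?_ (norm_nonneg _)
        calc (1 + ‖z‖) ^ k * ‖crossWigner ε φ' ψ z + σ * crossWigner ε φ ψ' z‖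
            ≤ (1 + ‖z‖) ^ k * (‖crossWigner ε φ' ψ z‖ + ‖crossWigner ε φ ψ' z‖) := by
              refine mul_le_mul_of_nonneg_left ((norm_add_le _ _).trans (le_of_eq ?_))
                (by positivity)
              rw [norm_mul, hσ, one_mul]
          _ ≤ C₁ + C₂ := by rw [mul_add]; exact add_le_add (h₁ z) (h₂ z)
      rintro (j | j)
      · exact key _ (1 / 2) (coordMul j φ) (coordMul j ψ) 1 (by simp) fun z => by
          rw [pos_mul_crossWigner, one_mul]
      · exact key _ (I * ε / 2) (coordDeriv j φ) (coordDeriv j ψ) (-1) (by simp) fun z => by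
          rw [mom_mul_crossWigner hε]; ring
    choose C hC using hj
    obtain ⟨C₀, h₀⟩ := ih φ ψ
    refine ⟨C₀ + ∑ j, C j, fun z => ?_⟩
    have hz : ‖z‖ ≤ ∑ j, ‖z j‖ := by
      conv_lhs => rw [← (EuclideanSpace.basisFun (Fin d ⊕ Fin d) ℝ).sum_repr z]
      refine (norm_sum_le _ _).trans (Finset.sum_le_sum fun j _ => ?_)
      simp [norm_smul]
    calc (1 + ‖z‖) ^ (k + 1) * ‖crossWigner ε φ ψ z‖
        = (1 + ‖z‖) ^ k * ‖crossWigner ε φ ψ z‖ +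
          (1 + ‖z‖) ^ k * (‖z‖ * ‖crossWigner ε φ ψ z‖) := by ring
      _ ≤ (1 + ‖z‖) ^ k * ‖crossWigner ε φ ψ z‖ +
          (1 + ‖z‖) ^ k * ((∑ j, ‖z j‖) * ‖crossWigner ε φ ψ z‖) := by gcongr
      _ ≤ C₀ + ∑ j, C j := by
        rw [Finset.sum_mul, Finset.mul_sum]
        exact add_le_add (h₀ z) (Finset.sum_le_sum fun j _ => hC j z)

theorem integrable_one_add_norm_zpow (E : Type*) [NormedAddCommGroup E] [NormedSpace ℝ E]
    [FiniteDimensional ℝ E] [MeasurableSpace E] [BorelSpace E] (μ : Measure E)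
    [μ.IsAddHaarMeasure] {n : ℕ} (hn : Module.finrank ℝ E < n) :
    Integrable (fun x : E => ((1 + ‖x‖) ^ n)⁻¹) μ := by
  have := integrable_one_add_norm (E := E) (μ := μ) (r := n) (by exact_mod_cast hn)
  refine this.congr (Filter.Eventually.of_forall fun x => ?_)
  simp only
  rw [Real.rpow_neg (by positivity), Real.rpow_natCast]

theorem integrable_mul_crossWigner {ε : ℝ} (hε : ε ≠ 0) {b : Phase d → ℝ} (hb : Continuous b)
    {C : ℝ} {k : ℕ} (hC : ∀ z, |b z| ≤ C * (1 + ‖z‖) ^ k) (φ ψ : 𝓢(Pos d, ℂ)) :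
    Integrable fun z : Phase d => (b z : ℂ) * crossWigner ε φ ψ z := by
  obtain ⟨C', h'⟩ := crossWigner_decay hε (k + (2 * d + 1)) φ ψ
  have hC0 : 0 ≤ C := by simpa using (abs_nonneg _).trans (hC 0)
  refine Integrable.mono' ((integrable_one_add_norm_zpow (Phase d) volume (n := 2 * d + 1)
    (by simp [finrank_euclideanSpace]; omega)).const_mul (C * C'))
    ((continuous_ofReal.comp hb).mul (continuous_crossWigner φ ψ)).aestronglyMeasurable
    (Filter.Eventually.of_forall fun z => ?_)
  rw [norm_mul, norm_real, Real.norm_eq_abs, ← div_eq_mul_inv, le_div_iff₀ (by positivity)]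
  calc |b z| * ‖crossWigner ε φ ψ z‖ * (1 + ‖z‖) ^ (2 * d + 1)
      ≤ C * (1 + ‖z‖) ^ k * ‖crossWigner ε φ ψ z‖ * (1 + ‖z‖) ^ (2 * d + 1) := by
        gcongr; exact hC z
    _ = C * ((1 + ‖z‖) ^ (k + (2 * d + 1)) * ‖crossWigner ε φ ψ z‖) := by ring
    _ ≤ C * C' := by gcongr; exact h' z

end Wigner

/-! ### Symbols and their Weyl quantization on Schwartz functions -/

section Symbol

open SchwartzMap LineDeriv

variable {d : ℕ}

/-- `b` is `n` times differentiable and its partial derivatives up to order `n` are bounded by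
multiples of `(1 + ‖z‖) ^ m`. -/
def SymbolBound (m : ℤ) : ℕ → (Phase d → ℝ) → Prop
  | 0, b => Continuous b ∧ ∃ C, ∀ z, |b z| ≤ C * (1 + ‖z‖) ^ m
  | n + 1, b => (Continuous b ∧ ∃ C, ∀ z, |b z| ≤ C * (1 + ‖z‖) ^ m) ∧ Differentiable ℝ b ∧
      ∀ v, SymbolBound m n fun z => fderiv ℝ b z v

namespace SymbolBound

variable {m m' : ℤ} {n : ℕ} {b b' : Phase d → ℝ}

theorem zero_order (h : SymbolBound m n b) :
    Continuous b ∧ ∃ C, ∀ z, |b z| ≤ C * (1 + ‖z‖) ^ m := by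
  cases n with
  | zero => exact h
  | succ n => exact h.1

theorem of_succ : ∀ {n : ℕ} {b : Phase d → ℝ}, SymbolBound m (n + 1) b → SymbolBound m n b := by
  intro n
  induction n with
  | zero => intro b h; exact h.1
  | succ n ih => intro b h; exact ⟨h.1, h.2.1, fun v => ih (h.2.2 v)⟩

theorem mono_order (hm : m ≤ m') : ∀ {n : ℕ} {b : Phase d → ℝ},
    SymbolBound m n b → SymbolBound m' n b := by
  have h0 : ∀ b : Phase d → ℝ, (Continuous b ∧ ∃ C, ∀ z, |b z| ≤ C * (1 + ‖z‖) ^ m) →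
      Continuous b ∧ ∃ C, ∀ z, |b z| ≤ C * (1 + ‖z‖) ^ m' := by
    rintro b ⟨hc, C, hC⟩
    refine ⟨hc, C, fun z => (hC z).trans ?_⟩
    have hC0 : 0 ≤ C := by simpa using (abs_nonneg _).trans (hC 0)
    exact mul_le_mul_of_nonneg_left (zpow_le_zpow_right₀ (by simp) hm) hC0
  intro n
  induction n with
  | zero => intro b h; exact h0 b h
  | succ n ih => intro b h; exact ⟨h0 b h.1, h.2.1, fun v => ih (h.2.2 v)⟩

theorem add : ∀ {n : ℕ} {b b' : Phase d → ℝ}, SymbolBound m n b → SymbolBound m n b' →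
    SymbolBound m n fun z => b z + b' z := by
  have h0 : ∀ b b' : Phase d → ℝ, (Continuous b ∧ ∃ C, ∀ z, |b z| ≤ C * (1 + ‖z‖) ^ m) →
      (Continuous b' ∧ ∃ C, ∀ z, |b' z| ≤ C * (1 + ‖z‖) ^ m) →
      Continuous (fun z => b z + b' z) ∧ ∃ C, ∀ z, |b z + b' z| ≤ C * (1 + ‖z‖) ^ m := by
    rintro b b' ⟨hc, C, hC⟩ ⟨hc', C', hC'⟩
    refine ⟨hc.add hc', C + C', fun z => (abs_add_le _ _).trans ?_⟩
    rw [add_mul]; exact add_le_add (hC z) (hC' z)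
  intro n
  induction n with
  | zero => intro b b' h h'; exact h0 b b' h h'
  | succ n ih =>
    intro b b' h h'
    refine ⟨h0 b b' h.1 h'.1, h.2.1.add h'.2.1, fun v => ?_⟩
    have e : (fun z => fderiv ℝ (fun z => b z + b' z) z v) =
        fun z => fderiv ℝ b z v + fderiv ℝ b' z v := by
      funext z
      rw [fderiv_fun_add (h.2.1 z) (h'.2.1 z)]; rfl
    rw [e]; exact ih (h.2.2 v) (h'.2.2 v)

theorem mul : ∀ {n : ℕ} {b b' : Phase d → ℝ}, SymbolBound m n b → SymbolBound m' n b' →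
    SymbolBound (m + m') n fun z => b z * b' z := by
  have h0 : ∀ b b' : Phase d → ℝ, (Continuous b ∧ ∃ C, ∀ z, |b z| ≤ C * (1 + ‖z‖) ^ m) →
      (Continuous b' ∧ ∃ C, ∀ z, |b' z| ≤ C * (1 + ‖z‖) ^ m') →
      Continuous (fun z => b z * b' z) ∧ ∃ C, ∀ z, |b z * b' z| ≤ C * (1 + ‖z‖) ^ (m + m') := by
    rintro b b' ⟨hc, C, hC⟩ ⟨hc', C', hC'⟩
    refine ⟨hc.mul hc', C * C', fun z => ?_⟩
    rw [abs_mul, zpow_add₀ (by positivity)]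
    calc |b z| * |b' z| ≤ (C * (1 + ‖z‖) ^ m) * (C' * (1 + ‖z‖) ^ m') :=
          mul_le_mul (hC z) (hC' z) (abs_nonneg _) ((abs_nonneg _).trans (hC z))
      _ = _ := by ring
  intro n
  induction n with
  | zero => intro b b' h h'; exact h0 b b' h h'
  | succ n ih =>
    intro b b' h h'
    refine ⟨h0 b b' h.1 h'.1, h.2.1.mul h'.2.1, fun v => ?_⟩
    have e : (fun z => fderiv ℝ (fun z => b z * b' z) z v) =
        fun z => b z * fderiv ℝ b' z v + fderiv ℝ b z v * b' z := by
      funext z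
      rw [fderiv_fun_mul (h.2.1 z) (h'.2.1 z)]
      simp [mul_comm]
    rw [e]; exact (ih h.of_succ (h'.2.2 v)).add (ih (h.2.2 v) h'.of_succ)

theorem const (c : ℝ) : ∀ n, SymbolBound (d := d) 0 n fun _ => c := by
  intro n
  induction n generalizing c with
  | zero => exact ⟨continuous_const, |c|, fun z => by simp⟩
  | succ n ih =>
    refine ⟨⟨continuous_const, |c|, fun z => by simp⟩, differentiable_const c, fun v => ?_⟩
    simpa using ih 0

theorem coord (j : Fin d ⊕ Fin d) : ∀ n, SymbolBound (d := d) 1 n fun z => z j := by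
  have h0 : Continuous (fun z : Phase d => z j) ∧
      ∃ C, ∀ z : Phase d, |z j| ≤ C * (1 + ‖z‖) ^ (1 : ℤ) := by
    refine ⟨by fun_prop, 1, fun z => ?_⟩
    have := PiLp.norm_apply_le z j
    rw [Real.norm_eq_abs] at this
    simp; linarith
  intro n
  cases n with
  | zero => exact h0
  | succ n =>
    refine ⟨h0, by fun_prop, fun v => ?_⟩
    have e : (fun z : Phase d => fderiv ℝ (fun z : Phase d => z j) z v) = fun _ => v j := by
      funext z
      have : HasFDerivAt (fun z : Phase d => z j) (EuclideanSpace.proj j : Phase d →L[ℝ] ℝ) z :=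
        (EuclideanSpace.proj j : Phase d →L[ℝ] ℝ).hasFDerivAt
      rw [this.fderiv]; rfl
    rw [e]; exact (const (v j) n).mono_order (by norm_num)

theorem sum {ι : Type*} (s : Finset ι) {b : ι → Phase d → ℝ} (hm : 0 ≤ m)
    (h : ∀ i ∈ s, SymbolBound m n (b i)) : SymbolBound m n fun z => ∑ i ∈ s, b i z := by
  classical
  induction s using Finset.induction_on with
  | empty => simpa using (const (d := d) 0 n).mono_order hm
  | insert i s hi ih =>
    simp only [Finset.sum_insert hi]
    exact (h i (Finset.mem_insert_self i s)).add
      (ih fun j hj => h j (Finset.mem_insert_of_mem hj))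

theorem inv_one_add_norm_sq : ∀ n, SymbolBound (d := d) (-2) n fun z => (1 + ‖z‖ ^ 2)⁻¹ := by
  have hc : Continuous fun z : Phase d => (1 + ‖z‖ ^ 2)⁻¹ :=
    (by fun_prop : Continuous fun z : Phase d => 1 + ‖z‖ ^ 2).inv₀ fun z => by positivity
  have h0 : Continuous (fun z : Phase d => (1 + ‖z‖ ^ 2)⁻¹) ∧
      ∃ C, ∀ z : Phase d, |(1 + ‖z‖ ^ 2)⁻¹| ≤ C * (1 + ‖z‖) ^ (-2 : ℤ) := by
    refine ⟨hc, 2, fun z => ?_⟩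
    rw [abs_of_pos (by positivity), zpow_neg, ← div_eq_mul_inv, le_div_iff₀ (by positivity),
      inv_mul_le_iff₀ (by positivity)]
    have : (1 + ‖z‖) ^ (2 : ℤ) = (1 + ‖z‖) ^ 2 := by norm_cast
    rw [this]
    nlinarith [sq_nonneg (‖z‖ - 1)]
  intro n
  induction n with
  | zero => exact h0
  | succ n ih =>
    have hd : ∀ z : Phase d, HasFDerivAt (fun z : Phase d => (1 + ‖z‖ ^ 2)⁻¹)
        (-((1 + ‖z‖ ^ 2) ^ 2)⁻¹ • ((2 : ℝ) • innerSL ℝ z)) z := by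
      intro z
      have h1 : HasFDerivAt (fun z : Phase d => 1 + ‖z‖ ^ 2) ((2 : ℝ) • innerSL ℝ z) z := by
        have := (hasStrictFDerivAt_norm_sq z).hasFDerivAt.const_add (1 : ℝ)
        refine this.congr_fderiv ?_
        ext v
        simp [two_smul]
      exact (hasDerivAt_inv (by positivity : (1 + ‖z‖ ^ 2) ≠ 0)).comp_hasFDerivAt z h1
    refine ⟨h0, fun z => (hd z).differentiableAt, fun v => ?_⟩
    have e : (fun z : Phase d => fderiv ℝ (fun z : Phase d => (1 + ‖z‖ ^ 2)⁻¹) z v) =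
        fun z => (-2 * ∑ j, v j * z j) * ((1 + ‖z‖ ^ 2)⁻¹ * (1 + ‖z‖ ^ 2)⁻¹) := by
      funext z
      rw [(hd z).fderiv]
      simp only [_root_.smul_apply, innerSL_apply_apply, smul_eq_mul, PiLp.inner_apply,
        RCLike.inner_apply, conj_trivial]
      rw [sq (1 + ‖z‖ ^ 2), mul_inv]; ring
    rw [e]
    have hs : SymbolBound (d := d) 1 n fun z => ∑ j, v j * z j :=
      sum _ (by norm_num) fun j _ => by simpa using (const (v j) n).mul (coord j n)
    have := (((const (-2) n).mul hs).mul (ih.mul ih))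
    exact this.mono_order (by norm_num)

end SymbolBound

/-- The derivative of the cross-Wigner function in the direction conjugate to a coordinate. -/
theorem exists_lineDeriv_crossWigner {ε : ℝ} (hε : ε ≠ 0) (j : Fin d ⊕ Fin d) (ψ : 𝓢(Pos d, ℂ)) :
    ∃ (ψ' : 𝓢(Pos d, ℂ)) (v : Phase d) (κ : ℂ), κ ≠ 0 ∧ ∀ (φ : 𝓢(Pos d, ℂ)) (z : Phase d),
      HasLineDerivAt ℝ (crossWigner ε φ ψ)
        (κ * ((z j : ℂ) * crossWigner ε φ ψ z - crossWigner ε φ ψ' z)) z v := by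
  have hε' : (ε : ℂ) ≠ 0 := by exact_mod_cast hε
  have hcont : ∀ (φ ψ : 𝓢(Pos d, ℂ)) (z : Phase d),
      Continuous fun s => conj (φ s) * ψ ((2 : ℝ) • posL z - s) * wignerPhase ε z s := by
    intro φ ψ z
    have hc : Continuous fun s => wignerPhase ε z s := by unfold wignerPhase; fun_prop
    exact ((Complex.continuous_conj.comp φ.continuous).mul
      (ψ.continuous.comp (by fun_prop))).mul hc
  rcases j with j | j
  · let v : Phase d := EuclideanSpace.single (Sum.inr j) (1 : ℝ)
    refine ⟨coordMul j ψ, v, 2 * I / ε, by simp [hε'], fun φ z => ?_⟩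
    have hpos : ∀ t : ℝ, posL (z + t • v) = posL z := by
      intro t; ext i; simp [v]
    have hmom : ∀ (t : ℝ) (s : Pos d), inner ℝ (momL (z + t • v)) (s - posL z) =
        inner ℝ (momL z) (s - posL z) + t * (s j - z (Sum.inl j)) := by
      intro t s
      have : momL v = EuclideanSpace.single j (1 : ℝ) := by
        ext i; simp [v]
      rw [map_add, map_smul, inner_add_left, inner_smul_left, this,
        EuclideanSpace.inner_single_left]
      simp
    let c : ℂ := (((Real.pi * ε) ^ d : ℝ) : ℂ)⁻¹
    let F : ℝ → Pos d → ℂ := fun t s =>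
      conj (φ s) * ψ ((2 : ℝ) • posL z - s) * wignerPhase ε (z + t • v) s
    let F' : ℝ → Pos d → ℂ := fun t s => conj (φ s) * ψ ((2 : ℝ) • posL z - s) *
      (2 / ε * (s j - z (Sum.inl j)) * I * wignerPhase ε (z + t • v) s)
    have hF : ∀ t : ℝ, crossWigner ε φ ψ (z + t • v) = c * ∫ s, F t s := fun t => by
      rw [crossWigner_eq, hpos]
    have hphase : ∀ (s : Pos d) (t : ℝ), HasDerivAt (fun t : ℝ => wignerPhase ε (z + t • v) s)
        (2 / ε * (s j - z (Sum.inl j)) * I * wignerPhase ε (z + t • v) s) t := by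
      intro s t
      unfold wignerPhase
      simp only [hpos, hmom]
      have h1 : HasDerivAt (fun t : ℝ => ((2 / ε * (inner ℝ (momL z) (s - posL z) +
          t * (s j - z (Sum.inl j))) : ℝ) : ℂ)) ((2 / ε * (s j - z (Sum.inl j)) : ℝ) : ℂ) t := by
        refine HasDerivAt.ofReal_comp ?_
        simpa using (((hasDerivAt_id t).mul_const (s j - z (Sum.inl j))).const_add
          (inner ℝ (momL z) (s - posL z))).const_mul (2 / ε)
      refine (h1.mul_const I).cexp.congr_deriv ?_
      push_cast; ring
    have hF'0 : F' 0 = fun s => (2 * I / ε) *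
        ((z (Sum.inl j) : ℂ) * (conj (φ s) * ψ ((2 : ℝ) • posL z - s) * wignerPhase ε z s) -
          conj (φ s) * coordMul j ψ ((2 : ℝ) • posL z - s) * wignerPhase ε z s) := by
      funext s
      simp only [F', zero_smul, add_zero, coordMul_apply, PiLp.sub_apply, PiLp.smul_apply,
        posL_apply, smul_eq_mul]
      push_cast; ring
    have hi := schwartz_integrable_comp (ε := ε) φ ψ z
    have hi' := schwartz_integrable_comp (ε := ε) φ (coordMul j ψ) z
    have hF'i : Integrable (F' 0) := by
      rw [hF'0]; exact ((hi.const_mul _).sub hi').const_mul _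
    have hd := hasDerivAt_integral_of_dominated_loc_of_deriv_le (μ := volume) (x₀ := (0 : ℝ))
      (s := Set.univ) (F := F) (F' := F') (bound := fun s => ‖F' 0 s‖) Filter.univ_mem
      (Filter.Eventually.of_forall fun t => by
        have := hcont φ ψ (z + t • v)
        rw [hpos] at this
        exact this.aestronglyMeasurable)
      (by simpa [F] using hi) hF'i.aestronglyMeasurable
      (Filter.Eventually.of_forall fun s t _ => by simp [F'])
      hF'i.norm (Filter.Eventually.of_forall fun s t _ => (hphase s t).const_mul _)
    unfold HasLineDerivAt
    simp only [hF]
    refine (hd.2.const_mul c).congr_deriv ?_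
    rw [hF'0, integral_const_mul, integral_sub (hi.const_mul _) hi', integral_const_mul,
      crossWigner_eq, crossWigner_eq]
    ring
  · let v : Phase d := EuclideanSpace.single (Sum.inl j) (1 : ℝ)
    refine ⟨(-(I * ε)) • coordDeriv j ψ, v, -(2 * I / ε), by simp [hε'], fun φ z => ?_⟩
    let e : Pos d := EuclideanSpace.single j (1 : ℝ)
    have hmom : ∀ t : ℝ, momL (z + t • v) = momL z := by
      intro t; ext i; simp [v]
    have hpos : ∀ t : ℝ, posL (z + t • v) = posL z + t • e := by
      intro t
      have : posL v = e := by ext i; simp [v, e]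
      rw [map_add, map_smul, this]
    let c : ℂ := (((Real.pi * ε) ^ d : ℝ) : ℂ)⁻¹
    let F : ℝ → Pos d → ℂ := fun t s =>
      conj (φ s) * ψ ((2 : ℝ) • posL (z + t • v) - s) * wignerPhase ε (z + t • v) s
    let F' : ℝ → Pos d → ℂ := fun t s =>
      conj (φ s) * (2 * coordDeriv j ψ ((2 : ℝ) • posL (z + t • v) - s)) *
        wignerPhase ε (z + t • v) s +
      conj (φ s) * ψ ((2 : ℝ) • posL (z + t • v) - s) *
        (-(2 / ε * z (Sum.inr j) * I) * wignerPhase ε (z + t • v) s)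
    have hF : ∀ t : ℝ, crossWigner ε φ ψ (z + t • v) = c * ∫ s, F t s := fun t => by
      rw [crossWigner_eq]
    have hphase : ∀ (s : Pos d) (t : ℝ), HasDerivAt (fun t : ℝ => wignerPhase ε (z + t • v) s)
        (-(2 / ε * z (Sum.inr j) * I) * wignerPhase ε (z + t • v) s) t := by
      intro s t
      have hin : ∀ t : ℝ, inner ℝ (momL z) (s - (posL z + t • e)) =
          inner ℝ (momL z) (s - posL z) - t * z (Sum.inr j) := by
        intro t
        rw [← sub_sub, inner_sub_right, inner_smul_right, EuclideanSpace.inner_single_right]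
        simp
      unfold wignerPhase
      simp only [hpos, hmom, hin]
      have h1 : HasDerivAt (fun t : ℝ => ((2 / ε * (inner ℝ (momL z) (s - posL z) -
          t * z (Sum.inr j)) : ℝ) : ℂ)) ((-(2 / ε * z (Sum.inr j)) : ℝ) : ℂ) t := by
        refine HasDerivAt.ofReal_comp ?_
        simpa using (((hasDerivAt_id t).mul_const (z (Sum.inr j))).const_sub
          (inner ℝ (momL z) (s - posL z))).const_mul (2 / ε)
      refine (h1.mul_const I).cexp.congr_deriv ?_
      push_cast; ring
    have hψd : ∀ (s : Pos d) (t : ℝ), HasDerivAt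
        (fun t : ℝ => ψ ((2 : ℝ) • posL (z + t • v) - s))
        (2 * coordDeriv j ψ ((2 : ℝ) • posL (z + t • v) - s)) t := by
      intro s t
      simp only [hpos]
      have h1 : HasDerivAt (fun t : ℝ => (2 : ℝ) • (posL z + t • e) - s) ((2 : ℝ) • e) t := by
        simpa using ((((hasDerivAt_id t).smul_const e).const_add (posL z)).const_smul
          (2 : ℝ)).sub_const s
      have h2 := (ψ.hasFDerivAt ((2 : ℝ) • (posL z + t • e) - s)).comp_hasDerivAt t h1
      refine h2.congr_deriv ?_
      rw [map_smul, coordDeriv_apply]; simp [e]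
    have hF'0 : F' 0 = fun s => (-(2 * I / ε)) *
        ((z (Sum.inr j) : ℂ) * (conj (φ s) * ψ ((2 : ℝ) • posL z - s) * wignerPhase ε z s) -
          conj (φ s) * ((-(I * ε)) • coordDeriv j ψ) ((2 : ℝ) • posL z - s) *
            wignerPhase ε z s) := by
      funext s
      simp only [F', zero_smul, add_zero, _root_.smul_apply, smul_eq_mul]
      field_simp
      linear_combination (ε * (starRingEnd ℂ) (φ s) * coordDeriv j ψ ((2 : ℝ) • posL z - s) *
        wignerPhase ε z s) * I_mul_I
    have hi := schwartz_integrable_comp (ε := ε) φ ψ z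
    have hi' := schwartz_integrable_comp (ε := ε) φ ((-(I * ε)) • coordDeriv j ψ) z
    have hF'i : Integrable (F' 0) := by
      rw [hF'0]; exact ((hi.const_mul _).sub hi').const_mul _
    let B : ℝ := 2 * SchwartzMap.seminorm ℝ 0 0 (coordDeriv j ψ) +
      SchwartzMap.seminorm ℝ 0 0 ψ * ‖(2 / ε * z (Sum.inr j) * I : ℂ)‖
    have hd := hasDerivAt_integral_of_dominated_loc_of_deriv_le (μ := volume) (x₀ := (0 : ℝ))
      (s := Set.univ) (F := F) (F' := F') (bound := fun s => ‖φ s‖ * B) Filter.univ_mem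
      (Filter.Eventually.of_forall fun t => (hcont φ ψ (z + t • v)).aestronglyMeasurable)
      (by simpa [F] using hi) hF'i.aestronglyMeasurable
      (Filter.Eventually.of_forall fun s t _ => by
        refine (norm_add_le _ _).trans ?_
        simp only [norm_mul, norm_wignerPhase, RCLike.norm_conj, mul_one, norm_neg, B, mul_add]
        refine add_le_add ?_ ?_
        · rw [Complex.norm_ofNat]
          exact mul_le_mul_of_nonneg_left (mul_le_mul_of_nonneg_left
            ((coordDeriv j ψ).norm_le_seminorm ℝ _) (by norm_num)) (norm_nonneg _)
        · rw [mul_assoc]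
          refine mul_le_mul_of_nonneg_left (mul_le_mul_of_nonneg_right
            (ψ.norm_le_seminorm ℝ _) (by positivity)) (norm_nonneg _))
      ((φ.integrable (μ := volume)).norm.mul_const B)
      (Filter.Eventually.of_forall fun s t _ => by
        have := ((hψd s t).const_mul (conj (φ s))).mul (hphase s t)
        exact this)
    unfold HasLineDerivAt
    simp only [hF]
    refine (hd.2.const_mul c).congr_deriv ?_
    rw [hF'0, integral_const_mul, integral_sub (hi.const_mul _) hi', integral_const_mul,
      crossWigner_eq, crossWigner_eq]
    ring

end Symbol

section WeylImage

open SchwartzMap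

variable {d : ℕ}

/-- A smooth function whose derivatives of order at least two are bounded. -/
structure IsSubquadratic (a : Phase d → ℝ) : Prop where
  smooth : ContDiff ℝ ∞ a
  bound : ∀ n : ℕ, 2 ≤ n → ∃ C : ℝ, ∀ z, ‖iteratedFDeriv ℝ n a z‖ ≤ C

theorem IsAdmissibleSymbol.isSubquadratic {h : ℝ → Phase d → ℝ} (hh : IsAdmissibleSymbol h)
    (t : ℝ) : IsSubquadratic (h t) :=
  ⟨hh.smooth t, fun n hn => by
    obtain ⟨C, -, hC⟩ := hh.subquadratic n hn
    exact ⟨C t, hC t⟩⟩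

theorem norm_le_of_norm_fderiv_le {F : Type*} [NormedAddCommGroup F] [NormedSpace ℝ F]
    {g : Phase d → F} (hg : Differentiable ℝ g) {C : ℝ} {k : ℕ}
    (hC : ∀ z, ‖fderiv ℝ g z‖ ≤ C * (1 + ‖z‖) ^ k) (z : Phase d) :
    ‖g z‖ ≤ (‖g 0‖ + C) * (1 + ‖z‖) ^ (k + 1) := by
  have hC0 : 0 ≤ C := by simpa using (norm_nonneg _).trans (hC 0)
  have h1 : ‖g z - g 0‖ ≤ C * (1 + ‖z‖) ^ k * ‖z - 0‖ := by
    refine Convex.norm_image_sub_le_of_norm_fderiv_le (𝕜 := ℝ) (s := Metric.closedBall 0 ‖z‖)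
      (fun x _ => hg x) (fun x hx => (hC x).trans ?_) (convex_closedBall _ _)
      (Metric.mem_closedBall_self (norm_nonneg z)) (by simp)
    have : ‖x‖ ≤ ‖z‖ := by simpa using hx
    gcongr
  rw [sub_zero] at h1
  have h2 : ‖g z‖ ≤ ‖g 0‖ + ‖g z - g 0‖ := by
    have := norm_add_le (g 0) (g z - g 0)
    rwa [add_sub_cancel] at this
  have h3 : 1 ≤ (1 + ‖z‖) ^ (k + 1) := one_le_pow₀ (by simp)
  have h4 : C * (1 + ‖z‖) ^ k * ‖z‖ ≤ C * (1 + ‖z‖) ^ (k + 1) := by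
    rw [pow_succ, ← mul_assoc]
    gcongr
    simp
  nlinarith [norm_nonneg (g 0)]

namespace IsSubquadratic

variable {a : Phase d → ℝ}

theorem differentiable (ha : IsSubquadratic a) : Differentiable ℝ a :=
  ha.smooth.differentiable (by simp)

theorem contDiff_fderiv (ha : IsSubquadratic a) : ContDiff ℝ ∞ (fderiv ℝ a) :=
  ha.smooth.fderiv_right (by simp)

theorem norm_fderiv_le (ha : IsSubquadratic a) :
    ∃ C, 0 ≤ C ∧ ∀ z, ‖fderiv ℝ a z‖ ≤ C * (1 + ‖z‖) ^ 1 := by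
  obtain ⟨C, hC⟩ := ha.bound 2 le_rfl
  have h1 : ∀ z, ‖fderiv ℝ (fderiv ℝ a) z‖ ≤ C * (1 + ‖z‖) ^ 0 := by
    intro z
    rw [← norm_iteratedFDeriv_one, norm_iteratedFDeriv_fderiv]
    simpa using hC z
  refine ⟨_, ?_, norm_le_of_norm_fderiv_le (ha.contDiff_fderiv.differentiable (by simp)) h1⟩
  have := (norm_nonneg _).trans (hC 0)
  positivity

theorem abs_le (ha : IsSubquadratic a) : ∃ C, 0 ≤ C ∧ ∀ z, |a z| ≤ C * (1 + ‖z‖) ^ 2 := by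
  obtain ⟨C, hC0, hC⟩ := ha.norm_fderiv_le
  exact ⟨_, by positivity, norm_le_of_norm_fderiv_le ha.differentiable hC⟩

theorem norm_iteratedFDeriv_partial_le (ha : ContDiff ℝ ∞ a) (v : Phase d) (n : ℕ) (z : Phase d) :
    ‖iteratedFDeriv ℝ n (fun z => fderiv ℝ a z v) z‖ ≤ ‖v‖ * ‖iteratedFDeriv ℝ (n + 1) a z‖ := by
  rw [← norm_iteratedFDeriv_fderiv]
  exact norm_iteratedFDeriv_clm_apply_const (N := ∞) (ha.fderiv_right (by simp)).contDiffAt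
    (by exact_mod_cast le_top)

theorem contDiff_partial (ha : ContDiff ℝ ∞ a) (v : Phase d) :
    ContDiff ℝ ∞ fun z => fderiv ℝ a z v :=
  (ha.fderiv_right (by simp)).clm_apply contDiff_const

theorem partial_bound (ha : IsSubquadratic a) (v : Phase d) (n : ℕ) (hn : 1 ≤ n) :
    ∃ C, ∀ z, ‖iteratedFDeriv ℝ n (fun z => fderiv ℝ a z v) z‖ ≤ C := by
  obtain ⟨C, hC⟩ := ha.bound (n + 1) (by omega)
  exact ⟨‖v‖ * C, fun z => (norm_iteratedFDeriv_partial_le ha.smooth v n z).trans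
    (mul_le_mul_of_nonneg_left (hC z) (norm_nonneg v))⟩

theorem partialDeriv (ha : IsSubquadratic a) (v : Phase d) :
    IsSubquadratic fun z => fderiv ℝ a z v :=
  ⟨contDiff_partial ha.smooth v, fun n hn => ha.partial_bound v n (by omega)⟩

theorem symbolBound_zero : ∀ {n : ℕ} {b : Phase d → ℝ}, ContDiff ℝ ∞ b →
    (∀ k, ∃ C, ∀ z, ‖iteratedFDeriv ℝ k b z‖ ≤ C) → SymbolBound 0 n b := by
  have h0 : ∀ b : Phase d → ℝ, ContDiff ℝ ∞ b →
      (∀ k, ∃ C, ∀ z, ‖iteratedFDeriv ℝ k b z‖ ≤ C) →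
      Continuous b ∧ ∃ C, ∀ z, |b z| ≤ C * (1 + ‖z‖) ^ (0 : ℤ) := by
    intro b hb hk
    obtain ⟨C, hC⟩ := hk 0
    exact ⟨hb.continuous, C, fun z => by simpa using hC z⟩
  intro n
  induction n with
  | zero => intro b hb hk; exact h0 b hb hk
  | succ n ih =>
    intro b hb hk
    refine ⟨h0 b hb hk, hb.differentiable (by simp), fun v => ih (contDiff_partial hb v) fun k => ?_⟩
    obtain ⟨C, hC⟩ := hk (k + 1)
    exact ⟨‖v‖ * C, fun z => (norm_iteratedFDeriv_partial_le hb v k z).trans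
      (mul_le_mul_of_nonneg_left (hC z) (norm_nonneg v))⟩

theorem symbolBound_partial (ha : IsSubquadratic a) (v : Phase d) (n : ℕ) :
    SymbolBound 1 n fun z => fderiv ℝ a z v := by
  have hs := contDiff_partial ha.smooth v
  obtain ⟨C, hC0, hC⟩ := ha.norm_fderiv_le
  have h0 : Continuous (fun z => fderiv ℝ a z v) ∧
      ∃ C, ∀ z, |fderiv ℝ a z v| ≤ C * (1 + ‖z‖) ^ (1 : ℤ) := by
    refine ⟨hs.continuous, C * ‖v‖, fun z => ?_⟩
    have h1 := (fderiv ℝ a z).le_opNorm v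
    rw [Real.norm_eq_abs] at h1
    refine h1.trans ((mul_le_mul_of_nonneg_right (hC z) (norm_nonneg v)).trans (le_of_eq ?_))
    rw [zpow_one, pow_one]; ring
  cases n with
  | zero => exact h0
  | succ n =>
    refine ⟨h0, hs.differentiable (by simp), fun w => ?_⟩
    refine (symbolBound_zero (contDiff_partial hs w) fun k => ?_).mono_order (by norm_num)
    obtain ⟨C, hC⟩ := ha.partial_bound v (k + 1) (by omega)
    exact ⟨‖w‖ * C, fun z => (norm_iteratedFDeriv_partial_le hs w k z).trans
      (mul_le_mul_of_nonneg_left (hC z) (norm_nonneg w))⟩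

theorem symbolBound (ha : IsSubquadratic a) (n : ℕ) : SymbolBound 2 n a := by
  obtain ⟨C, hC0, hC⟩ := ha.abs_le
  have h0 : Continuous a ∧ ∃ C, ∀ z, |a z| ≤ C * (1 + ‖z‖) ^ (2 : ℤ) :=
    ⟨ha.smooth.continuous, C, fun z => by exact_mod_cast hC z⟩
  cases n with
  | zero => exact h0
  | succ n =>
    exact ⟨h0, ha.differentiable, fun v => (ha.symbolBound_partial v n).mono_order (by norm_num)⟩

end IsSubquadratic

/-- The functional `φ ↦ ∫ b W(φ, ψ)` is represented by an element of `L²`. -/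
def HasWeylImage (ε : ℝ) (b : Phase d → ℝ) (ψ : 𝓢(Pos d, ℂ)) : Prop :=
  ∃ f : Hilb d, ∀ φ : 𝓢(Pos d, ℂ),
    inner ℂ (φ.toLp 2 volume) f = ∫ z : Phase d, (b z : ℂ) * crossWigner ε φ ψ z

theorem inner_toLp_eq (φ : 𝓢(Pos d, ℂ)) (f : Hilb d) :
    inner ℂ (φ.toLp 2 volume) f = ∫ x, conj (φ x) * f x := by
  rw [L2.inner_def]
  refine integral_congr_ae ?_
  filter_upwards [φ.coeFn_toLp 2 volume] with x hx
  rw [hx, RCLike.inner_apply, mul_comm]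

theorem SymbolBound.integrable_mul {ε : ℝ} (hε : ε ≠ 0) {m : ℤ} {n : ℕ} {b : Phase d → ℝ}
    (hb : SymbolBound m n b) (φ ψ : 𝓢(Pos d, ℂ)) :
    Integrable fun z : Phase d => (b z : ℂ) * crossWigner ε φ ψ z := by
  obtain ⟨hc, C, hC⟩ := (hb.mono_order (m' := (m.toNat : ℤ)) (Int.self_le_toNat m)).zero_order
  exact integrable_mul_crossWigner hε hc (k := m.toNat) (fun z => by exact_mod_cast hC z) φ ψ

theorem hasWeylImage_of_decay {ε : ℝ} {b : Phase d → ℝ} (hb : Continuous b) {C : ℝ}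
    (hC : ∀ z, |b z| ≤ C * ((1 + ‖z‖) ^ (3 * d + 2))⁻¹) (ψ : 𝓢(Pos d, ℂ)) :
    HasWeylImage ε b ψ := by
  have hC0 : 0 ≤ C := by simpa using (abs_nonneg _).trans (hC 0)
  let c : ℂ := (((Real.pi * ε) ^ d : ℝ) : ℂ)⁻¹
  let K : Pos d → Phase d → ℂ := fun s z => (b z : ℂ) * (ψ ((2 : ℝ) • posL z - s) * wignerPhase ε z s)
  let f : Pos d → ℂ := fun s => c * ∫ z, K s z
  have hwc : Continuous fun p : Pos d × Phase d => wignerPhase ε p.2 p.1 := by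
    unfold wignerPhase; fun_prop
  have hKc : Continuous (Function.uncurry K) :=
    (continuous_ofReal.comp (hb.comp continuous_snd)).mul
      ((ψ.continuous.comp (by fun_prop)).mul hwc)
  have hfm : AEStronglyMeasurable f volume :=
    ((hKc.stronglyMeasurable.integral_prod_right).const_mul c).aestronglyMeasurable
  obtain ⟨B, hB⟩ : ∃ B, ∀ w : Pos d, (1 + ‖w‖) ^ (d + 1) * ‖ψ w‖ ≤ B :=
    ⟨_, fun w => by
      have := one_add_le_sup_seminorm_apply (𝕜 := ℝ) (m := (d + 1, 0)) (k := d + 1) (n := 0) le_rfl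
        le_rfl ψ w
      rwa [norm_iteratedFDeriv_zero] at this⟩
  have hB0 : 0 ≤ B := by
    have := hB 0
    refine le_trans ?_ this
    positivity
  have hbi : Integrable fun z : Phase d => ((1 + ‖z‖) ^ (2 * d + 1))⁻¹ :=
    integrable_one_add_norm_zpow (Phase d) volume (by simp [finrank_euclideanSpace]; omega)
  have hKb : ∀ s z, (1 + ‖s‖) ^ (d + 1) * ‖K s z‖ ≤
      C * 2 ^ (d + 1) * B * ((1 + ‖z‖) ^ (2 * d + 1))⁻¹ := by
    intro s z
    have h1 : 1 + ‖s‖ ≤ (2 * (1 + ‖z‖)) * (1 + ‖(2 : ℝ) • posL z - s‖) := by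
      have h2 : ‖s‖ ≤ ‖(2 : ℝ) • posL z‖ + ‖(2 : ℝ) • posL z - s‖ := by
        have := norm_sub_le ((2 : ℝ) • posL z) ((2 : ℝ) • posL z - s)
        simpa using this
      rw [norm_smul, Real.norm_ofNat] at h2
      have h3 := norm_posL_le z
      nlinarith [norm_nonneg z, norm_nonneg ((2 : ℝ) • posL z - s), norm_nonneg s,
        mul_nonneg (norm_nonneg z) (norm_nonneg ((2 : ℝ) • posL z - s))]
    have h4 := pow_le_pow_left₀ (by positivity) h1 (d + 1)
    simp only [K, norm_mul, norm_wignerPhase, mul_one, norm_real, Real.norm_eq_abs]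
    calc (1 + ‖s‖) ^ (d + 1) * (|b z| * ‖ψ ((2 : ℝ) • posL z - s)‖)
        ≤ ((2 * (1 + ‖z‖)) * (1 + ‖(2 : ℝ) • posL z - s‖)) ^ (d + 1) *
          (C * ((1 + ‖z‖) ^ (3 * d + 2))⁻¹ * ‖ψ ((2 : ℝ) • posL z - s)‖) := by
          gcongr; exact hC z
      _ = C * 2 ^ (d + 1) * ((1 + ‖(2 : ℝ) • posL z - s‖) ^ (d + 1) * ‖ψ ((2 : ℝ) • posL z - s)‖) *
          ((1 + ‖z‖) ^ (d + 1) * ((1 + ‖z‖) ^ (3 * d + 2))⁻¹) := by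
          rw [mul_pow, mul_pow]; ring
      _ ≤ C * 2 ^ (d + 1) * B * ((1 + ‖z‖) ^ (d + 1) * ((1 + ‖z‖) ^ (3 * d + 2))⁻¹) := by
          gcongr; exact hB _
      _ = _ := by
          congr 1
          rw [show 3 * d + 2 = (d + 1) + (2 * d + 1) by ring, pow_add (1 + ‖z‖) (d + 1) (2 * d + 1),
            mul_inv, ← mul_assoc, mul_inv_cancel₀ (by positivity), one_mul]
  have hfb : ∀ s, ‖f s‖ ≤ (‖c‖ * ∫ z : Phase d, C * 2 ^ (d + 1) * B *
      ((1 + ‖z‖) ^ (2 * d + 1))⁻¹) * ((1 + ‖s‖) ^ (d + 1))⁻¹ := by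
    intro s
    rw [← div_eq_mul_inv, le_div_iff₀ (by positivity), norm_mul, mul_assoc]
    refine mul_le_mul_of_nonneg_left ?_ (norm_nonneg _)
    rw [mul_comm]
    have h1 : (1 + ‖s‖) ^ (d + 1) * ‖∫ z, K s z‖ = ‖∫ z, ((1 + ‖s‖) ^ (d + 1)) • K s z‖ := by
      rw [integral_smul, norm_smul, Real.norm_of_nonneg (by positivity)]
    rw [h1]
    refine norm_integral_le_of_norm_le (hbi.const_mul _) (Filter.Eventually.of_forall fun z => ?_)
    rw [norm_smul, Real.norm_of_nonneg (by positivity)]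
    exact hKb s z
  have hfL : MemLp f 2 volume := by
    rw [memLp_two_iff_integrable_sq_norm hfm]
    refine Integrable.mono' ((integrable_one_add_norm_zpow (Pos d) volume (n := 2 * d + 2)
      (by simp [finrank_euclideanSpace]; omega)).const_mul ((‖c‖ * ∫ z : Phase d, C * 2 ^ (d + 1) *
        B * ((1 + ‖z‖) ^ (2 * d + 1))⁻¹) ^ 2)) (hfm.norm.pow 2)
      (Filter.Eventually.of_forall fun s => ?_)
    rw [Real.norm_of_nonneg (by positivity)]
    refine (pow_le_pow_left₀ (norm_nonneg _) (hfb s) 2).trans (le_of_eq ?_)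
    rw [mul_pow, inv_pow, ← pow_mul]; ring_nf
  refine ⟨hfL.toLp f, fun φ => ?_⟩
  rw [inner_toLp_eq]
  have e1 : ∫ x, conj (φ x) * hfL.toLp f x = ∫ s, ∫ z, c * (conj (φ s) * K s z) := by
    refine integral_congr_ae ?_
    filter_upwards [hfL.coeFn_toLp] with s hs
    rw [hs, integral_const_mul, integral_const_mul]; ring
  have e2 : ∫ z : Phase d, (b z : ℂ) * crossWigner ε φ ψ z =
      ∫ z, ∫ s, c * (conj (φ s) * K s z) := by
    refine integral_congr_ae (Filter.Eventually.of_forall fun z => ?_)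
    simp only [crossWigner_eq, K]
    rw [integral_const_mul, mul_left_comm, ← integral_const_mul (b z : ℂ)]
    refine congrArg (fun w : ℂ => c * w) (integral_congr_ae (Filter.Eventually.of_forall fun s => ?_))
    simp only; ring
  rw [e1, e2]
  refine integral_integral_swap ?_
  have hdom : Integrable (fun p : Pos d × Phase d => ‖φ p.1‖ *
      (C * 2 ^ (d + 1) * B * ((1 + ‖p.2‖) ^ (2 * d + 1))⁻¹)) (volume.prod volume) :=
    (φ.integrable (μ := volume)).norm.mul_prod (hbi.const_mul _)
  refine Integrable.mono' (hdom.const_mul ‖c‖) ?_ (Filter.Eventually.of_forall fun p => ?_)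
  · exact (continuous_const.mul ((Complex.continuous_conj.comp
      (φ.continuous.comp continuous_fst)).mul hKc)).aestronglyMeasurable
  · simp only [Function.uncurry, norm_mul c, norm_mul (conj _), RCLike.norm_conj]
    gcongr
    refine le_trans ?_ (hKb p.1 p.2)
    exact le_mul_of_one_le_left (norm_nonneg _) (one_le_pow₀ (by simp))

theorem HasWeylImage.add {ε : ℝ} {b b' : Phase d → ℝ} {ψ : 𝓢(Pos d, ℂ)}
    (h : HasWeylImage ε b ψ) (h' : HasWeylImage ε b' ψ)
    (hi : ∀ φ : 𝓢(Pos d, ℂ), Integrable fun z : Phase d => (b z : ℂ) * crossWigner ε φ ψ z)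
    (hi' : ∀ φ : 𝓢(Pos d, ℂ), Integrable fun z : Phase d => (b' z : ℂ) * crossWigner ε φ ψ z) :
    HasWeylImage ε (fun z => b z + b' z) ψ := by
  obtain ⟨f, hf⟩ := h
  obtain ⟨f', hf'⟩ := h'
  refine ⟨f + f', fun φ => ?_⟩
  rw [inner_add_right, hf, hf', ← integral_add (hi φ) (hi' φ)]
  refine integral_congr_ae (Filter.Eventually.of_forall fun z => ?_)
  simp only; push_cast; ring

theorem HasWeylImage.sum {ε : ℝ} {ι : Type*} (s : Finset ι) {b : ι → Phase d → ℝ}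
    {ψ : 𝓢(Pos d, ℂ)} (h : ∀ i, HasWeylImage ε (b i) ψ)
    (hi : ∀ i, ∀ φ : 𝓢(Pos d, ℂ),
      Integrable fun z : Phase d => (b i z : ℂ) * crossWigner ε φ ψ z) :
    HasWeylImage ε (fun z => ∑ i ∈ s, b i z) ψ := by
  choose f hf using h
  refine ⟨∑ i ∈ s, f i, fun φ => ?_⟩
  rw [inner_sum, Finset.sum_congr rfl fun i _ => hf i φ, ← integral_finsetSum _ fun i _ => hi i φ]
  refine integral_congr_ae (Filter.Eventually.of_forall fun z => ?_)
  simp only; push_cast; rw [Finset.sum_mul]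

/-- Multiplying a symbol by a coordinate amounts to applying an operator to the state and
differentiating the symbol. -/
theorem hasWeylImage_coord_mul {ε : ℝ} (hε : ε ≠ 0) {m : ℤ} {n : ℕ} {c : Phase d → ℝ}
    (hc : SymbolBound m (n + 1) c) (h1 : ∀ ψ, HasWeylImage ε c ψ)
    (h2 : ∀ ψ v, HasWeylImage ε (fun z => fderiv ℝ c z v) ψ) (j : Fin d ⊕ Fin d)
    (ψ : 𝓢(Pos d, ℂ)) : HasWeylImage ε (fun z => z j * c z) ψ := by
  obtain ⟨ψ', v, κ, hκ, hW⟩ := exists_lineDeriv_crossWigner hε j ψ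
  obtain ⟨f, hf⟩ := h1 ψ'
  obtain ⟨g, hg⟩ := h2 ψ v
  refine ⟨f + (-κ⁻¹) • g, fun φ => ?_⟩
  have i1 : Integrable fun z : Phase d => (c z : ℂ) * crossWigner ε φ ψ' z :=
    hc.integrable_mul hε φ ψ'
  have i2 : Integrable fun z : Phase d => ((z j * c z : ℝ) : ℂ) * crossWigner ε φ ψ z :=
    ((SymbolBound.coord j (n + 1)).mul hc).integrable_mul hε φ ψ
  have i3 : Integrable fun z : Phase d => ((fderiv ℝ c z v : ℝ) : ℂ) * crossWigner ε φ ψ z :=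
    (hc.2.2 v).integrable_mul hε φ ψ
  have hibp := integral_bilinear_hasLineDerivAt_right_eq_neg_left_of_integrable
    (μ := (volume : Measure (Phase d))) (B := ContinuousLinearMap.mul ℝ ℂ) (v := v)
    (f := fun z => (c z : ℂ)) (f' := fun z => ((fderiv ℝ c z v : ℝ) : ℂ))
    (g := crossWigner ε φ ψ)
    (g' := fun z => κ * ((z j : ℂ) * crossWigner ε φ ψ z - crossWigner ε φ ψ' z)) i3 ?_
    (hc.integrable_mul hε φ ψ)
    (fun z _ => HasDerivAt.ofReal_comp ((hc.2.1 z).hasFDerivAt.hasLineDerivAt v))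
    (fun z _ => hW φ z)
  · simp only [ContinuousLinearMap.mul_apply'] at hibp
    rw [inner_add_right, inner_smul_right, hf, hg]
    have e : ∫ z : Phase d, (c z : ℂ) * (κ * ((z j : ℂ) * crossWigner ε φ ψ z -
        crossWigner ε φ ψ' z)) = κ * ((∫ z : Phase d, ((z j * c z : ℝ) : ℂ) * crossWigner ε φ ψ z) -
        ∫ z : Phase d, (c z : ℂ) * crossWigner ε φ ψ' z) := by
      rw [← integral_sub i2 i1, ← integral_const_mul]
      refine integral_congr_ae (Filter.Eventually.of_forall fun z => ?_)
      simp only; push_cast; ring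
    rw [e] at hibp
    have h5 := congrArg (fun w => κ⁻¹ * w) hibp
    simp only [inv_mul_cancel_left₀ hκ] at h5
    linear_combination -h5
  · refine ((i2.sub i1).const_mul κ).congr (Filter.Eventually.of_forall fun z => ?_)
    simp only [ContinuousLinearMap.mul_apply', Pi.sub_apply]
    push_cast; ring

theorem SymbolBound.hasWeylImage {ε : ℝ} (hε : ε ≠ 0) : ∀ (n : ℕ) {m : ℤ} {b : Phase d → ℝ},
    m ≤ n - (3 * d + 2 : ℕ) → SymbolBound m n b → ∀ ψ, HasWeylImage ε b ψ := by
  intro n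
  induction n with
  | zero =>
    intro m b hm hb ψ
    obtain ⟨hc, C, hC⟩ := (hb.mono_order (m' := -((3 * d + 2 : ℕ) : ℤ)) (by simpa using hm))
    exact hasWeylImage_of_decay hc (fun z => by
      have := hC z
      rwa [zpow_neg, zpow_natCast] at this) ψ
  | succ n ih =>
    intro m b hm hb ψ
    have hm1 : m - 1 ≤ n - (3 * d + 2 : ℕ) := by push_cast at hm ⊢; linarith
    let b₀ : Phase d → ℝ := fun z => b z * (1 + ‖z‖ ^ 2)⁻¹
    have hb₀ : SymbolBound (m + -2) (n + 1) b₀ := hb.mul (SymbolBound.inv_one_add_norm_sq _)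
    let c : Fin d ⊕ Fin d → Phase d → ℝ := fun j z => z j * b₀ z
    have hc : ∀ j, SymbolBound (m - 1) (n + 1) (c j) := fun j =>
      ((SymbolBound.coord j _).mul hb₀).mono_order (by linarith)
    have h1 : ∀ j ψ, HasWeylImage ε (c j) ψ := fun j => ih hm1 (hc j).of_succ
    have h2 : ∀ j ψ v, HasWeylImage ε (fun z => fderiv ℝ (c j) z v) ψ := fun j ψ v =>
      ih hm1 ((hc j).2.2 v) ψ
    have h3 : ∀ j, HasWeylImage ε (fun z => z j * c j z) ψ := fun j =>
      hasWeylImage_coord_mul hε (hc j) (h1 j) (h2 j) j ψ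
    have h4 : ∀ j (φ : 𝓢(Pos d, ℂ)),
        Integrable fun z : Phase d => ((z j * c j z : ℝ) : ℂ) * crossWigner ε φ ψ z := fun j φ =>
      ((SymbolBound.coord j _).mul (hc j)).integrable_mul hε φ ψ
    have h5 := (ih hm1 (hb₀.of_succ.mono_order (by linarith)) ψ).add
      (HasWeylImage.sum Finset.univ h3 h4) (fun φ => hb₀.integrable_mul hε φ ψ) fun φ => by
        refine (integrable_finsetSum Finset.univ fun j _ => h4 j φ).congr
          (Filter.Eventually.of_forall fun z => ?_)
        simp only; push_cast; rw [Finset.sum_mul]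
    convert h5 using 2 with z
    have hz : ∑ j, z j * z j = ‖z‖ ^ 2 := by
      rw [EuclideanSpace.norm_sq_eq]
      exact Finset.sum_congr rfl fun j _ => by rw [Real.norm_eq_abs, sq_abs, sq]
    have : (1 + ‖z‖ ^ 2) ≠ 0 := by positivity
    simp only [c, ← mul_assoc]
    rw [← Finset.sum_mul, hz]
    simp only [b₀]; field_simp

theorem crossWigner_congr {ε : ℝ} {φ : Pos d → ℂ} {u ψ : Pos d → ℂ} (hu : u =ᵐ[volume] ψ)
    (z : Phase d) : crossWigner ε φ u z = crossWigner ε φ ψ z := by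
  rw [crossWigner_eq, crossWigner_eq]
  refine congrArg (fun w : ℂ => _ * w) (integral_congr_ae ?_)
  have := (quasiMeasurePreserving_sub_left volume ((2 : ℝ) • posL z)).ae_eq_comp hu
  filter_upwards [this] with s hs
  simp only [Function.comp] at hs
  simp only [hs]

/-- Quantizations of subquadratic symbols map Schwartz functions to `L²`. -/
theorem IsSubquadratic.exists_isWeylImage {ε : ℝ} (hε : ε ≠ 0) {a : Phase d → ℝ}
    (ha : IsSubquadratic a) (ψ : 𝓢(Pos d, ℂ)) {u : Hilb d} (hu : ⇑u =ᵐ[volume] ψ) :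
    ∃ f, IsWeylImage ε a u f := by
  obtain ⟨f, hf⟩ := (ha.symbolBound (3 * d + 4)).hasWeylImage hε _ (by push_cast; linarith) ψ
  refine ⟨f, fun φ => ?_⟩
  simp only [crossWigner_congr hu]
  exact ⟨(ha.symbolBound 0).integrable_mul hε φ ψ, hf φ⟩

end WeylImage

/-! ### Gaussian averages -/

section GaussianMean

/-- The unnormalized standard Gaussian weight. -/
def gaussWeight {E : Type*} [NormedAddCommGroup E] (ζ : E) : ℝ := Real.exp (-(1 / 2) * ‖ζ‖ ^ 2)

variable {ι : Type*} [Fintype ι]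

theorem gaussWeight_pos {E : Type*} [NormedAddCommGroup E] (ζ : E) : 0 < gaussWeight ζ :=
  Real.exp_pos _

theorem continuous_gaussWeight {E : Type*} [NormedAddCommGroup E] :
    Continuous (gaussWeight : E → ℝ) := by
  unfold gaussWeight; fun_prop

theorem integrable_exp_neg_mul_norm_sq {b : ℝ} (hb : 0 < b) :
    Integrable fun x : EuclideanSpace ℝ ι => Real.exp (-b * ‖x‖ ^ 2) := by
  have := (GaussianFourier.integrable_cexp_neg_mul_sq_norm_add (b := b) (by simpa using hb) 0
    (0 : EuclideanSpace ℝ ι)).norm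
  refine this.congr (Filter.Eventually.of_forall fun x => ?_)
  simp only [Complex.norm_exp]
  congr 1
  simp [← ofReal_pow]

theorem one_add_pow_mul_exp_le (k : ℕ) {b r : ℝ} (hb : 0 < b) (hr : 0 ≤ r) :
    (1 + r) ^ k * Real.exp (-b * r ^ 2) ≤
      k.factorial * Real.exp (1 + 1 / (2 * b)) * Real.exp (-(b / 2) * r ^ 2) := by
  have h1 : (1 + r) ^ k ≤ k.factorial * Real.exp (1 + r) := by
    have := Real.pow_div_factorial_le_exp (1 + r) (by positivity) k
    rwa [div_le_iff₀ (by positivity), mul_comm] at this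
  calc (1 + r) ^ k * Real.exp (-b * r ^ 2)
      ≤ k.factorial * Real.exp (1 + r) * Real.exp (-b * r ^ 2) := by gcongr
    _ = k.factorial * Real.exp (1 + r + -b * r ^ 2) := by rw [Real.exp_add (1 + r)]; ring
    _ ≤ k.factorial * Real.exp (1 + 1 / (2 * b) + -(b / 2) * r ^ 2) := by
        refine mul_le_mul_of_nonneg_left (Real.exp_le_exp.2 ?_) (by positivity)
        have h2 : 0 ≤ (b * r - 1) ^ 2 / (2 * b) := by positivity
        have h3 : (b * r - 1) ^ 2 / (2 * b) = b / 2 * r ^ 2 - r + 1 / (2 * b) := by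
          field_simp; ring
        linarith
    _ = _ := by rw [Real.exp_add (1 + 1 / (2 * b))]; ring

theorem integrable_pow_mul_exp (k : ℕ) {b : ℝ} (hb : 0 < b) :
    Integrable fun x : EuclideanSpace ℝ ι => (1 + ‖x‖) ^ k * Real.exp (-b * ‖x‖ ^ 2) := by
  refine Integrable.mono' ((integrable_exp_neg_mul_norm_sq (half_pos hb)).const_mul
    (k.factorial * Real.exp (1 + 1 / (2 * b)))) (by fun_prop)
    (Filter.Eventually.of_forall fun x => ?_)
  rw [Real.norm_of_nonneg (by positivity)]
  exact one_add_pow_mul_exp_le k hb (norm_nonneg x)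

/-- `f` grows at most polynomially. -/
def PolyGrowth {E F : Type*} [NormedAddCommGroup E] [NormedAddCommGroup F] (f : E → F) : Prop :=
  ∃ (C : ℝ) (k : ℕ), ∀ x, ‖f x‖ ≤ C * (1 + ‖x‖) ^ k

theorem PolyGrowth.mul {E R : Type*} [NormedAddCommGroup E] [NormedRing R] {f g : E → R}
    (hf : PolyGrowth f) (hg : PolyGrowth g) : PolyGrowth fun x => f x * g x := by
  obtain ⟨C, k, hC⟩ := hf
  obtain ⟨C', k', hC'⟩ := hg
  refine ⟨C * C', k + k', fun x => (norm_mul_le _ _).trans ?_⟩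
  calc ‖f x‖ * ‖g x‖ ≤ (C * (1 + ‖x‖) ^ k) * (C' * (1 + ‖x‖) ^ k') :=
        mul_le_mul (hC x) (hC' x) (norm_nonneg _) ((norm_nonneg _).trans (hC x))
    _ = _ := by ring

theorem PolyGrowth.add {E F : Type*} [NormedAddCommGroup E] [NormedAddCommGroup F] {f g : E → F}
    (hf : PolyGrowth f) (hg : PolyGrowth g) : PolyGrowth fun x => f x + g x := by
  obtain ⟨C, k, hC⟩ := hf
  obtain ⟨C', k', hC'⟩ := hg
  have hC0 : 0 ≤ C := by simpa using (norm_nonneg _).trans (hC 0)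
  have hC0' : 0 ≤ C' := by simpa using (norm_nonneg _).trans (hC' 0)
  refine ⟨C + C', max k k', fun x => (norm_add_le _ _).trans ?_⟩
  rw [add_mul]
  refine add_le_add ((hC x).trans ?_) ((hC' x).trans ?_)
  · exact mul_le_mul_of_nonneg_left (pow_le_pow_right₀ (by simp) (le_max_left _ _)) hC0
  · exact mul_le_mul_of_nonneg_left (pow_le_pow_right₀ (by simp) (le_max_right _ _)) hC0'

theorem PolyGrowth.const {E F : Type*} [NormedAddCommGroup E] [NormedAddCommGroup F] (c : F) :
    PolyGrowth fun _ : E => c := ⟨‖c‖, 0, fun x => by simp⟩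

theorem PolyGrowth.coord (j : ι) : PolyGrowth fun x : EuclideanSpace ℝ ι => x j := by
  refine ⟨1, 1, fun x => (PiLp.norm_apply_le x j).trans ?_⟩
  simp

theorem PolyGrowth.ofReal {E : Type*} [NormedAddCommGroup E] {f : E → ℝ} (hf : PolyGrowth f) :
    PolyGrowth fun x => (f x : ℂ) := by
  obtain ⟨C, k, hC⟩ := hf
  exact ⟨C, k, fun x => by simpa using hC x⟩

theorem PolyGrowth.sum {E F κ : Type*} [NormedAddCommGroup E] [NormedAddCommGroup F] (s : Finset κ)
    {f : κ → E → F} (hf : ∀ i, PolyGrowth (f i)) : PolyGrowth fun x => ∑ i ∈ s, f i x := by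
  classical
  induction s using Finset.induction_on with
  | empty => simpa using PolyGrowth.const (0 : F)
  | insert i s hi ih => simp only [Finset.sum_insert hi]; exact (hf i).add ih

theorem PolyGrowth.integrable {F : Type*} [NormedAddCommGroup F] [NormedSpace ℝ F]
    {f : EuclideanSpace ℝ ι → F} (hf : PolyGrowth f) (hc : AEStronglyMeasurable f volume) :
    Integrable fun x => gaussWeight x • f x := by
  obtain ⟨C, k, hC⟩ := hf
  refine Integrable.mono' ((integrable_pow_mul_exp k one_half_pos).const_mul C)
    (continuous_gaussWeight.aestronglyMeasurable.smul hc) (Filter.Eventually.of_forall fun x => ?_)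
  rw [norm_smul, Real.norm_of_nonneg (gaussWeight_pos x).le, gaussWeight]
  calc Real.exp (-(1 / 2) * ‖x‖ ^ 2) * ‖f x‖
      ≤ Real.exp (-(1 / 2) * ‖x‖ ^ 2) * (C * (1 + ‖x‖) ^ k) := by gcongr; exact hC x
    _ = _ := by ring

/-- Integration by parts against the standard Gaussian weight. -/
theorem integral_coord_smul_gaussWeight [DecidableEq ι] {F : Type*} [NormedAddCommGroup F]
    [NormedSpace ℝ F] {f : EuclideanSpace ℝ ι → F} (hd : Differentiable ℝ f) (hf : PolyGrowth f)
    (j : ι) {f' : EuclideanSpace ℝ ι → F}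
    (hf' : ∀ x, fderiv ℝ f x (EuclideanSpace.single j 1) = f' x) (hg : PolyGrowth f')
    (hm : AEStronglyMeasurable f' volume) :
    ∫ x, gaussWeight x • (x j • f x) = ∫ x, gaussWeight x • f' x := by
  have hw : ∀ x : EuclideanSpace ℝ ι, HasFDerivAt gaussWeight (gaussWeight x • -innerSL ℝ x) x := by
    intro x
    have h1 : HasFDerivAt (fun z : EuclideanSpace ℝ ι => -(1 / 2) * ‖z‖ ^ 2) (-innerSL ℝ x) x := by
      have := (hasStrictFDerivAt_norm_sq x).hasFDerivAt.const_mul (-(1 / 2) : ℝ)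
      refine this.congr_fderiv ?_
      ext v
      simp [two_smul]; ring
    exact h1.exp
  have hw' : ∀ x : EuclideanSpace ℝ ι,
      fderiv ℝ gaussWeight x (EuclideanSpace.single j 1) = -(gaussWeight x * x j) := by
    intro x
    rw [(hw x).fderiv]
    simp [EuclideanSpace.inner_single_right]
  have hf0 : PolyGrowth fun x : EuclideanSpace ℝ ι => x j • f x := by
    obtain ⟨C, k, hC⟩ := hf
    obtain ⟨C', k', hC'⟩ := PolyGrowth.coord (ι := ι) j
    refine ⟨C' * C, k' + k, fun x => (norm_smul_le _ _).trans ?_⟩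
    calc ‖x j‖ * ‖f x‖ ≤ (C' * (1 + ‖x‖) ^ k') * (C * (1 + ‖x‖) ^ k) :=
          mul_le_mul (hC' x) (hC x) (norm_nonneg _) ((norm_nonneg _).trans (hC' x))
      _ = _ := by ring
  have i1 := hf0.integrable ((by fun_prop : Continuous fun x : EuclideanSpace ℝ ι =>
    x j).smul hd.continuous).aestronglyMeasurable
  have := integral_smul_fderiv_eq_neg_fderiv_smul_of_integrable
    (μ := (volume : Measure (EuclideanSpace ℝ ι))) (𝕜 := ℝ) (f := gaussWeight) (g := f)
    (v := EuclideanSpace.single j (1 : ℝ)) ?_ ?_ ?_ (fun x _ => (hw x).differentiableAt)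
    (fun x _ => hd x)
  · simp only [hw', hf', neg_smul, integral_neg, neg_neg] at this
    rw [this]
    simp only [mul_smul]
  · simp only [hw', neg_smul, mul_smul]; exact i1.neg
  · simp only [hf']; exact hg.integrable hm
  · exact hf.integrable hd.continuous.aestronglyMeasurable

end GaussianMean

section Average

variable {d : ℕ}

/-- The position of a centre coordinate among the canonical coordinates. -/
def centerIdx : Fin d ⊕ Fin d → Coord d ⊕ Coord d
  | Sum.inl i => Sum.inl (Sum.inl i)
  | Sum.inr i => Sum.inr (Sum.inl i)

/-- The position of a width matrix entry among the canonical coordinates. -/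
def widthIdx : Fin d ⊕ Fin d → Fin d ⊕ Fin d → Coord d ⊕ Coord d
  | Sum.inl i, Sum.inl j => Sum.inl (Sum.inr (Sum.inl (j, i)))
  | Sum.inl i, Sum.inr j => Sum.inl (Sum.inr (Sum.inr (j, i)))
  | Sum.inr i, Sum.inl j => Sum.inr (Sum.inr (Sum.inl (j, i)))
  | Sum.inr i, Sum.inr j => Sum.inr (Sum.inr (Sum.inr (j, i)))

theorem center_apply (Z : Param d) (i : Fin d ⊕ Fin d) : center Z i = Z (centerIdx i) := by
  rcases i with i | i <;> rfl

theorem scaledWidth_apply (Z : Param d) (i j : Fin d ⊕ Fin d) :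
    scaledWidth Z i j = Z (widthIdx i j) := by
  rcases i with i | i <;> rcases j with j | j <;> rfl

/-- The centre as a linear map. -/
def centerL : Param d →L[ℝ] Phase d :=
  LinearMap.toContinuousLinearMap
    { toFun := center
      map_add' := fun Z W => by ext i; simp [center_apply]
      map_smul' := fun c Z => by ext i; simp [center_apply] }

/-- The scaled width matrix, acting on phase space, as a linear function of the coordinates. -/
def widthL : Param d →L[ℝ] Phase d →L[ℝ] Phase d :=
  LinearMap.toContinuousLinearMap
    { toFun := fun Z => LinearMap.toContinuousLinearMap
        { toFun := fun ζ => WithLp.toLp 2 (scaledWidth Z *ᵥ ⇑ζ)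
          map_add' := fun ζ η => by ext i; simp [Matrix.mulVec_add]
          map_smul' := fun c ζ => by ext i; simp [Matrix.mulVec_smul] }
      map_add' := fun Z W => by
        ext ζ i
        simp [Matrix.mulVec, dotProduct, scaledWidth_apply, add_mul, Finset.sum_add_distrib]
      map_smul' := fun c Z => by
        ext ζ i
        simp [Matrix.mulVec, dotProduct, scaledWidth_apply, mul_assoc, Finset.mul_sum, mul_add] }

theorem widthL_apply (Z : Param d) (ζ : Phase d) :
    widthL Z ζ = WithLp.toLp 2 (scaledWidth Z *ᵥ ⇑ζ) := rfl

/-- The phase space point with normal coordinates `ζ`. -/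
def phasePoint (Z : Param d) (ζ : Phase d) : Phase d := widthL Z ζ + centerL Z

theorem averageIntegrand_eq (a : Phase d → ℝ) (Z : Param d) (ζ : Phase d) :
    averageIntegrand a Z ζ = gaussWeight ζ • a (phasePoint Z ζ) := mul_comm _ _

theorem average_eq (a : Phase d → ℝ) (Z : Param d) :
    average a Z = ((2 * Real.pi) ^ d)⁻¹ * ∫ ζ : Phase d, gaussWeight ζ • a (phasePoint Z ζ) := by
  simp only [average, averageIntegrand_eq]

theorem norm_phasePoint_le (Z : Param d) (ζ : Phase d) :
    1 + ‖phasePoint Z ζ‖ ≤ (1 + (‖widthL (d := d)‖ + ‖centerL (d := d)‖) * ‖Z‖) * (1 + ‖ζ‖) := by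
  have h1 : ‖phasePoint Z ζ‖ ≤ ‖widthL (d := d)‖ * ‖Z‖ * ‖ζ‖ + ‖centerL (d := d)‖ * ‖Z‖ :=
    (norm_add_le _ _).trans (add_le_add (widthL.le_opNorm₂ Z ζ) (centerL.le_opNorm Z))
  have h2 : 0 ≤ ‖widthL (d := d)‖ * ‖Z‖ := by positivity
  have h3 : 0 ≤ ‖centerL (d := d)‖ * ‖Z‖ := by positivity
  nlinarith [norm_nonneg ζ, mul_nonneg h3 (norm_nonneg ζ)]

theorem PolyGrowth.comp_phasePoint {F : Type*} [NormedAddCommGroup F] {f : Phase d → F}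
    (hf : PolyGrowth f) (Z : Param d) : PolyGrowth fun ζ => f (phasePoint Z ζ) := by
  obtain ⟨C, k, hC⟩ := hf
  have hC0 : 0 ≤ C := by simpa using (norm_nonneg _).trans (hC 0)
  refine ⟨C * (1 + (‖widthL (d := d)‖ + ‖centerL (d := d)‖) * ‖Z‖) ^ k, k, fun ζ =>
    (hC _).trans ?_⟩
  rw [mul_assoc, ← mul_pow]
  gcongr
  exact norm_phasePoint_le Z ζ

theorem continuous_phasePoint (Z : Param d) : Continuous (phasePoint Z) :=
  (widthL Z).continuous.add continuous_const

theorem IsSubquadratic.polyGrowth {a : Phase d → ℝ} (ha : IsSubquadratic a) : PolyGrowth a := by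
  obtain ⟨C, -, hC⟩ := ha.abs_le
  exact ⟨C, 2, hC⟩

theorem IsSubquadratic.integrable {a : Phase d → ℝ} (ha : IsSubquadratic a) (Z : Param d) :
    Integrable fun ζ => gaussWeight ζ • a (phasePoint Z ζ) :=
  (ha.polyGrowth.comp_phasePoint Z).integrable
    (ha.smooth.continuous.comp (continuous_phasePoint Z)).aestronglyMeasurable

/-- The partial derivative of a function on phase space. -/
def pd (i : Fin d ⊕ Fin d) (a : Phase d → ℝ) (z : Phase d) : ℝ :=
  fderiv ℝ a z (EuclideanSpace.single i 1)

theorem IsSubquadratic.pd {a : Phase d → ℝ} (ha : IsSubquadratic a) (i : Fin d ⊕ Fin d) :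
    IsSubquadratic (pd i a) := ha.partialDeriv _

theorem fderiv_eq_sum_pd (a : Phase d → ℝ) (z v : Phase d) :
    fderiv ℝ a z v = ∑ i, v i * pd i a z := by
  conv_lhs => rw [← (EuclideanSpace.basisFun (Fin d ⊕ Fin d) ℝ).sum_repr v]
  simp [pd]

theorem fderiv_comp_phasePoint {a : Phase d → ℝ} (ha : Differentiable ℝ a) (Z : Param d)
    (ζ : Phase d) (j : Fin d ⊕ Fin d) :
    fderiv ℝ (fun ζ => a (phasePoint Z ζ)) ζ (EuclideanSpace.single j 1) =
      ∑ i, scaledWidth Z i j * pd i a (phasePoint Z ζ) := by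
  have h1 : HasFDerivAt (phasePoint Z) (widthL Z) ζ := (widthL Z).hasFDerivAt.add_const _
  have h2 := (ha (phasePoint Z ζ)).hasFDerivAt.comp ζ h1
  have h3 : fderiv ℝ (fun ζ => a (phasePoint Z ζ)) ζ = _ := h2.fderiv
  rw [h3, ContinuousLinearMap.comp_apply, fderiv_eq_sum_pd]
  refine Finset.sum_congr rfl fun i _ => ?_
  congr 1
  rw [widthL_apply]
  simp

theorem average_sum {ι : Type*} (s : Finset ι) (c : ι → ℝ) {a : ι → Phase d → ℝ}
    (ha : ∀ i, IsSubquadratic (a i)) (Z : Param d) :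
    ((2 * Real.pi) ^ d)⁻¹ * ∫ ζ : Phase d, gaussWeight ζ • ∑ i ∈ s, c i * a i (phasePoint Z ζ) =
      ∑ i ∈ s, c i * average (a i) Z := by
  have e : ∀ ζ : Phase d, gaussWeight ζ • ∑ i ∈ s, c i * a i (phasePoint Z ζ) =
      ∑ i ∈ s, c i * (gaussWeight ζ • a i (phasePoint Z ζ)) := by
    intro ζ
    rw [Finset.smul_sum]
    exact Finset.sum_congr rfl fun i _ => by simp only [smul_eq_mul]; ring
  simp only [e]
  rw [integral_finsetSum _ fun i _ => ((ha i).integrable Z).const_mul _, Finset.mul_sum]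
  refine Finset.sum_congr rfl fun i _ => ?_
  rw [integral_const_mul, average_eq]; ring

/-- First moments of a symbol. -/
theorem average_coord_mul {a : Phase d → ℝ} (ha : IsSubquadratic a) (Z : Param d)
    (j : Fin d ⊕ Fin d) :
    ((2 * Real.pi) ^ d)⁻¹ * ∫ ζ : Phase d, gaussWeight ζ • (ζ j * a (phasePoint Z ζ)) =
      ∑ i, scaledWidth Z i j * average (pd i a) Z := by
  have hp : ∀ i, PolyGrowth fun ζ => pd i a (phasePoint Z ζ) := fun i =>
    (ha.pd i).polyGrowth.comp_phasePoint Z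
  have hd : Differentiable ℝ fun ζ => a (phasePoint Z ζ) :=
    ha.differentiable.comp ((widthL Z).differentiable.add_const _)
  have := integral_coord_smul_gaussWeight hd (ha.polyGrowth.comp_phasePoint Z) j
    (fun ζ => fderiv_comp_phasePoint ha.differentiable Z ζ j)
    (PolyGrowth.sum _ fun i => (PolyGrowth.const _).mul (hp i))
    (Continuous.aestronglyMeasurable (continuous_finsetSum _ fun i _ => continuous_const.mul
      ((ha.pd i).smooth.continuous.comp (continuous_phasePoint Z))))
  simp only [smul_eq_mul] at this ⊢
  rw [this]
  have h2 := average_sum Finset.univ (fun i => scaledWidth Z i j) ha.pd Z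
  simpa only [smul_eq_mul] using h2

/-- Second moments of a symbol. -/
theorem average_coord_mul_coord_mul {a : Phase d → ℝ} (ha : IsSubquadratic a) (Z : Param d)
    (j k : Fin d ⊕ Fin d) :
    ((2 * Real.pi) ^ d)⁻¹ * ∫ ζ : Phase d, gaussWeight ζ • (ζ j * (ζ k * a (phasePoint Z ζ))) =
      (if j = k then average a Z else 0) +
        ∑ i, ∑ l, scaledWidth Z i j * (scaledWidth Z l k * average (pd l (pd i a)) Z) := by
  have hc : ∀ i, Continuous fun ζ => pd i a (phasePoint Z ζ) := fun i =>
    (ha.pd i).smooth.continuous.comp (continuous_phasePoint Z)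
  have hd : Differentiable ℝ fun ζ => a (phasePoint Z ζ) :=
    ha.differentiable.comp ((widthL Z).differentiable.add_const _)
  have hk : ∀ ζ : Phase d, HasFDerivAt (fun ζ : Phase d => ζ k)
      (EuclideanSpace.proj k : Phase d →L[ℝ] ℝ) ζ := fun ζ =>
    (EuclideanSpace.proj k : Phase d →L[ℝ] ℝ).hasFDerivAt
  have hpa := ha.polyGrowth.comp_phasePoint Z
  have hpd : ∀ i, PolyGrowth fun ζ => pd i a (phasePoint Z ζ) := fun i =>
    (ha.pd i).polyGrowth.comp_phasePoint Z
  have hst := integral_coord_smul_gaussWeight (f := fun ζ => ζ k * a (phasePoint Z ζ))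
    (f' := fun ζ => (if j = k then 1 else 0) * a (phasePoint Z ζ) +
      ∑ i, scaledWidth Z i j * (ζ k * pd i a (phasePoint Z ζ)))
    (fun ζ => (hk ζ).differentiableAt.mul (hd ζ)) ((PolyGrowth.coord k).mul hpa) j
    (fun ζ => by
      have h1 : fderiv ℝ (fun ζ : Phase d => ζ k * a (phasePoint Z ζ)) ζ = _ :=
        ((hk ζ).mul (hd ζ).hasFDerivAt).fderiv
      have h2 := fderiv_comp_phasePoint ha.differentiable Z ζ j
      rw [h1]
      simp only [_root_.add_apply, _root_.smul_apply, h2, smul_eq_mul]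
      rw [add_comm, Finset.mul_sum]
      congr 1
      · simp [eq_comm, mul_comm]
      · exact Finset.sum_congr rfl fun i _ => by ring)
    (((PolyGrowth.const _).mul hpa).add (PolyGrowth.sum _ fun i =>
      (PolyGrowth.const _).mul ((PolyGrowth.coord k).mul (hpd i))))
    (Continuous.aestronglyMeasurable ((continuous_const.mul hd.continuous).add
      (continuous_finsetSum _ fun i _ => continuous_const.mul
        ((by fun_prop : Continuous fun ζ : Phase d => ζ k).mul (hc i)))))
  have hi : ∀ i, Integrable fun ζ : Phase d =>
      gaussWeight ζ * (ζ k * pd i a (phasePoint Z ζ)) := fun i =>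
    ((PolyGrowth.coord k).mul (hpd i)).integrable
      ((by fun_prop : Continuous fun ζ : Phase d => ζ k).mul (hc i)).aestronglyMeasurable
  simp only [smul_eq_mul] at hst ⊢
  rw [hst]
  have e : ∀ ζ : Phase d, gaussWeight ζ * ((if j = k then 1 else 0) * a (phasePoint Z ζ) +
      ∑ i, scaledWidth Z i j * (ζ k * pd i a (phasePoint Z ζ))) =
      (if j = k then 1 else 0) * (gaussWeight ζ • a (phasePoint Z ζ)) +
      ∑ i, scaledWidth Z i j * (gaussWeight ζ * (ζ k * pd i a (phasePoint Z ζ))) := by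
    intro ζ
    rw [mul_add, Finset.mul_sum, smul_eq_mul]
    congr 1
    · ring
    · exact Finset.sum_congr rfl fun i _ => by ring
  simp only [e]
  rw [integral_add ((ha.integrable Z).const_mul _)
    (integrable_finsetSum _ fun i _ => (hi i).const_mul _), integral_const_mul,
    integral_finsetSum _ fun i _ => (hi i).const_mul _, mul_add, mul_left_comm, ← average_eq,
    Finset.mul_sum]
  congr 1
  · split_ifs <;> simp
  · refine Finset.sum_congr rfl fun i _ => ?_
    rw [integral_const_mul, mul_left_comm]
    have := average_coord_mul (ha.pd i) Z k
    simp only [smul_eq_mul] at this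
    rw [this, Finset.mul_sum]

theorem hasFDerivAt_average {a : Phase d → ℝ} (ha : IsSubquadratic a) (Z : Param d) :
    ∃ L : Param d →L[ℝ] ℝ, HasFDerivAt (average a) L Z ∧ ∀ V : Param d, L V =
      ((2 * Real.pi) ^ d)⁻¹ * ∫ ζ : Phase d, gaussWeight ζ • fderiv ℝ a (phasePoint Z ζ)
        (phasePoint V ζ) := by
  let P : Phase d → Param d →L[ℝ] Phase d := fun ζ => (widthL (d := d)).flip ζ + centerL
  have hP : ∀ V ζ, P ζ V = phasePoint V ζ := fun V ζ => rfl
  let F' : Param d → Phase d → Param d →L[ℝ] ℝ := fun Z ζ =>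
    gaussWeight ζ • (fderiv ℝ a (phasePoint Z ζ)).comp (P ζ)
  obtain ⟨C, hC0, hC⟩ := ha.norm_fderiv_le
  let K : ℝ := 1 + (‖widthL (d := d)‖ + ‖centerL (d := d)‖) * (‖Z‖ + 1)
  let N : ℝ := ‖widthL (d := d)‖ + ‖centerL (d := d)‖
  have hPn : ∀ ζ, ‖P ζ‖ ≤ N * (1 + ‖ζ‖) := by
    intro ζ
    have h1 : ‖P ζ‖ ≤ ‖widthL (d := d)‖ * ‖ζ‖ + ‖centerL (d := d)‖ := by
      refine (norm_add_le _ _).trans (add_le_add ?_ le_rfl)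
      have := (widthL (d := d)).flip.le_opNorm ζ
      rwa [ContinuousLinearMap.opNorm_flip] at this
    have : 0 ≤ ‖widthL (d := d)‖ := (widthL (d := d)).opNorm_nonneg
    have : 0 ≤ ‖centerL (d := d)‖ := norm_nonneg _
    simp only [N]
    nlinarith [norm_nonneg ζ]
  have hF'b : ∀ W ∈ Metric.ball Z 1, ∀ ζ, ‖F' W ζ‖ ≤
      C * K * N * ((1 + ‖ζ‖) ^ 2 * Real.exp (-(1 / 2) * ‖ζ‖ ^ 2)) := by
    intro W hW ζ
    have hWn : ‖W‖ ≤ ‖Z‖ + 1 := by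
      have h1 : ‖W - Z‖ < 1 := by simpa [dist_eq_norm] using hW
      have := norm_add_le Z (W - Z)
      rw [add_sub_cancel] at this
      linarith
    have h1 : 1 + ‖phasePoint W ζ‖ ≤ K * (1 + ‖ζ‖) :=
      (norm_phasePoint_le W ζ).trans (by simp only [K]; gcongr)
    have hN0 : 0 ≤ N := add_nonneg (widthL (d := d)).opNorm_nonneg (norm_nonneg _)
    have hK0 : 0 ≤ K :=
      add_nonneg zero_le_one (mul_nonneg hN0 (add_nonneg (norm_nonneg _) zero_le_one))
    calc ‖F' W ζ‖ = gaussWeight ζ * ‖(fderiv ℝ a (phasePoint W ζ)).comp (P ζ)‖ := by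
          rw [norm_smul, Real.norm_of_nonneg (gaussWeight_pos ζ).le]
      _ ≤ gaussWeight ζ * (‖fderiv ℝ a (phasePoint W ζ)‖ * ‖P ζ‖) := by
          gcongr
          · exact (gaussWeight_pos ζ).le
          · exact ContinuousLinearMap.opNorm_comp_le _ _
      _ ≤ gaussWeight ζ * ((C * (K * (1 + ‖ζ‖))) * (N * (1 + ‖ζ‖))) := by
          have h2 : ‖fderiv ℝ a (phasePoint W ζ)‖ ≤ C * (K * (1 + ‖ζ‖)) := by
            refine (hC _).trans ?_
            rw [pow_one]; gcongr
          have := gaussWeight_pos ζ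
          gcongr
          exact hPn ζ
      _ = _ := by rw [gaussWeight]; ring
  have hPc : Continuous P := (widthL (d := d)).flip.continuous.add continuous_const
  have hF'm : AEStronglyMeasurable (F' Z) volume := by
    refine Continuous.aestronglyMeasurable (continuous_gaussWeight.smul ?_)
    exact (ha.contDiff_fderiv.continuous.comp (continuous_phasePoint Z)).clm_comp hPc
  have hbi := (integrable_pow_mul_exp (ι := Fin d ⊕ Fin d) 2 one_half_pos).const_mul (C * K * N)
  have hd := hasFDerivAt_integral_of_dominated_of_fderiv_le (𝕜 := ℝ)
    (μ := (volume : Measure (Phase d))) (x₀ := Z)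
    (F := fun Z ζ => gaussWeight ζ • a (phasePoint Z ζ)) (F' := F') (s := Metric.ball Z 1)
    (Metric.ball_mem_nhds Z one_pos)
    (Filter.Eventually.of_forall fun W => (ha.integrable W).aestronglyMeasurable)
    (ha.integrable Z) hF'm (Filter.Eventually.of_forall fun ζ W hW => hF'b W hW ζ) hbi
    (Filter.Eventually.of_forall fun ζ W _ => by
      have h1 : HasFDerivAt (fun W => phasePoint W ζ) (P ζ) W := (P ζ).hasFDerivAt
      exact ((ha.differentiable _).hasFDerivAt.comp W h1).const_smul (gaussWeight ζ))
  have hF'i : Integrable (F' Z) := Integrable.mono' hbi hF'm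
    (Filter.Eventually.of_forall fun ζ => hF'b Z (Metric.mem_ball_self one_pos) ζ)
  refine ⟨((2 * Real.pi) ^ d)⁻¹ • ∫ ζ, F' Z ζ, ?_, fun V => ?_⟩
  · have : average a = fun Z => ((2 * Real.pi) ^ d)⁻¹ •
        ∫ ζ : Phase d, gaussWeight ζ • a (phasePoint Z ζ) := funext fun Z => average_eq a Z
    rw [this]
    exact hd.const_smul (((2 * Real.pi) ^ d)⁻¹)
  · rw [_root_.smul_apply, ContinuousLinearMap.integral_apply hF'i, smul_eq_mul]
    rfl

theorem differentiable_average {a : Phase d → ℝ} (ha : IsSubquadratic a) :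
    Differentiable ℝ (average a) := fun Z =>
  let ⟨_, hL, _⟩ := hasFDerivAt_average ha Z
  hL.differentiableAt

theorem gradient_apply {f : Param d → ℝ} {Z : Param d} {L : Param d →L[ℝ] ℝ}
    (hf : HasFDerivAt f L Z) (k : Coord d ⊕ Coord d) :
    gradient f Z k = L (EuclideanSpace.single k 1) := by
  rw [gradient, hf.fderiv]
  have h1 : inner ℝ ((InnerProductSpace.toDual ℝ (Param d)).symm L) (EuclideanSpace.single k 1) =
      L (EuclideanSpace.single k 1) := InnerProductSpace.toDual_symm_apply
  rw [← h1, EuclideanSpace.inner_single_right]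
  simp

theorem phasePoint_single_centerIdx (i : Fin d ⊕ Fin d) (ζ : Phase d) :
    phasePoint (EuclideanSpace.single (centerIdx i) 1) ζ = EuclideanSpace.single i 1 := by
  ext k
  have h1 : ∀ k l, scaledWidth (EuclideanSpace.single (centerIdx i) (1 : ℝ)) k l = 0 := by
    intro k l
    rw [scaledWidth_apply]
    rcases i with i | i <;> rcases k with k | k <;> rcases l with l | l <;>
      simp [centerIdx, widthIdx]
  have h2 : center (EuclideanSpace.single (centerIdx i) (1 : ℝ)) k =
      (EuclideanSpace.single i (1 : ℝ) : Phase d) k := by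
    rw [center_apply]
    rcases i with i | i <;> rcases k with k | k <;> simp [centerIdx]
  have h3 : phasePoint (EuclideanSpace.single (centerIdx i) 1) ζ k =
    (scaledWidth (EuclideanSpace.single (centerIdx i) (1 : ℝ)) *ᵥ ⇑ζ) k +
      center (EuclideanSpace.single (centerIdx i) (1 : ℝ)) k := rfl
  rw [h3, h2, Matrix.mulVec, dotProduct]
  simp [h1]

theorem phasePoint_single_widthIdx (i j : Fin d ⊕ Fin d) (ζ : Phase d) :
    phasePoint (EuclideanSpace.single (widthIdx i j) 1) ζ = ζ j • EuclideanSpace.single i 1 := by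
  ext k
  have h1 : ∀ k l, scaledWidth (EuclideanSpace.single (widthIdx i j) (1 : ℝ)) k l =
      if k = i ∧ l = j then 1 else 0 := by
    intro k l
    rw [scaledWidth_apply]
    rcases i with i | i <;> rcases k with k | k <;> rcases l with l | l <;> rcases j with j | j <;>
      simp [widthIdx, and_comm]
  have h2 : center (EuclideanSpace.single (widthIdx i j) (1 : ℝ)) k = 0 := by
    rw [center_apply]
    rcases i with i | i <;> rcases j with j | j <;> rcases k with k | k <;>
      simp [centerIdx, widthIdx]
  have h3 : phasePoint (EuclideanSpace.single (widthIdx i j) 1) ζ k =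
    (scaledWidth (EuclideanSpace.single (widthIdx i j) (1 : ℝ)) *ᵥ ⇑ζ) k +
      center (EuclideanSpace.single (widthIdx i j) (1 : ℝ)) k := rfl
  rw [h3, h2, Matrix.mulVec, dotProduct]
  simp [h1, ite_and]

/-- The averaged gradient. -/
def meanGrad (a : Phase d → ℝ) (Z : Param d) : Fin d ⊕ Fin d → ℝ := fun i => average (pd i a) Z

/-- The averaged Hessian. -/
def meanHess (a : Phase d → ℝ) (Z : Param d) : Matrix (Fin d ⊕ Fin d) (Fin d ⊕ Fin d) ℝ :=
  Matrix.of fun i k => average (pd k (pd i a)) Z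

theorem pd_pd_comm {a : Phase d → ℝ} (ha : IsSubquadratic a) (i k : Fin d ⊕ Fin d) :
    pd k (pd i a) = pd i (pd k a) := by
  have h1 : ∀ i k z, pd k (pd i a) z = fderiv ℝ (fderiv ℝ a) z (EuclideanSpace.single k 1)
      (EuclideanSpace.single i 1) := by
    intro i k z
    have hd : DifferentiableAt ℝ (fderiv ℝ a) z := (ha.contDiff_fderiv.differentiable (by simp)) z
    show fderiv ℝ (fun z => fderiv ℝ a z (EuclideanSpace.single i 1)) z _ = _
    rw [fderiv_clm_apply hd (differentiableAt_const _)]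
    simp
  funext z
  rw [h1, h1]
  have : IsSymmSndFDerivAt ℝ a z :=
    (ha.smooth.contDiffAt (x := z)).isSymmSndFDerivAt (by simp; exact WithTop.coe_le_coe.2 le_top)
  exact this.eq _ _

theorem meanHess_transpose {a : Phase d → ℝ} (ha : IsSubquadratic a) (Z : Param d) :
    (meanHess a Z)ᵀ = meanHess a Z := by
  ext i k
  simp only [meanHess, Matrix.transpose_apply, Matrix.of_apply]
  rw [pd_pd_comm ha]

theorem gradient_average_centerIdx {a : Phase d → ℝ} (ha : IsSubquadratic a) (Z : Param d)
    (i : Fin d ⊕ Fin d) : gradient (average a) Z (centerIdx i) = meanGrad a Z i := by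
  obtain ⟨L, hL, hV⟩ := hasFDerivAt_average ha Z
  rw [gradient_apply hL, hV]
  simp only [phasePoint_single_centerIdx]
  exact (average_eq (pd i a) Z).symm

theorem gradient_average_widthIdx {a : Phase d → ℝ} (ha : IsSubquadratic a) (Z : Param d)
    (i j : Fin d ⊕ Fin d) :
    gradient (average a) Z (widthIdx i j) = (meanHess a Z * scaledWidth Z) i j := by
  obtain ⟨L, hL, hV⟩ := hasFDerivAt_average ha Z
  rw [gradient_apply hL, hV]
  simp only [phasePoint_single_widthIdx, map_smul]
  refine (average_coord_mul (ha.pd i) Z j).trans ?_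
  rw [Matrix.mul_apply]
  exact Finset.sum_congr rfl fun k _ => mul_comm _ _

theorem Omega_mulVec_inl {l : Type} [Fintype l] [DecidableEq l] (v : l ⊕ l → ℝ) (i : l) :
    (Omega l *ᵥ v) (Sum.inl i) = v (Sum.inr i) := by
  simp [Omega, Matrix.fromBlocks_mulVec, Matrix.neg_mulVec]

theorem Omega_mulVec_inr {l : Type} [Fintype l] [DecidableEq l] (v : l ⊕ l → ℝ) (i : l) :
    (Omega l *ᵥ v) (Sum.inr i) = -v (Sum.inl i) := by
  simp [Omega, Matrix.fromBlocks_mulVec, Matrix.neg_mulVec]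

theorem center_hamiltonField {h : ℝ → Phase d → ℝ} {t : ℝ} (ha : IsSubquadratic (h t))
    (Z : Param d) :
    center (hamiltonField h t Z) = WithLp.toLp 2 (Omega (Fin d) *ᵥ meanGrad (h t) Z) := by
  ext i
  have h1 := gradient_average_centerIdx ha Z
  rw [center_apply]
  rcases i with i | i
  · exact (Omega_mulVec_inl _ _).trans ((h1 (Sum.inr i)).trans (Omega_mulVec_inl _ _).symm)
  · exact (Omega_mulVec_inr _ _).trans
      ((congrArg (fun x : ℝ => -x) (h1 (Sum.inl i))).trans (Omega_mulVec_inr _ _).symm)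

theorem scaledWidth_hamiltonField {h : ℝ → Phase d → ℝ} {t : ℝ} (ha : IsSubquadratic (h t))
    (Z : Param d) :
    scaledWidth (hamiltonField h t Z) = Omega (Fin d) * (meanHess (h t) Z * scaledWidth Z) := by
  ext i j
  have h1 := gradient_average_widthIdx ha Z
  rw [scaledWidth_apply]
  have e : ∀ M : Matrix (Fin d ⊕ Fin d) (Fin d ⊕ Fin d) ℝ,
      (Omega (Fin d) * M) i j = (Omega (Fin d) *ᵥ fun k => M k j) i := fun M => rfl
  rw [e]
  rcases i with i | i <;> rcases j with j | j
  · exact (Omega_mulVec_inl _ _).trans ((h1 (Sum.inr i) (Sum.inl j)).trans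
      (Omega_mulVec_inl (fun k => (meanHess (h t) Z * scaledWidth Z) k (Sum.inl j)) i).symm)
  · exact (Omega_mulVec_inl _ _).trans ((h1 (Sum.inr i) (Sum.inr j)).trans
      (Omega_mulVec_inl (fun k => (meanHess (h t) Z * scaledWidth Z) k (Sum.inr j)) i).symm)
  · exact (Omega_mulVec_inr _ _).trans
      ((congrArg (fun x : ℝ => -x) (h1 (Sum.inl i) (Sum.inl j))).trans
      (Omega_mulVec_inr (fun k => (meanHess (h t) Z * scaledWidth Z) k (Sum.inl j)) i).symm)
  · exact (Omega_mulVec_inr _ _).trans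
      ((congrArg (fun x : ℝ => -x) (h1 (Sum.inl i) (Sum.inr j))).trans
      (Omega_mulVec_inr (fun k => (meanHess (h t) Z * scaledWidth Z) k (Sum.inr j)) i).symm)

end Average

/-! ### Symplectic algebra of Hagedorn's parameters -/

section Symplectic

variable {d : ℕ}

/-- Real matrices as complex matrices. -/
abbrev toC (A : Matrix (Fin d) (Fin d) ℝ) : Matrix (Fin d) (Fin d) ℂ := A.map Complex.ofReal

theorem toC_mul (A B : Matrix (Fin d) (Fin d) ℝ) : toC (A * B) = toC A * toC B :=
  Matrix.map_mul (f := Complex.ofRealHom)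

theorem toC_one : toC (1 : Matrix (Fin d) (Fin d) ℝ) = 1 := by
  ext i j; simp [Matrix.one_apply]; split_ifs <;> simp

theorem toC_conjTranspose (A : Matrix (Fin d) (Fin d) ℝ) : (toC A)ᴴ = toC Aᵀ := by
  ext i j; simp

theorem symplectic_iff (Q P : Matrix (Fin d) (Fin d) ℂ) :
    (widthY Q P)ᵀ * Omega (Fin d) * widthY Q P = Omega (Fin d) ↔
      Qᵀ * P = Pᵀ * Q ∧ Qᴴ * P - Pᴴ * Q = (2 * I) • (1 : Matrix (Fin d) (Fin d) ℂ) := by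
  have e : (widthY Q P)ᵀ * Omega (Fin d) * widthY Q P = Matrix.fromBlocks
      ((Q.map re)ᵀ * P.map re - (P.map re)ᵀ * Q.map re)
      ((Q.map re)ᵀ * P.map im - (P.map re)ᵀ * Q.map im)
      ((Q.map im)ᵀ * P.map re - (P.map im)ᵀ * Q.map re)
      ((Q.map im)ᵀ * P.map im - (P.map im)ᵀ * Q.map im) := by
    simp only [widthY, Omega, Matrix.fromBlocks_transpose, Matrix.fromBlocks_multiply, mul_zero,
      mul_one, mul_neg, zero_add, add_zero, neg_mul]
    congr 1 <;> abel
  rw [e, Omega, Matrix.fromBlocks_inj]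
  simp only [← Matrix.ext_iff, Complex.ext_iff, Matrix.sub_apply, Matrix.mul_apply,
    Matrix.transpose_apply, Matrix.map_apply, Matrix.conjTranspose_apply, Matrix.smul_apply,
    Complex.re_sum, Complex.im_sum, Complex.sub_re, Complex.sub_im, Complex.mul_re, Complex.mul_im,
    RCLike.star_def, Complex.conj_re, Complex.conj_im, Finset.sum_sub_distrib,
    Finset.sum_add_distrib, Matrix.zero_apply, Matrix.neg_apply, neg_mul, sub_neg_eq_add,
    Finset.sum_neg_distrib, smul_eq_mul]
  have one_re : ∀ i j : Fin d, ((1 : Matrix (Fin d) (Fin d) ℂ) i j).re =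
      (1 : Matrix (Fin d) (Fin d) ℝ) i j := by
    intro i j; simp only [Matrix.one_apply]; split_ifs <;> simp
  have one_im : ∀ i j : Fin d, ((1 : Matrix (Fin d) (Fin d) ℂ) i j).im = 0 := by
    intro i j; simp only [Matrix.one_apply]; split_ifs <;> simp
  simp only [one_re, one_im, Complex.I_re, Complex.I_im]
  constructor
  · rintro ⟨h1, h2, h3, h4⟩
    refine ⟨fun i j => ?_, fun i j => ?_⟩
    · have := h1 i j; have := h2 i j; have := h3 i j; have := h4 i j
      constructor <;> linarith
    · have := h1 i j; have := h2 i j; have := h3 i j; have := h4 i j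
      constructor <;> norm_num <;> linarith
  · rintro ⟨h1, h2⟩
    norm_num at h2
    refine ⟨fun i j => ?_, fun i j => ?_, fun i j => ?_, fun i j => ?_⟩ <;>
    · have := h1 i j; have := h2 i j
      linarith

theorem isUnit_of_mulVec_injective {A : Matrix (Fin d) (Fin d) ℂ}
    (h : ∀ v, A *ᵥ v = 0 → v = 0) : IsUnit A := by
  rw [← Matrix.mulVec_injective_iff_isUnit]
  intro v w hvw
  have := h (v - w) (by rw [Matrix.mulVec_sub, hvw, sub_self])
  exact sub_eq_zero.1 this

theorem star_dotProduct_self (v : Fin d → ℂ) : star v ⬝ᵥ v = ((∑ i, ‖v i‖ ^ 2 : ℝ) : ℂ) := by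
  simp only [dotProduct, Pi.star_apply, RCLike.star_def, ofReal_sum]
  exact Finset.sum_congr rfl fun i _ => by rw [mul_comm, Complex.mul_conj, Complex.normSq_eq_norm_sq]

theorem sum_norm_sq_eq_zero {v : Fin d → ℂ} (h : ∑ i, ‖v i‖ ^ 2 = 0) : v = 0 := by
  rw [Finset.sum_eq_zero_iff_of_nonneg fun i _ => by positivity] at h
  exact funext fun i => by simpa using h i (Finset.mem_univ i)

theorem isUnit_of_symplectic {Q P : Matrix (Fin d) (Fin d) ℂ}
    (h : Qᴴ * P - Pᴴ * Q = (2 * I) • (1 : Matrix (Fin d) (Fin d) ℂ)) : IsUnit Q ∧ IsUnit P := by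
  have key : ∀ v : Fin d → ℂ, star (Q *ᵥ v) ⬝ᵥ (P *ᵥ v) - star (P *ᵥ v) ⬝ᵥ (Q *ᵥ v) =
      2 * I * (star v ⬝ᵥ v) := by
    intro v
    have h1 := congrArg (fun M => star v ⬝ᵥ (M *ᵥ v)) h
    simp only [Matrix.sub_mulVec, dotProduct_sub, ← Matrix.mulVec_mulVec, Matrix.smul_mulVec,
      Matrix.one_mulVec, dotProduct_smul, smul_eq_mul] at h1
    rw [Matrix.star_mulVec, Matrix.star_mulVec, ← Matrix.dotProduct_mulVec,
      ← Matrix.dotProduct_mulVec]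
    exact h1
  have hz : ∀ v : Fin d → ℂ, 2 * I * (star v ⬝ᵥ v) = 0 → v = 0 := by
    intro v hv
    have : star v ⬝ᵥ v = 0 := by simpa using hv
    rw [star_dotProduct_self] at this
    exact sum_norm_sq_eq_zero (by exact_mod_cast this)
  constructor
  · exact isUnit_of_mulVec_injective fun v hv => hz v (by rw [← key, hv]; simp)
  · exact isUnit_of_mulVec_injective fun v hv => hz v (by rw [← key, hv]; simp)

theorem sub_conjTranspose_of_symm {C : Matrix (Fin d) (Fin d) ℂ} (hC : Cᵀ = C) :
    C - Cᴴ = (2 * I) • toC (C.map im) := by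
  ext i j
  have : C j i = C i j := congrFun (congrFun hC i) j
  simp only [Matrix.sub_apply, Matrix.conjTranspose_apply, this, Matrix.smul_apply,
    Matrix.map_apply, smul_eq_mul, RCLike.star_def]
  apply Complex.ext <;> simp
  ring

/-- The width matrix `P Q⁻¹` of symplectic parameters is symmetric with imaginary part
`(Q Qᴴ)⁻¹`. -/
theorem width_of_symplectic {Q P : Matrix (Fin d) (Fin d) ℂ}
    (hY : (widthY Q P)ᵀ * Omega (Fin d) * widthY Q P = Omega (Fin d)) :
    IsUnit Q ∧ IsUnit P ∧ (P * Q⁻¹)ᵀ = P * Q⁻¹ ∧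
      Qᴴ * toC ((P * Q⁻¹).map im) * Q = 1 := by
  obtain ⟨h1, h2⟩ := (symplectic_iff Q P).1 hY
  obtain ⟨hQ, hP⟩ := isUnit_of_symplectic h2
  have hQd : IsUnit Q.det := (Matrix.isUnit_iff_isUnit_det Q).1 hQ
  have hs : (P * Q⁻¹)ᵀ = P * Q⁻¹ := by
    have hQt : IsUnit Qᵀ.det := by rwa [Matrix.det_transpose]
    have : Qᵀ * (P * Q⁻¹)ᵀ * Q = Qᵀ * (P * Q⁻¹) * Q := by
      rw [Matrix.transpose_mul, ← mul_assoc Qᵀ, ← Matrix.transpose_mul Q⁻¹ Q,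
        Matrix.nonsing_inv_mul _ hQd, Matrix.transpose_one, one_mul, mul_assoc Qᵀ, mul_assoc P,
        Matrix.nonsing_inv_mul _ hQd, mul_one, h1]
    have h3 := congrArg (fun M => Qᵀ⁻¹ * M * Q⁻¹) this
    simp only [mul_assoc, Matrix.mul_nonsing_inv _ hQd, mul_one] at h3
    simpa only [← mul_assoc, Matrix.nonsing_inv_mul _ hQt, one_mul] using h3
  refine ⟨hQ, hP, hs, ?_⟩
  have h4 := sub_conjTranspose_of_symm hs
  have h5 : Qᴴ * (P * Q⁻¹ - (P * Q⁻¹)ᴴ) * Q = (2 * I) • (1 : Matrix (Fin d) (Fin d) ℂ) := by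
    rw [← h2, mul_sub, sub_mul, Matrix.conjTranspose_mul, ← mul_assoc Qᴴ (Q⁻¹)ᴴ,
      ← Matrix.conjTranspose_mul Q⁻¹ Q, Matrix.nonsing_inv_mul _ hQd, Matrix.conjTranspose_one,
      one_mul, mul_assoc Qᴴ, mul_assoc P, Matrix.nonsing_inv_mul _ hQd, mul_one]
  rw [h4, Matrix.mul_smul, Matrix.smul_mul] at h5
  exact smul_right_injective _ (by simp : (2 * I : ℂ) ≠ 0) h5

theorem posDef_of_conj {A : Matrix (Fin d) (Fin d) ℝ} {Q : Matrix (Fin d) (Fin d) ℂ}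
    (hA : Aᵀ = A) (h : Qᴴ * toC A * Q = 1) : A.PosDef := by
  have hQ : IsUnit Q.det := by
    have := congrArg Matrix.det h
    rw [Matrix.det_mul, Matrix.det_one] at this
    exact IsUnit.of_mul_eq_one _ ((mul_comm _ _).trans this)
  refine Matrix.PosDef.of_dotProduct_mulVec_pos (by rwa [Matrix.IsHermitian,
    Matrix.conjTranspose_eq_transpose_of_trivial]) fun x hx => ?_
  let v : Fin d → ℂ := Q⁻¹ *ᵥ (fun i => (x i : ℂ))
  have hv : Q *ᵥ v = fun i => (x i : ℂ) := by
    simp only [v, Matrix.mulVec_mulVec, Matrix.mul_nonsing_inv _ hQ, Matrix.one_mulVec]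
  have hv0 : v ≠ 0 := by
    intro h0
    rw [h0, Matrix.mulVec_zero] at hv
    exact hx (funext fun i => by simpa using (congrFun hv i).symm)
  have h1 : star v ⬝ᵥ v = ((star x ⬝ᵥ A *ᵥ x : ℝ) : ℂ) := by
    have h2 := congrArg (fun M => star v ⬝ᵥ (M *ᵥ v)) h.symm
    rw [Matrix.one_mulVec, ← Matrix.mulVec_mulVec, hv, ← Matrix.mulVec_mulVec,
      Matrix.dotProduct_mulVec (star v) Qᴴ, ← Matrix.star_mulVec, hv] at h2
    rw [h2]
    simp [dotProduct, Matrix.mulVec]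
  rw [star_dotProduct_self] at h1
  rw [← Complex.ofReal_injective h1]
  exact lt_of_le_of_ne (Finset.sum_nonneg fun i _ => by positivity)
    fun h0 => hv0 (sum_norm_sq_eq_zero h0.symm)

open scoped MatrixOrder Matrix.Norms.L2Operator in
/-- A real width factor of a positive definite matrix. -/
theorem exists_real_factor {A : Matrix (Fin d) (Fin d) ℝ} (hA : A.PosDef) :
    ∃ R : Matrix (Fin d) (Fin d) ℝ, IsUnit R.det ∧ Rᵀ * A * R = 1 ∧ R * Rᵀ * A = 1 := by
  obtain ⟨B, hB⟩ := CStarAlgebra.nonneg_iff_eq_star_mul_self.mp hA.posSemidef.nonneg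
  rw [Matrix.star_eq_conjTranspose, Matrix.conjTranspose_eq_transpose_of_trivial] at hB
  have hBd : IsUnit B.det := by
    have := hA.det_pos
    rw [hB, Matrix.det_mul] at this
    exact isUnit_iff_ne_zero.2 fun h0 => by simp [h0] at this
  have hBt : IsUnit Bᵀ.det := by rwa [Matrix.det_transpose]
  refine ⟨B⁻¹, by rw [Matrix.det_nonsing_inv]; exact hBd.ringInverse, ?_, ?_⟩
  · rw [hB, Matrix.transpose_nonsing_inv, ← mul_assoc, Matrix.nonsing_inv_mul _ hBt, one_mul,
      Matrix.mul_nonsing_inv _ hBd]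
  · rw [hB, Matrix.transpose_nonsing_inv, mul_assoc, ← mul_assoc Bᵀ⁻¹,
      Matrix.nonsing_inv_mul _ hBt, one_mul, Matrix.nonsing_inv_mul _ hBd]

theorem widthY_mul_transpose (Q P : Matrix (Fin d) (Fin d) ℂ) :
    widthY Q P * (widthY Q P)ᵀ = Matrix.fromBlocks ((Q * Qᴴ).map re) ((Q * Pᴴ).map re)
      ((P * Qᴴ).map re) ((P * Pᴴ).map re) := by
  have e : ∀ A B : Matrix (Fin d) (Fin d) ℂ,
      A.map re * (B.map re)ᵀ + A.map im * (B.map im)ᵀ = (A * Bᴴ).map re := by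
    intro A B
    ext i j
    simp [Matrix.mul_apply, Complex.re_sum, Finset.sum_add_distrib]
  simp only [widthY, Matrix.fromBlocks_transpose, Matrix.fromBlocks_multiply, e]

theorem widthY_mul_transpose_congr {Q Q' C : Matrix (Fin d) (Fin d) ℂ} (h : Q * Qᴴ = Q' * Q'ᴴ) :
    widthY Q (C * Q) * (widthY Q (C * Q))ᵀ = widthY Q' (C * Q') * (widthY Q' (C * Q'))ᵀ := by
  simp only [widthY_mul_transpose, Matrix.conjTranspose_mul, ← mul_assoc, h]
  simp only [mul_assoc C, h]

theorem scaledWidth_canonicalCoords (ε : ℝ) (q p : Pos d) (Q P : Matrix (Fin d) (Fin d) ℂ) :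
    scaledWidth (canonicalCoords ε q p Q P) = √(ε / 2) • widthY Q P := by
  ext i j
  rcases i with i | i <;> rcases j with j | j <;> rfl

theorem center_canonicalCoords (ε : ℝ) (q p : Pos d) (Q P : Matrix (Fin d) (Fin d) ℂ) :
    center (canonicalCoords ε q p Q P) = WithLp.toLp 2 (Sum.elim q p) := rfl

/-- A Gaussian average depends on the width only through the covariance. -/
theorem average_congr {Z Z' : Param d} (a : Phase d → ℝ) (hc : center Z = center Z')
    (hu : IsUnit (scaledWidth Z).det)
    (hW : scaledWidth Z * (scaledWidth Z)ᵀ = scaledWidth Z' * (scaledWidth Z')ᵀ) :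
    average a Z = average a Z' := by
  let O : Matrix (Fin d ⊕ Fin d) (Fin d ⊕ Fin d) ℝ := (scaledWidth Z)⁻¹ * scaledWidth Z'
  have hO : O * Oᵀ = 1 := by
    have hut : IsUnit (scaledWidth Z)ᵀ.det := by rwa [Matrix.det_transpose]
    calc O * Oᵀ = (scaledWidth Z)⁻¹ * (scaledWidth Z' * (scaledWidth Z')ᵀ) *
          ((scaledWidth Z)⁻¹)ᵀ := by
          simp only [O, Matrix.transpose_mul, mul_assoc]
      _ = 1 := by
          rw [← hW, ← mul_assoc, Matrix.nonsing_inv_mul _ hu, one_mul,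
            Matrix.transpose_nonsing_inv, Matrix.mul_nonsing_inv _ hut]
  have hO' : Oᵀ * O = 1 := mul_eq_one_comm.1 hO
  have hWO : scaledWidth Z * O = scaledWidth Z' := by
    simp only [O, ← mul_assoc, Matrix.mul_nonsing_inv _ hu, one_mul]
  let L : Phase d ≃ₗ[ℝ] Phase d :=
    { toFun := fun ζ => WithLp.toLp 2 (O *ᵥ ⇑ζ)
      map_add' := fun ζ η => by ext i; simp [Matrix.mulVec_add]
      map_smul' := fun c ζ => by ext i; simp [Matrix.mulVec_smul]
      invFun := fun ζ => WithLp.toLp 2 (Oᵀ *ᵥ ⇑ζ)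
      left_inv := fun ζ => by ext i; simp [Matrix.mulVec_mulVec, hO']
      right_inv := fun ζ => by ext i; simp [Matrix.mulVec_mulVec, hO] }
  have hn : ∀ ζ, ‖L ζ‖ = ‖ζ‖ := by
    intro ζ
    rw [← sq_eq_sq₀ (norm_nonneg _) (norm_nonneg _), ← real_inner_self_eq_norm_sq,
      ← real_inner_self_eq_norm_sq, PiLp.inner_apply, PiLp.inner_apply]
    have h1 : (O *ᵥ ⇑ζ) ⬝ᵥ (O *ᵥ ⇑ζ) = (⇑ζ ⬝ᵥ ⇑ζ : ℝ) := by
      rw [Matrix.dotProduct_mulVec, Matrix.vecMul_mulVec, hO', Matrix.vecMul_one]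
    simpa [dotProduct, L, sq] using h1
  let Li : Phase d ≃ₗᵢ[ℝ] Phase d := ⟨L, hn⟩
  have hph : ∀ ζ, phasePoint Z (Li ζ) = phasePoint Z' ζ := by
    intro ζ
    have : center Z = center Z' := hc
    show WithLp.toLp 2 (scaledWidth Z *ᵥ (O *ᵥ ⇑ζ)) + center Z =
      WithLp.toLp 2 (scaledWidth Z' *ᵥ ⇑ζ) + center Z'
    rw [Matrix.mulVec_mulVec, hWO, hc]
  rw [average_eq, average_eq, ← Li.measurePreserving.integral_comp
    Li.toHomeomorph.measurableEmbedding]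
  simp only [hph, gaussWeight, Li.norm_map]

end Symplectic

/-! ### Gaussians as Schwartz functions and their dependence on the parameters -/

section Packet

open scoped SchwartzMap

theorem norm_iteratedFDeriv_cexp_le (n : ℕ) (w : ℂ) :
    ‖iteratedFDeriv ℝ n cexp w‖ ≤ ‖cexp w‖ := by
  have hc : ContDiff ℝ ∞ cexp := Complex.contDiff_exp
  induction n generalizing w with
  | zero => simp
  | succ n ih =>
    let L : ℂ →L[ℝ] ℂ →L[ℝ] ℂ := ContinuousLinearMap.mul ℝ ℂ
    have hf : fderiv ℝ cexp = L ∘ cexp := by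
      funext w
      have h1 : HasFDerivAt cexp (L (cexp w)) w := by
        have := (Complex.hasDerivAt_exp w).hasFDerivAt.restrictScalars ℝ
        refine this.congr_fderiv ?_
        ext <;> simp [L, mul_comm]
      exact h1.fderiv
    have hL : ‖L‖ ≤ 1 := ContinuousLinearMap.opNorm_mul_le ℝ ℂ
    calc ‖iteratedFDeriv ℝ (n + 1) cexp w‖ = ‖iteratedFDeriv ℝ n (fderiv ℝ cexp) w‖ :=
          (norm_iteratedFDeriv_fderiv).symm
      _ ≤ ‖L‖ * ‖iteratedFDeriv ℝ n cexp w‖ := by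
          rw [hf]
          exact L.norm_iteratedFDeriv_comp_left hc.contDiffAt (by exact_mod_cast le_top)
      _ ≤ 1 * ‖cexp w‖ := by gcongr; exact ih w
      _ = _ := one_mul _

theorem exists_schwartz_exp {ι : Type*} [Fintype ι] {g : EuclideanSpace ℝ ι → ℂ}
    (hg : g.HasTemperateGrowth) {K c : ℝ} (hc : 0 < c)
    (hb : ∀ x, ‖cexp (g x)‖ ≤ K * Real.exp (-c * ‖x‖ ^ 2)) :
    ∃ φ : 𝓢(EuclideanSpace ℝ ι, ℂ), ∀ x, φ x = cexp (g x) := by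
  have hce : ContDiff ℝ ∞ cexp := Complex.contDiff_exp
  refine ⟨⟨fun x => cexp (g x), hce.comp hg.1, fun k n => ?_⟩, fun x => rfl⟩
  obtain ⟨l, D, hD0, hD⟩ := hg.norm_iteratedFDeriv_le_uniform n
  have hK : 0 ≤ K := by simpa using (norm_nonneg _).trans (hb 0)
  refine ⟨n.factorial * (1 + D) ^ n * K * ((k + l * n).factorial * Real.exp (1 + 1 / (2 * c))),
    fun x => ?_⟩
  have h1 : ‖iteratedFDeriv ℝ n (cexp ∘ g) x‖ ≤
      n.factorial * ‖cexp (g x)‖ * ((1 + D) * (1 + ‖x‖) ^ l) ^ n := by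
    refine norm_iteratedFDeriv_comp_le hce hg.1 (by exact_mod_cast le_top) x
      (fun i _ => norm_iteratedFDeriv_cexp_le i _) fun i hi hin => ?_
    have hp : 1 ≤ (1 + ‖x‖) ^ l := one_le_pow₀ (by simp)
    have h2 : 1 ≤ (1 + D) * (1 + ‖x‖) ^ l := by nlinarith
    calc ‖iteratedFDeriv ℝ i g x‖ ≤ D * (1 + ‖x‖) ^ l := hD i hin x
      _ ≤ (1 + D) * (1 + ‖x‖) ^ l := by gcongr; linarith
      _ ≤ _ := le_self_pow₀ h2 (by omega)
  have h2 := one_add_pow_mul_exp_le (k + l * n) hc (norm_nonneg x)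
  have h3 : Real.exp (-(c / 2) * ‖x‖ ^ 2) ≤ 1 := Real.exp_le_one_iff.2 (by nlinarith [sq_nonneg ‖x‖])
  calc ‖x‖ ^ k * ‖iteratedFDeriv ℝ n (fun x => cexp (g x)) x‖
      ≤ (1 + ‖x‖) ^ k * (n.factorial * (K * Real.exp (-c * ‖x‖ ^ 2)) *
        ((1 + D) * (1 + ‖x‖) ^ l) ^ n) := by
        gcongr
        · simp
        · exact h1.trans (by gcongr; exact hb x)
    _ = n.factorial * (1 + D) ^ n * K *
        ((1 + ‖x‖) ^ (k + l * n) * Real.exp (-c * ‖x‖ ^ 2)) := by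
        rw [mul_pow, ← pow_mul, pow_add]; ring
    _ ≤ n.factorial * (1 + D) ^ n * K * ((k + l * n).factorial *
        Real.exp (1 + 1 / (2 * c)) * 1) := by
        refine mul_le_mul_of_nonneg_left (h2.trans ?_) (by positivity)
        exact mul_le_mul_of_nonneg_left h3 (by positivity)
    _ = _ := by rw [mul_one]

variable {d : ℕ}

/-- A real vector as a complex vector. -/
def cvec (x : Pos d) : Fin d → ℂ := fun i => (x i : ℂ)

theorem cvec_sub (x y : Pos d) : cvec (x - y) = cvec x - cvec y := by
  funext i; simp [cvec]

theorem cvec_add (x y : Pos d) : cvec (x + y) = cvec x + cvec y := by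
  funext i; simp [cvec]

theorem cvec_smul (c : ℝ) (x : Pos d) : cvec (c • x) = (c : ℂ) • cvec x := by
  funext i; simp [cvec]

/-- The Gaussian `κ exp (i/ε (½ xᵀ C x + bᵀ x))`. -/
def packet (ε : ℝ) (κ : ℂ) (b : Fin d → ℂ) (C : Matrix (Fin d) (Fin d) ℂ) (x : Pos d) : ℂ :=
  κ * cexp (I / ε * (1 / 2 * (cvec x ⬝ᵥ C *ᵥ cvec x) + b ⬝ᵥ cvec x))

theorem gaussian_def (ε : ℝ) (q p : Pos d) (C : Matrix (Fin d) (Fin d) ℂ) (ζ : ℂ) (x : Pos d) :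
    gaussian ε q p C ζ x = cexp (I / ε * (1 / 2 * (cvec (x - q) ⬝ᵥ C *ᵥ cvec (x - q)) +
      cvec p ⬝ᵥ cvec (x - q) + ζ)) := rfl

theorem dotProduct_mulVec_symm {C : Matrix (Fin d) (Fin d) ℂ} (hC : Cᵀ = C) (v w : Fin d → ℂ) :
    v ⬝ᵥ C *ᵥ w = w ⬝ᵥ C *ᵥ v := by
  rw [dotProduct_comm, ← Matrix.vecMul_transpose, hC, ← Matrix.dotProduct_mulVec]

theorem gaussian_eq_packet (ε : ℝ) (q p : Pos d) {C : Matrix (Fin d) (Fin d) ℂ} (hC : Cᵀ = C)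
    (ζ : ℂ) : gaussian ε q p C ζ =
      packet ε (cexp (I / ε * (1 / 2 * (cvec q ⬝ᵥ C *ᵥ cvec q) - cvec p ⬝ᵥ cvec q + ζ)))
        (cvec p - C *ᵥ cvec q) C := by
  funext x
  rw [gaussian_def, packet, ← Complex.exp_add]
  congr 1
  rw [cvec_sub, Matrix.mulVec_sub, sub_dotProduct, dotProduct_sub, dotProduct_sub, dotProduct_sub,
    sub_dotProduct, dotProduct_mulVec_symm hC (cvec q) (cvec x), dotProduct_comm (C *ᵥ cvec q)]
  ring

theorem im_cvec_form (C : Matrix (Fin d) (Fin d) ℂ) (x : Pos d) :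
    (cvec x ⬝ᵥ C *ᵥ cvec x).im = x ⬝ᵥ C.map im *ᵥ x := by
  simp [dotProduct, Matrix.mulVec, cvec, Complex.im_sum]

theorem norm_packet (ε : ℝ) (κ : ℂ) (b : Fin d → ℂ) (C : Matrix (Fin d) (Fin d) ℂ) (x : Pos d) :
    ‖packet ε κ b C x‖ = ‖κ‖ * Real.exp (-(1 / ε) * (1 / 2 * (x ⬝ᵥ C.map im *ᵥ x) +
      ∑ i, (b i).im * x i)) := by
  rw [packet, norm_mul, Complex.norm_exp, ← im_cvec_form]
  congr 2
  have : I / (ε : ℂ) = ((1 / ε : ℝ) : ℂ) * I := by push_cast; ring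
  rw [this, mul_assoc, Complex.re_ofReal_mul, Complex.I_mul_re]
  have h2 : (b ⬝ᵥ cvec x).im = ∑ i, (b i).im * x i := by
    simp [dotProduct, cvec, Complex.im_sum]
  have h3 : (1 / 2 * (cvec x ⬝ᵥ C *ᵥ cvec x)).im = 1 / 2 * (cvec x ⬝ᵥ C *ᵥ cvec x).im := by
    have : (1 / 2 : ℂ) = ((1 / 2 : ℝ) : ℂ) := by push_cast; rfl
    rw [this, Complex.im_ofReal_mul]
  rw [Complex.add_im, h2, h3]
  ring

theorem exists_posDef_lower_bound {A : Matrix (Fin d) (Fin d) ℝ} (hA : A.PosDef) :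
    ∃ c > 0, ∀ x : Pos d, c * ‖x‖ ^ 2 ≤ x ⬝ᵥ A *ᵥ x := by
  obtain ⟨R, hR, h1, -⟩ := exists_real_factor hA
  let L : Pos d →L[ℝ] Pos d := LinearMap.toContinuousLinearMap (Matrix.toEuclideanLin R)
  refine ⟨((1 + ‖L‖) ^ 2)⁻¹, by positivity, fun x => ?_⟩
  let y : Pos d := WithLp.toLp 2 (R⁻¹ *ᵥ ⇑x)
  have hxy : L y = x := by
    ext i
    show (R *ᵥ (R⁻¹ *ᵥ ⇑x)) i = x i
    rw [Matrix.mulVec_mulVec, Matrix.mul_nonsing_inv _ hR, Matrix.one_mulVec]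
  have h2 : x ⬝ᵥ A *ᵥ x = ‖y‖ ^ 2 := by
    have hx : (x : Fin d → ℝ) = R *ᵥ ⇑y := by
      conv_lhs => rw [← hxy]
      rfl
    have h3 : (R *ᵥ ⇑y) ⬝ᵥ A *ᵥ (R *ᵥ ⇑y) = ⇑y ⬝ᵥ ((Rᵀ * A * R) *ᵥ ⇑y) := by
      rw [← Matrix.mulVec_mulVec, ← Matrix.mulVec_mulVec, Matrix.dotProduct_mulVec _ Rᵀ,
        Matrix.vecMul_transpose]
    rw [hx, h3, h1, Matrix.one_mulVec, EuclideanSpace.norm_sq_eq]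
    simp [dotProduct, sq]
  have h3 : ‖x‖ ≤ (1 + ‖L‖) * ‖y‖ := by
    calc ‖x‖ = ‖L y‖ := by rw [hxy]
      _ ≤ ‖L‖ * ‖y‖ := L.le_opNorm y
      _ ≤ _ := by gcongr; linarith
  rw [h2, inv_mul_le_iff₀ (by positivity), ← mul_pow]
  gcongr

theorem norm_packet_le {ε : ℝ} (hε : 0 < ε) {κ : ℂ} {b : Fin d → ℂ} {C : Matrix (Fin d) (Fin d) ℂ}
    {c B M : ℝ} (hc : 0 < c) (hA : ∀ x : Pos d, c * ‖x‖ ^ 2 ≤ x ⬝ᵥ C.map im *ᵥ x)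
    (hB : ∑ i, ‖b i‖ ≤ B) (hM : ‖κ‖ ≤ M) (x : Pos d) :
    ‖packet ε κ b C x‖ ≤ M * Real.exp (B ^ 2 / (c * ε)) * Real.exp (-(c / (4 * ε)) * ‖x‖ ^ 2) := by
  have h1 : -(B * ‖x‖) ≤ ∑ i, (b i).im * x i := by
    have : |∑ i, (b i).im * x i| ≤ B * ‖x‖ := by
      calc |∑ i, (b i).im * x i| ≤ ∑ i, |(b i).im * x i| := Finset.abs_sum_le_sum_abs _ _
        _ ≤ ∑ i, ‖b i‖ * ‖x‖ := by
            refine Finset.sum_le_sum fun i _ => ?_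
            rw [abs_mul]
            exact mul_le_mul (Complex.abs_im_le_norm _) (PiLp.norm_apply_le x i) (abs_nonneg _)
              (norm_nonneg _)
        _ = (∑ i, ‖b i‖) * ‖x‖ := by rw [Finset.sum_mul]
        _ ≤ B * ‖x‖ := by gcongr
    exact (abs_le.1 this).1
  have hM0 : 0 ≤ M := (norm_nonneg _).trans hM
  rw [norm_packet, mul_assoc, ← Real.exp_add]
  have h2 : 0 ≤ (c * ‖x‖ - 2 * B) ^ 2 / (4 * c) := by positivity
  have h3 : (c * ‖x‖ - 2 * B) ^ 2 / (4 * c) = c / 4 * ‖x‖ ^ 2 - B * ‖x‖ + B ^ 2 / c := by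
    field_simp; ring
  have h4 : c / 4 * ‖x‖ ^ 2 - B ^ 2 / c ≤
      1 / 2 * (x ⬝ᵥ C.map im *ᵥ x) + ∑ i, (b i).im * x i := by
    have := hA x
    linarith
  have h5 : -(1 / ε) * (1 / 2 * (x ⬝ᵥ C.map im *ᵥ x) + ∑ i, (b i).im * x i) ≤
      B ^ 2 / (c * ε) + -(c / (4 * ε)) * ‖x‖ ^ 2 := by
    have h6 := mul_le_mul_of_nonneg_left h4 (by positivity : 0 ≤ 1 / ε)
    have h7 : 1 / ε * (c / 4 * ‖x‖ ^ 2 - B ^ 2 / c) =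
        -(B ^ 2 / (c * ε) + -(c / (4 * ε)) * ‖x‖ ^ 2) := by
      field_simp; ring
    linarith
  exact mul_le_mul hM (Real.exp_le_exp.2 h5) (Real.exp_pos _).le hM0

theorem hasTemperateGrowth_coord (i : Fin d) :
    (fun x : Pos d => (x i : ℂ)).HasTemperateGrowth :=
  (Complex.ofRealCLM.comp (EuclideanSpace.proj i : Pos d →L[ℝ] ℝ)).hasTemperateGrowth

theorem exists_schwartz_packet {ε : ℝ} (hε : 0 < ε) (κ : ℂ) (b : Fin d → ℂ)
    {C : Matrix (Fin d) (Fin d) ℂ} (hC : (C.map im).PosDef) :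
    ∃ φ : 𝓢(Pos d, ℂ), ∀ x, φ x = packet ε κ b C x := by
  obtain ⟨c, hc, hA⟩ := exists_posDef_lower_bound hC
  have hg : (fun x : Pos d => I / ε * (1 / 2 * (cvec x ⬝ᵥ C *ᵥ cvec x) +
      b ⬝ᵥ cvec x)).HasTemperateGrowth := by
    refine (Function.HasTemperateGrowth.const _).mul
      (((Function.HasTemperateGrowth.const _).mul ?_).add ?_)
    · unfold dotProduct Matrix.mulVec dotProduct
      exact Function.HasTemperateGrowth.sum fun i _ => (hasTemperateGrowth_coord i).mul
        (Function.HasTemperateGrowth.sum fun j _ =>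
          (Function.HasTemperateGrowth.const _).mul (hasTemperateGrowth_coord j))
    · exact Function.HasTemperateGrowth.sum fun i _ =>
        (Function.HasTemperateGrowth.const _).mul (hasTemperateGrowth_coord i)
  obtain ⟨φ, hφ⟩ := exists_schwartz_exp hg (by positivity : 0 < c / (4 * ε)) fun x => by
    have := norm_packet_le hε (κ := 1) hc hA (le_refl (∑ i, ‖b i‖)) (le_of_eq norm_one) x
    rwa [packet, one_mul, one_mul] at this
  exact ⟨κ • φ, fun x => by rw [smul_apply, hφ, smul_eq_mul, packet]⟩

theorem exists_schwartz_gaussian {ε : ℝ} (hε : 0 < ε) (q p : Pos d)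
    {C : Matrix (Fin d) (Fin d) ℂ} (hs : Cᵀ = C) (hC : (C.map im).PosDef) (ζ : ℂ) :
    ∃ φ : 𝓢(Pos d, ℂ), ∀ x, φ x = gaussian ε q p C ζ x := by
  rw [gaussian_eq_packet ε q p hs]
  exact exists_schwartz_packet hε _ _ hC

theorem norm_sq_eq_integral (f : Hilb d) : ‖f‖ ^ 2 = ∫ x, ‖f x‖ ^ 2 := by
  have h1 : (inner ℂ f f : ℂ) = ((∫ x, ‖f x‖ ^ 2 : ℝ) : ℂ) := by
    rw [L2.inner_def, ← integral_complex_ofReal]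
    refine integral_congr_ae (Filter.Eventually.of_forall fun x => ?_)
    simp only [inner_self_eq_norm_sq_to_K]
    norm_cast
  rw [inner_self_eq_norm_sq_to_K] at h1
  exact Complex.ofReal_injective (by rw [← h1]; norm_cast)

theorem posDef_form_ge {A A' : Matrix (Fin d) (Fin d) ℝ} {c : ℝ}
    (hA : ∀ x : Pos d, c * ‖x‖ ^ 2 ≤ x ⬝ᵥ A *ᵥ x) (x : Pos d) :
    (c - ∑ i, ∑ j, |A i j - A' i j|) * ‖x‖ ^ 2 ≤ x ⬝ᵥ A' *ᵥ x := by
  have h1 : x ⬝ᵥ A *ᵥ x - x ⬝ᵥ A' *ᵥ x ≤ (∑ i, ∑ j, |A i j - A' i j|) * ‖x‖ ^ 2 := by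
    rw [← dotProduct_sub, ← Matrix.sub_mulVec]
    simp only [dotProduct, Matrix.mulVec, Finset.mul_sum, Finset.sum_mul, Matrix.sub_apply]
    refine Finset.sum_le_sum fun i _ => Finset.sum_le_sum fun j _ => ?_
    calc x i * ((A i j - A' i j) * x j) ≤ |x i * ((A i j - A' i j) * x j)| := le_abs_self _
      _ = |A i j - A' i j| * (|x i| * |x j|) := by rw [abs_mul, abs_mul]; ring
      _ ≤ |A i j - A' i j| * (‖x‖ * ‖x‖) := by
          gcongr
          · exact PiLp.norm_apply_le x i
          · exact PiLp.norm_apply_le x j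
      _ = _ := by ring
  have := hA x
  linarith

theorem continuous_packet (ε : ℝ) (κ : ℂ) (b : Fin d → ℂ) (C : Matrix (Fin d) (Fin d) ℂ) :
    Continuous (packet ε κ b C) := by
  unfold packet cvec dotProduct Matrix.mulVec dotProduct
  fun_prop

/-- Polynomially weighted Gaussians depend continuously in `L²` on the parameters. -/
theorem tendsto_packet {ε : ℝ} (hε : 0 < ε) {T : Type*} {l : Filter T} [l.IsCountablyGenerated]
    {κ : T → ℂ} {b : T → Fin d → ℂ} {C : T → Matrix (Fin d) (Fin d) ℂ} {κ₀ : ℂ} {b₀ : Fin d → ℂ}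
    {C₀ : Matrix (Fin d) (Fin d) ℂ} (hκ : Filter.Tendsto κ l (nhds κ₀))
    (hb : Filter.Tendsto b l (nhds b₀)) (hC : Filter.Tendsto C l (nhds C₀))
    (hA : (C₀.map im).PosDef) {m : Pos d → ℂ} (hm : PolyGrowth m)
    (hmc : Continuous m)     {F : T → Hilb d} {F₀ : Hilb d} (hF : ∀ᶠ t in l, F t =ᵐ[volume] fun x =>
      m x * packet ε (κ t) (b t) (C t) x)
    (hF₀ : F₀ =ᵐ[volume] fun x => m x * packet ε κ₀ b₀ C₀ x) :
    Filter.Tendsto F l (nhds F₀) := by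
  obtain ⟨c, hc, hcA⟩ := exists_posDef_lower_bound hA
  obtain ⟨D, k, hD⟩ := hm
  have hD0 : 0 ≤ D := by simpa using (norm_nonneg _).trans (hD 0)
  have e1 : ∀ᶠ t in l, ‖κ t‖ ≤ ‖κ₀‖ + 1 :=
    (hκ.norm.eventually (gt_mem_nhds (lt_add_one _))).mono fun t ht => ht.le
  have e2 : ∀ᶠ t in l, ∑ i, ‖b t i‖ ≤ ∑ i, ‖b₀ i‖ + 1 := by
    have : Filter.Tendsto (fun t => ∑ i, ‖b t i‖) l (nhds (∑ i, ‖b₀ i‖)) :=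
      tendsto_finsetSum _ fun i _ => ((tendsto_pi_nhds.1 hb) i).norm
    exact (this.eventually (gt_mem_nhds (lt_add_one _))).mono fun t ht => ht.le
  have e3 : ∀ᶠ t in l, ∀ x : Pos d, c / 2 * ‖x‖ ^ 2 ≤ x ⬝ᵥ (C t).map im *ᵥ x := by
    have : Filter.Tendsto (fun t => ∑ i, ∑ j, |C₀.map im i j - (C t).map im i j|) l
        (nhds (∑ i, ∑ j, |C₀.map im i j - C₀.map im i j|)) :=
      tendsto_finsetSum _ fun i _ => tendsto_finsetSum _ fun j _ =>
        (tendsto_const_nhds.sub ((Complex.continuous_im.tendsto _).comp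
          ((tendsto_pi_nhds.1 ((tendsto_pi_nhds.1 hC) i)) j))).abs
    simp only [sub_self, abs_zero, Finset.sum_const_zero] at this
    filter_upwards [this.eventually (gt_mem_nhds (half_pos hc))] with t ht x
    refine le_trans ?_ (posDef_form_ge hcA x)
    gcongr
    linarith
  set M : ℝ := (‖κ₀‖ + 1) * Real.exp ((∑ i, ‖b₀ i‖ + 1) ^ 2 / (c / 2 * ε)) with hM
  set s : ℝ := c / 2 / (4 * ε) with hs
  have hs0 : 0 < s := by positivity
  have hM0 : 0 ≤ M := by positivity
  have hbd : ∀ᶠ t in l, ∀ x, ‖m x * packet ε (κ t) (b t) (C t) x‖ ≤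
      D * M * ((1 + ‖x‖) ^ k * Real.exp (-s * ‖x‖ ^ 2)) := by
    filter_upwards [e1, e2, e3] with t h1 h2 h3 x
    rw [norm_mul]
    calc ‖m x‖ * ‖packet ε (κ t) (b t) (C t) x‖
        ≤ (D * (1 + ‖x‖) ^ k) * (M * Real.exp (-s * ‖x‖ ^ 2)) := by
          gcongr
          · exact hD x
          · exact norm_packet_le hε (half_pos hc) h3 h2 h1 x
      _ = _ := by ring
  have hp : ∀ x, Filter.Tendsto (fun t => packet ε (κ t) (b t) (C t) x) l
      (nhds (packet ε κ₀ b₀ C₀ x)) := by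
    intro x
    refine hκ.mul ((Complex.continuous_exp.tendsto _).comp (tendsto_const_nhds.mul
      ((tendsto_const_nhds.mul ?_).add ?_)))
    · unfold dotProduct Matrix.mulVec dotProduct
      refine tendsto_finsetSum _ fun i _ => tendsto_const_nhds.mul
        (tendsto_finsetSum _ fun j _ => ?_)
      exact ((tendsto_pi_nhds.1 ((tendsto_pi_nhds.1 hC) i)) j).mul tendsto_const_nhds
    · exact tendsto_finsetSum _ fun i _ => ((tendsto_pi_nhds.1 hb) i).mul tendsto_const_nhds
  rcases l.eq_or_neBot with rfl | hl
  · exact Filter.tendsto_bot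
  have hbd₀ : ∀ x, ‖m x * packet ε κ₀ b₀ C₀ x‖ ≤
      D * M * ((1 + ‖x‖) ^ k * Real.exp (-s * ‖x‖ ^ 2)) := fun x =>
    le_of_tendsto ((tendsto_const_nhds.mul (hp x)).norm) (hbd.mono fun t ht => ht x)
  rw [tendsto_iff_norm_sub_tendsto_zero]
  have hlim := tendsto_integral_filter_of_dominated_convergence (μ := (volume : Measure (Pos d)))
    (l := l) (F := fun t x => ‖m x * packet ε (κ t) (b t) (C t) x - m x * packet ε κ₀ b₀ C₀ x‖ ^ 2)
    (f := fun _ => 0) (fun x => (D * M * (k.factorial * Real.exp (1 + 1 / (2 * s))) * 2) ^ 2 *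
      Real.exp (-s * ‖x‖ ^ 2))
    (Filter.Eventually.of_forall fun t => Continuous.aestronglyMeasurable
      ((((hmc.mul (continuous_packet _ _ _ _)).sub
        (hmc.mul (continuous_packet _ _ _ _))).norm).pow 2))
    (by
      filter_upwards [hbd] with t h2
      refine Filter.Eventually.of_forall fun x => ?_
      rw [Real.norm_of_nonneg (by positivity)]
      have h6 := norm_sub_le (m x * packet ε (κ t) (b t) (C t) x) (m x * packet ε κ₀ b₀ C₀ x)
      have h7 := one_add_pow_mul_exp_le k hs0 (norm_nonneg x)
      have h8 : ‖m x * packet ε (κ t) (b t) (C t) x - m x * packet ε κ₀ b₀ C₀ x‖ ≤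
          D * M * (k.factorial * Real.exp (1 + 1 / (2 * s))) * 2 *
            Real.exp (-(s / 2) * ‖x‖ ^ 2) := by
        have h9 := mul_le_mul_of_nonneg_left h7 (mul_nonneg hD0 hM0)
        have := h2 x
        have := hbd₀ x
        linarith
      have h10 : Real.exp (-s * ‖x‖ ^ 2) = Real.exp (-(s / 2) * ‖x‖ ^ 2) ^ 2 := by
        rw [← Real.exp_nat_mul]; congr 1; push_cast; ring
      rw [h10, ← mul_pow]
      gcongr)
    ((integrable_exp_neg_mul_norm_sq hs0).const_mul _)
    (Filter.Eventually.of_forall fun x => by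
      have h1 := ((((hp x).const_mul (m x)).sub_const (m x * packet ε κ₀ b₀ C₀ x)).norm).pow 2
      simpa using h1)
  have hsq : Filter.Tendsto (fun t => ‖F t - F₀‖ ^ 2) l (nhds 0) := by
    rw [integral_zero] at hlim
    refine hlim.congr' ?_
    filter_upwards [hF] with t ht
    rw [norm_sq_eq_integral]
    refine integral_congr_ae ?_
    filter_upwards [ht, hF₀, Lp.coeFn_sub (F t) F₀] with x h3 h4 h5
    rw [h5, Pi.sub_apply, h3, h4]
  have := hsq.sqrt
  simpa using this

end Packet

/-! ### Weyl matrix elements of Gaussians -/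

section Moments

variable {ι : Type*} [Fintype ι] [DecidableEq ι]

theorem integral_affine {F : Type*} [NormedAddCommGroup F] [NormedSpace ℝ F] {M : Matrix ι ι ℝ}
    (hM : IsUnit M.det) (c : EuclideanSpace ℝ ι) (f : EuclideanSpace ℝ ι → F) :
    ∫ x, f x = |M.det| • ∫ v : EuclideanSpace ℝ ι, f (c + WithLp.toLp 2 (M *ᵥ ⇑v)) := by
  let L : EuclideanSpace ℝ ι →ₗ[ℝ] EuclideanSpace ℝ ι := Matrix.toEuclideanLin M
  have hdet : LinearMap.det L = M.det := by
    simp only [L, Matrix.toLpLin_eq_toLin, LinearMap.det_toLin]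
  have hd0 : LinearMap.det L ≠ 0 := by rw [hdet]; exact hM.ne_zero
  have hmap := Measure.map_linearMap_addHaar_eq_smul_addHaar
    (volume : Measure (EuclideanSpace ℝ ι)) hd0
  have hemb : MeasurableEmbedding L :=
    (L.equivOfDetNeZero hd0).toContinuousLinearEquiv.toHomeomorph.measurableEmbedding
  have h1 : ∫ v, f (c + L v) = |(M.det)⁻¹| • ∫ x, f x := by
    have h2 := hemb.integral_map (μ := volume) (fun y => f (c + y))
    rw [← h2, hmap, integral_smul_measure, hdet, ENNReal.toReal_ofReal (abs_nonneg _),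
      integral_add_left_eq_self (fun y => f y) c]
  have h3 : ∀ v : EuclideanSpace ℝ ι, WithLp.toLp 2 (M *ᵥ ⇑v) = L v := fun v => rfl
  simp only [h3]
  rw [h1, smul_smul, ← abs_mul, mul_inv_cancel₀ hM.ne_zero, abs_one, one_smul]

/-- Second Gaussian moments by integrating by parts twice. -/
theorem integral_coord_coord_smul_gaussWeight {f : EuclideanSpace ℝ ι → ℂ}
    {f₁ : ι → EuclideanSpace ℝ ι → ℂ} {f₂ : ι → ι → EuclideanSpace ℝ ι → ℂ}
    (hd : Differentiable ℝ f) (hd₁ : ∀ k, Differentiable ℝ (f₁ k))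
    (h₁ : ∀ k x, fderiv ℝ f x (EuclideanSpace.single k 1) = f₁ k x)
    (h₂ : ∀ j k x, fderiv ℝ (f₁ k) x (EuclideanSpace.single j 1) = f₂ j k x)
    (hf : PolyGrowth f) (hf₁ : ∀ k, PolyGrowth (f₁ k)) (hf₂ : ∀ j k, PolyGrowth (f₂ j k))
    (hc₂ : ∀ j k, Continuous (f₂ j k)) (j k : ι) :
    ∫ x, gaussWeight x • (x j • x k • f x) =
      (if j = k then 1 else 0) * (∫ x, gaussWeight x • f x) + ∫ x, gaussWeight x • f₂ k j x := by
  have hk : ∀ x : EuclideanSpace ℝ ι, HasFDerivAt (fun x : EuclideanSpace ℝ ι => x k)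
      (EuclideanSpace.proj k : EuclideanSpace ℝ ι →L[ℝ] ℝ) x := fun x =>
    (EuclideanSpace.proj k : EuclideanSpace ℝ ι →L[ℝ] ℝ).hasFDerivAt
  have hkc : Continuous fun x : EuclideanSpace ℝ ι => x k := by fun_prop
  have hp : ∀ g : EuclideanSpace ℝ ι → ℂ, PolyGrowth g → PolyGrowth fun x => x k • g x := by
    intro g hg
    simpa only [Complex.real_smul] using (PolyGrowth.coord k).ofReal.mul hg
  have hs := integral_coord_smul_gaussWeight (f := fun x => x k • f x)
    (f' := fun x => (if j = k then (1 : ℂ) else 0) * f x + x k • f₁ j x)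
    (fun x => (hk x).differentiableAt.smul (hd x)) (hp f hf) j
    (fun x => by
      have h3 : fderiv ℝ (fun x : EuclideanSpace ℝ ι => x k • f x) x = _ :=
        ((hk x).smul (hd x).hasFDerivAt).fderiv
      rw [h3]
      simp [h₁, eq_comm, add_comm])
    (((PolyGrowth.const _).mul hf).add (hp _ (hf₁ j)))
    (((continuous_const.mul hd.continuous).add
      (hkc.smul (hd₁ j).continuous)).aestronglyMeasurable)
  rw [hs]
  have i1 := hf.integrable hd.continuous.aestronglyMeasurable
  have i2 := (hp _ (hf₁ j)).integrable (hkc.smul (hd₁ j).continuous).aestronglyMeasurable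
  have e : ∀ x, gaussWeight x • ((if j = k then (1 : ℂ) else 0) * f x + x k • f₁ j x) =
      (if j = k then (1 : ℂ) else 0) * (gaussWeight x • f x) + gaussWeight x • (x k • f₁ j x) := by
    intro x
    rw [smul_add, mul_smul_comm]
  simp only [e]
  rw [integral_add (i1.const_mul _) i2, integral_const_mul]
  congr 1
  have h4 := integral_coord_smul_gaussWeight (hd₁ j) (hf₁ j) k (fun x => h₂ k j x) (hf₂ k j)
    (hc₂ k j).aestronglyMeasurable
  rw [h4]

/-- The total mass of the Gaussian weight. -/
def gaussMass (ι : Type*) [Fintype ι] : ℝ := ∫ x : EuclideanSpace ℝ ι, gaussWeight x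

theorem gaussMass_pos : 0 < gaussMass ι := by
  have : gaussMass ι = _ := GaussianFourier.integral_rexp_neg_mul_sq_norm
    (V := EuclideanSpace ℝ ι) one_half_pos
  rw [this]; positivity

/-- A plane wave. -/
def wave (η v : EuclideanSpace ℝ ι) : ℂ := cexp (I * (inner ℝ η v : ℝ))

theorem polyGrowth_wave (η : EuclideanSpace ℝ ι) : PolyGrowth (wave η) :=
  ⟨1, 0, fun v => by rw [wave, Complex.norm_exp]; simp⟩

theorem hasFDerivAt_wave (η v : EuclideanSpace ℝ ι) : ∃ L : EuclideanSpace ℝ ι →L[ℝ] ℂ,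
    HasFDerivAt (wave η) L v ∧ ∀ w, L w = I * (inner ℝ η w : ℝ) * wave η v := by
  have h1 : HasFDerivAt (fun v : EuclideanSpace ℝ ι => I * ((inner ℝ η v : ℝ) : ℂ))
      (I • Complex.ofRealCLM.comp (innerSL ℝ η)) v :=
    (Complex.ofRealCLM.comp (innerSL ℝ η)).hasFDerivAt.const_mul I
  refine ⟨_, h1.cexp, fun w => ?_⟩
  simp [wave]; ring

theorem differentiable_wave (η : EuclideanSpace ℝ ι) : Differentiable ℝ (wave η) := fun v =>
  (hasFDerivAt_wave η v).choose_spec.1.differentiableAt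

theorem fderiv_wave (η v : EuclideanSpace ℝ ι) (j : ι) :
    fderiv ℝ (wave η) v (EuclideanSpace.single j 1) = I * η j * wave η v := by
  obtain ⟨L, hL, h⟩ := hasFDerivAt_wave η v
  rw [hL.fderiv, h, EuclideanSpace.inner_single_right]
  simp

theorem integral_wave (η : EuclideanSpace ℝ ι) :
    ∫ v, gaussWeight v • wave η v = gaussMass ι * gaussWeight η := by
  have h1 := GaussianFourier.integral_cexp_neg_mul_sq_norm_add (V := EuclideanSpace ℝ ι)
    (b := 1 / 2) (by norm_num) I η
  have h2 := GaussianFourier.integral_cexp_neg_mul_sq_norm_add (V := EuclideanSpace ℝ ι)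
    (b := 1 / 2) (by norm_num) 0 η
  have e1 : ∀ v : EuclideanSpace ℝ ι, gaussWeight v • wave η v =
      cexp (-(1 / 2) * ‖v‖ ^ 2 + I * (inner ℝ η v : ℝ)) := by
    intro v
    rw [gaussWeight, wave, Complex.real_smul, Complex.ofReal_exp, ← Complex.exp_add]
    push_cast; rfl
  have e2 : ∀ v : EuclideanSpace ℝ ι, ((gaussWeight v : ℝ) : ℂ) =
      cexp (-(1 / 2) * ‖v‖ ^ 2 + 0 * (inner ℝ η v : ℝ)) := by
    intro v
    rw [gaussWeight, Complex.ofReal_exp]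
    push_cast; rw [zero_mul, add_zero]
  have h3 : (gaussMass ι : ℂ) = _ := (integral_complex_ofReal).symm.trans
    ((integral_congr_ae (Filter.Eventually.of_forall e2)).trans h2)
  simp only [e1]
  rw [h1, h3, gaussWeight, Complex.ofReal_exp]
  push_cast
  rw [zero_pow two_ne_zero, zero_mul, zero_div, Complex.exp_zero, mul_one, Complex.I_sq]
  congr 2
  ring

theorem integral_coord_wave (η : EuclideanSpace ℝ ι) (j : ι) :
    ∫ v, gaussWeight v • (v j • wave η v) = I * η j * (gaussMass ι * gaussWeight η) := by
  rw [integral_coord_smul_gaussWeight (differentiable_wave η) (polyGrowth_wave η) j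
    (fun v => fderiv_wave η v j) ((PolyGrowth.const _).mul (polyGrowth_wave η))
    (continuous_const.mul (differentiable_wave η).continuous).aestronglyMeasurable]
  simp only [← mul_smul_comm]
  rw [integral_const_mul, integral_wave]

theorem integral_coord_coord_wave (η : EuclideanSpace ℝ ι) (j k : ι) :
    ∫ v, gaussWeight v • (v j • v k • wave η v) =
      ((if j = k then 1 else 0) + I * η j * (I * η k)) * (gaussMass ι * gaussWeight η) := by
  have hfd : ∀ j k v, fderiv ℝ (fun v => I * η k * wave η v) v (EuclideanSpace.single j 1) =
      I * η j * (I * η k) * wave η v := by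
    intro j k v
    rw [fderiv_const_mul (differentiable_wave η v), _root_.smul_apply, fderiv_wave, smul_eq_mul]
    ring
  rw [integral_coord_coord_smul_gaussWeight (f₂ := fun j k v => I * η j * (I * η k) * wave η v)
    (differentiable_wave η) (fun k => (differentiable_wave η).const_mul _)
    (fun k v => fderiv_wave η v k) hfd (polyGrowth_wave η)
    (fun k => (PolyGrowth.const _).mul (polyGrowth_wave η))
    (fun j k => (PolyGrowth.const _).mul (polyGrowth_wave η))
    (fun j k => continuous_const.mul (differentiable_wave η).continuous) j k]
  simp only [← mul_smul_comm]
  rw [integral_const_mul, integral_wave]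
  ring

/-- A complex polynomial of degree at most two. -/
def quad (α : ℂ) (β : ι → ℂ) (Γ : Matrix ι ι ℂ) (s : EuclideanSpace ℝ ι) : ℂ :=
  α + β ⬝ᵥ (fun i => (s i : ℂ)) + 1 / 2 * ((fun i => (s i : ℂ)) ⬝ᵥ Γ *ᵥ fun i => (s i : ℂ))

theorem quad_eq (α : ℂ) (β : ι → ℂ) (Γ : Matrix ι ι ℂ) (s : EuclideanSpace ℝ ι) :
    quad α β Γ s = α + ∑ i, β i * s i + 1 / 2 * ∑ i, s i * ∑ j, Γ i j * s j := rfl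

theorem polyGrowth_affine (α : ℂ) (β : ι → ℂ) :
    PolyGrowth fun s : EuclideanSpace ℝ ι => α + ∑ i, β i * s i :=
  (PolyGrowth.const _).add (PolyGrowth.sum _ fun i => (PolyGrowth.const _).mul
    (PolyGrowth.coord i).ofReal)

theorem polyGrowth_quad (α : ℂ) (β : ι → ℂ) (Γ : Matrix ι ι ℂ) : PolyGrowth (quad α β Γ) :=
  (polyGrowth_affine α β).add ((PolyGrowth.const _).mul (PolyGrowth.sum _ fun i =>
    (PolyGrowth.coord i).ofReal.mul (PolyGrowth.sum _ fun j =>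
      (PolyGrowth.const _).mul (PolyGrowth.coord j).ofReal)))

theorem hasFDerivAt_coord (i : ι) (s : EuclideanSpace ℝ ι) :
    HasFDerivAt (fun s : EuclideanSpace ℝ ι => (s i : ℂ))
      (Complex.ofRealCLM.comp (EuclideanSpace.proj i : EuclideanSpace ℝ ι →L[ℝ] ℝ)) s :=
  (Complex.ofRealCLM.comp (EuclideanSpace.proj i : EuclideanSpace ℝ ι →L[ℝ] ℝ)).hasFDerivAt

theorem differentiable_affine (α : ℂ) (β : ι → ℂ) :
    Differentiable ℝ fun s : EuclideanSpace ℝ ι => α + ∑ i, β i * s i := by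
  have h1 : ∀ i, Differentiable ℝ fun s : EuclideanSpace ℝ ι => (s i : ℂ) := fun i s =>
    (hasFDerivAt_coord i s).differentiableAt
  exact (differentiable_const _).add (Differentiable.fun_sum fun i _ => (h1 i).const_mul _)

theorem fderiv_affine (α : ℂ) (β : ι → ℂ) (s : EuclideanSpace ℝ ι) (j : ι) :
    fderiv ℝ (fun s : EuclideanSpace ℝ ι => α + ∑ i, β i * s i) s (EuclideanSpace.single j 1) =
      β j := by
  have h1 : HasFDerivAt (fun s : EuclideanSpace ℝ ι => α + ∑ i, β i * s i) _ s :=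
    (HasFDerivAt.fun_sum fun i _ => (hasFDerivAt_coord i s).const_mul (β i)).const_add α
  rw [h1.fderiv]
  simp [apply_ite]

theorem differentiable_quad (α : ℂ) (β : ι → ℂ) (Γ : Matrix ι ι ℂ) :
    Differentiable ℝ (quad α β Γ) := by
  have h1 : ∀ i, Differentiable ℝ fun s : EuclideanSpace ℝ ι => (s i : ℂ) := fun i s =>
    (hasFDerivAt_coord i s).differentiableAt
  have h2 := fun i => differentiable_affine 0 (fun j => Γ i j)
  simp only [zero_add] at h2
  exact (differentiable_affine α β).add ((Differentiable.fun_sum fun i _ =>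
    Differentiable.mul (h1 i) (h2 i)).const_mul _)

theorem fderiv_quad (α : ℂ) (β : ι → ℂ) {Γ : Matrix ι ι ℂ} (hΓ : Γᵀ = Γ)
    (s : EuclideanSpace ℝ ι) (k : ι) :
    fderiv ℝ (quad α β Γ) s (EuclideanSpace.single k 1) = β k + ∑ j, Γ k j * s j := by
  have h2 : ∀ i, HasFDerivAt (fun s : EuclideanSpace ℝ ι => ∑ j, Γ i j * (s j : ℂ)) _ s := fun i =>
    HasFDerivAt.fun_sum fun j _ => (hasFDerivAt_coord j s).const_mul (Γ i j)
  have h1 : HasFDerivAt (quad α β Γ) _ s :=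
    ((HasFDerivAt.fun_sum fun i _ => (hasFDerivAt_coord i s).const_mul (β i)).const_add α).add
      ((HasFDerivAt.fun_sum fun i _ => (hasFDerivAt_coord i s).mul (h2 i)).const_mul (1 / 2))
  rw [h1.fderiv]
  have h3 : ∀ i j, Γ i j = Γ j i := fun i j => congrFun (congrFun hΓ j) i
  have h4 : ∑ x, (s x : ℂ) * Γ x k = ∑ x, Γ k x * (s x : ℂ) :=
    Finset.sum_congr rfl fun x _ => by rw [h3 x k, mul_comm]
  simp [Finset.sum_add_distrib, apply_ite, h4]
  ring

/-- Gaussian moments of a quadratic polynomial. -/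
theorem integral_quad (α : ℂ) (β : ι → ℂ) {Γ : Matrix ι ι ℂ} (hΓ : Γᵀ = Γ) :
    ∫ s, gaussWeight s • quad α β Γ s = gaussMass ι * (α + 1 / 2 * Γ.trace) ∧
    (∀ j, ∫ s, gaussWeight s • (s j • quad α β Γ s) = gaussMass ι * β j) ∧
    ∀ j k, ∫ s, gaussWeight s • (s j • s k • quad α β Γ s) =
      gaussMass ι * ((if j = k then 1 else 0) * (α + 1 / 2 * Γ.trace) + Γ j k) := by
  have hmass : ∀ c : ℂ, ∫ s : EuclideanSpace ℝ ι, gaussWeight s • c = gaussMass ι * c := by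
    intro c
    simp only [Complex.real_smul]
    rw [integral_mul_const, integral_complex_ofReal, gaussMass]
  have hone : ∀ i, ∫ s : EuclideanSpace ℝ ι, gaussWeight s • (s i : ℂ) = 0 := by
    intro i
    have := integral_coord_smul_gaussWeight (f := fun _ : EuclideanSpace ℝ ι => (1 : ℂ))
      (f' := fun _ => 0) (differentiable_const _) (PolyGrowth.const _) i (fun x => by simp)
      (PolyGrowth.const _) aestronglyMeasurable_const
    simpa using this
  have hi : ∀ i, Integrable fun s : EuclideanSpace ℝ ι => gaussWeight s • (s i : ℂ) := fun i =>
    (PolyGrowth.coord i).ofReal.integrable (by fun_prop)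
  have hic : ∀ c : ℂ, Integrable fun s : EuclideanSpace ℝ ι => gaussWeight s • c := fun c =>
    (PolyGrowth.const c).integrable aestronglyMeasurable_const
  have haff : ∀ (α : ℂ) (β : ι → ℂ),
      ∫ s : EuclideanSpace ℝ ι, gaussWeight s • (α + ∑ i, β i * s i) = gaussMass ι * α := by
    intro α β
    have e : ∀ s : EuclideanSpace ℝ ι, gaussWeight s • (α + ∑ i, β i * (s i : ℂ)) =
        gaussWeight s • α + ∑ i, β i * (gaussWeight s • (s i : ℂ)) := by
      intro s
      rw [smul_add, Finset.smul_sum]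
      simp only [mul_smul_comm]
    simp only [e]
    rw [integral_add (hic α) (integrable_finsetSum _ fun i _ => (hi i).const_mul _), hmass,
      integral_finsetSum _ fun i _ => (hi i).const_mul _]
    simp only [integral_const_mul, hone, mul_zero, Finset.sum_const_zero, add_zero]
  have h2 : ∀ i j, ∫ s : EuclideanSpace ℝ ι, gaussWeight s • ((s i : ℂ) * s j) =
      if i = j then (gaussMass ι : ℂ) else 0 := by
    intro i j
    have := integral_coord_coord_smul_gaussWeight (f := fun _ : EuclideanSpace ℝ ι => (1 : ℂ))
      (f₁ := fun _ _ => 0) (f₂ := fun _ _ _ => 0) (differentiable_const _)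
      (fun _ => differentiable_const _) (fun k x => by simp) (fun j k x => by simp)
      (PolyGrowth.const _) (fun _ => PolyGrowth.const _) (fun _ _ => PolyGrowth.const _)
      (fun _ _ => continuous_const) i j
    rw [hmass] at this
    simpa using this
  have h0 : ∫ s, gaussWeight s • quad α β Γ s = gaussMass ι * (α + 1 / 2 * Γ.trace) := by
    have e : ∀ s : EuclideanSpace ℝ ι, gaussWeight s • quad α β Γ s =
        gaussWeight s • (α + ∑ i, β i * (s i : ℂ)) +
          ∑ i, ∑ j, (1 / 2 * Γ i j) * (gaussWeight s • ((s i : ℂ) * s j)) := by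
      intro s
      rw [quad_eq, smul_add, Finset.mul_sum, Finset.smul_sum]
      congr 1
      refine Finset.sum_congr rfl fun i _ => ?_
      rw [Finset.mul_sum, Finset.mul_sum, Finset.smul_sum]
      refine Finset.sum_congr rfl fun j _ => ?_
      rw [mul_smul_comm]
      congr 1
      ring
    have hij : ∀ i j, Integrable fun s : EuclideanSpace ℝ ι =>
        gaussWeight s • ((s i : ℂ) * s j) := fun i j =>
      ((PolyGrowth.coord i).ofReal.mul (PolyGrowth.coord j).ofReal).integrable (by fun_prop)
    simp only [e]
    rw [integral_add ((polyGrowth_affine α β).integrable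
        (differentiable_affine α β).continuous.aestronglyMeasurable)
      (integrable_finsetSum _ fun i _ => integrable_finsetSum _ fun j _ =>
        (hij i j).const_mul _), haff,
      integral_finsetSum _ fun i _ => integrable_finsetSum _ fun j _ => (hij i j).const_mul _]
    simp only [integral_finsetSum _ fun j _ => (hij _ j).const_mul _, integral_const_mul, h2]
    simp [Matrix.trace, Finset.mul_sum, mul_add, mul_comm, mul_left_comm]
  refine ⟨h0, fun j => ?_, fun j k => ?_⟩
  · rw [integral_coord_smul_gaussWeight (differentiable_quad α β Γ) (polyGrowth_quad α β Γ) j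
      (fun s => fderiv_quad α β hΓ s j) (polyGrowth_affine _ _)
      (differentiable_affine _ _).continuous.aestronglyMeasurable, haff]
  · rw [integral_coord_coord_smul_gaussWeight (f₁ := fun k s => β k + ∑ j, Γ k j * s j)
      (f₂ := fun j k s => Γ k j) (differentiable_quad α β Γ)
      (fun k => differentiable_affine _ _) (fun k s => fderiv_quad α β hΓ s k)
      (fun j k s => fderiv_affine _ _ s j) (polyGrowth_quad α β Γ)
      (fun k => polyGrowth_affine _ _) (fun _ _ => PolyGrowth.const _)
      (fun _ _ => continuous_const) j k, h0, hmass]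
    ring

end Moments

section Pairing

open scoped SchwartzMap

variable {d : ℕ}

/-- `R` is a real width factor of the symmetric matrix `C`. -/
structure IsFrame (C : Matrix (Fin d) (Fin d) ℂ) (R : Matrix (Fin d) (Fin d) ℝ) : Prop where
  symm : Cᵀ = C
  det : IsUnit R.det
  factor : Rᵀ * C.map im * R = 1

theorem exists_isFrame {C : Matrix (Fin d) (Fin d) ℂ} (hs : Cᵀ = C) (hC : (C.map im).PosDef) :
    ∃ R, IsFrame C R :=
  let ⟨R, h1, h2, _⟩ := exists_real_factor hC
  ⟨R, hs, h1, h2⟩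

/-- Coordinates adapted to a wave packet. -/
def chart (ε : ℝ) (q : Pos d) (R : Matrix (Fin d) (Fin d) ℝ) (s : Pos d) : Pos d :=
  q + WithLp.toLp 2 ((√(ε / 2) • R) *ᵥ ⇑s)

theorem map_re_toC (R : Matrix (Fin d) (Fin d) ℝ) : (toC R).map re = R := by ext; simp

theorem map_im_toC (R : Matrix (Fin d) (Fin d) ℝ) : (toC R).map im = 0 := by ext; simp

theorem map_re_mul_toC (C : Matrix (Fin d) (Fin d) ℂ) (R : Matrix (Fin d) (Fin d) ℝ) :
    (C * toC R).map re = C.map re * R := by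
  ext i j; simp [Matrix.mul_apply, Complex.re_sum]

theorem map_im_mul_toC (C : Matrix (Fin d) (Fin d) ℂ) (R : Matrix (Fin d) (Fin d) ℝ) :
    (C * toC R).map im = C.map im * R := by
  ext i j; simp [Matrix.mul_apply, Complex.im_sum]

theorem scaledWidth_frame (ε : ℝ) (q p : Pos d) (C : Matrix (Fin d) (Fin d) ℂ)
    (R : Matrix (Fin d) (Fin d) ℝ) :
    scaledWidth (canonicalCoords ε q p (toC R) (C * toC R)) =
      √(ε / 2) • Matrix.fromBlocks R 0 (C.map re * R) (C.map im * R) := by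
  rw [scaledWidth_canonicalCoords, widthY, map_re_toC, map_im_toC, map_re_mul_toC, map_im_mul_toC]

theorem posL_phasePoint_frame (ε : ℝ) (q p : Pos d) (C : Matrix (Fin d) (Fin d) ℂ)
    (R : Matrix (Fin d) (Fin d) ℝ) (ζ : Phase d) :
    posL (phasePoint (canonicalCoords ε q p (toC R) (C * toC R)) ζ) = chart ε q R (posL ζ) := by
  have h : phasePoint (canonicalCoords ε q p (toC R) (C * toC R)) ζ = WithLp.toLp 2
    (scaledWidth (canonicalCoords ε q p (toC R) (C * toC R)) *ᵥ ⇑ζ) +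
      WithLp.toLp 2 (Sum.elim q p) := rfl
  ext i
  rw [h, scaledWidth_frame]
  simp [chart, Matrix.smul_mulVec, Matrix.fromBlocks_mulVec]
  exact add_comm _ _

theorem momL_phasePoint_frame (ε : ℝ) (q p : Pos d) (C : Matrix (Fin d) (Fin d) ℂ)
    (R : Matrix (Fin d) (Fin d) ℝ) (ζ : Phase d) :
    momL (phasePoint (canonicalCoords ε q p (toC R) (C * toC R)) ζ) = p + WithLp.toLp 2
      (C.map re *ᵥ ((√(ε / 2) • R) *ᵥ ⇑(posL ζ)) + C.map im *ᵥ ((√(ε / 2) • R) *ᵥ ⇑(momL ζ))) := by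
  have h : phasePoint (canonicalCoords ε q p (toC R) (C * toC R)) ζ = WithLp.toLp 2
    (scaledWidth (canonicalCoords ε q p (toC R) (C * toC R)) *ᵥ ⇑ζ) +
      WithLp.toLp 2 (Sum.elim q p) := rfl
  ext i
  rw [h, scaledWidth_frame]
  simp [Matrix.smul_mulVec, Matrix.fromBlocks_mulVec, add_comm, Matrix.mulVec_smul,
    ← Matrix.mulVec_mulVec, mul_add]
  rfl

theorem IsFrame.form {ε : ℝ} (hε : 0 < ε) {C : Matrix (Fin d) (Fin d) ℂ}
    {R : Matrix (Fin d) (Fin d) ℝ} (hR : IsFrame C R) (v w : Fin d → ℝ) :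
    ((√(ε / 2) • R) *ᵥ v) ⬝ᵥ C.map im *ᵥ ((√(ε / 2) • R) *ᵥ w) = ε / 2 * (v ⬝ᵥ w) := by
  have h3 : (R *ᵥ v) ⬝ᵥ C.map im *ᵥ (R *ᵥ w) = v ⬝ᵥ w := by
    have : (R *ᵥ v) ⬝ᵥ C.map im *ᵥ (R *ᵥ w) = v ⬝ᵥ ((Rᵀ * C.map im * R) *ᵥ w) := by
      rw [← Matrix.mulVec_mulVec, ← Matrix.mulVec_mulVec, Matrix.dotProduct_mulVec _ Rᵀ,
        Matrix.vecMul_transpose]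
    rw [this, hR.factor, Matrix.one_mulVec]
  rw [Matrix.smul_mulVec, Matrix.smul_mulVec, Matrix.mulVec_smul, smul_dotProduct,
    dotProduct_smul, h3, smul_eq_mul, smul_eq_mul, ← mul_assoc, Real.mul_self_sqrt (by positivity)]

theorem gaussian_add (ε : ℝ) (q p : Pos d) (C : Matrix (Fin d) (Fin d) ℂ) (ζ : ℂ)
    (w : Pos d) : gaussian ε q p C ζ (q + w) =
      cexp (I / ε * (1 / 2 * (((w ⬝ᵥ C.map re *ᵥ w : ℝ) : ℂ) + ((w ⬝ᵥ C.map im *ᵥ w : ℝ) : ℂ) * I) +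
        ((p ⬝ᵥ w : ℝ) : ℂ) + ζ)) := by
  have h1 : cvec w ⬝ᵥ C *ᵥ cvec w =
      ((w ⬝ᵥ C.map re *ᵥ w : ℝ) : ℂ) + ((w ⬝ᵥ C.map im *ᵥ w : ℝ) : ℂ) * I := by
    rw [← Complex.re_add_im (cvec w ⬝ᵥ C *ᵥ cvec w), im_cvec_form]
    congr 2
    simp [dotProduct, Matrix.mulVec, cvec, Complex.re_sum]
  have h2 : cvec p ⬝ᵥ cvec w = ((p ⬝ᵥ w : ℝ) : ℂ) := by simp [dotProduct, cvec]
  rw [gaussian_def, add_sub_cancel_left, h1, h2]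

theorem symm_re {C : Matrix (Fin d) (Fin d) ℂ} (hC : Cᵀ = C) : (C.map re)ᵀ = C.map re := by
  ext i j; simp [← congrFun (congrFun hC i) j]

theorem symm_im {C : Matrix (Fin d) (Fin d) ℂ} (hC : Cᵀ = C) : (C.map im)ᵀ = C.map im := by
  ext i j; simp [← congrFun (congrFun hC i) j]

theorem real_form_symm {A : Matrix (Fin d) (Fin d) ℝ} (hA : Aᵀ = A) (v w : Fin d → ℝ) :
    v ⬝ᵥ A *ᵥ w = w ⬝ᵥ A *ᵥ v := by
  rw [dotProduct_comm, ← Matrix.vecMul_transpose, hA, ← Matrix.dotProduct_mulVec]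

/-- The squared modulus of the amplitude of `gaussian ε q p C ζ`. -/
def amplitudeSq (ε : ℝ) (ζ : ℂ) : ℝ := Real.exp (-(2 / ε) * ζ.im)

theorem norm_sq_pos (x : Pos d) : ‖x‖ ^ 2 = x ⬝ᵥ x := by
  rw [EuclideanSpace.norm_sq_eq]; simp [dotProduct, sq]

theorem normSq_gaussian_chart {ε : ℝ} (hε : 0 < ε) (q p : Pos d) {C : Matrix (Fin d) (Fin d) ℂ}
    {R : Matrix (Fin d) (Fin d) ℝ} (hR : IsFrame C R) (ζ : ℂ) (s : Pos d) :
    conj (gaussian ε q p C ζ (chart ε q R s)) * gaussian ε q p C ζ (chart ε q R s) =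
      ((amplitudeSq ε ζ * gaussWeight s : ℝ) : ℂ) := by
  rw [chart, gaussian_add, ← Complex.exp_conj, ← Complex.exp_add, amplitudeSq, gaussWeight,
    ← Real.exp_add, Complex.ofReal_exp]
  congr 1
  have h1 := hR.form hε s s
  rw [← norm_sq_pos] at h1
  simp only [map_mul, map_add, map_div₀, Complex.conj_I, Complex.conj_ofReal, map_one, map_ofNat]
  have h2 : conj ζ = ζ.re - ζ.im * I := by
    apply Complex.ext <;> simp
  have h3 : ζ = ζ.re + ζ.im * I := (Complex.re_add_im ζ).symm
  rw [h2]
  generalize hre : ζ.re = a at *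
  generalize him : ζ.im = b at *
  rw [h3, h1]
  have hε' : (ε : ℂ) ≠ 0 := by exact_mod_cast hε.ne'
  push_cast
  field_simp
  ring_nf
  simp only [Complex.I_sq]
  ring

/-- The integrand of the cross-Wigner function of a Gaussian in adapted coordinates. -/
theorem wigner_integrand_chart {ε : ℝ} (hε : 0 < ε) (q p : Pos d) {C : Matrix (Fin d) (Fin d) ℂ}
    {R : Matrix (Fin d) (Fin d) ℝ} (hR : IsFrame C R) (ζ : ℂ) (η : Phase d) (v : Pos d) :
    conj (gaussian ε q p C ζ (chart ε q R (posL η + v))) *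
      gaussian ε q p C ζ ((2 : ℝ) • chart ε q R (posL η) - chart ε q R (posL η + v)) *
      wignerPhase ε (phasePoint (canonicalCoords ε q p (toC R) (C * toC R)) η)
        (chart ε q R (posL η + v)) =
      ((amplitudeSq ε ζ * gaussWeight (posL η) * gaussWeight v : ℝ) : ℂ) * wave (momL η) v := by
  set Y : Matrix (Fin d) (Fin d) ℝ := √(ε / 2) • R with hY
  set y₁ : Pos d := WithLp.toLp 2 (Y *ᵥ ⇑(posL η)) with hy₁
  set y : Pos d := WithLp.toLp 2 (Y *ᵥ ⇑v) with hy
  have c1 : chart ε q R (posL η + v) = q + (y₁ + y) := by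
    ext i; simp [chart, y₁, y, Y, Matrix.mulVec_add]
  have c2 : (2 : ℝ) • chart ε q R (posL η) - (q + (y₁ + y)) = q + (y₁ - y) := by
    have : chart ε q R (posL η) = q + y₁ := rfl
    rw [this, two_smul]; abel
  have c3 : chart ε q R (posL η) = q + y₁ := rfl
  rw [wignerPhase, posL_phasePoint_frame, momL_phasePoint_frame, c1, c2, c3, gaussian_add,
    gaussian_add, ← Complex.exp_conj, wave, amplitudeSq, gaussWeight, gaussWeight, ← Real.exp_add,
    ← Real.exp_add, Complex.ofReal_exp, ← Complex.exp_add, ← Complex.exp_add, ← Complex.exp_add]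
  congr 1
  have hBs := symm_re hR.symm
  have hAs := symm_im hR.symm
  have e1 : ∀ A : Matrix (Fin d) (Fin d) ℝ, Aᵀ = A → (y₁.ofLp + y.ofLp) ⬝ᵥ A *ᵥ (y₁.ofLp + y.ofLp) =
      y₁ ⬝ᵥ A *ᵥ y₁ + 2 * (y ⬝ᵥ A *ᵥ y₁) + y ⬝ᵥ A *ᵥ y := by
    intro A hA
    rw [Matrix.mulVec_add, add_dotProduct, dotProduct_add, dotProduct_add,
      real_form_symm hA y₁ y]; ring
  have e2 : ∀ A : Matrix (Fin d) (Fin d) ℝ, Aᵀ = A → (y₁.ofLp - y.ofLp) ⬝ᵥ A *ᵥ (y₁.ofLp - y.ofLp) =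
      y₁ ⬝ᵥ A *ᵥ y₁ - 2 * (y ⬝ᵥ A *ᵥ y₁) + y ⬝ᵥ A *ᵥ y := by
    intro A hA
    rw [Matrix.mulVec_sub, sub_dotProduct, dotProduct_sub, dotProduct_sub,
      real_form_symm hA y₁ y]; ring
  have a1 : y₁ ⬝ᵥ C.map im *ᵥ y₁ = ε / 2 * ‖posL η‖ ^ 2 := by
    rw [norm_sq_pos]; exact hR.form hε _ _
  have a2 : y ⬝ᵥ C.map im *ᵥ y = ε / 2 * ‖v‖ ^ 2 := by
    rw [norm_sq_pos]; exact hR.form hε _ _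
  have a3 : y ⬝ᵥ C.map im *ᵥ (Y *ᵥ ⇑(momL η)) = ε / 2 * inner ℝ (momL η) v := by
    have : (inner ℝ (momL η) v : ℝ) = v ⬝ᵥ momL η := by
      simp [PiLp.inner_apply, dotProduct, mul_comm]
    rw [this]; exact hR.form hε _ _
  have i1 : (inner ℝ (p + WithLp.toLp 2 (C.map re *ᵥ (Y *ᵥ ⇑(posL η)) +
      C.map im *ᵥ (Y *ᵥ ⇑(momL η)))) (q + (y₁ + y) - (q + y₁)) : ℝ) =
      p ⬝ᵥ y + y ⬝ᵥ C.map re *ᵥ y₁ + ε / 2 * inner ℝ (momL η) v := by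
    rw [← a3]
    have : q + (y₁ + y) - (q + y₁) = y := by abel
    rw [this]
    have h5 : ∀ a b : Pos d, (inner ℝ a b : ℝ) = b ⬝ᵥ a := by
      intro a b; simp [PiLp.inner_apply, dotProduct, mul_comm]
    rw [h5, WithLp.ofLp_add, dotProduct_add, WithLp.ofLp_toLp, dotProduct_add,
      dotProduct_comm, add_assoc]
  rw [i1]
  have b1 : ((y₁ + y : Pos d) : Fin d → ℝ) = ⇑y₁ + ⇑y := rfl
  have b2 : ((y₁ - y : Pos d) : Fin d → ℝ) = ⇑y₁ - ⇑y := rfl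
  rw [b1, b2, e1 _ hBs, e1 _ hAs, e2 _ hBs, e2 _ hAs, a1, a2, dotProduct_add, dotProduct_sub]
  simp only [map_mul, map_add, map_div₀, Complex.conj_I, Complex.conj_ofReal, map_one, map_ofNat]
  have h2 : conj ζ = ζ.re - ζ.im * I := by
    apply Complex.ext <;> simp
  have h3 : ζ = ζ.re + ζ.im * I := (Complex.re_add_im ζ).symm
  rw [h2]
  generalize hre : ζ.re = a at *
  generalize him : ζ.im = b at *
  rw [h3]
  have hε' : (ε : ℂ) ≠ 0 := by exact_mod_cast hε.ne'
  push_cast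
  field_simp
  ring_nf
  simp only [Complex.I_sq]
  ring

end Pairing

section MatrixElements

open scoped SchwartzMap

variable {d : ℕ}

/-- The canonical coordinates belonging to a real width factor. -/
abbrev frameCoords (ε : ℝ) (q p : Pos d) (C : Matrix (Fin d) (Fin d) ℂ)
    (R : Matrix (Fin d) (Fin d) ℝ) : Param d :=
  canonicalCoords ε q p (toC R) (C * toC R)

theorem det_scaledWidth_frame {ε : ℝ} (hε : 0 < ε) (q p : Pos d) {C : Matrix (Fin d) (Fin d) ℂ}
    {R : Matrix (Fin d) (Fin d) ℝ} (hR : IsFrame C R) :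
    (scaledWidth (frameCoords ε q p C R)).det = (ε / 2) ^ d := by
  have h1 : R.det * (C.map im * R).det = 1 := by
    have := congrArg Matrix.det hR.factor
    rw [mul_assoc, Matrix.det_mul, Matrix.det_transpose, Matrix.det_one] at this
    exact this
  rw [scaledWidth_frame, Matrix.det_smul, Matrix.det_fromBlocks_zero₁₂, h1, mul_one,
    Fintype.card_sum, Fintype.card_fin, pow_add, ← mul_pow, Real.mul_self_sqrt (by positivity)]

theorem isUnit_smul_det {ε : ℝ} (hε : 0 < ε) {C : Matrix (Fin d) (Fin d) ℂ}
    {R : Matrix (Fin d) (Fin d) ℝ} (hR : IsFrame C R) : IsUnit (√(ε / 2) • R).det := by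
  rw [Matrix.det_smul]
  exact (isUnit_iff_ne_zero.2 (by positivity)).mul hR.det

/-- The squared norm of a Gaussian. -/
def packetMass (ε : ℝ) (R : Matrix (Fin d) (Fin d) ℝ) (ζ : ℂ) : ℝ :=
  |(√(ε / 2) • R).det| * amplitudeSq ε ζ * gaussMass (Fin d)

theorem crossWigner_chart {ε : ℝ} (hε : 0 < ε) (q p : Pos d) {C : Matrix (Fin d) (Fin d) ℂ}
    {R : Matrix (Fin d) (Fin d) ℝ} (hR : IsFrame C R) (ζ : ℂ) {φ : Pos d → ℂ} {m : Pos d → ℝ}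
    (hφ : ∀ s, φ (chart ε q R s) = m s * gaussian ε q p C ζ (chart ε q R s)) (η : Phase d) :
    crossWigner ε φ (gaussian ε q p C ζ) (phasePoint (frameCoords ε q p C R) η) =
      ((((Real.pi * ε) ^ d)⁻¹ * (|(√(ε / 2) • R).det| * amplitudeSq ε ζ * gaussWeight (posL η)) :
        ℝ) : ℂ) * ∫ v, gaussWeight v • (m (posL η + v) • wave (momL η) v) := by
  have hc : ∀ v : Pos d, chart ε q R (posL η) + WithLp.toLp 2 ((√(ε / 2) • R) *ᵥ ⇑v) =
      chart ε q R (posL η + v) := by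
    intro v
    ext i; simp [chart, Matrix.mulVec_add, add_assoc]
  rw [crossWigner_eq, integral_affine (isUnit_smul_det hε hR) (chart ε q R (posL η))]
  simp only [hc]
  have e : ∀ v : Pos d, conj (φ (chart ε q R (posL η + v))) * gaussian ε q p C ζ
      ((2 : ℝ) • posL (phasePoint (frameCoords ε q p C R) η) - chart ε q R (posL η + v)) *
      wignerPhase ε (phasePoint (frameCoords ε q p C R) η) (chart ε q R (posL η + v)) =
      ((amplitudeSq ε ζ * gaussWeight (posL η) : ℝ) : ℂ) *
        (gaussWeight v • (m (posL η + v) • wave (momL η) v)) := by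
    intro v
    rw [hφ, map_mul, conj_ofReal, mul_assoc, mul_assoc, ← mul_assoc (conj _),
      posL_phasePoint_frame, wigner_integrand_chart hε q p hR]
    simp only [Complex.real_smul]
    push_cast; ring
  simp only [e]
  rw [integral_const_mul, Complex.real_smul]
  push_cast; ring

theorem gaussWeight_phase (η : Phase d) :
    gaussWeight η = gaussWeight (posL η) * gaussWeight (momL η) := by
  rw [gaussWeight, gaussWeight, gaussWeight, ← Real.exp_add, EuclideanSpace.norm_sq_eq,
    EuclideanSpace.norm_sq_eq, EuclideanSpace.norm_sq_eq, Fintype.sum_sum_type]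
  congr 1
  simp only [posL_apply, momL_apply]
  ring

/-- Weyl matrix elements of a Gaussian as phase space averages. -/
theorem integral_mul_crossWigner_chart {ε : ℝ} (hε : 0 < ε) (q p : Pos d)
    {C : Matrix (Fin d) (Fin d) ℂ} {R : Matrix (Fin d) (Fin d) ℝ} (hR : IsFrame C R) (ζ : ℂ)
    {φ : Pos d → ℂ} {m : Pos d → ℝ}
    (hφ : ∀ s, φ (chart ε q R s) = m s * gaussian ε q p C ζ (chart ε q R s)) {w : Phase d → ℂ}
    (hw : ∀ η, ∫ v, gaussWeight v • (m (posL η + v) • wave (momL η) v) =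
      gaussMass (Fin d) * gaussWeight (momL η) * w η) (a : Phase d → ℝ) :
    ∫ z, (a z : ℂ) * crossWigner ε φ (gaussian ε q p C ζ) z =
      packetMass ε R ζ * ((((2 * Real.pi) ^ d)⁻¹ : ℝ) *
        ∫ η, gaussWeight η • (w η * a (phasePoint (frameCoords ε q p C R) η))) := by
  have hdet := det_scaledWidth_frame hε q p hR
  have hu : IsUnit (scaledWidth (frameCoords ε q p C R)).det := by
    rw [hdet]; exact isUnit_iff_ne_zero.2 (by positivity)
  have hph : ∀ η : Phase d, center (frameCoords ε q p C R) +
      WithLp.toLp 2 (scaledWidth (frameCoords ε q p C R) *ᵥ ⇑η) =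
      phasePoint (frameCoords ε q p C R) η := fun η => add_comm _ _
  rw [integral_affine hu (center (frameCoords ε q p C R)), hdet]
  simp only [hph, crossWigner_chart hε q p hR ζ hφ, hw]
  have e : ∀ η : Phase d, (a (phasePoint (frameCoords ε q p C R) η) : ℂ) *
      (((((Real.pi * ε) ^ d)⁻¹ * (|(√(ε / 2) • R).det| * amplitudeSq ε ζ * gaussWeight (posL η)) :
        ℝ) : ℂ) * (gaussMass (Fin d) * gaussWeight (momL η) * w η)) =
      ((((Real.pi * ε) ^ d)⁻¹ * packetMass ε R ζ : ℝ) : ℂ) *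
        (gaussWeight η • (w η * a (phasePoint (frameCoords ε q p C R) η))) := by
    intro η
    rw [gaussWeight_phase, Complex.real_smul, packetMass]
    push_cast; ring
  simp only [e]
  rw [integral_const_mul, Complex.real_smul, abs_of_pos (by positivity)]
  have h2 : (ε / 2) ^ d * ((Real.pi * ε) ^ d)⁻¹ = ((2 * Real.pi) ^ d)⁻¹ := by
    rw [← inv_pow, ← mul_pow, ← inv_pow]
    congr 1
    field_simp
  rw [← mul_assoc, ← h2]
  push_cast; ring

theorem polyGrowth_shift_wave (c : ℝ) (j : Fin d) (η : Pos d) {f : Pos d → ℂ}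
    (hf : PolyGrowth f) : PolyGrowth fun v : Pos d => (c + v j) • f v := by
  have h1 : PolyGrowth fun v : Pos d => ((c : ℂ) + (v j : ℂ)) * f v :=
    ((PolyGrowth.const _).add (PolyGrowth.coord j).ofReal).mul hf
  refine (funext fun v => ?_ : (fun v : Pos d => (c + v j) • f v) = _) ▸ h1
  rw [Complex.real_smul]; push_cast; rfl

theorem integral_add_four {α : Type*} [MeasurableSpace α] {μ : Measure α} {f g h k : α → ℂ}
    (hf : Integrable f μ) (hg : Integrable g μ) (hh : Integrable h μ) (hk : Integrable k μ) :
    ∫ x, (f x + (g x + h x) + k x) ∂μ =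
      ∫ x, f x ∂μ + (∫ x, g x ∂μ + ∫ x, h x ∂μ) + ∫ x, k x ∂μ := by
  have i1 : Integrable (fun x => g x + h x) μ := hg.add hh
  have i2 : Integrable (fun x => f x + (g x + h x)) μ := hf.add i1
  rw [integral_add i2 hk, integral_add hf i1, integral_add hg hh]

theorem integral_shift_wave (ξ η : Pos d) (j : Fin d) :
    ∫ v, gaussWeight v • ((ξ + v) j • wave η v) =
      gaussMass (Fin d) * gaussWeight η * (ξ j + I * η j) := by
  have hc : Continuous fun v : Pos d => v j := by fun_prop
  have hw := (differentiable_wave η).continuous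
  have i0 := (polyGrowth_wave η).integrable hw.aestronglyMeasurable
  have i1 : Integrable fun v : Pos d => gaussWeight v • (v j • wave η v) := by
    refine PolyGrowth.integrable ?_ (hc.smul hw).aestronglyMeasurable
    simpa using polyGrowth_shift_wave 0 j η (polyGrowth_wave η)
  have e : ∀ v : Pos d, gaussWeight v • ((ξ + v) j • wave η v) =
      (ξ j : ℂ) * (gaussWeight v • wave η v) + gaussWeight v • (v j • wave η v) := by
    intro v
    rw [PiLp.add_apply, add_smul, smul_add, smul_comm _ (ξ j), Complex.real_smul (x := ξ j)]
  simp only [e]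
  rw [integral_add (i0.const_mul _) i1, integral_const_mul, integral_wave, integral_coord_wave]
  ring

theorem integral_shift_shift_wave (ξ η : Pos d) (j k : Fin d) :
    ∫ v, gaussWeight v • (((ξ + v) j * (ξ + v) k) • wave η v) =
      gaussMass (Fin d) * gaussWeight η *
        ((ξ j + I * η j) * (ξ k + I * η k) + if j = k then 1 else 0) := by
  have hc : ∀ j, Continuous fun v : Pos d => v j := fun j => by fun_prop
  have hw := (differentiable_wave η).continuous
  have i0 := (polyGrowth_wave η).integrable hw.aestronglyMeasurable
  have p1 : ∀ j, PolyGrowth fun v : Pos d => v j • wave η v := fun j => by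
    simpa using polyGrowth_shift_wave 0 j η (polyGrowth_wave η)
  have i1 : ∀ j, Integrable fun v : Pos d => gaussWeight v • (v j • wave η v) := fun j =>
    (p1 j).integrable ((hc j).smul hw).aestronglyMeasurable
  have i2 : Integrable fun v : Pos d => gaussWeight v • (v j • v k • wave η v) := by
    refine PolyGrowth.integrable ?_ ((hc j).smul ((hc k).smul hw)).aestronglyMeasurable
    simpa using polyGrowth_shift_wave 0 j η (p1 k)
  have e : ∀ v : Pos d, gaussWeight v • (((ξ + v) j * (ξ + v) k) • wave η v) =
      (ξ j * ξ k : ℂ) * (gaussWeight v • wave η v) + ((ξ j : ℂ) * (gaussWeight v • (v k • wave η v))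
        + (ξ k : ℂ) * (gaussWeight v • (v j • wave η v))) +
        gaussWeight v • (v j • v k • wave η v) := by
    intro v
    simp only [PiLp.add_apply, Complex.real_smul]
    push_cast; ring
  simp only [e]
  have ia := (i0.const_mul (ξ j * ξ k : ℂ))
  have ib := ((i1 k).const_mul (ξ j : ℂ))
  have ic := ((i1 j).const_mul (ξ k : ℂ))
  rw [integral_add_four ia ib ic i2, integral_const_mul, integral_const_mul, integral_const_mul, integral_wave,
    integral_coord_wave, integral_coord_wave, integral_coord_coord_wave]
  ring

/-- The identity on top of `C`. -/
def stack (C : Matrix (Fin d) (Fin d) ℂ) : Matrix (Fin d ⊕ Fin d) (Fin d) ℂ := Matrix.fromRows 1 C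

/-- The linear coefficient `(∂ₓ + C ∂_ξ) a` of the projected symbol, on average. -/
def forceGrad (a : Phase d → ℝ) (Z : Param d) (C : Matrix (Fin d) (Fin d) ℂ) : Fin d → ℂ :=
  (stack C)ᵀ *ᵥ fun i => (meanGrad a Z i : ℂ)

/-- The quadratic coefficient of the projected symbol. -/
def forceHess (a : Phase d → ℝ) (Z : Param d) (C : Matrix (Fin d) (Fin d) ℂ) :
    Matrix (Fin d) (Fin d) ℂ :=
  (stack C)ᵀ * (meanHess a Z).map Complex.ofReal * stack C

theorem forceHess_transpose {a : Phase d → ℝ} (ha : IsSubquadratic a) (Z : Param d)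
    (C : Matrix (Fin d) (Fin d) ℂ) : (forceHess a Z C)ᵀ = forceHess a Z C := by
  have h : ((meanHess a Z).map Complex.ofReal)ᵀ = (meanHess a Z).map Complex.ofReal :=
    congrArg (fun M : Matrix (Fin d ⊕ Fin d) (Fin d ⊕ Fin d) ℝ => M.map Complex.ofReal)
      (meanHess_transpose ha Z)
  rw [forceHess, Matrix.transpose_mul, Matrix.transpose_mul, Matrix.transpose_transpose, h,
    Matrix.mul_assoc]

theorem stack_mul_frame (ε : ℝ) (q p : Pos d) (C : Matrix (Fin d) (Fin d) ℂ)
    (R : Matrix (Fin d) (Fin d) ℝ) (i : Fin d ⊕ Fin d) (j : Fin d) :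
    (scaledWidth (frameCoords ε q p C R) i (Sum.inl j) : ℂ) +
      I * scaledWidth (frameCoords ε q p C R) i (Sum.inr j) =
      √(ε / 2) * (stack C * toC R) i j := by
  rw [scaledWidth_canonicalCoords, stack, Matrix.fromRows_mul]
  rcases i with i | i
  · simp [widthY]
  · simp only [widthY, Matrix.smul_apply, Matrix.fromBlocks_apply₂₁, Matrix.fromBlocks_apply₂₂,
      Matrix.map_apply, Matrix.fromRows_apply_inr, smul_eq_mul]
    conv_rhs => rw [← Complex.re_add_im ((C * toC R) i j)]
    push_cast; ring

theorem matrixElement_one {ε : ℝ} (hε : 0 < ε) (q p : Pos d) {C : Matrix (Fin d) (Fin d) ℂ}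
    {R : Matrix (Fin d) (Fin d) ℝ} (hR : IsFrame C R) (ζ : ℂ) (a : Phase d → ℝ) :
    ∫ z, (a z : ℂ) * crossWigner ε (gaussian ε q p C ζ) (gaussian ε q p C ζ) z =
      packetMass ε R ζ * average a (frameCoords ε q p C R) := by
  rw [integral_mul_crossWigner_chart hε q p hR ζ (m := fun _ => 1) (fun s => by simp)
    (w := fun _ => 1) (fun η => by
      simp only [one_smul, mul_one]; exact integral_wave _), average_eq]
  congr 1
  push_cast
  rw [← integral_complex_ofReal]
  simp

theorem matrixElement_coord {ε : ℝ} (hε : 0 < ε) (q p : Pos d) {C : Matrix (Fin d) (Fin d) ℂ}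
    {R : Matrix (Fin d) (Fin d) ℝ} (hR : IsFrame C R) (ζ : ℂ) {a : Phase d → ℝ}
    (ha : IsSubquadratic a) {φ : Pos d → ℂ} (j : Fin d)
    (hφ : ∀ s, φ (chart ε q R s) = (s j : ℝ) * gaussian ε q p C ζ (chart ε q R s)) :
    ∫ z, (a z : ℂ) * crossWigner ε φ (gaussian ε q p C ζ) z =
      packetMass ε R ζ * (((√(ε / 2) : ℂ) • (toC R)ᵀ) *ᵥ
        forceGrad a (frameCoords ε q p C R) C) j := by
  set Z := frameCoords ε q p C R with hZ
  rw [integral_mul_crossWigner_chart hε q p hR ζ hφ (w := fun η => posL η j + I * momL η j)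
    (fun η => integral_shift_wave _ _ _)]
  congr 1
  have hp : ∀ i : Fin d ⊕ Fin d, Integrable fun η : Phase d =>
      gaussWeight η * (η i * a (phasePoint Z η)) := fun i =>
    ((PolyGrowth.coord i).mul (ha.polyGrowth.comp_phasePoint Z)).integrable
      ((by fun_prop : Continuous fun ζ : Phase d => ζ i).mul
        (ha.smooth.continuous.comp (continuous_phasePoint Z))).aestronglyMeasurable
  have e : ∀ η : Phase d, gaussWeight η • (((posL η j : ℂ) + I * momL η j) *
      a (phasePoint Z η)) = ((gaussWeight η * (η (Sum.inl j) * a (phasePoint Z η)) : ℝ) : ℂ) +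
        I * ((gaussWeight η * (η (Sum.inr j) * a (phasePoint Z η)) : ℝ) : ℂ) := by
    intro η
    simp only [posL_apply, momL_apply, Complex.real_smul]
    push_cast; ring
  simp only [← hZ, e]
  have j1 : ∀ i : Fin d ⊕ Fin d, Integrable fun η : Phase d =>
      ((gaussWeight η * (η i * a (phasePoint Z η)) : ℝ) : ℂ) := fun i => (hp i).ofReal
  rw [integral_add (j1 _) ((j1 _).const_mul I), integral_const_mul,
    integral_complex_ofReal, integral_complex_ofReal]
  have h1 := average_coord_mul ha Z (Sum.inl j)
  have h2 := average_coord_mul ha Z (Sum.inr j)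
  simp only [smul_eq_mul] at h1 h2
  rw [mul_add, mul_left_comm, ← Complex.ofReal_mul, ← Complex.ofReal_mul, h1, h2]
  have h3 := fun i => stack_mul_frame ε q p C R i j
  have h4 : (((√(ε / 2) : ℂ) • (toC R)ᵀ) *ᵥ forceGrad a Z C) j =
      ∑ i, (√(ε / 2) * (stack C * toC R) i j) * meanGrad a Z i := by
    rw [forceGrad, Matrix.mulVec_mulVec, Matrix.smul_mul, ← Matrix.transpose_mul]
    rfl
  rw [h4]
  simp only [← h3]
  push_cast
  rw [Finset.mul_sum, ← Finset.sum_add_distrib]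
  refine Finset.sum_congr rfl fun i _ => ?_
  rw [meanGrad]; ring

theorem matrixElement_coord_coord {ε : ℝ} (hε : 0 < ε) (q p : Pos d)
    {C : Matrix (Fin d) (Fin d) ℂ} {R : Matrix (Fin d) (Fin d) ℝ} (hR : IsFrame C R) (ζ : ℂ)
    {a : Phase d → ℝ} (ha : IsSubquadratic a) {φ : Pos d → ℂ} (j k : Fin d)
    (hφ : ∀ s, φ (chart ε q R s) = (s j * s k : ℝ) * gaussian ε q p C ζ (chart ε q R s)) :
    ∫ z, (a z : ℂ) * crossWigner ε φ (gaussian ε q p C ζ) z =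
      packetMass ε R ζ * ((if j = k then 1 else 0) * average a (frameCoords ε q p C R) +
        (((√(ε / 2) : ℂ) • (toC R)ᵀ) * forceHess a (frameCoords ε q p C R) C *
          ((√(ε / 2) : ℂ) • toC R)) j k) := by
  set Z := frameCoords ε q p C R with hZ
  rw [integral_mul_crossWigner_chart hε q p hR ζ hφ (w := fun η => (posL η j + I * momL η j) *
    (posL η k + I * momL η k) + if j = k then 1 else 0)
    (fun η => integral_shift_shift_wave _ _ _ _)]
  congr 1
  have hc : ∀ i : Fin d ⊕ Fin d, Continuous fun ζ : Phase d => ζ i := fun i => by fun_prop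
  have hac := ha.smooth.continuous.comp (continuous_phasePoint Z)
  have hp : ∀ i l : Fin d ⊕ Fin d, Integrable fun η : Phase d =>
      gaussWeight η * (η i * (η l * a (phasePoint Z η))) := fun i l =>
    ((PolyGrowth.coord i).mul ((PolyGrowth.coord l).mul
      (ha.polyGrowth.comp_phasePoint Z))).integrable
      ((hc i).mul ((hc l).mul hac)).aestronglyMeasurable
  have h0 : Integrable fun η : Phase d => gaussWeight η * a (phasePoint Z η) := ha.integrable Z
  have e : ∀ η : Phase d, gaussWeight η • ((((posL η j : ℂ) + I * momL η j) *
      (posL η k + I * momL η k) + if j = k then 1 else 0) * a (phasePoint Z η)) =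
      (((gaussWeight η * (η (Sum.inl j) * (η (Sum.inl k) * a (phasePoint Z η))) : ℝ) : ℂ) -
        ((gaussWeight η * (η (Sum.inr j) * (η (Sum.inr k) * a (phasePoint Z η))) : ℝ) : ℂ)) +
      (I * ((gaussWeight η * (η (Sum.inl j) * (η (Sum.inr k) * a (phasePoint Z η))) : ℝ) : ℂ) +
        I * ((gaussWeight η * (η (Sum.inr j) * (η (Sum.inl k) * a (phasePoint Z η))) : ℝ) : ℂ)) +
      (if j = k then 1 else 0) * ((gaussWeight η * a (phasePoint Z η) : ℝ) : ℂ) := by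
    intro η
    simp only [posL_apply, momL_apply, Complex.real_smul]
    push_cast
    linear_combination ((gaussWeight η : ℂ) * η (Sum.inr j) * η (Sum.inr k) *
      a (phasePoint Z η)) * Complex.I_sq
  simp only [← hZ, e]
  have j1 : ∀ i l : Fin d ⊕ Fin d, Integrable fun η : Phase d =>
      ((gaussWeight η * (η i * (η l * a (phasePoint Z η))) : ℝ) : ℂ) := fun i l => (hp i l).ofReal
  have k1 : Integrable fun η : Phase d =>
      ((gaussWeight η * (η (Sum.inl j) * (η (Sum.inl k) * a (phasePoint Z η))) : ℝ) : ℂ) -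
        ((gaussWeight η * (η (Sum.inr j) * (η (Sum.inr k) * a (phasePoint Z η))) : ℝ) : ℂ) :=
    (j1 _ _).sub (j1 _ _)
  have k3 : Integrable fun η : Phase d => (if j = k then (1 : ℂ) else 0) *
      ((gaussWeight η * a (phasePoint Z η) : ℝ) : ℂ) := h0.ofReal.const_mul _
  rw [integral_add_four k1 ((j1 _ _).const_mul I) ((j1 _ _).const_mul I) k3,
    integral_sub (j1 _ _) (j1 _ _)]
  simp only [integral_const_mul]
  simp only [integral_complex_ofReal]
  have h1 := fun i l => average_coord_mul_coord_mul ha Z i l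
  have h2 := average_eq a Z
  simp only [smul_eq_mul] at h1 h2
  have h5 : ∀ x₁ x₂ x₃ x₄ x₅ : ℝ, (((2 * Real.pi) ^ d)⁻¹ : ℝ) * (((x₁ : ℂ) - x₂) +
      (I * (x₃ : ℂ) + I * x₄) + (if j = k then 1 else 0) * (x₅ : ℂ)) =
      ((((2 * Real.pi) ^ d)⁻¹ * x₁ : ℝ) : ℂ) - ((((2 * Real.pi) ^ d)⁻¹ * x₂ : ℝ) : ℂ) +
      (I * (((((2 * Real.pi) ^ d)⁻¹ * x₃ : ℝ) : ℂ) + ((((2 * Real.pi) ^ d)⁻¹ * x₄ : ℝ) : ℂ)) +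
        (if j = k then 1 else 0) * ((((2 * Real.pi) ^ d)⁻¹ * x₅ : ℝ) : ℂ)) := by
    intro x₁ x₂ x₃ x₄ x₅
    push_cast; ring
  rw [h5, h1, h1, h1, h1, ← h2]
  have h3 := fun i j => stack_mul_frame ε q p C R i j
  have h4 : (((√(ε / 2) : ℂ) • (toC R)ᵀ) * forceHess a Z C * ((√(ε / 2) : ℂ) • toC R)) j k =
      ∑ i, ∑ l, (√(ε / 2) * (stack C * toC R) i j) * ((√(ε / 2) * (stack C * toC R) l k) *
        (meanHess a Z i l : ℂ)) := by
    have h6 : ((√(ε / 2) : ℂ) • (toC R)ᵀ) * forceHess a Z C * ((√(ε / 2) : ℂ) • toC R) =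
        ((√(ε / 2) : ℂ) • (stack C * toC R))ᵀ * (meanHess a Z).map Complex.ofReal *
          ((√(ε / 2) : ℂ) • (stack C * toC R)) := by
      rw [forceHess]
      simp only [Matrix.transpose_smul, Matrix.transpose_mul, Matrix.smul_mul, Matrix.mul_smul,
        Matrix.mul_assoc]
    rw [h6, Matrix.mul_assoc, Matrix.mul_apply]
    refine Finset.sum_congr rfl fun i _ => ?_
    rw [Matrix.mul_apply, Finset.mul_sum]
    refine Finset.sum_congr rfl fun l _ => ?_
    simp only [Matrix.transpose_apply, Matrix.smul_apply, Matrix.map_apply, smul_eq_mul]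
    ring
  rw [h4]
  simp only [← h3, Sum.inl.injEq, Sum.inr.injEq, reduceCtorEq, if_false, zero_add]
  push_cast
  have h7 : ∀ A₁ A₂ A₃ A₄ X : ℂ, A₁ - A₂ + I * (A₃ + A₄) = X →
      (if j = k then (average a Z : ℂ) else 0) + A₁ - ((if j = k then (average a Z : ℂ) else 0) + A₂)
        + (I * (A₃ + A₄) + (if j = k then 1 else 0) * (average a Z : ℂ)) =
      (if j = k then 1 else 0) * (average a Z : ℂ) + X := by
    intro A₁ A₂ A₃ A₄ X h
    rw [← h]; ring
  have h8 : ∀ x : ℝ, ((if j = k then x else 0 : ℝ) : ℂ) = if j = k then (x : ℂ) else 0 := by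
    intro x; split_ifs <;> simp
  rw [h8]
  refine h7 _ _ _ _ _ ?_
  rw [← Finset.sum_sub_distrib, ← Finset.sum_add_distrib, Finset.mul_sum, ← Finset.sum_add_distrib]
  refine Finset.sum_congr rfl fun i _ => ?_
  rw [← Finset.sum_sub_distrib, ← Finset.sum_add_distrib, Finset.mul_sum, ← Finset.sum_add_distrib]
  refine Finset.sum_congr rfl fun l _ => ?_
  simp only [meanHess, Matrix.of_apply]
  linear_combination ((scaledWidth Z i (Sum.inr j) : ℂ) * scaledWidth Z l (Sum.inr k) *
    average (pd l (pd i a)) Z) * (-Complex.I_sq)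

end MatrixElements

/-! ### The projected Hamiltonian -/

section Projection

open scoped SchwartzMap

variable {d : ℕ}

theorem exists_schwartz_mul {g : Pos d → ℂ} (hg : g.HasTemperateGrowth) (φ : 𝓢(Pos d, ℂ)) :
    ∃ ψ : 𝓢(Pos d, ℂ), ∀ x, ψ x = g x * φ x :=
  ⟨SchwartzMap.smulLeftCLM ℂ g φ, fun x => by
    rw [SchwartzMap.smulLeftCLM_apply_apply hg, smul_eq_mul]⟩

theorem hasTemperateGrowth_quad_sub (α : ℂ) (β : Fin d → ℂ) (Γ : Matrix (Fin d) (Fin d) ℂ)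
    (q : Pos d) : (fun x : Pos d => quad α β Γ (x - q)).HasTemperateGrowth := by
  have h1 : ∀ i, (fun x : Pos d => ((x - q) i : ℂ)).HasTemperateGrowth := fun i => by
    have := (hasTemperateGrowth_coord i).sub (Function.HasTemperateGrowth.const (q i : ℂ))
    refine (funext fun x => ?_ : (fun x : Pos d => ((x - q) i : ℂ)) = _) ▸ this
    simp
  simp only [quad_eq]
  exact ((Function.HasTemperateGrowth.const α).add (Function.HasTemperateGrowth.sum fun i _ =>
    (Function.HasTemperateGrowth.const _).mul (h1 i))).add
    ((Function.HasTemperateGrowth.const _).mul (Function.HasTemperateGrowth.sum fun i _ =>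
      (h1 i).mul (Function.HasTemperateGrowth.sum fun j _ =>
        (Function.HasTemperateGrowth.const _).mul (h1 j))))

/-- Inverse of `chart`. -/
def chartInv (ε : ℝ) (q : Pos d) (R : Matrix (Fin d) (Fin d) ℝ) (x : Pos d) : Pos d :=
  WithLp.toLp 2 ((√(ε / 2) • R)⁻¹ *ᵥ ⇑(x - q))

theorem chartInv_chart {ε : ℝ} (hε : 0 < ε) {C : Matrix (Fin d) (Fin d) ℂ}
    {R : Matrix (Fin d) (Fin d) ℝ} (hR : IsFrame C R) (q s : Pos d) :
    chartInv ε q R (chart ε q R s) = s := by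
  rw [chartInv, chart, add_sub_cancel_left]
  ext i
  simp only [Matrix.mulVec_mulVec, Matrix.nonsing_inv_mul _ (isUnit_smul_det hε hR),
    Matrix.one_mulVec]

theorem chart_chartInv {ε : ℝ} (hε : 0 < ε) {C : Matrix (Fin d) (Fin d) ℂ}
    {R : Matrix (Fin d) (Fin d) ℝ} (hR : IsFrame C R) (q x : Pos d) :
    chart ε q R (chartInv ε q R x) = x := by
  rw [chartInv, chart]
  have h : (√(ε / 2) • R) *ᵥ ((√(ε / 2) • R)⁻¹ *ᵥ ⇑(x - q)) = ⇑(x - q) := by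
    rw [Matrix.mulVec_mulVec, Matrix.mul_nonsing_inv _ (isUnit_smul_det hε hR), Matrix.one_mulVec]
  rw [h]
  exact add_sub_cancel q x

theorem hasTemperateGrowth_chartInv (ε : ℝ) (q : Pos d) (R : Matrix (Fin d) (Fin d) ℝ)
    (j : Fin d) : (fun x : Pos d => (chartInv ε q R x j : ℂ)).HasTemperateGrowth := by
  have h := hasTemperateGrowth_quad_sub 0 (fun k => (((√(ε / 2) • R)⁻¹ j k : ℝ) : ℂ)) 0 q
  refine (funext fun x => ?_ : (fun x : Pos d => (chartInv ε q R x j : ℂ)) = _) ▸ h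
  simp [quad_eq, chartInv, Matrix.mulVec, dotProduct]

theorem quad_chart (ε : ℝ) (q : Pos d) (R : Matrix (Fin d) (Fin d) ℝ) (α : ℂ) (β : Fin d → ℂ)
    (Γ : Matrix (Fin d) (Fin d) ℂ) (s : Pos d) :
    quad α β Γ (chart ε q R s - q) = quad α (((√(ε / 2) : ℂ) • (toC R)ᵀ) *ᵥ β)
      (((√(ε / 2) : ℂ) • (toC R)ᵀ) * Γ * ((√(ε / 2) : ℂ) • toC R)) s := by
  have h1 : (fun i => ((chart ε q R s - q) i : ℂ)) =
      ((√(ε / 2) : ℂ) • toC R) *ᵥ fun i => (s i : ℂ) := by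
    funext i
    simp [chart, Matrix.mulVec, dotProduct]
  have h2 : ((√(ε / 2) : ℂ) • (toC R)ᵀ) = ((√(ε / 2) : ℂ) • toC R)ᵀ := by
    rw [Matrix.transpose_smul]
  rw [quad, quad, h1, h2, ← Matrix.mulVec_mulVec, ← Matrix.mulVec_mulVec]
  congr 2
  · rw [Matrix.mulVec_transpose, ← Matrix.dotProduct_mulVec]
  · rw [Matrix.dotProduct_mulVec _ (_)ᵀ, Matrix.vecMul_transpose]

theorem inner_schwartz_quad {ε : ℝ} (hε : 0 < ε) (q p : Pos d) {C : Matrix (Fin d) (Fin d) ℂ}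
    {R : Matrix (Fin d) (Fin d) ℝ} (hR : IsFrame C R) (ζ : ℂ) {φ : 𝓢(Pos d, ℂ)} {m : Pos d → ℝ}
    (hφ : ∀ s, φ (chart ε q R s) = m s * gaussian ε q p C ζ (chart ε q R s)) {f : Hilb d}
    {F : Pos d → ℂ} (hf : f =ᵐ[volume] fun x => F x * gaussian ε q p C ζ x) :
    inner ℂ (φ.toLp 2 volume) f = ((|(√(ε / 2) • R).det| * amplitudeSq ε ζ : ℝ) : ℂ) *
      ∫ s, gaussWeight s • (m s • F (chart ε q R s)) := by
  rw [inner_toLp_eq]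
  have h1 : ∫ x, conj (φ x) * f x = ∫ x, conj (φ x) * (F x * gaussian ε q p C ζ x) := by
    refine integral_congr_ae ?_
    filter_upwards [hf] with x hx
    rw [hx]
  have hc : ∀ s : Pos d, q + WithLp.toLp 2 ((√(ε / 2) • R) *ᵥ ⇑s) = chart ε q R s := fun s => rfl
  rw [h1, integral_affine (isUnit_smul_det hε hR) q]
  simp only [hc]
  have e : ∀ s : Pos d, conj (φ (chart ε q R s)) * (F (chart ε q R s) *
      gaussian ε q p C ζ (chart ε q R s)) =
      (amplitudeSq ε ζ : ℂ) * (gaussWeight s • (m s • F (chart ε q R s))) := by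
    intro s
    have h2 := normSq_gaussian_chart hε q p hR ζ s
    rw [hφ, map_mul, conj_ofReal]
    calc _ = m s * F (chart ε q R s) * (conj (gaussian ε q p C ζ (chart ε q R s)) *
          gaussian ε q p C ζ (chart ε q R s)) := by ring
      _ = _ := by
          rw [h2]; simp only [Complex.real_smul]; push_cast; ring
  simp only [e]
  rw [integral_const_mul, Complex.real_smul]
  push_cast; ring

/-- A function that is a polynomial of degree at most two in real coordinates. -/
def IsQuadFun (f : Pos d → ℂ) : Prop :=
  ∃ (α : ℂ) (β : Fin d → ℂ) (Γ : Fin d → Fin d → ℂ), ∀ s,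
    f s = α + ∑ j, β j * (s j : ℂ) + ∑ j, ∑ k, Γ j k * ((s j : ℂ) * (s k : ℂ))

theorem IsQuadFun.add {f g : Pos d → ℂ} (hf : IsQuadFun f) (hg : IsQuadFun g) :
    IsQuadFun fun s => f s + g s := by
  obtain ⟨α, β, Γ, h⟩ := hf
  obtain ⟨α', β', Γ', h'⟩ := hg
  refine ⟨α + α', fun j => β j + β' j, fun j k => Γ j k + Γ' j k, fun s => ?_⟩
  simp only [h, h', add_mul, Finset.sum_add_distrib]
  ring

theorem IsQuadFun.const_mul {f : Pos d → ℂ} (hf : IsQuadFun f) (c : ℂ) :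
    IsQuadFun fun s => c * f s := by
  obtain ⟨α, β, Γ, h⟩ := hf
  refine ⟨c * α, fun j => c * β j, fun j k => c * Γ j k, fun s => ?_⟩
  simp only [h, mul_add, Finset.mul_sum, mul_assoc]

theorem isQuadFun_const (c : ℂ) : IsQuadFun fun _ : Pos d => c :=
  ⟨c, 0, 0, fun s => by simp⟩

theorem IsQuadFun.sum {κ : Type*} (t : Finset κ) {f : κ → Pos d → ℂ}
    (hf : ∀ i ∈ t, IsQuadFun (f i)) : IsQuadFun fun s => ∑ i ∈ t, f i s := by
  classical
  induction t using Finset.induction_on with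
  | empty => simpa using isQuadFun_const 0
  | insert i t hi ih =>
    simp only [Finset.sum_insert hi]
    exact (hf i (Finset.mem_insert_self _ _)).add
      (ih fun j hj => hf j (Finset.mem_insert_of_mem hj))

theorem isQuadFun_affine (a : ℂ) (b : Fin d → ℂ) :
    IsQuadFun fun s : Pos d => a + ∑ j, b j * (s j : ℂ) :=
  ⟨a, b, 0, fun s => by simp⟩

theorem isQuadFun_affine_mul_affine (a a' : ℂ) (b b' : Fin d → ℂ) :
    IsQuadFun fun s : Pos d => (a + ∑ j, b j * (s j : ℂ)) * (a' + ∑ j, b' j * (s j : ℂ)) := by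
  refine ⟨a * a', fun j => a * b' j + a' * b j, fun j k => b j * b' k, fun s => ?_⟩
  have : ∑ j, ∑ k, b j * b' k * ((s j : ℂ) * (s k : ℂ)) =
      (∑ j, b j * (s j : ℂ)) * ∑ k, b' k * (s k : ℂ) := by
    rw [Finset.sum_mul_sum]
    exact Finset.sum_congr rfl fun j _ => Finset.sum_congr rfl fun k _ => by ring
  rw [this]
  simp only [add_mul, Finset.sum_add_distrib, mul_assoc, ← Finset.mul_sum]
  ring

theorem isQuadFun_eval {φ : MvPolynomial (Fin d) ℂ} (hφ : φ.totalDegree ≤ 2)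
    {y : Fin d → Pos d → ℂ} (hy : ∀ i, ∃ (a : ℂ) (b : Fin d → ℂ), ∀ s,
      y i s = a + ∑ j, b j * (s j : ℂ)) :
    IsQuadFun fun s => MvPolynomial.eval (fun i => y i s) φ := by
  choose a b hab using hy
  simp only [MvPolynomial.eval_eq]
  refine IsQuadFun.sum _ fun m hm => IsQuadFun.const_mul ?_ _
  have hcard : Multiset.card (Finsupp.toMultiset m) ≤ 2 := by
    rw [Finsupp.card_toMultiset]
    exact (MvPolynomial.le_totalDegree hm).trans hφ
  have hprod : ∀ s, ∏ i ∈ m.support, y i s ^ m i =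
      ((Finsupp.toMultiset m).map fun i => y i s).prod := by
    intro s
    rw [Finsupp.toMultiset_map, Finsupp.prod_toMultiset, Finsupp.prod_mapDomain_index
      (fun _ => pow_zero _) (fun _ _ _ => pow_add _ _ _)]
    rfl
  simp only [hprod]
  generalize Finsupp.toMultiset m = M at hcard
  interval_cases h : Multiset.card M
  · rw [Multiset.card_eq_zero] at h
    subst h
    simpa using isQuadFun_const 1
  · obtain ⟨i, rfl⟩ := Multiset.card_eq_one.1 h
    simp only [Multiset.map_singleton, Multiset.prod_singleton, hab]
    exact isQuadFun_affine _ _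
  · obtain ⟨i, j, rfl⟩ := Multiset.card_eq_two.1 h
    simp only [Multiset.insert_eq_cons, Multiset.map_cons, Multiset.map_singleton,
      Multiset.prod_cons, Multiset.prod_singleton, hab]
    exact isQuadFun_affine_mul_affine _ _ _ _

theorem exists_mvPolynomial_quad (α : ℂ) (β : Fin d → ℂ) (Γ : Matrix (Fin d) (Fin d) ℂ)
    (q : Pos d) : ∃ φ : MvPolynomial (Fin d) ℂ, φ.totalDegree ≤ 2 ∧
      ∀ x : Pos d, MvPolynomial.eval (fun i => ((x i : ℝ) : ℂ)) φ = quad α β Γ (x - q) := by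
  let y : Fin d → MvPolynomial (Fin d) ℂ := fun i => MvPolynomial.X i - MvPolynomial.C (q i : ℂ)
  have hy : ∀ i, (y i).totalDegree ≤ 1 := fun i =>
    (MvPolynomial.totalDegree_sub _ _).trans (by simp)
  have hC : ∀ (c : ℂ) (f : MvPolynomial (Fin d) ℂ) (n : ℕ), f.totalDegree ≤ n →
      (MvPolynomial.C c * f).totalDegree ≤ n := fun c f n hf =>
    (MvPolynomial.totalDegree_mul _ _).trans (by simpa using hf)
  refine ⟨MvPolynomial.C α + ∑ i, MvPolynomial.C (β i) * y i +
    MvPolynomial.C (1 / 2) * ∑ i, y i * ∑ j, MvPolynomial.C (Γ i j) * y j, ?_, fun x => ?_⟩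
  · refine (MvPolynomial.totalDegree_add _ _).trans (max_le
      ((MvPolynomial.totalDegree_add _ _).trans (max_le (by simp) ?_)) (hC _ _ _ ?_))
    · exact MvPolynomial.totalDegree_finsetSum_le fun i _ => (hC _ _ _ (hy i)).trans one_le_two
    · refine MvPolynomial.totalDegree_finsetSum_le fun i _ =>
        (MvPolynomial.totalDegree_mul _ _).trans ?_
      have h1 : (∑ j, MvPolynomial.C (Γ i j) * y j).totalDegree ≤ 1 :=
        MvPolynomial.totalDegree_finsetSum_le fun j _ => hC _ _ _ (hy j)
      have := hy i
      omega
  · simp [quad_eq, y]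

variable {ε : ℝ} {q p : Pos d} {C : Matrix (Fin d) (Fin d) ℂ} {R : Matrix (Fin d) (Fin d) ℝ}
  {ζ : ℂ} {u : Hilb d} {a : Phase d → ℝ}

theorem exists_isWeylImage_gaussian (hε : 0 < ε) (hs : Cᵀ = C) (hC : (C.map im).PosDef)
    (hu : u =ᵐ[volume] gaussian ε q p C ζ) (ha : IsSubquadratic a) :
    ∃ f, IsWeylImage ε a u f := by
  obtain ⟨φ, hφ⟩ := exists_schwartz_gaussian hε q p hs hC ζ
  exact ha.exists_isWeylImage hε.ne' φ (hu.trans (Filter.Eventually.of_forall fun x => (hφ x).symm))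

theorem inner_weylOp_eq (hε : 0 < ε) (hs : Cᵀ = C) (hC : (C.map im).PosDef)
    (hu : u =ᵐ[volume] gaussian ε q p C ζ) (ha : IsSubquadratic a) (φ : 𝓢(Pos d, ℂ)) :
    inner ℂ (φ.toLp 2 volume) (weylOp ε a u) =
      ∫ z, (a z : ℂ) * crossWigner ε φ (gaussian ε q p C ζ) z := by
  obtain ⟨f, hf⟩ := exists_isWeylImage_gaussian hε hs hC hu ha
  rw [weylOp_eq hf, (hf φ).2]
  simp only [crossWigner_congr hu]

theorem toLp_eq_of_ae {φ : 𝓢(Pos d, ℂ)} (h : u =ᵐ[volume] φ) : u = φ.toLp 2 volume :=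
  Lp.ext (h.trans (φ.coeFn_toLp 2 volume).symm)

theorem IsFrame.posDef (hR : IsFrame C R) : (C.map im).PosDef := by
  refine posDef_of_conj (Q := toC R) (symm_im hR.symm) ?_
  rw [toC_conjTranspose, ← toC_mul, ← toC_mul, hR.factor, toC_one]

/-- Energy expectation values of Gaussians are Gaussian averages. -/
theorem inner_weylOp_self (hε : 0 < ε) (hR : IsFrame C R) (hu : u =ᵐ[volume] gaussian ε q p C ζ)
    (ha : IsSubquadratic a) :
    inner ℂ u (weylOp ε a u) = packetMass ε R ζ * average a (frameCoords ε q p C R) := by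
  obtain ⟨φ, hφ⟩ := exists_schwartz_gaussian hε q p hR.symm hR.posDef ζ
  have hφ' : ⇑φ = gaussian ε q p C ζ := funext hφ
  have h1 : u = φ.toLp 2 volume :=
    toLp_eq_of_ae (hu.trans (Filter.Eventually.of_forall fun x => (hφ x).symm))
  have h2 := inner_weylOp_eq hε hR.symm hR.posDef hu ha φ
  rw [← h1, hφ', matrixElement_one hε q p hR ζ a] at h2
  exact h2

theorem norm_sq_eq_packetMass (hε : 0 < ε) (hR : IsFrame C R)
    (hu : u =ᵐ[volume] gaussian ε q p C ζ) : ‖u‖ ^ 2 = packetMass ε R ζ := by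
  obtain ⟨φ, hφ⟩ := exists_schwartz_gaussian hε q p hR.symm hR.posDef ζ
  have h1 : u = φ.toLp 2 volume :=
    toLp_eq_of_ae (hu.trans (Filter.Eventually.of_forall fun x => (hφ x).symm))
  have h2 := inner_schwartz_quad hε q p hR ζ (φ := φ) (m := fun _ => 1) (fun s => by simp [hφ])
    (f := u) (F := fun _ => 1) (hu.trans (Filter.Eventually.of_forall fun x => by simp))
  rw [← h1, inner_self_eq_norm_sq_to_K] at h2
  have h3 : ∫ s : Pos d, gaussWeight s • ((1 : ℝ) • (1 : ℂ)) = gaussMass (Fin d) := by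
    simp only [one_smul, Complex.real_smul, mul_one]
    exact integral_complex_ofReal
  rw [h3] at h2
  have h4 : ((‖u‖ ^ 2 : ℝ) : ℂ) = ((packetMass ε R ζ : ℝ) : ℂ) := by
    rw [packetMass]; push_cast at h2 ⊢; exact h2
  exact_mod_cast h4

/-- The constant coefficient of the projected symbol. -/
def forceConst (ε : ℝ) (a : Phase d → ℝ) (Z : Param d) (C : Matrix (Fin d) (Fin d) ℂ) : ℂ :=
  average a Z - ε / 4 * (forceHess a Z C * toC (C.map im)⁻¹).trace

theorem IsFrame.inv (hR : IsFrame C R) : (C.map im)⁻¹ = R * Rᵀ := by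
  have h1 : Rᵀ * (C.map im * R) = 1 := by rw [← mul_assoc]; exact hR.factor
  have h2 : C.map im * (R * Rᵀ) = 1 := by rw [← mul_assoc]; exact mul_eq_one_comm.1 h1
  exact Matrix.inv_eq_right_inv h2

theorem forceConst_frame (hε : 0 < ε) (hR : IsFrame C R) (Z : Param d) :
    forceConst ε a Z C + 1 / 2 * (((√(ε / 2) : ℂ) • (toC R)ᵀ) * forceHess a Z C *
      ((√(ε / 2) : ℂ) • toC R)).trace = average a Z := by
  have h1 : ((√(ε / 2) : ℂ)) * √(ε / 2) = ε / 2 := by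
    rw [← Complex.ofReal_mul, Real.mul_self_sqrt (by positivity)]; push_cast; rfl
  rw [forceConst, hR.inv, toC_mul, Matrix.smul_mul, Matrix.smul_mul, Matrix.mul_smul, smul_smul, h1,
    Matrix.trace_smul, ← mul_assoc, Matrix.trace_mul_comm _ (toC Rᵀ), ← mul_assoc, smul_eq_mul]
  have : toC Rᵀ = (toC R)ᵀ := rfl
  rw [this]
  ring

/-- The Dirac-Frenkel projection of `op(a) u` for a Gaussian `u`. -/
theorem starProjection_weylOp (hε : 0 < ε) (hR : IsFrame C R)
    (hu : u =ᵐ[volume] gaussian ε q p C ζ) (ha : IsSubquadratic a) :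
    ⇑((tangentSpace u).starProjection (weylOp ε a u)) =ᵐ[volume] fun x =>
      quad (forceConst ε a (frameCoords ε q p C R) C) (forceGrad a (frameCoords ε q p C R) C)
        (forceHess a (frameCoords ε q p C R) C) (x - q) * gaussian ε q p C ζ x := by
  set Z := frameCoords ε q p C R with hZ
  set α := forceConst ε a Z C
  set β := forceGrad a Z C
  set Γ := forceHess a Z C with hΓ
  obtain ⟨φ, hφ⟩ := exists_schwartz_gaussian hε q p hR.symm hR.posDef ζ
  obtain ⟨φ₀, hφ₀⟩ := exists_schwartz_mul (hasTemperateGrowth_quad_sub α β Γ q) φ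
  have hcI := fun j => hasTemperateGrowth_chartInv ε q R j
  choose φ₁ hφ₁ using fun j => exists_schwartz_mul (hcI j) φ
  choose φ₂ hφ₂ using fun j k => exists_schwartz_mul ((hcI j).mul (hcI k)) φ
  have c1 : ∀ j s, φ₁ j (chart ε q R s) = (s j : ℝ) * gaussian ε q p C ζ (chart ε q R s) := by
    intro j s
    rw [hφ₁, hφ, chartInv_chart hε hR]
  have c2 : ∀ j k s, φ₂ j k (chart ε q R s) =
      (s j * s k : ℝ) * gaussian ε q p C ζ (chart ε q R s) := by
    intro j k s
    rw [hφ₂, hφ, Pi.mul_apply, chartInv_chart hε hR]; push_cast; rfl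
  set f₀ : Hilb d := φ₀.toLp 2 volume with hf₀
  have hf₀e : f₀ =ᵐ[volume] fun x => quad α β Γ (x - q) * gaussian ε q p C ζ x :=
    (φ₀.coeFn_toLp 2 volume).trans (Filter.Eventually.of_forall fun x => by rw [hφ₀, hφ])
  set β' := ((√(ε / 2) : ℂ) • (toC R)ᵀ) *ᵥ β
  set Γ' := ((√(ε / 2) : ℂ) • (toC R)ᵀ) * Γ * ((√(ε / 2) : ℂ) • toC R) with hΓ'
  have hΓs : Γ'ᵀ = Γ' := by
    rw [hΓ']
    simp only [Matrix.transpose_mul, Matrix.transpose_smul, Matrix.transpose_transpose, hΓ,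
      forceHess_transpose ha, Matrix.mul_assoc]
  obtain ⟨m0, m1, m2⟩ := integral_quad α β' hΓs
  have hconst : α + 1 / 2 * Γ'.trace = average a Z := forceConst_frame hε hR Z
  rw [hconst] at m0 m2
  have hP : ((packetMass ε R ζ : ℝ) : ℂ) = ((|(√(ε / 2) • R).det| * amplitudeSq ε ζ : ℝ) : ℂ) *
      gaussMass (Fin d) := by rw [packetMass]; push_cast; ring
  have o0 : inner ℂ (φ.toLp 2 volume) (weylOp ε a u - f₀) = 0 := by
    rw [inner_sub_right, inner_weylOp_eq hε hR.symm hR.posDef hu ha, (funext hφ : ⇑φ = _),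
      matrixElement_one hε q p hR, inner_schwartz_quad hε q p hR ζ (m := fun _ => 1)
        (fun s => by simp [hφ]) hf₀e]
    simp only [quad_chart, one_smul]
    rw [m0, hP]; ring
  have o1 : ∀ j, inner ℂ ((φ₁ j).toLp 2 volume) (weylOp ε a u - f₀) = 0 := by
    intro j
    rw [inner_sub_right, inner_weylOp_eq hε hR.symm hR.posDef hu ha,
      matrixElement_coord hε q p hR ζ ha j (c1 j), inner_schwartz_quad hε q p hR ζ (c1 j) hf₀e]
    simp only [quad_chart]
    rw [m1, hP]; ring
  have o2 : ∀ j k, inner ℂ ((φ₂ j k).toLp 2 volume) (weylOp ε a u - f₀) = 0 := by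
    intro j k
    rw [inner_sub_right, inner_weylOp_eq hε hR.symm hR.posDef hu ha,
      matrixElement_coord_coord hε q p hR ζ ha j k (c2 j k),
      inner_schwartz_quad hε q p hR ζ (c2 j k) hf₀e]
    simp only [quad_chart, mul_smul]
    rw [m2, hP]; ring
  have hmem : f₀ ∈ tangentSpace u := by
    obtain ⟨P, hP2, hPe⟩ := exists_mvPolynomial_quad α β Γ q
    refine ⟨P, hP2, ?_⟩
    filter_upwards [hf₀e, hu] with x h1 h2
    rw [h1, hPe, h2]
  have horth : ∀ g ∈ tangentSpace u, inner ℂ (weylOp ε a u - f₀) g = 0 := by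
    rintro g ⟨P, hP2, hg⟩
    obtain ⟨α₀, β₀, Γ₀, hq⟩ := isQuadFun_eval hP2 (y := fun i s => ((chart ε q R s i : ℝ) : ℂ))
      fun i => ⟨(q i : ℂ), fun k => (((√(ε / 2) • R) i k : ℝ) : ℂ), fun s => by
        simp [chart, Matrix.mulVec, dotProduct]⟩
    have hge : g = α₀ • φ.toLp 2 volume + ∑ j, β₀ j • (φ₁ j).toLp 2 volume +
        ∑ j, ∑ k, Γ₀ j k • (φ₂ j k).toLp 2 volume := by
      have hS : g = (α₀ • φ + ∑ j, β₀ j • φ₁ j + ∑ j, ∑ k, Γ₀ j k • φ₂ j k).toLp 2 volume := by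
        refine toLp_eq_of_ae ?_
        filter_upwards [hg, hu] with x h1 h2
        have h3 := hq (chartInv ε q R x)
        simp only [chart_chartInv hε hR] at h3
        rw [h1, h2, h3]
        simp [hφ₁, hφ₂, hφ, add_mul, Finset.sum_mul, mul_assoc]
      rw [hS]
      have hL : ∀ ψ : 𝓢(Pos d, ℂ), ψ.toLp 2 (volume : Measure (Pos d)) =
        SchwartzMap.toLpCLM ℂ ℂ 2 volume ψ := fun ψ => rfl
      simp only [hL, map_add, map_sum, map_smul]
    rw [hge, ← inner_conj_symm]
    simp only [inner_add_left, sum_inner, inner_smul_left, o0, o1, o2, mul_zero,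
      Finset.sum_const_zero, add_zero, map_zero]
  rw [Submodule.eq_starProjection_of_mem_of_inner_eq_zero hmem horth]
  exact hf₀e

end Projection

/-! ### Hagedorn's normalization -/

section Hagedorn

variable {d : ℕ} {ε : ℝ} {q p : Pos d} {Q P : Matrix (Fin d) (Fin d) ℂ}
  {R : Matrix (Fin d) (Fin d) ℝ} {u : Hilb d}

theorem mul_conjTranspose_eq_frame
    (hY : (widthY Q P)ᵀ * Omega (Fin d) * widthY Q P = Omega (Fin d))
    (hR : IsFrame (P * Q⁻¹) R) : Q * Qᴴ = toC R * (toC R)ᴴ := by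
  obtain ⟨-, -, -, h⟩ := width_of_symplectic hY
  have h1 : toC ((P * Q⁻¹).map im) * (Q * Qᴴ) = 1 := by
    rw [← mul_assoc]
    exact mul_eq_one_comm.1 (by rw [← mul_assoc]; exact h)
  have h2 : (toC R * (toC R)ᴴ) * toC ((P * Q⁻¹).map im) = 1 := by
    rw [toC_conjTranspose, ← toC_mul, ← toC_mul, ← hR.inv,
      Matrix.nonsing_inv_mul _ ((Matrix.isUnit_iff_isUnit_det _).1 hR.posDef.isUnit), toC_one]
  calc Q * Qᴴ = (toC R * (toC R)ᴴ * toC ((P * Q⁻¹).map im)) * (Q * Qᴴ) := by rw [h2, one_mul]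
    _ = toC R * (toC R)ᴴ := by rw [mul_assoc, h1, mul_one]

theorem average_frame (hε : 0 < ε)
    (hY : (widthY Q P)ᵀ * Omega (Fin d) * widthY Q P = Omega (Fin d))
    (hR : IsFrame (P * Q⁻¹) R) (a : Phase d → ℝ) :
    average a (frameCoords ε q p (P * Q⁻¹) R) = average a (canonicalCoords ε q p Q P) := by
  have hQ : IsUnit Q.det := (Matrix.isUnit_iff_isUnit_det Q).1 (width_of_symplectic hY).1
  have hP : P = P * Q⁻¹ * Q := by rw [mul_assoc, Matrix.nonsing_inv_mul _ hQ, mul_one]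
  refine average_congr a rfl ?_ ?_
  · rw [det_scaledWidth_frame hε q p hR]
    exact isUnit_iff_ne_zero.2 (by positivity)
  · have h1 := widthY_mul_transpose_congr (C := P * Q⁻¹) (mul_conjTranspose_eq_frame hY hR)
    rw [← hP] at h1
    simp only [scaledWidth_canonicalCoords, Matrix.transpose_smul, Matrix.smul_mul,
      Matrix.mul_smul, h1]

theorem meanGrad_frame (hε : 0 < ε)
    (hY : (widthY Q P)ᵀ * Omega (Fin d) * widthY Q P = Omega (Fin d))
    (hR : IsFrame (P * Q⁻¹) R) (a : Phase d → ℝ) :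
    meanGrad a (frameCoords ε q p (P * Q⁻¹) R) = meanGrad a (canonicalCoords ε q p Q P) :=
  funext fun _ => average_frame hε hY hR _

theorem meanHess_frame (hε : 0 < ε)
    (hY : (widthY Q P)ᵀ * Omega (Fin d) * widthY Q P = Omega (Fin d))
    (hR : IsFrame (P * Q⁻¹) R) (a : Phase d → ℝ) :
    meanHess a (frameCoords ε q p (P * Q⁻¹) R) = meanHess a (canonicalCoords ε q p Q P) := by
  ext i k
  exact average_frame hε hY hR _

theorem gaussMass_eq : gaussMass (Fin d) = (2 * Real.pi) ^ ((d : ℝ) / 2) := by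
  have : gaussMass (Fin d) = _ := GaussianFourier.integral_rexp_neg_mul_sq_norm
    (V := Pos d) one_half_pos
  rw [this, finrank_euclideanSpace_fin]
  congr 1
  ring

/-- The normalization constant of Hagedorn's wave packets. -/
theorem hagedorn_constant (hε : 0 < ε)
    (hY : (widthY Q P)ᵀ * Omega (Fin d) * widthY Q P = Omega (Fin d))
    (hR : IsFrame (P * Q⁻¹) R) {δ : ℂ} (hδ : δ ^ 2 = Q.det) :
    ‖(((ε * Real.pi) ^ (-(d : ℝ) / 4) : ℝ) : ℂ) / δ‖ ^ 2 *
      (|(√(ε / 2) • R).det| * gaussMass (Fin d)) = 1 := by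
  have h1 := congrArg (fun M => ‖M.det‖) (mul_conjTranspose_eq_frame hY hR)
  simp only [Matrix.det_mul, Matrix.det_conjTranspose, norm_mul, norm_star] at h1
  have hdet : (toC R).det = ((R.det : ℝ) : ℂ) := by
    have := Complex.ofRealHom.map_det R
    exact this.symm
  rw [hdet, Complex.norm_real, Real.norm_eq_abs] at h1
  have hQ : IsUnit Q.det := (Matrix.isUnit_iff_isUnit_det Q).1 (width_of_symplectic hY).1
  have h2 : ‖δ‖ ^ 2 = |R.det| := by
    have h3 : ‖Q.det‖ = |R.det| := by
      have := (mul_self_eq_mul_self_iff.1 h1)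
      rcases this with h | h
      · exact h
      · have := norm_nonneg Q.det; have := abs_nonneg R.det
        linarith
    rw [← norm_pow, hδ, h3]
  have hR0 : 0 < |R.det| := abs_pos.2 hR.det.ne_zero
  have hs : √(ε / 2) ^ d = (ε / 2) ^ ((d : ℝ) / 2) := by
    rw [Real.sqrt_eq_rpow, ← Real.rpow_natCast, ← Real.rpow_mul (by positivity)]
    congr 1; ring
  have hπ := Real.pi_pos
  rw [norm_div, div_pow, h2, Complex.norm_real, Real.norm_of_nonneg (by positivity),
    Matrix.det_smul, Fintype.card_fin, abs_mul, abs_of_pos (by positivity : 0 < √(ε / 2) ^ d), hs,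
    gaussMass_eq]
  have h4 : ((ε * Real.pi) ^ (-(d : ℝ) / 4)) ^ 2 = (ε * Real.pi) ^ (-((d : ℝ) / 2)) := by
    rw [← Real.rpow_natCast, ← Real.rpow_mul (by positivity)]
    congr 1; push_cast; ring
  have h5 : (ε / 2) ^ ((d : ℝ) / 2) * (2 * Real.pi) ^ ((d : ℝ) / 2) =
      (ε * Real.pi) ^ ((d : ℝ) / 2) := by
    rw [← Real.mul_rpow (by positivity) (by positivity)]
    congr 1; ring
  have h6 : (ε * Real.pi) ^ (-((d : ℝ) / 2)) * (ε * Real.pi) ^ ((d : ℝ) / 2) = 1 := by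
    rw [← Real.rpow_add (by positivity), neg_add_cancel, Real.rpow_zero]
  rw [h4]
  calc (ε * Real.pi) ^ (-((d : ℝ) / 2)) / |R.det| * ((ε / 2) ^ ((d : ℝ) / 2) * |R.det| *
        (2 * Real.pi) ^ ((d : ℝ) / 2))
      = (ε * Real.pi) ^ (-((d : ℝ) / 2)) * ((ε / 2) ^ ((d : ℝ) / 2) *
        (2 * Real.pi) ^ ((d : ℝ) / 2)) * (|R.det| / |R.det|) := by ring
    _ = 1 := by rw [h5, h6, div_self hR0.ne', mul_one]

theorem mul_gaussian (hε : 0 < ε) {c : ℂ} (hc : c ≠ 0) (q p : Pos d)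
    (C : Matrix (Fin d) (Fin d) ℂ) (ζ : ℂ) (x : Pos d) :
    c * gaussian ε q p C ζ x = gaussian ε q p C (ζ + ε / I * Complex.log c) x := by
  have hε' : (ε : ℂ) ≠ 0 := by exact_mod_cast hε.ne'
  rw [gaussian_def, gaussian_def]
  conv_lhs => rw [← Complex.exp_log hc, ← Complex.exp_add]
  congr 1
  have : I / (ε : ℂ) * (ε / I * Complex.log c) = Complex.log c := by
    field_simp
  rw [← add_assoc, mul_add _ _ (ε / I * Complex.log c), this, add_comm]

theorem amplitudeSq_eq (hε : 0 < ε) (ζ : ℂ) : amplitudeSq ε ζ = ‖cexp (I / ε * ζ)‖ ^ 2 := by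
  rw [amplitudeSq, Complex.norm_exp, ← Real.exp_nat_mul]
  congr 1
  have : I / (ε : ℂ) = ((1 / ε : ℝ) : ℂ) * I := by push_cast; ring
  rw [this, mul_assoc, Complex.re_ofReal_mul, Complex.I_mul_re]
  push_cast; ring

theorem HasHagedornParameters.symplectic (hu : HasHagedornParameters ε u q p Q P) :
    (widthY Q P)ᵀ * Omega (Fin d) * widthY Q P = Omega (Fin d) := hu.2.2.1

theorem HasHagedornParameters.exists_frame (hu : HasHagedornParameters ε u q p Q P) :
    ∃ R, IsFrame (P * Q⁻¹) R := by
  obtain ⟨-, -, hs, h⟩ := width_of_symplectic hu.symplectic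
  exact exists_isFrame hs (posDef_of_conj (symm_im hs) h)

theorem HasHagedornParameters.exists_gaussian (hε : 0 < ε)
    (hu : HasHagedornParameters ε u q p Q P) :
    ∃ ζ, u =ᵐ[volume] gaussian ε q p (P * Q⁻¹) ζ := by
  obtain ⟨hQ, hP, hY, S, δ, hδ, h⟩ := hu
  have hQd : Q.det ≠ 0 := ((Matrix.isUnit_iff_isUnit_det Q).1 hQ).ne_zero
  have hδ0 : δ ≠ 0 := by
    rintro rfl
    exact hQd (by rw [← hδ]; simp)
  have hπ := Real.pi_pos
  have hc : (((ε * Real.pi) ^ (-(d : ℝ) / 4) : ℝ) : ℂ) / δ ≠ 0 :=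
    div_ne_zero (by exact_mod_cast (by positivity : (ε * Real.pi) ^ (-(d : ℝ) / 4) ≠ 0)) hδ0
  exact ⟨_, h.trans (Filter.Eventually.of_forall fun x => mul_gaussian hε hc q p _ _ x)⟩

theorem HasHagedornParameters.norm_eq_one (hε : 0 < ε)
    (hu : HasHagedornParameters ε u q p Q P) : ‖u‖ = 1 := by
  obtain ⟨R, hR⟩ := hu.exists_frame
  obtain ⟨hQ, hP, hY, S, δ, hδ, h⟩ := hu
  have hQd : Q.det ≠ 0 := ((Matrix.isUnit_iff_isUnit_det Q).1 hQ).ne_zero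
  have hδ0 : δ ≠ 0 := by
    rintro rfl
    exact hQd (by rw [← hδ]; simp)
  have hπ := Real.pi_pos
  have hc : (((ε * Real.pi) ^ (-(d : ℝ) / 4) : ℝ) : ℂ) / δ ≠ 0 :=
    div_ne_zero (by exact_mod_cast (by positivity : (ε * Real.pi) ^ (-(d : ℝ) / 4) ≠ 0)) hδ0
  have h1 := norm_sq_eq_packetMass hε hR
    (h.trans (Filter.Eventually.of_forall fun x => mul_gaussian hε hc q p _ _ x))
  have h2 := hagedorn_constant hε hY hR hδ
  have hε' : (ε : ℂ) ≠ 0 := by exact_mod_cast hε.ne'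
  have h3 : I / (ε : ℂ) * ((S : ℂ) + ε / I * Complex.log
      ((((ε * Real.pi) ^ (-(d : ℝ) / 4) : ℝ) : ℂ) / δ)) = ((S / ε : ℝ) : ℂ) * I +
      Complex.log ((((ε * Real.pi) ^ (-(d : ℝ) / 4) : ℝ) : ℂ) / δ) := by
    push_cast; field_simp
  rw [packetMass, amplitudeSq_eq hε, h3, Complex.exp_add, Complex.exp_log hc, norm_mul,
    Complex.norm_exp_ofReal_mul_I, one_mul, mul_right_comm, mul_comm, h2] at h1
  nlinarith [norm_nonneg u]

/-- Normalized Gaussians with symplectic width parameters are Hagedorn wave packets. -/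
theorem hasHagedornParameters_of_gaussian (hε : 0 < ε)
    (hY : (widthY Q P)ᵀ * Omega (Fin d) * widthY Q P = Omega (Fin d)) {ζ : ℂ}
    (hu : u =ᵐ[volume] gaussian ε q p (P * Q⁻¹) ζ) (hn : ‖u‖ = 1) :
    HasHagedornParameters ε u q p Q P := by
  obtain ⟨hQ, hP, hs, h⟩ := width_of_symplectic hY
  obtain ⟨R, hR⟩ := exists_isFrame hs (posDef_of_conj (symm_im hs) h)
  obtain ⟨δ, hδ⟩ := IsAlgClosed.exists_pow_nat_eq Q.det two_pos
  have hQd : Q.det ≠ 0 := ((Matrix.isUnit_iff_isUnit_det Q).1 hQ).ne_zero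
  have hδ0 : δ ≠ 0 := by
    rintro rfl
    exact hQd (by rw [← hδ]; simp)
  have hπ := Real.pi_pos
  set c : ℂ := (((ε * Real.pi) ^ (-(d : ℝ) / 4) : ℝ) : ℂ) / δ with hcdef
  have hc : c ≠ 0 :=
    div_ne_zero (by exact_mod_cast (by positivity : (ε * Real.pi) ^ (-(d : ℝ) / 4) ≠ 0)) hδ0
  have h1 := norm_sq_eq_packetMass hε hR hu
  have h2 := hagedorn_constant hε hY hR hδ
  rw [hn, packetMass, amplitudeSq_eq hε] at h1
  have hX : |(√(ε / 2) • R).det| * gaussMass (Fin d) ≠ 0 :=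
    (mul_pos (abs_pos.2 (isUnit_smul_det hε hR).ne_zero) gaussMass_pos).ne'
  have h3 : ‖cexp (I / ε * ζ)‖ ^ 2 = ‖c‖ ^ 2 := by
    refine mul_right_cancel₀ hX ?_
    rw [h2]; linarith
  have h4 : ‖cexp (I / ε * ζ) / c‖ = 1 := by
    rw [norm_div, div_eq_one_iff_eq (norm_ne_zero_iff.2 hc)]
    exact (sq_eq_sq₀ (norm_nonneg _) (norm_nonneg _)).1 h3
  obtain ⟨θ, hθ⟩ := (Complex.norm_eq_one_iff _).1 h4
  refine ⟨hQ, hP, hY, ε * θ, δ, hδ, ?_⟩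
  filter_upwards [hu] with x hx
  have hε' : (ε : ℂ) ≠ 0 := by exact_mod_cast hε.ne'
  rw [hx, gaussian_def, gaussian_def, ← hcdef]
  have h5 : cexp (I / ε * ζ) = c * cexp (I / ε * ((ε * θ : ℝ) : ℂ)) := by
    have : I / (ε : ℂ) * ((ε * θ : ℝ) : ℂ) = θ * I := by push_cast; field_simp
    rw [this, hθ, mul_div_cancel₀ _ hc]
  rw [mul_add _ _ ζ, Complex.exp_add, h5, mul_add _ _ ((ε * θ : ℝ) : ℂ), Complex.exp_add]
  ring

/-- The energy of a Hagedorn wave packet is the averaged Hamiltonian. -/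
theorem HasHagedornParameters.energy (hε : 0 < ε) (hu : HasHagedornParameters ε u q p Q P)
    {a : Phase d → ℝ} (ha : IsSubquadratic a) :
    u ∈ weylDomain ε a ∧
      inner ℂ u (weylOp ε a u) = ((average a (canonicalCoords ε q p Q P) : ℝ) : ℂ) := by
  obtain ⟨R, hR⟩ := hu.exists_frame
  obtain ⟨ζ, hζ⟩ := hu.exists_gaussian hε
  have h1 := norm_sq_eq_packetMass hε hR hζ
  refine ⟨exists_isWeylImage_gaussian hε hR.symm hR.posDef hζ ha, ?_⟩
  rw [inner_weylOp_self hε hR hζ ha, ← h1, hu.norm_eq_one hε, average_frame hε hu.symplectic hR]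
  simp

end Hagedorn

attribute [local instance] Matrix.linftyOpNormedAddCommGroup Matrix.linftyOpNormedSpace
  Matrix.linftyOpNormedRing Matrix.linftyOpNormedAlgebra

/-! ### Local integrability and primitives of matrix-valued curves -/

section MatrixPrimitive

variable {E F G : Type*} [NormedAddCommGroup E] [NormedSpace ℝ E]
  [NormedAddCommGroup F] [NormedSpace ℝ F] [NormedAddCommGroup G] [NormedSpace ℝ G]
  {I : Set ℝ}

/-- Integrability on all compact subintervals of the interval `I`. -/
def IsLocIntegrable (I : Set ℝ) (g : ℝ → E) : Prop :=
  ∀ s ∈ I, ∀ t ∈ I, IntervalIntegrable g volume s t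

theorem IsPrimitiveOn.isLocIntegrable {g y : ℝ → E} (h : IsPrimitiveOn I g y) :
    IsLocIntegrable I g := fun s hs t ht => (h s hs t ht).1

namespace IsLocIntegrable

theorem congr {g g' : ℝ → E} (h : IsLocIntegrable I g) (hI : I.OrdConnected)
    (hg : ∀ t ∈ I, g t = g' t) : IsLocIntegrable I g' := fun s hs t ht =>
  (h s hs t ht).congr fun _ hτ => hg _ (hI.uIcc_subset hs ht (Set.uIoc_subset_uIcc hτ))

theorem bilin {g : ℝ → E} {y : ℝ → F} (h : IsLocIntegrable I g) (hI : I.OrdConnected)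
    (hy : ContinuousOn y I) (B : E →L[ℝ] F →L[ℝ] G) : IsLocIntegrable I fun t => B (g t) (y t) :=
  fun s hs t ht => intervalIntegrable_bilin B (h s hs t ht) (hy.mono (hI.uIcc_subset hs ht))

theorem clm {g : ℝ → E} (h : IsLocIntegrable I g) (L : E →L[ℝ] F) :
    IsLocIntegrable I fun t => L (g t) := fun s hs t ht =>
  ⟨L.integrable_comp (h s hs t ht).1, L.integrable_comp (h s hs t ht).2⟩

theorem linear [FiniteDimensional ℝ E] {g : ℝ → E} (h : IsLocIntegrable I g) (L : E →ₗ[ℝ] F) :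
    IsLocIntegrable I fun t => L (g t) := h.clm L.toContinuousLinearMap

theorem add {g g' : ℝ → E} (h : IsLocIntegrable I g) (h' : IsLocIntegrable I g') :
    IsLocIntegrable I fun t => g t + g' t := fun s hs t ht => (h s hs t ht).add (h' s hs t ht)

theorem neg {g : ℝ → E} (h : IsLocIntegrable I g) :
    IsLocIntegrable I fun t => -g t := fun s hs t ht => (h s hs t ht).neg

theorem sub {g g' : ℝ → E} (h : IsLocIntegrable I g) (h' : IsLocIntegrable I g') :
    IsLocIntegrable I fun t => g t - g' t := fun s hs t ht => (h s hs t ht).sub (h' s hs t ht)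

theorem const_mul {g : ℝ → ℂ} (h : IsLocIntegrable I g) (c : ℂ) :
    IsLocIntegrable I fun t => c * g t := fun s hs t ht => (h s hs t ht).const_mul c

theorem sum {κ : Type*} (s : Finset κ) {g : κ → ℝ → E} (h : ∀ i, IsLocIntegrable I (g i)) :
    IsLocIntegrable I fun t => ∑ i ∈ s, g i t := by
  exact fun a ha b hb => ⟨integrable_finsetSum s fun i _ => (h i a ha b hb).1,
    integrable_finsetSum s fun i _ => (h i a ha b hb).2⟩

theorem pi {ι : Type*} [Fintype ι] {g : ℝ → ι → E} (h : ∀ i, IsLocIntegrable I fun t => g t i) :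
    IsLocIntegrable I g := fun s hs t ht =>
  ⟨Integrable.of_eval fun i => (h i s hs t ht).1, Integrable.of_eval fun i => (h i s hs t ht).2⟩

theorem bilinear [FiniteDimensional ℝ E] [FiniteDimensional ℝ F] {g : ℝ → E} {y : ℝ → F}
    (h : IsLocIntegrable I g) (hI : I.OrdConnected) (hy : ContinuousOn y I)
    (B : E →ₗ[ℝ] F →ₗ[ℝ] G) : IsLocIntegrable I fun t => B (g t) (y t) :=
  h.bilin hI hy B.toContinuousBilinearMap

theorem isPrimitiveOn {g : ℝ → E} (h : IsLocIntegrable I g) (hI : I.OrdConnected) {t₀ : ℝ}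
    (h₀ : t₀ ∈ I) (y₀ : E) : IsPrimitiveOn I g fun t => y₀ + ∫ τ in t₀..t, g τ :=
  IsPrimitiveOn.of_base hI h₀ (fun t ht => h t₀ h₀ t ht) fun t _ => by simp

end IsLocIntegrable

theorem IsPrimitiveOn.linear [FiniteDimensional ℝ E] [CompleteSpace F] {g y : ℝ → E}
    (h : IsPrimitiveOn I g y) (L : E →ₗ[ℝ] F) :
    IsPrimitiveOn I (fun t => L (g t)) (fun t => L (y t)) :=
  have := FiniteDimensional.complete ℝ E
  h.clm L.toContinuousLinearMap

theorem IsPrimitiveOn.bilinear [FiniteDimensional ℝ E] [FiniteDimensional ℝ F] [CompleteSpace G]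
    {g y : ℝ → E} {g₂ y₂ : ℝ → F} (h : IsPrimitiveOn I g y) (h₂ : IsPrimitiveOn I g₂ y₂)
    (hI : I.OrdConnected) (B : E →ₗ[ℝ] F →ₗ[ℝ] G) :
    IsPrimitiveOn I (fun t => B (g t) (y₂ t) + B (y t) (g₂ t)) (fun t => B (y t) (y₂ t)) :=
  have := FiniteDimensional.complete ℝ E
  have := FiniteDimensional.complete ℝ F
  h.bilin h₂ hI B.toContinuousBilinearMap

variable {l m n : Type*} [Fintype l] [Fintype m] [Fintype n]

/-- The entry of a matrix as a linear map. -/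
def entryL (𝕜 : Type*) [RCLike 𝕜] (i : m) (j : n) : Matrix m n 𝕜 →ₗ[ℝ] 𝕜 where
  toFun A := A i j
  map_add' _ _ := rfl
  map_smul' _ _ := rfl

/-- Matrix multiplication as a real bilinear map. -/
def mulL (𝕜 : Type*) [RCLike 𝕜] : Matrix l m 𝕜 →ₗ[ℝ] Matrix m n 𝕜 →ₗ[ℝ] Matrix l n 𝕜 :=
  LinearMap.mk₂ ℝ (fun A B => A * B) Matrix.add_mul (fun c A B => Matrix.smul_mul c A B)
    Matrix.mul_add fun c A B => Matrix.mul_smul A c B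

@[simp] theorem mulL_apply {𝕜 : Type*} [RCLike 𝕜] (A : Matrix l m 𝕜) (B : Matrix m n 𝕜) :
    mulL 𝕜 A B = A * B := rfl

/-- The action of matrices on vectors as a real bilinear map. -/
def mulVecL (𝕜 : Type*) [RCLike 𝕜] : Matrix l m 𝕜 →ₗ[ℝ] (m → 𝕜) →ₗ[ℝ] (l → 𝕜) :=
  LinearMap.mk₂ ℝ (fun A v => A *ᵥ v) Matrix.add_mulVec (fun c A v => Matrix.smul_mulVec c A v)
    Matrix.mulVec_add fun c A v => Matrix.mulVec_smul A c v

@[simp] theorem mulVecL_apply {𝕜 : Type*} [RCLike 𝕜] (A : Matrix l m 𝕜) (v : m → 𝕜) :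
    mulVecL 𝕜 A v = A *ᵥ v := rfl

/-- The dot product as a real bilinear map. -/
def dotL (𝕜 : Type*) [RCLike 𝕜] : (m → 𝕜) →ₗ[ℝ] (m → 𝕜) →ₗ[ℝ] 𝕜 :=
  LinearMap.mk₂ ℝ (fun v w => v ⬝ᵥ w) add_dotProduct (fun c v w => smul_dotProduct c v w)
    dotProduct_add fun c v w => dotProduct_smul c v w

@[simp] theorem dotL_apply {𝕜 : Type*} [RCLike 𝕜] (v w : m → 𝕜) : dotL 𝕜 v w = v ⬝ᵥ w := rfl

/-- Transposition as a real linear map. -/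
def transposeL (𝕜 : Type*) [RCLike 𝕜] : Matrix m n 𝕜 →ₗ[ℝ] Matrix n m 𝕜 where
  toFun A := Aᵀ
  map_add' _ _ := rfl
  map_smul' _ _ := rfl

@[simp] theorem transposeL_apply {𝕜 : Type*} [RCLike 𝕜] (A : Matrix m n 𝕜) :
    transposeL 𝕜 A = Aᵀ := rfl

theorem IsPrimitiveOn.matrix {𝕜 : Type*} [RCLike 𝕜] {g y : ℝ → Matrix m n 𝕜}
    (h : ∀ i j, IsPrimitiveOn I (fun t => g t i j) (fun t => y t i j)) : IsPrimitiveOn I g y := by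
  have h1 : IsPrimitiveOn I (fun t i j => g t i j) (fun t i j => y t i j) :=
    IsPrimitiveOn.pi fun i => IsPrimitiveOn.pi (h i)
  exact h1.linear (E := m → n → 𝕜) (F := Matrix m n 𝕜)
    { toFun := fun f => Matrix.of f, map_add' := fun _ _ => rfl, map_smul' := fun _ _ => rfl }

theorem IsLocIntegrable.matrix {𝕜 : Type*} [RCLike 𝕜] {g : ℝ → Matrix m n 𝕜}
    (h : ∀ i j, IsLocIntegrable I (fun t => g t i j)) : IsLocIntegrable I g := by
  have h1 : IsLocIntegrable I (fun t i j => g t i j) :=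
    IsLocIntegrable.pi fun i => IsLocIntegrable.pi (h i)
  exact h1.linear (E := m → n → 𝕜) (F := Matrix m n 𝕜)
    { toFun := fun f => Matrix.of f, map_add' := fun _ _ => rfl, map_smul' := fun _ _ => rfl }

variable [DecidableEq m]

theorem continuousOn_matrix_inv {𝕜 : Type*} [RCLike 𝕜] {y : ℝ → Matrix m m 𝕜}
    (hy : ContinuousOn y I) (hu : ∀ t ∈ I, IsUnit (y t)) : ContinuousOn (fun t => (y t)⁻¹) I := by
  intro t ht
  have h1 : ContinuousAt Ring.inverse (y t) := by
    obtain ⟨v, hv⟩ := hu t ht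
    rw [← hv]; exact NormedRing.inverse_continuousAt v
  have := h1.comp_continuousWithinAt (hy t ht)
  refine this.congr (fun s _ => ?_) ?_ <;> exact Matrix.nonsing_inv_eq_ringInverse _

theorem IsPrimitiveOn.matrix_inv {𝕜 : Type*} [RCLike 𝕜] {g y : ℝ → Matrix m m 𝕜}
    (h : IsPrimitiveOn I g y) (hI : I.OrdConnected) (hu : ∀ t ∈ I, IsUnit (y t)) :
    IsPrimitiveOn I (fun t => -((y t)⁻¹ * g t * (y t)⁻¹)) (fun t => (y t)⁻¹) := by
  have hc := continuousOn_matrix_inv (h.continuousOn hI) hu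
  have := h.comp hI (f := Ring.inverse)
    (f' := fun y => -ContinuousLinearMap.mulLeftRight ℝ (Matrix m m 𝕜) y⁻¹ y⁻¹) (fun t ht => ?_) ?_
  · refine this.congr hI (fun t _ => ?_) fun t _ => (Matrix.nonsing_inv_eq_ringInverse _).symm
    simp
  · obtain ⟨v, hv⟩ := hu t ht
    have h2 := hasFDerivAt_ringInverse (𝕜 := ℝ) v
    rw [← hv, Matrix.nonsing_inv_eq_ringInverse, Ring.inverse_unit]
    exact h2
  · have h3 : Continuous fun y : Matrix m m 𝕜 =>
        -ContinuousLinearMap.mulLeftRight ℝ (Matrix m m 𝕜) y y := by fun_prop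
    exact h3.comp_continuousOn hc

theorem Omega_transpose_mul (l : Type) [Fintype l] [DecidableEq l] :
    (Omega l)ᵀ * Omega l = 1 := by
  simp [Omega, Matrix.fromBlocks_transpose, Matrix.fromBlocks_multiply]

theorem Omega_mul_self (l : Type) [Fintype l] [DecidableEq l] : Omega l * Omega l = -1 := by
  simp [Omega, Matrix.fromBlocks_multiply, ← Matrix.fromBlocks_one, Matrix.fromBlocks_neg]

/-- Linear Hamiltonian flows are symplectic. -/
theorem symplectic_form_conserved {l : Type} [Fintype l] [DecidableEq l] (hI : I.OrdConnected)
    {K Y : ℝ → Matrix (l ⊕ l) (l ⊕ l) ℝ} (hK : ∀ t ∈ I, (K t)ᵀ = K t)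
    (hY : IsPrimitiveOn I (fun t => Omega l * (K t * Y t)) Y) {s t : ℝ} (hs : s ∈ I) (ht : t ∈ I) :
    (Y t)ᵀ * Omega l * Y t = (Y s)ᵀ * Omega l * Y s := by
  have h1 := hY.linear (transposeL ℝ)
  have h2 := hY.linear (mulL ℝ (Omega l))
  have h3 := (h1.bilinear h2 hI (mulL ℝ)).congr hI (g' := fun _ => 0) (fun τ hτ => ?_)
    fun _ _ => rfl
  · have := h3.eq_of_zero hs ht
    simpa [Matrix.mul_assoc] using this
  · have e1 : (Omega l)ᵀ * (Omega l * Y τ) = Y τ := by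
      rw [← Matrix.mul_assoc, Omega_transpose_mul, Matrix.one_mul]
    have e2 : Omega l * (Omega l * (K τ * Y τ)) = -(K τ * Y τ) := by
      rw [← Matrix.mul_assoc, Omega_mul_self, neg_mul, Matrix.one_mul]
    simp only [mulL_apply, transposeL_apply, Matrix.transpose_mul, hK τ hτ, e2, Matrix.mul_assoc,
      e1]
    simp

end MatrixPrimitive

/-! ### Conservation of the norm -/

section Norm

variable {d : ℕ} {ε : ℝ} {J : Set ℝ}

theorem inner_diracFrenkelField (hε : 0 < ε) {h : ℝ → Phase d → ℝ} {t : ℝ}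
    (ha : IsSubquadratic (h t)) {u : Hilb d} (hu : u ∈ gaussianManifold d ε) :
    ∃ r : ℝ, inner ℂ u (diracFrenkelField ε h t u) = (I * (ε : ℂ))⁻¹ * r := by
  obtain ⟨q, p, C, ζ, hs, hC, hg⟩ := hu
  obtain ⟨R, hR⟩ := exists_isFrame hs hC
  have hmem : u ∈ tangentSpace u :=
    ⟨1, by simp, Filter.Eventually.of_forall fun x => by simp⟩
  refine ⟨packetMass ε R ζ * average (h t) (frameCoords ε q p C R), ?_⟩
  rw [diracFrenkelField, inner_smul_right, ← Submodule.inner_starProjection_left_eq_right,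
    Submodule.starProjection_eq_self_iff.2 hmem, inner_weylOp_self hε hR hg ha]
  push_cast; rfl

theorem norm_conserved (hε : 0 < ε) (hI : J.OrdConnected) {h : ℝ → Phase d → ℝ}
    (ha : ∀ t, IsSubquadratic (h t)) {u : ℝ → Hilb d} (hu : ∀ t ∈ J, u t ∈ gaussianManifold d ε)
    (hDF : IsCaratheodorySolution J (diracFrenkelField ε h) u) {s t : ℝ} (hs : s ∈ J)
    (ht : t ∈ J) : ‖u t‖ = ‖u s‖ := by
  have hp : IsPrimitiveOn J (fun τ => diracFrenkelField ε h τ (u τ)) u := hDF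
  have hB : IsBoundedBilinearMap ℝ fun p : Hilb d × Hilb d => inner ℂ p.1 p.2 :=
    isBoundedBilinearMap_inner
  have h1 := (hp.bilin hp hI hB.toContinuousLinearMap).congr hI (g' := fun _ => 0)
    (fun τ hτ => ?_) fun _ _ => rfl
  · have h2 := h1.eq_of_zero hs ht
    have h3 : inner ℂ (u t) (u t) = inner ℂ (u s) (u s) := h2
    rw [inner_self_eq_norm_sq_to_K, inner_self_eq_norm_sq_to_K] at h3
    have h4 : ‖u t‖ ^ 2 = ‖u s‖ ^ 2 := by exact_mod_cast h3
    exact (sq_eq_sq₀ (norm_nonneg _) (norm_nonneg _)).1 h4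
  · obtain ⟨r, hr⟩ := inner_diracFrenkelField hε (ha τ) (hu τ hτ)
    show inner ℂ (diracFrenkelField ε h τ (u τ)) (u τ) +
      inner ℂ (u τ) (diracFrenkelField ε h τ (u τ)) = 0
    rw [← inner_conj_symm, hr]
    simp

end Norm

/-! ### Curves of wave packets -/

section PacketCurve

open scoped SchwartzMap

variable {d : ℕ} {ε : ℝ}

theorem _root_.Function.HasTemperateGrowth.polyGrowth {m : Pos d → ℂ} (hm : m.HasTemperateGrowth) :
    PolyGrowth m := by
  obtain ⟨k, C, h⟩ := hm.2 0
  exact ⟨C, k, fun x => by simpa using h x⟩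

theorem coe_quad_combination (v : Hilb d) (F : Fin d → Hilb d) (F₂ : Fin d → Fin d → Hilb d)
    (α : ℂ) (β : Fin d → ℂ) (Γ : Matrix (Fin d) (Fin d) ℂ) {g : Pos d → ℂ}
    (hv : v =ᵐ[volume] g) (hF : ∀ i, F i =ᵐ[volume] fun x => (x i : ℂ) * g x)
    (hF₂ : ∀ i j, F₂ i j =ᵐ[volume] fun x => (x i : ℂ) * (x j : ℂ) * g x) :
    ⇑(α • v + ∑ i, β i • F i + ∑ i, ∑ j, (1 / 2 * Γ i j) • F₂ i j) =ᵐ[volume] fun x =>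
      quad α β Γ x * g x := by
  have s1 : ⇑(∑ i, β i • F i) =ᵐ[volume] fun x => ∑ i, β i * F i x := by
    filter_upwards [Lp.coeFn_finsetSum Finset.univ fun i => β i • F i,
      ae_all_iff.2 fun i => Lp.coeFn_smul (β i) (F i)] with x h h'
    rw [h, Finset.sum_apply]
    exact Finset.sum_congr rfl fun i _ => h' i
  have s2 : ⇑(∑ i, ∑ j, (1 / 2 * Γ i j) • F₂ i j) =ᵐ[volume] fun x =>
      ∑ i, ∑ j, (1 / 2 * Γ i j) * F₂ i j x := by
    filter_upwards [Lp.coeFn_finsetSum Finset.univ fun i => ∑ j, (1 / 2 * Γ i j) • F₂ i j,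
      ae_all_iff.2 fun i => Lp.coeFn_finsetSum Finset.univ fun j => (1 / 2 * Γ i j) • F₂ i j,
      ae_all_iff.2 fun i => ae_all_iff.2 fun j => Lp.coeFn_smul (1 / 2 * Γ i j) (F₂ i j)]
      with x h h' h''
    rw [h, Finset.sum_apply]
    refine Finset.sum_congr rfl fun i _ => ?_
    rw [h' i, Finset.sum_apply]
    exact Finset.sum_congr rfl fun j _ => h'' i j
  filter_upwards [Lp.coeFn_add (α • v + ∑ i, β i • F i)
    (∑ i, ∑ j, (1 / 2 * Γ i j) • F₂ i j), Lp.coeFn_add (α • v) (∑ i, β i • F i),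
    Lp.coeFn_smul α v, s1, s2, hv, ae_all_iff.2 hF, ae_all_iff.2 fun i => ae_all_iff.2 (hF₂ i)]
    with x h h' h'' h3 h4 h5 h6 h7
  rw [h, Pi.add_apply, h', Pi.add_apply, h'', h3, h4, Pi.smul_apply, h5, smul_eq_mul, quad_eq]
  simp only [h6, h7, add_mul, Finset.mul_sum, Finset.sum_mul]
  simp only [mul_assoc, mul_left_comm]

/-- A continuous curve of parameters of wave packets on `J`, with the curve of wave packets. -/
structure IsPacketCurve (ε : ℝ) (J : Set ℝ) (κ : ℝ → ℂ) (b : ℝ → Fin d → ℂ)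
    (C : ℝ → Matrix (Fin d) (Fin d) ℂ) (u : ℝ → Hilb d) : Prop where
  continuousOn_amplitude : ContinuousOn κ J
  continuousOn_slope : ContinuousOn b J
  continuousOn_width : ContinuousOn C J
  posDef : ∀ t ∈ J, ((C t).map im).PosDef
  coe_ae_eq : ∀ t ∈ J, u t =ᵐ[volume] packet ε (κ t) (b t) (C t)

variable {J : Set ℝ} {κ : ℝ → ℂ} {b : ℝ → Fin d → ℂ} {C : ℝ → Matrix (Fin d) (Fin d) ℂ}
  {u : ℝ → Hilb d}

namespace IsPacketCurve

theorem exists_mul (hε : 0 < ε) (hu : IsPacketCurve ε J κ b C u) {m : Pos d → ℂ}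
    (hm : m.HasTemperateGrowth) : ∃ F : ℝ → Hilb d, ContinuousOn F J ∧
      ∀ t ∈ J, F t =ᵐ[volume] fun x => m x * packet ε (κ t) (b t) (C t) x := by
  have h1 : ∀ t, ∃ F : Hilb d, t ∈ J →
      F =ᵐ[volume] fun x => m x * packet ε (κ t) (b t) (C t) x := by
    intro t
    by_cases ht : t ∈ J
    · obtain ⟨φ, hφ⟩ := exists_schwartz_packet hε (κ t) (b t) (hu.posDef t ht)
      obtain ⟨ψ, hψ⟩ := exists_schwartz_mul hm φ
      refine ⟨ψ.toLp 2 volume, fun _ => (ψ.coeFn_toLp 2 volume).trans ?_⟩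
      exact Filter.Eventually.of_forall fun x => by rw [hψ, hφ]
    · exact ⟨0, fun h => absurd h ht⟩
  choose F hF using h1
  refine ⟨F, fun t ht => ?_, hF⟩
  exact tendsto_packet hε (hu.continuousOn_amplitude t ht) (hu.continuousOn_slope t ht)
    (hu.continuousOn_width t ht) (hu.posDef t ht) hm.polyGrowth hm.1.continuous
    (eventually_mem_nhdsWithin.mono hF) (hF t ht)

theorem continuousOn (hε : 0 < ε) (hu : IsPacketCurve ε J κ b C u) : ContinuousOn u J := fun t ht =>
  tendsto_packet hε (hu.continuousOn_amplitude t ht) (hu.continuousOn_slope t ht)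
    (hu.continuousOn_width t ht) (hu.posDef t ht) (m := fun _ => 1) (PolyGrowth.const 1)
    continuous_const (eventually_mem_nhdsWithin.mono fun s hs => by
      simpa using hu.coe_ae_eq s hs) (by simpa using hu.coe_ae_eq t ht)

variable {α : ℝ → ℂ} {β : ℝ → Fin d → ℂ} {Γ : ℝ → Matrix (Fin d) (Fin d) ℂ}

theorem isLocIntegrable (hε : 0 < ε) (hJ : J.OrdConnected) (hu : IsPacketCurve ε J κ b C u)
    (hα : IsLocIntegrable J α) (hβ : IsLocIntegrable J β) (hΓ : IsLocIntegrable J Γ)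
    {f : ℝ → Hilb d} (hf : ∀ t ∈ J, f t =ᵐ[volume] fun x =>
      quad (α t) (β t) (Γ t) x * packet ε (κ t) (b t) (C t) x) : IsLocIntegrable J f := by
  have hg := fun i : Fin d => hasTemperateGrowth_coord i
  choose F hF hFe using fun i => hu.exists_mul hε (hg i)
  choose F₂ hF₂ hF₂e using fun i j => hu.exists_mul hε ((hg i).mul (hg j))
  let B : ℂ →L[ℝ] Hilb d →L[ℝ] Hilb d := ContinuousLinearMap.lsmul ℝ ℂ
  have h1 := hα.bilin hJ (hu.continuousOn hε) B
  have h2 := IsLocIntegrable.sum Finset.univ fun i =>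
    (hβ.linear (LinearMap.proj i)).bilin hJ (hF i) B
  have h3 := IsLocIntegrable.sum Finset.univ fun i => IsLocIntegrable.sum Finset.univ fun j =>
    ((hΓ.linear (entryL ℂ i j)).const_mul (1 / 2)).bilin hJ (hF₂ i j) B
  refine ((h1.add h2).add h3).congr hJ fun t ht => Lp.ext ?_
  exact (coe_quad_combination (u t) (fun i => F i t) (fun i j => F₂ i j t) _ _ _
    (hu.coe_ae_eq t ht) (fun i => hFe i t ht) (fun i j => hF₂e i j t ht)).trans (hf t ht).symm

theorem continuous_quad : Continuous fun w : (ℂ × (Fin d → ℂ) × Matrix (Fin d) (Fin d) ℂ) × Pos d =>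
    quad w.1.1 w.1.2.1 w.1.2.2 w.2 := by
  unfold quad; fun_prop

theorem continuous_packet_joint (ε : ℝ) :
    Continuous fun w : (ℂ × (Fin d → ℂ) × Matrix (Fin d) (Fin d) ℂ) × Pos d =>
      packet ε w.1.1 w.1.2.1 w.1.2.2 w.2 := by
  unfold packet cvec; fun_prop

/-- The integral of a curve of quadratic multiples of wave packets, evaluated pointwise. -/
theorem integral_ae_eq (hε : 0 < ε) (hJ : J.OrdConnected) (hu : IsPacketCurve ε J κ b C u)
    (hα : IsLocIntegrable J α) (hβ : IsLocIntegrable J β) (hΓ : IsLocIntegrable J Γ)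
    {f : ℝ → Hilb d} (hf : ∀ t ∈ J, f t =ᵐ[volume] fun x =>
      quad (α t) (β t) (Γ t) x * packet ε (κ t) (b t) (C t) x) {s t : ℝ} (hs : s ∈ J)
    (ht : t ∈ J) : ⇑(∫ τ in s..t, f τ) =ᵐ[volume] fun x =>
      ∫ τ in s..t, quad (α τ) (β τ) (Γ τ) x * packet ε (κ τ) (b τ) (C τ) x := by
  have key : ∀ s ∈ J, ∀ t ∈ J, ⇑(∫ τ in Set.Ioc s t, f τ) =ᵐ[volume] fun x =>
      ∫ τ in Set.Ioc s t, quad (α τ) (β τ) (Γ τ) x * packet ε (κ τ) (b τ) (C τ) x := by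
    intro s hs t ht
    have hsub : Set.Ioc s t ⊆ J := Set.Ioc_subset_Icc_self.trans (hJ.out hs ht)
    have : TopologicalSpace.PseudoMetrizableSpace (Matrix (Fin d) (Fin d) ℂ) :=
      inferInstanceAs (TopologicalSpace.PseudoMetrizableSpace (Fin d → Fin d → ℂ))
    have : SecondCountableTopology (Matrix (Fin d) (Fin d) ℂ) :=
      inferInstanceAs (SecondCountableTopology (Fin d → Fin d → ℂ))
    refine integral_coeFn_ae_eq (hu.isLocIntegrable hε hJ hα hβ hΓ hf s hs t ht).1 ?_ ?_
    · have c1 := ((hα s hs t ht).1.aestronglyMeasurable.prodMk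
        ((hβ s hs t ht).1.aestronglyMeasurable.prodMk (hΓ s hs t ht).1.aestronglyMeasurable))
      have c2 := ((hu.continuousOn_amplitude.mono hsub).aestronglyMeasurable
        (μ := volume) measurableSet_Ioc).prodMk
          (((hu.continuousOn_slope.mono hsub).aestronglyMeasurable
            (μ := volume) measurableSet_Ioc).prodMk
              ((hu.continuousOn_width.mono hsub).aestronglyMeasurable
                (μ := volume) measurableSet_Ioc))
      have hx : AEStronglyMeasurable (fun w : ℝ × Pos d => w.2)
          ((volume.restrict (Set.Ioc s t)).prod volume) := by
        exact measurable_snd.aestronglyMeasurable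
      exact (continuous_quad.comp_aestronglyMeasurable (c1.comp_fst.prodMk hx)).mul
        ((continuous_packet_joint ε).comp_aestronglyMeasurable (c2.comp_fst.prodMk hx))
    · exact (ae_restrict_mem measurableSet_Ioc).mono fun τ hτ => hf τ (hsub hτ)
  filter_upwards [key s hs t ht, key t ht s hs, Lp.coeFn_sub (∫ τ in Set.Ioc s t, f τ)
    (∫ τ in Set.Ioc t s, f τ)] with x h1 h2 h3
  rw [intervalIntegral, h3, Pi.sub_apply, h1, h2, intervalIntegral]

end IsPacketCurve

end PacketCurve

/-! ### Width matrices along Hamiltonian flows -/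

section Width

variable {d : ℕ} {J : Set ℝ}

/-- A real matrix with doubled columns as a complex matrix. -/
def complexify (n : Type) [Fintype n] : Matrix n (Fin d ⊕ Fin d) ℝ →ₗ[ℝ] Matrix n (Fin d) ℂ where
  toFun Y := Matrix.of fun i j => (Y i (Sum.inl j) : ℂ) + Y i (Sum.inr j) * I
  map_add' Y Y' := by ext i j; simp; ring
  map_smul' c Y := by ext i j; simp; ring

/-- The real and imaginary parts of a complex matrix, side by side. -/
def realify (n : Type) [Fintype n] : Matrix n (Fin d) ℂ →ₗ[ℝ] Matrix n (Fin d ⊕ Fin d) ℝ where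
  toFun X := Matrix.of fun i => Sum.elim (fun j => (X i j).re) fun j => (X i j).im
  map_add' X X' := by ext i (j | j) <;> simp
  map_smul' c X := by ext i (j | j) <;> simp

theorem complexify_mul {n m : Type} [Fintype n] [Fintype m] (M : Matrix n m ℝ)
    (Y : Matrix m (Fin d ⊕ Fin d) ℝ) :
    complexify n (M * Y) = M.map Complex.ofReal * complexify m Y := by
  ext i j
  simp only [complexify, LinearMap.coe_mk, AddHom.coe_mk, Matrix.of_apply, Matrix.mul_apply,
    Matrix.map_apply, ofReal_sum, ofReal_mul, Finset.sum_mul, ← Finset.sum_add_distrib, mul_add,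
    mul_assoc]

theorem realify_complexify {n : Type} [Fintype n] (Y : Matrix n (Fin d ⊕ Fin d) ℝ) :
    realify n (complexify n Y) = Y := by
  ext i (j | j) <;> simp [realify, complexify]

theorem complexify_widthY (Q P : Matrix (Fin d) (Fin d) ℂ) :
    complexify (Fin d ⊕ Fin d) (widthY Q P) = Matrix.fromRows Q P := by
  ext (i | i) j <;> simp [complexify, widthY, re_add_im]

theorem realify_fromRows (Q P : Matrix (Fin d) (Fin d) ℂ) :
    realify (Fin d ⊕ Fin d) (Matrix.fromRows Q P) = widthY Q P := by
  rw [← complexify_widthY, realify_complexify]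

theorem Omega_map_mul (X : Matrix (Fin d ⊕ Fin d) (Fin d) ℂ) :
    (Omega (Fin d)).map Complex.ofReal * X = Matrix.fromRows X.toRows₂ (-X.toRows₁) := by
  conv_lhs => rw [← Matrix.fromRows_toRows X]
  have : (Omega (Fin d)).map Complex.ofReal = Matrix.fromBlocks 0 1 (-1) 0 := by
    rw [Omega, Matrix.fromBlocks_map]
    congr 1 <;> ext i j <;> simp [Matrix.one_apply, apply_ite Complex.ofReal]
  rw [this, Matrix.fromBlocks_mul_fromRows]
  simp

theorem stack_mul {Q P : Matrix (Fin d) (Fin d) ℂ} (hQ : IsUnit Q) :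
    stack (P * Q⁻¹) * Q = Matrix.fromRows Q P := by
  have hQ' : IsUnit Q.det := (Matrix.isUnit_iff_isUnit_det _).1 hQ
  rw [stack, Matrix.fromRows_mul, Matrix.one_mul, Matrix.mul_assoc, Matrix.nonsing_inv_mul _ hQ',
    Matrix.mul_one]

/-- The averaged Hessian applied to the stacked width matrix. -/
def hessStack (K : Matrix (Fin d ⊕ Fin d) (Fin d ⊕ Fin d) ℝ) (C : Matrix (Fin d) (Fin d) ℂ) :
    Matrix (Fin d ⊕ Fin d) (Fin d) ℂ := K.map Complex.ofReal * stack C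

theorem forceHess_eq {a : Phase d → ℝ} {Z : Param d} {C : Matrix (Fin d) (Fin d) ℂ} (hC : Cᵀ = C) :
    forceHess a Z C = (hessStack (meanHess a Z) C).toRows₁ +
      C * (hessStack (meanHess a Z) C).toRows₂ := by
  rw [forceHess, Matrix.mul_assoc, ← hessStack]
  conv_lhs => rw [← Matrix.fromRows_toRows (hessStack (meanHess a Z) C)]
  rw [stack, Matrix.transpose_fromRows, Matrix.fromCols_mul_fromRows, hC, Matrix.transpose_one,
    Matrix.one_mul]

theorem forceGrad_eq {a : Phase d → ℝ} {Z : Param d} {C : Matrix (Fin d) (Fin d) ℂ} (hC : Cᵀ = C) :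
    forceGrad a Z C = (fun i => (meanGrad a Z (Sum.inl i) : ℂ)) +
      C *ᵥ fun i => (meanGrad a Z (Sum.inr i) : ℂ) := by
  have h : (fun i => (meanGrad a Z i : ℂ)) = Sum.elim (fun i => (meanGrad a Z (Sum.inl i) : ℂ))
      (fun i => (meanGrad a Z (Sum.inr i) : ℂ)) := by funext i; cases i <;> rfl
  rw [forceGrad, h, stack, Matrix.transpose_fromRows, Matrix.fromCols_mulVec_sumElim, hC,
    Matrix.transpose_one, Matrix.one_mulVec]

/-- The first block of rows as a linear map. -/
def rows₁L : Matrix (Fin d ⊕ Fin d) (Fin d) ℂ →ₗ[ℝ] Matrix (Fin d) (Fin d) ℂ where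
  toFun X := X.toRows₁
  map_add' _ _ := rfl
  map_smul' _ _ := rfl

/-- The second block of rows as a linear map. -/
def rows₂L : Matrix (Fin d ⊕ Fin d) (Fin d) ℂ →ₗ[ℝ] Matrix (Fin d) (Fin d) ℂ where
  toFun X := X.toRows₂
  map_add' _ _ := rfl
  map_smul' _ _ := rfl

/-- Entrywise inclusion of real matrices as a linear map. -/
def ofRealL (m n : Type) [Fintype m] [Fintype n] : Matrix m n ℝ →ₗ[ℝ] Matrix m n ℂ where
  toFun A := A.map Complex.ofReal
  map_add' A B := by ext i j; simp
  map_smul' c A := by ext i j; simp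

theorem continuous_stack : Continuous (stack (d := d)) := by
  refine continuous_matrix fun i j => ?_
  cases i with
  | inl i => exact continuous_const
  | inr i => exact (continuous_id (X := Matrix (Fin d) (Fin d) ℂ)).matrix_elem i j

section Flow

variable {K : ℝ → Matrix (Fin d ⊕ Fin d) (Fin d ⊕ Fin d) ℝ} {Q P : ℝ → Matrix (Fin d) (Fin d) ℂ}

/-- The linear Hamiltonian flow in terms of the complex blocks `Q`, `P`. -/
theorem isPrimitiveOn_blocks (hJ : J.OrdConnected)
    (hQ : ∀ t ∈ J, IsUnit (Q t))
    (hY : IsPrimitiveOn J (fun t => Omega (Fin d) * (K t * widthY (Q t) (P t)))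
      fun t => widthY (Q t) (P t)) :
    IsPrimitiveOn J (fun t => (hessStack (K t) (P t * (Q t)⁻¹)).toRows₂ * Q t) Q ∧
    IsPrimitiveOn J (fun t => -((hessStack (K t) (P t * (Q t)⁻¹)).toRows₁ * Q t)) P := by
  have h1 := (hY.linear (complexify (Fin d ⊕ Fin d))).congr hJ (g' := fun t => Matrix.fromRows
    ((hessStack (K t) (P t * (Q t)⁻¹)).toRows₂ * Q t)
    (-((hessStack (K t) (P t * (Q t)⁻¹)).toRows₁ * Q t))) (y' := fun t => Matrix.fromRows (Q t) (P t))
    (fun t ht => ?_) fun t ht => complexify_widthY _ _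
  · exact ⟨h1.linear rows₁L, h1.linear rows₂L⟩
  · rw [complexify_mul, complexify_mul, complexify_widthY, ← stack_mul (hQ t ht), Omega_map_mul,
      ← Matrix.mul_assoc, ← hessStack]
    rfl

theorem isPrimitiveOn_widthY (hJ : J.OrdConnected) {C : ℝ → Matrix (Fin d) (Fin d) ℂ}
    (hC : IsPrimitiveOn J (fun t => -((hessStack (K t) (C t)).toRows₁ +
      C t * (hessStack (K t) (C t)).toRows₂)) C)
    (hQ : IsPrimitiveOn J (fun t => (hessStack (K t) (C t)).toRows₂ * Q t) Q) :
    IsPrimitiveOn J (fun t => Omega (Fin d) * (K t * widthY (Q t) (C t * Q t)))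
      fun t => widthY (Q t) (C t * Q t) := by
  have hP := (hC.bilinear hQ hJ (mulL ℂ)).congr hJ
    (g' := fun t => -((hessStack (K t) (C t)).toRows₁ * Q t)) (fun t _ => by
      simp only [mulL_apply]
      generalize hessStack (K t) (C t) = W
      simp only [neg_mul, add_mul, Matrix.mul_assoc]
      abel) fun _ _ => rfl
  have h3 : IsPrimitiveOn J (fun t => Matrix.fromRows ((hessStack (K t) (C t)).toRows₂ * Q t)
      (-((hessStack (K t) (C t)).toRows₁ * Q t))) fun t => Matrix.fromRows (Q t) (C t * Q t) :=
    IsPrimitiveOn.matrix fun i j => by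
      cases i with
      | inl i => exact hQ.linear (entryL ℂ i j)
      | inr i => exact hP.linear (entryL ℂ i j)
  refine (h3.linear (realify (Fin d ⊕ Fin d))).congr hJ (fun t ht => ?_)
    fun t _ => realify_fromRows _ _
  rw [← realify_complexify (Omega (Fin d) * (K t * widthY (Q t) (C t * Q t)))]
  congr 1
  have e : Matrix.fromRows (Q t) (C t * Q t) = stack (C t) * Q t := by
    rw [stack, Matrix.fromRows_mul, Matrix.one_mul]
  rw [complexify_mul, complexify_mul, complexify_widthY, e, Omega_map_mul, ← Matrix.mul_assoc,
    ← hessStack]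
  rfl

/-- The matrix Riccati equation of the complex width. -/
theorem isPrimitiveOn_riccati (hJ : J.OrdConnected) (hQ : ∀ t ∈ J, IsUnit (Q t))
    (h₁ : IsPrimitiveOn J (fun t => (hessStack (K t) (P t * (Q t)⁻¹)).toRows₂ * Q t) Q)
    (h₂ : IsPrimitiveOn J (fun t => -((hessStack (K t) (P t * (Q t)⁻¹)).toRows₁ * Q t)) P) :
    IsPrimitiveOn J (fun t => -((hessStack (K t) (P t * (Q t)⁻¹)).toRows₁ +
      P t * (Q t)⁻¹ * (hessStack (K t) (P t * (Q t)⁻¹)).toRows₂)) fun t => P t * (Q t)⁻¹ := by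
  refine (h₂.bilinear (h₁.matrix_inv hJ hQ) hJ (mulL ℂ)).congr hJ (fun t ht => ?_) fun _ _ => rfl
  have hQ' : IsUnit (Q t).det := (Matrix.isUnit_iff_isUnit_det _).1 (hQ t ht)
  generalize hessStack (K t) (P t * (Q t)⁻¹) = W
  simp only [mulL_apply, Matrix.mul_neg, Matrix.neg_mul, Matrix.mul_assoc,
    Matrix.mul_nonsing_inv _ hQ', Matrix.mul_one]
  abel

end Flow

end Width

/-! ### From Hamilton's equations to the variational approximation -/

section Converse

variable {d : ℕ} {ε : ℝ} {J : Set ℝ}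

theorem quad_sub_point (α : ℂ) (β : Fin d → ℂ) {Γ : Matrix (Fin d) (Fin d) ℂ} (hΓ : Γᵀ = Γ)
    (q x : Pos d) : quad α β Γ (x - q) =
      quad (α - β ⬝ᵥ cvec q + 1 / 2 * (cvec q ⬝ᵥ Γ *ᵥ cvec q)) (β - Γ *ᵥ cvec q) Γ x := by
  show α + β ⬝ᵥ cvec (x - q) + 1 / 2 * (cvec (x - q) ⬝ᵥ Γ *ᵥ cvec (x - q)) =
    (α - β ⬝ᵥ cvec q + 1 / 2 * (cvec q ⬝ᵥ Γ *ᵥ cvec q)) + (β - Γ *ᵥ cvec q) ⬝ᵥ cvec x +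
      1 / 2 * (cvec x ⬝ᵥ Γ *ᵥ cvec x)
  rw [cvec_sub, Matrix.mulVec_sub, dotProduct_sub, dotProduct_sub, sub_dotProduct, sub_dotProduct,
    sub_dotProduct, dotProduct_mulVec_symm hΓ (cvec q) (cvec x), dotProduct_comm (Γ *ᵥ cvec q)]
  ring

theorem mul_quad (c α : ℂ) (β : Fin d → ℂ) (Γ : Matrix (Fin d) (Fin d) ℂ) (x : Pos d) :
    c * quad α β Γ x = quad (c * α) (c • β) (c • Γ) x := by
  simp only [quad, smul_dotProduct, Matrix.smul_mulVec, dotProduct_smul, smul_eq_mul]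
  ring

/-- The projected Hamiltonian applied to a wave packet with symplectic width. -/
theorem starProjection_weylOp_symplectic (hε : 0 < ε) {q p : Pos d}
    {Q P : Matrix (Fin d) (Fin d) ℂ} {ζ : ℂ} {u : Hilb d} {a : Phase d → ℝ}
    (hY : (widthY Q P)ᵀ * Omega (Fin d) * widthY Q P = Omega (Fin d))
    (hu : u =ᵐ[volume] gaussian ε q p (P * Q⁻¹) ζ) (ha : IsSubquadratic a) :
    ⇑((tangentSpace u).starProjection (weylOp ε a u)) =ᵐ[volume] fun x =>
      quad (forceConst ε a (canonicalCoords ε q p Q P) (P * Q⁻¹))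
        (forceGrad a (canonicalCoords ε q p Q P) (P * Q⁻¹))
        (forceHess a (canonicalCoords ε q p Q P) (P * Q⁻¹)) (x - q) *
          gaussian ε q p (P * Q⁻¹) ζ x := by
  obtain ⟨-, -, hs, hA⟩ := width_of_symplectic hY
  obtain ⟨R, hR⟩ := exists_isFrame hs (posDef_of_conj (symm_im hs) hA)
  have := starProjection_weylOp hε hR hu ha
  rwa [forceConst, forceGrad, forceHess, average_frame hε hY hR, meanGrad_frame hε hY hR,
    meanHess_frame hε hY hR] at this

/-- The exponent of a Gaussian along the flow of its parameters. -/
theorem isPrimitiveOn_exponent (hJ : J.OrdConnected) {q p g k : ℝ → Fin d → ℂ}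
    {C Φ : ℝ → Matrix (Fin d) (Fin d) ℂ} {ζ α : ℝ → ℂ} (hs : ∀ t ∈ J, (C t)ᵀ = C t)
    (hq : IsPrimitiveOn J g q) (hp : IsPrimitiveOn J (fun t => -k t) p)
    (hC : IsPrimitiveOn J (fun t => -Φ t) C)
    (hζ : IsPrimitiveOn J (fun t => p t ⬝ᵥ g t - α t) ζ) (v : Fin d → ℂ) :
    IsPrimitiveOn J (fun t => -(α t + (k t + C t *ᵥ g t) ⬝ᵥ (v - q t) +
      1 / 2 * ((v - q t) ⬝ᵥ Φ t *ᵥ (v - q t))))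
      fun t => 1 / 2 * ((v - q t) ⬝ᵥ C t *ᵥ (v - q t)) + p t ⬝ᵥ (v - q t) + ζ t := by
  have hy : IsPrimitiveOn J (fun t => -g t) fun t => v - q t := by
    intro s hs t ht
    refine ⟨(hq s hs t ht).1.neg, ?_⟩
    rw [intervalIntegral.integral_neg, ← (hq s hs t ht).2,
      sub_sub_sub_cancel_left, neg_sub]
  have h1 := (hC.bilinear hy hJ (mulVecL ℂ))
  have h2 := (hy.bilinear h1 hJ (dotL ℂ)).linear
    (E := ℂ) (F := ℂ) (LinearMap.mulLeft ℝ (1 / 2 : ℂ))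
  have h3 := hp.bilinear hy hJ (dotL ℂ)
  refine ((h2.add h3).add hζ).congr hJ (fun t ht => ?_) fun t _ => ?_
  · simp only [mulVecL_apply, dotL_apply, LinearMap.mulLeft_apply]
    generalize v - q t = y
    rw [Matrix.neg_mulVec, Matrix.mulVec_neg, neg_dotProduct, neg_dotProduct, add_dotProduct,
      dotProduct_add, dotProduct_neg, dotProduct_neg, dotProduct_neg,
      dotProduct_mulVec_symm (hs t ht) (g t) y,
      dotProduct_comm (C t *ᵥ g t) y]
    ring
  · rfl

end Converse

section Canonical

variable {d : ℕ} {ε : ℝ} {J : Set ℝ}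

theorem forall_coord_iff {p : Coord d ⊕ Coord d → Prop} :
    (∀ k, p k) ↔ (∀ i, p (centerIdx i)) ∧ ∀ i j, p (widthIdx i j) := by
  refine ⟨fun h => ⟨fun i => h _, fun i j => h _⟩, fun ⟨h₁, h₂⟩ k => ?_⟩
  rcases k with (i | ⟨j, i⟩ | ⟨j, i⟩) | (i | ⟨j, i⟩ | ⟨j, i⟩)
  · exact h₁ (Sum.inl i)
  · exact h₂ (Sum.inl i) (Sum.inl j)
  · exact h₂ (Sum.inl i) (Sum.inr j)
  · exact h₁ (Sum.inr i)
  · exact h₂ (Sum.inr i) (Sum.inl j)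
  · exact h₂ (Sum.inr i) (Sum.inr j)

theorem hamiltonField_centerIdx {h : ℝ → Phase d → ℝ} {t : ℝ} (ha : IsSubquadratic (h t))
    (Z : Param d) (i : Fin d ⊕ Fin d) :
    hamiltonField h t Z (centerIdx i) = (Omega (Fin d) *ᵥ meanGrad (h t) Z) i := by
  rw [← center_apply, center_hamiltonField ha]

theorem hamiltonField_widthIdx {h : ℝ → Phase d → ℝ} {t : ℝ} (ha : IsSubquadratic (h t))
    (Z : Param d) (i j : Fin d ⊕ Fin d) :
    hamiltonField h t Z (widthIdx i j) =
      (Omega (Fin d) * (meanHess (h t) Z * scaledWidth Z)) i j := by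
  rw [← scaledWidth_apply, scaledWidth_hamiltonField ha]

/-- Hamilton's equations in terms of the centre and the width matrix. -/
theorem isCaratheodorySolution_canonical_iff (hε : 0 < ε) {h : ℝ → Phase d → ℝ}
    (ha : ∀ t, IsSubquadratic (h t)) (hJ : J.OrdConnected) {q p : ℝ → Pos d}
    {Q P : ℝ → Matrix (Fin d) (Fin d) ℂ} {Z : ℝ → Param d}
    (hZ : Z = fun t => canonicalCoords ε (q t) (p t) (Q t) (P t)) :
    IsCaratheodorySolution J (hamiltonField h) Z ↔
      IsPrimitiveOn J (fun t i => (meanGrad (h t) (Z t) (Sum.inr i) : ℂ)) (fun t => cvec (q t)) ∧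
      IsPrimitiveOn J (fun t => -fun i => (meanGrad (h t) (Z t) (Sum.inl i) : ℂ))
        (fun t => cvec (p t)) ∧
      IsPrimitiveOn J (fun t => Omega (Fin d) * (meanHess (h t) (Z t) * widthY (Q t) (P t)))
        (fun t => widthY (Q t) (P t)) := by
  have hc : √(ε / 2) ≠ 0 := (Real.sqrt_pos.2 (by positivity)).ne'
  have hcen : ∀ t i, Z t (centerIdx i) = Sum.elim (q t) (p t) i := fun t i => by
    rw [← center_apply, hZ, center_canonicalCoords]
  have hwid : ∀ t i j, Z t (widthIdx i j) = √(ε / 2) * widthY (Q t) (P t) i j := fun t i j => by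
    rw [← scaledWidth_apply, hZ, scaledWidth_canonicalCoords]; rfl
  have hfield : ∀ t i j, hamiltonField h t (Z t) (widthIdx i j) = √(ε / 2) *
      (Omega (Fin d) * (meanHess (h t) (Z t) * widthY (Q t) (P t))) i j := fun t i j => by
    rw [hamiltonField_widthIdx (ha t)]
    have : scaledWidth (Z t) = √(ε / 2) • widthY (Q t) (P t) := by
      rw [hZ]; exact scaledWidth_canonicalCoords _ _ _ _ _
    rw [this, Matrix.mul_smul, Matrix.mul_smul]; rfl
  have hsplit : IsCaratheodorySolution J (hamiltonField h) Z ↔ ∀ k : Coord d ⊕ Coord d,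
      IsPrimitiveOn J (fun t => hamiltonField h t (Z t) k) fun t => Z t k := by
    constructor
    · intro H k
      have H' : IsPrimitiveOn J (fun t => hamiltonField h t (Z t)) Z := H
      exact H'.clm (EuclideanSpace.proj k : Param d →L[ℝ] ℝ)
    · intro H
      have H' := IsPrimitiveOn.pi (g := fun t k => hamiltonField h t (Z t) k)
        (y := fun t k => Z t k) H
      exact H'.clm ((EuclideanSpace.equiv (Coord d ⊕ Coord d) ℝ).symm :
        (Coord d ⊕ Coord d → ℝ) →L[ℝ] Param d)
  rw [hsplit, forall_coord_iff]
  simp only [hamiltonField_centerIdx (ha _), hcen, hwid, hfield]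
  refine ⟨fun ⟨h₁, h₂⟩ => ⟨?_, ?_, ?_⟩, fun ⟨h₁, h₂, h₃⟩ => ⟨fun i => ?_, fun i j => ?_⟩⟩
  · refine IsPrimitiveOn.pi fun i => ?_
    refine ((h₁ (Sum.inl i)).clm Complex.ofRealCLM).congr hJ (fun t _ => ?_) fun t _ => rfl
    rw [Omega_mulVec_inl]; rfl
  · refine IsPrimitiveOn.pi fun i => ?_
    refine ((h₁ (Sum.inr i)).clm Complex.ofRealCLM).congr hJ (fun t _ => ?_) fun t _ => rfl
    rw [Omega_mulVec_inr]; simp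
  · refine IsPrimitiveOn.matrix fun i j => ?_
    refine ((h₂ i j).linear (LinearMap.mulLeft ℝ (√(ε / 2))⁻¹)).congr hJ (fun t _ => ?_)
      fun t _ => ?_ <;>
    · rw [LinearMap.mulLeft_apply, inv_mul_cancel_left₀ hc]
  · cases i with
    | inl i =>
      refine (h₁.clm (Complex.reCLM.comp (ContinuousLinearMap.proj i))).congr hJ (fun t _ => ?_)
        fun t _ => rfl
      rw [Omega_mulVec_inl]; rfl
    | inr i =>
      refine (h₂.clm (Complex.reCLM.comp (ContinuousLinearMap.proj i))).congr hJ (fun t _ => ?_)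
        fun t _ => rfl
      rw [Omega_mulVec_inr]; simp
  · exact ((h₃.linear (entryL ℝ i j)).linear (LinearMap.mulLeft ℝ (√(ε / 2))))

end Canonical

section Converse

variable {d : ℕ} {ε : ℝ} {J : Set ℝ}

/-- A curve of Gaussians with continuous parameters. -/
theorem isPacketCurve_gaussian {q p : ℝ → Pos d} {C : ℝ → Matrix (Fin d) (Fin d) ℂ} {ζ : ℝ → ℂ}
    {u : ℝ → Hilb d} (hs : ∀ t ∈ J, (C t)ᵀ = C t) (hA : ∀ t ∈ J, ((C t).map im).PosDef)
    (hu : ∀ t ∈ J, u t =ᵐ[volume] gaussian ε (q t) (p t) (C t) (ζ t))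
    (hq : ContinuousOn (fun t => cvec (q t)) J) (hp : ContinuousOn (fun t => cvec (p t)) J)
    (hC : ContinuousOn C J) (hζ : ContinuousOn ζ J) :
    IsPacketCurve ε J
      (fun t => cexp (I / ε * (1 / 2 * (cvec (q t) ⬝ᵥ C t *ᵥ cvec (q t)) - cvec (p t) ⬝ᵥ cvec (q t) +
        ζ t))) (fun t => cvec (p t) - C t *ᵥ cvec (q t)) C u where
  continuousOn_amplitude := by
    have hc : Continuous fun w : (Fin d → ℂ) × (Fin d → ℂ) × Matrix (Fin d) (Fin d) ℂ × ℂ =>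
        cexp (I / ε * (1 / 2 * (w.1 ⬝ᵥ w.2.2.1 *ᵥ w.1) - w.2.1 ⬝ᵥ w.1 + w.2.2.2)) := by fun_prop
    have h := hq.prodMk (hp.prodMk (hC.prodMk hζ))
    exact (hc.comp_continuousOn h :)
  continuousOn_slope := by
    have hc : Continuous fun w : (Fin d → ℂ) × (Fin d → ℂ) × Matrix (Fin d) (Fin d) ℂ =>
        w.2.1 - w.2.2 *ᵥ w.1 := by fun_prop
    have h := hq.prodMk (hp.prodMk hC)
    exact (hc.comp_continuousOn h :)
  continuousOn_width := hC
  posDef := hA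
  coe_ae_eq t ht := by rw [← gaussian_eq_packet ε _ _ (hs t ht)]; exact hu t ht

/-- Solutions of Hamilton's equations give variational approximations. -/
theorem exists_isDiracFrenkelSolution (hε : 0 < ε) {h : ℝ → Phase d → ℝ}
    (ha : ∀ t, IsSubquadratic (h t)) (hJ : J.OrdConnected) {t₀ : ℝ} (h₀ : t₀ ∈ J)
    {q p : ℝ → Pos d} {Q P : ℝ → Matrix (Fin d) (Fin d) ℂ}
    (hZ : IsCaratheodorySolution J (hamiltonField h)
      (fun t => canonicalCoords ε (q t) (p t) (Q t) (P t)))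
    (hint : ∀ t ∈ J, IntervalIntegrable
      (fun τ => average (h τ) (canonicalCoords ε (q τ) (p τ) (Q τ) (P τ))) volume t₀ t)
    {u₀ : Hilb d} (hu₀ : HasHagedornParameters ε u₀ (q t₀) (p t₀) (Q t₀) (P t₀)) :
    ∃ u : ℝ → Hilb d, u t₀ = u₀ ∧ IsDiracFrenkelSolution ε h J u ∧
      ∀ t ∈ J, HasHagedornParameters ε (u t) (q t) (p t) (Q t) (P t) := by
  obtain ⟨hq, hp, hY⟩ := (isCaratheodorySolution_canonical_iff hε ha hJ rfl).1 hZ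
  set Z : ℝ → Param d := fun t => canonicalCoords ε (q t) (p t) (Q t) (P t) with hZdef
  have hsym : ∀ t ∈ J, (widthY (Q t) (P t))ᵀ * Omega (Fin d) * widthY (Q t) (P t) =
      Omega (Fin d) := fun t ht =>
    (symplectic_form_conserved hJ (fun τ _ => meanHess_transpose (ha τ) _) hY h₀ ht).trans
      hu₀.symplectic
  have hQ : ∀ t ∈ J, IsUnit (Q t) := fun t ht => (width_of_symplectic (hsym t ht)).1
  have hs : ∀ t ∈ J, (P t * (Q t)⁻¹)ᵀ = P t * (Q t)⁻¹ := fun t ht =>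
    (width_of_symplectic (hsym t ht)).2.2.1
  have hA : ∀ t ∈ J, ((P t * (Q t)⁻¹).map im).PosDef := fun t ht =>
    posDef_of_conj (symm_im (hs t ht)) (width_of_symplectic (hsym t ht)).2.2.2
  obtain ⟨hQ', hP'⟩ := isPrimitiveOn_blocks hJ hQ hY
  set C : ℝ → Matrix (Fin d) (Fin d) ℂ := fun t => P t * (Q t)⁻¹ with hCdef
  have hC : IsPrimitiveOn J (fun t => -forceHess (h t) (Z t) (C t)) C :=
    (isPrimitiveOn_riccati hJ hQ hQ' hP').congr hJ
      (fun t ht => by rw [forceHess_eq (hs t ht)]) fun _ _ => rfl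
  have hCc := hC.continuousOn hJ
  have hΦ : IsLocIntegrable J fun t => forceHess (h t) (Z t) (C t) :=
    hC.isLocIntegrable.neg.congr hJ fun t _ => neg_neg _
  have hgq := hq.isLocIntegrable
  have hgp : IsLocIntegrable J fun t i => (meanGrad (h t) (Z t) (Sum.inl i) : ℂ) :=
    hp.isLocIntegrable.neg.congr hJ fun t _ => neg_neg _
  have hφ₁ : IsLocIntegrable J fun t => forceGrad (h t) (Z t) (C t) :=
    (hgp.add (hgq.bilinear hJ hCc (mulVecL ℂ).flip)).congr hJ
      fun t ht => (forceGrad_eq (hs t ht)).symm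
  have hAc : ContinuousOn (fun t => toC ((C t).map im)⁻¹) J := by
    have h1 : ContinuousOn (fun t => (C t).map im) J :=
      (Continuous.matrix_map continuous_id continuous_im).comp_continuousOn hCc
    have h2 := continuousOn_matrix_inv h1 fun t ht => (hA t ht).isUnit
    exact (Continuous.matrix_map continuous_id continuous_ofReal).comp_continuousOn h2
  have hφ₀ : IsLocIntegrable J fun t => forceConst ε (h t) (Z t) (C t) := by
    have h1 : IsLocIntegrable J fun t => (average (h t) (Z t) : ℂ) :=
      IsLocIntegrable.clm (L := Complex.ofRealCLM) fun s hs t ht => (hint s hs).symm.trans (hint t ht)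
    have h2 := (((hΦ.bilinear hJ hAc (mulL ℂ)).linear
      (Matrix.traceLinearMap (Fin d) ℝ ℂ)).const_mul (ε / 4))
    exact h1.sub h2
  obtain ⟨ζ₀, hζ₀⟩ := hu₀.exists_gaussian hε
  have hζ' : IsLocIntegrable J fun t => cvec (p t) ⬝ᵥ (fun i =>
      (meanGrad (h t) (Z t) (Sum.inr i) : ℂ)) - forceConst ε (h t) (Z t) (C t) :=
    (hgq.bilinear hJ (hp.continuousOn hJ) (dotL ℂ).flip).sub hφ₀
  have hζ := hζ'.isPrimitiveOn hJ h₀ ζ₀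
  set ζ : ℝ → ℂ := fun t => ζ₀ + ∫ τ in t₀..t, (cvec (p τ) ⬝ᵥ (fun i =>
      (meanGrad (h τ) (Z τ) (Sum.inr i) : ℂ)) - forceConst ε (h τ) (Z τ) (C τ)) with hζdef
  have hζt₀ : ζ t₀ = ζ₀ := by simp [hζdef]
  have hex : ∀ t, ∃ u : Hilb d, t ∈ J → u =ᵐ[volume] gaussian ε (q t) (p t) (C t) (ζ t) := by
    intro t
    by_cases ht : t ∈ J
    · obtain ⟨φ, hφ⟩ := exists_schwartz_gaussian hε (q t) (p t) (hs t ht) (hA t ht) (ζ t)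
      exact ⟨φ.toLp 2 volume, fun _ => (φ.coeFn_toLp 2 volume).trans
        (Filter.Eventually.of_forall hφ)⟩
    · exact ⟨0, fun h => absurd h ht⟩
  choose u hu using hex
  have hu₀' : u t₀ = u₀ := Lp.ext ((hu t₀ h₀).trans (by rw [hζt₀]; exact hζ₀.symm))
  have hmem : ∀ t ∈ J, u t ∈ gaussianManifold d ε := fun t ht =>
    ⟨q t, p t, C t, ζ t, hs t ht, hA t ht, hu t ht⟩
  have hcurve := isPacketCurve_gaussian hs hA hu (hq.continuousOn hJ) (hp.continuousOn hJ) hCc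
    (hζ.continuousOn hJ)
  set α : ℝ → ℂ := fun t => forceConst ε (h t) (Z t) (C t) - forceGrad (h t) (Z t) (C t) ⬝ᵥ
    cvec (q t) + 1 / 2 * (cvec (q t) ⬝ᵥ forceHess (h t) (Z t) (C t) *ᵥ cvec (q t)) with hα
  set β : ℝ → Fin d → ℂ := fun t => forceGrad (h t) (Z t) (C t) -
    forceHess (h t) (Z t) (C t) *ᵥ cvec (q t) with hβ
  set c : ℂ := (I * (ε : ℂ))⁻¹ with hc
  have hquad : ∀ t x, c * quad (forceConst ε (h t) (Z t) (C t)) (forceGrad (h t) (Z t) (C t))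
      (forceHess (h t) (Z t) (C t)) (x - q t) = quad (c * α t) (c • β t)
        (c • forceHess (h t) (Z t) (C t)) x := fun t x => by
    rw [quad_sub_point _ _ (forceHess_transpose (ha t) _ _), mul_quad]
  have hΦq := hΦ.bilinear hJ (hq.continuousOn hJ) (mulVecL ℂ)
  have hαi : IsLocIntegrable J fun t => c * α t := by
    refine IsLocIntegrable.const_mul ((hφ₀.sub (hφ₁.bilinear hJ (hq.continuousOn hJ) (dotL ℂ))).add
      (IsLocIntegrable.const_mul ?_ (1 / 2))) c
    exact hΦq.bilinear hJ (hq.continuousOn hJ) (dotL ℂ).flip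
  have hβi : IsLocIntegrable J fun t => c • β t :=
    (hφ₁.sub hΦq).linear ((LinearMap.lsmul ℂ (Fin d → ℂ) c).restrictScalars ℝ)
  have hΓi : IsLocIntegrable J fun t => c • forceHess (h t) (Z t) (C t) :=
    hΦ.linear ((LinearMap.lsmul ℂ (Matrix (Fin d) (Fin d) ℂ) c).restrictScalars ℝ)
  have hf : ∀ t ∈ J, diracFrenkelField ε h t (u t) =ᵐ[volume] fun x =>
      quad (c * α t) (c • β t) (c • forceHess (h t) (Z t) (C t)) x *
        packet ε (cexp (I / ε * (1 / 2 * (cvec (q t) ⬝ᵥ C t *ᵥ cvec (q t)) -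
          cvec (p t) ⬝ᵥ cvec (q t) + ζ t))) (cvec (p t) - C t *ᵥ cvec (q t)) (C t) x := by
    intro t ht
    refine (Lp.coeFn_smul _ _).trans ?_
    filter_upwards [starProjection_weylOp_symplectic hε (hsym t ht) (hu t ht) (ha t)] with x hx
    rw [Pi.smul_apply, hx, smul_eq_mul, ← mul_assoc, hquad, gaussian_eq_packet ε _ _ (hs t ht)]
  have hDF : IsCaratheodorySolution J (diracFrenkelField ε h) u := by
    intro s hsJ t ht
    refine ⟨hcurve.isLocIntegrable hε hJ hαi hβi hΓi hf s hsJ t ht, Lp.ext ?_⟩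
    filter_upwards [Lp.coeFn_sub (u t) (u s), hu t ht, hu s hsJ,
      hcurve.integral_ae_eq hε hJ hαi hβi hΓi hf hsJ ht] with x h1 h2 h3 h4
    rw [h1, h4, Pi.sub_apply, h2, h3]
    have hE := ((isPrimitiveOn_exponent hJ hs hq hp hC hζ (cvec x)).linear
      (LinearMap.mulLeft ℝ (I / ε))).exp_comp hJ
    have hE' := hE.congr hJ (g' := fun τ => quad (c * α τ) (c • β τ)
      (c • forceHess (h τ) (Z τ) (C τ)) x * packet ε (cexp (I / ε * (1 / 2 * (cvec (q τ) ⬝ᵥ C τ *ᵥ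
        cvec (q τ)) - cvec (p τ) ⬝ᵥ cvec (q τ) + ζ τ))) (cvec (p τ) - C τ *ᵥ cvec (q τ)) (C τ) x) (y' := fun t => gaussian ε (q t) (p t) (C t) (ζ t) x)
      (fun τ hτ => ?_) fun τ hτ => ?_
    · exact (hE' s hsJ t ht).2
    · rw [← gaussian_eq_packet ε _ _ (hs τ hτ), ← hquad, gaussian_def, cvec_sub,
        LinearMap.mulLeft_apply, LinearMap.mulLeft_apply, forceGrad_eq (hs τ hτ), quad, mul_comm]
      congr 1
      have e : (fun i => ((x - q τ) i : ℂ)) = cvec x - cvec (q τ) := cvec_sub _ _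
      have e2 : c = -(I / ε) := by rw [hc, mul_inv, inv_I]; ring
      rw [e, e2]; ring
    · rw [gaussian_def, cvec_sub, LinearMap.mulLeft_apply]
  refine ⟨u, hu₀', ⟨hmem, fun t ht => ?_, hDF⟩, fun t ht => ?_⟩
  · exact exists_isWeylImage_gaussian hε (hs t ht) (hA t ht) (hu t ht) (ha t)
  · refine hasHagedornParameters_of_gaussian hε (hsym t ht) (hu t ht) ?_
    rw [norm_conserved hε hJ ha hmem hDF h₀ ht, hu₀']
    exact hu₀.norm_eq_one hε

end Converse

/-! ### Continuity of the parameters of a Gaussian -/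

section ParameterContinuity

open Filter Topology

theorem tendsto_zero_of_exp_smul {δ : ℕ → ℂ}
    (h : ∀ s : ℝ, Tendsto (fun n => cexp (s * δ n)) atTop (𝓝 1)) : Tendsto δ atTop (𝓝 0) := by
  have hre : Tendsto (fun n => (δ n).re) atTop (𝓝 0) := by
    have h1 := (h 1).norm
    rw [norm_one] at h1
    have h2 := (Real.continuousAt_log one_ne_zero).tendsto.comp h1
    rw [Real.log_one] at h2
    refine h2.congr fun n => ?_
    simp [Complex.norm_exp]
  have him : Tendsto (fun n => (δ n).im) atTop (𝓝 0) := by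
    have h1 : ∀ s : ℝ, Tendsto (fun n => cexp ((δ n).im * s * I)) atTop (𝓝 1) := by
      intro s
      have h2 : Tendsto (fun n => cexp (-(s * (δ n).re : ℝ))) atTop (𝓝 1) := by
        have h3 : Tendsto (fun n => -(s * (δ n).re)) atTop (𝓝 0) := by
          simpa using (hre.const_mul s).neg
        have h4 := (Complex.continuous_exp.comp continuous_ofReal).continuousAt.tendsto.comp h3
        simpa [Function.comp_def] using h4
      have h5 := (h s).mul h2
      rw [one_mul] at h5
      refine h5.congr fun n => ?_
      rw [← Complex.exp_add]
      congr 1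
      have e : (s : ℂ) * δ n = s * ((δ n).re + (δ n).im * I) := by rw [re_add_im]
      rw [e]; push_cast; ring
    have h2 : Tendsto (fun n => charFun (ProbabilityTheory.gaussianReal 0 1) (δ n).im) atTop
        (𝓝 1) := by
      have h3 : Tendsto (fun n => ∫ x, cexp ((δ n).im * x * I)
          ∂(ProbabilityTheory.gaussianReal 0 1)) atTop
          (𝓝 (∫ _, 1 ∂(ProbabilityTheory.gaussianReal 0 1))) := by
        refine tendsto_integral_of_dominated_convergence (fun _ => 1)
          (fun n => Continuous.aestronglyMeasurable (by fun_prop)) (integrable_const 1)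
          (fun n => Eventually.of_forall fun x => ?_) (Eventually.of_forall h1)
        have : ((δ n).im * x * I : ℂ) = ((δ n).im * x : ℝ) * I := by push_cast; rfl
        rw [this, Complex.norm_exp_ofReal_mul_I]
      simpa [charFun_apply_real] using h3
    simp only [ProbabilityTheory.charFun_gaussianReal] at h2
    have h4 := h2.norm
    simp only [Complex.norm_exp, norm_one] at h4
    have h5 := (Real.continuousAt_log one_ne_zero).tendsto.comp h4
    rw [Real.log_one] at h5
    have h6 : Tendsto (fun n => (δ n).im ^ 2) atTop (𝓝 0) := by
      have := h5.const_mul (-2)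
      rw [mul_zero] at this
      refine this.congr fun n => ?_
      simp only [Function.comp_def, Real.log_exp]
      have : (((δ n).im : ℂ) * ((0 : ℝ) : ℂ) * I - ((1 : NNReal) : ℂ) * ((δ n).im : ℂ) ^ 2 / 2) =
        ((-((δ n).im ^ 2) / 2 : ℝ) : ℂ) := by push_cast; simp; ring
      rw [this, ofReal_re]; ring
    have h7 := h6.sqrt
    simp only [Real.sqrt_sq_eq_abs, Real.sqrt_zero] at h7
    exact (tendsto_zero_iff_abs_tendsto_zero _).2 h7
  have := (Complex.continuous_ofReal.tendsto 0 |>.comp hre).add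
    ((Complex.continuous_ofReal.tendsto 0 |>.comp him).mul_const I)
  simpa [Function.comp_def, re_add_im] using this

theorem tendsto_of_exp_smul {θ : ℕ → ℂ} {θ₀ : ℂ}
    (h : ∀ s : ℝ, Tendsto (fun n => cexp (s * θ n)) atTop (𝓝 (cexp (s * θ₀)))) :
    Tendsto θ atTop (𝓝 θ₀) := by
  have := tendsto_zero_of_exp_smul (δ := fun n => θ n - θ₀) fun s => by
    have h1 := (h s).mul_const (cexp (-(s * θ₀)))
    rw [← Complex.exp_add, add_neg_cancel, Complex.exp_zero] at h1
    refine h1.congr fun n => ?_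
    rw [← Complex.exp_add]; ring_nf
  simpa using this.add_const θ₀

variable {d : ℕ} {ε : ℝ}

theorem packet_ne_zero {κ : ℂ} (hκ : κ ≠ 0) (b : Fin d → ℂ) (C : Matrix (Fin d) (Fin d) ℂ)
    (x : Pos d) : packet ε κ b C x ≠ 0 := mul_ne_zero hκ (Complex.exp_ne_zero _)

theorem packet_add_div {κ : ℂ} (hκ : κ ≠ 0) (b : Fin d → ℂ) {C : Matrix (Fin d) (Fin d) ℂ}
    (hC : Cᵀ = C) (x w : Pos d) : packet ε κ b C (x + w) / packet ε κ b C x =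
      cexp (I / ε * (1 / 2 * (cvec w ⬝ᵥ C *ᵥ cvec w) + cvec w ⬝ᵥ C *ᵥ cvec x)) *
        cexp (I / ε * (b ⬝ᵥ cvec w)) := by
  rw [div_eq_iff (packet_ne_zero hκ b C x), packet, packet, mul_left_comm, ← Complex.exp_add,
    ← Complex.exp_add, cvec_add, Matrix.mulVec_add, dotProduct_add, dotProduct_add, add_dotProduct,
    add_dotProduct, dotProduct_mulVec_symm hC (cvec x) (cvec w)]
  congr 2
  ring

theorem packet_second_difference {κ : ℂ} (hκ : κ ≠ 0) (b : Fin d → ℂ)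
    {C : Matrix (Fin d) (Fin d) ℂ} (hC : Cᵀ = C) (x w : Pos d) :
    packet ε κ b C (x + w) / packet ε κ b C x * (packet ε κ b C (x - w) / packet ε κ b C x) =
      cexp (I / ε * (cvec w ⬝ᵥ C *ᵥ cvec w)) := by
  have hw : cvec (-w) = -cvec w := by simpa using cvec_smul (-1) w
  rw [sub_eq_add_neg, packet_add_div hκ b hC, packet_add_div hκ b hC, ← Complex.exp_add,
    ← Complex.exp_add, ← Complex.exp_add, hw, Matrix.mulVec_neg, neg_dotProduct, neg_dotProduct,
    dotProduct_neg, dotProduct_neg, neg_neg]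
  congr 1
  ring

theorem cvec_single (i : Fin d) (c : ℝ) : cvec (EuclideanSpace.single i c) = Pi.single i (c : ℂ) := by
  funext j
  by_cases h : j = i
  · subst h; simp [cvec]
  · simp [cvec, h]

theorem form_polarization {C : Matrix (Fin d) (Fin d) ℂ} (hC : Cᵀ = C) (i j : Fin d) :
    C i j = 1 / 2 * ((cvec (EuclideanSpace.single i 1 + EuclideanSpace.single j 1) ⬝ᵥ
      C *ᵥ cvec (EuclideanSpace.single i 1 + EuclideanSpace.single j 1)) -
      cvec (EuclideanSpace.single i 1) ⬝ᵥ C *ᵥ cvec (EuclideanSpace.single i 1) -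
      cvec (EuclideanSpace.single j 1) ⬝ᵥ C *ᵥ cvec (EuclideanSpace.single j 1)) := by
  have h : ∀ v w : Fin d → ℂ, (v + w) ⬝ᵥ C *ᵥ (v + w) =
      v ⬝ᵥ C *ᵥ v + 2 * (v ⬝ᵥ C *ᵥ w) + w ⬝ᵥ C *ᵥ w := fun v w => by
    rw [Matrix.mulVec_add, dotProduct_add, add_dotProduct, add_dotProduct,
      dotProduct_mulVec_symm hC w v]; ring
  rw [cvec_add, h]
  simp [cvec_single]
  ring

variable {κ : ℕ → ℂ} {b : ℕ → Fin d → ℂ} {C : ℕ → Matrix (Fin d) (Fin d) ℂ} {κ₀ : ℂ}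
  {b₀ : Fin d → ℂ} {C₀ : Matrix (Fin d) (Fin d) ℂ}

/-- Almost everywhere convergence of wave packets implies convergence of their parameters. -/
theorem tendsto_parameters_of_ae (hε : 0 < ε) (hκ : ∀ n, κ n ≠ 0) (hκ₀ : κ₀ ≠ 0)
    (hC : ∀ n, (C n)ᵀ = C n) (hC₀ : C₀ᵀ = C₀)
    (h : ∀ᵐ x, Tendsto (fun n => packet ε (κ n) (b n) (C n) x) atTop (𝓝 (packet ε κ₀ b₀ C₀ x))) :
    Tendsto κ atTop (𝓝 κ₀) ∧ Tendsto b atTop (𝓝 b₀) ∧ Tendsto C atTop (𝓝 C₀) := by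
  have hcI : I / (ε : ℂ) ≠ 0 := div_ne_zero I_ne_zero (by exact_mod_cast hε.ne')
  have hquot : ∀ x y, Tendsto (fun n => packet ε (κ n) (b n) (C n) x) atTop
      (𝓝 (packet ε κ₀ b₀ C₀ x)) → Tendsto (fun n => packet ε (κ n) (b n) (C n) y) atTop
      (𝓝 (packet ε κ₀ b₀ C₀ y)) → Tendsto (fun n => packet ε (κ n) (b n) (C n) y /
        packet ε (κ n) (b n) (C n) x) atTop (𝓝 (packet ε κ₀ b₀ C₀ y / packet ε κ₀ b₀ C₀ x)) :=
    fun x y hx hy => hy.div hx (packet_ne_zero hκ₀ _ _ _)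
  have hshift : ∀ w : Pos d, ∀ᵐ x, Tendsto (fun n => packet ε (κ n) (b n) (C n) (x + w)) atTop
      (𝓝 (packet ε κ₀ b₀ C₀ (x + w))) := fun w =>
    (measurePreserving_add_right volume w).quasiMeasurePreserving.ae h
  have hform : ∀ w : Pos d, Tendsto (fun n => cexp (I / ε * (cvec w ⬝ᵥ C n *ᵥ cvec w))) atTop
      (𝓝 (cexp (I / ε * (cvec w ⬝ᵥ C₀ *ᵥ cvec w)))) := by
    intro w
    obtain ⟨x, hx, hxw, hxw'⟩ := (h.and ((hshift w).and (hshift (-w)))).exists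
    rw [← packet_second_difference hκ₀ b₀ hC₀ x w]
    refine ((hquot _ _ hx hxw).mul (hquot _ _ hx hxw')).congr fun n => ?_
    rw [← sub_eq_add_neg, packet_second_difference (hκ n) _ (hC n)]
  have hform' : ∀ w : Pos d, Tendsto (fun n => cvec w ⬝ᵥ C n *ᵥ cvec w) atTop
      (𝓝 (cvec w ⬝ᵥ C₀ *ᵥ cvec w)) := by
    intro w
    have hpos : ∀ s : ℝ, 0 ≤ s → Tendsto (fun n => cexp (s * (I / ε * (cvec w ⬝ᵥ C n *ᵥ cvec w))))
        atTop (𝓝 (cexp (s * (I / ε * (cvec w ⬝ᵥ C₀ *ᵥ cvec w))))) := by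
      intro s hs
      have e : ∀ M : Matrix (Fin d) (Fin d) ℂ, I / ε * (cvec (√s • w) ⬝ᵥ M *ᵥ cvec (√s • w)) =
          s * (I / ε * (cvec w ⬝ᵥ M *ᵥ cvec w)) := fun M => by
        rw [cvec_smul, Matrix.mulVec_smul, smul_dotProduct, dotProduct_smul, smul_eq_mul,
          smul_eq_mul]
        have : (s : ℂ) = (√s : ℂ) * (√s : ℂ) := by exact_mod_cast (Real.mul_self_sqrt hs).symm
        rw [this]; ring
      simpa only [e] using hform (√s • w)
    have := tendsto_of_exp_smul (θ := fun n => I / ε * (cvec w ⬝ᵥ C n *ᵥ cvec w))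
      (θ₀ := I / ε * (cvec w ⬝ᵥ C₀ *ᵥ cvec w)) fun s => by
      rcases le_total 0 s with hs | hs
      · exact hpos s hs
      · have h1 := (hpos (-s) (neg_nonneg.2 hs)).inv₀ (Complex.exp_ne_zero _)
        simpa [← Complex.exp_neg] using h1
    have h2 := this.const_mul (I / (ε : ℂ))⁻¹
    simpa only [inv_mul_cancel_left₀ hcI] using h2
  have hCt : Tendsto C atTop (𝓝 C₀) := by
    have : ∀ i j, Tendsto (fun n => C n i j) atTop (𝓝 (C₀ i j)) := fun i j => by
      rw [form_polarization hC₀ i j]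
      refine Tendsto.congr (fun n => (form_polarization (hC n) i j).symm) ?_
      exact (((hform' _).sub (hform' _)).sub (hform' _)).const_mul _
    exact tendsto_pi_nhds.2 fun i => tendsto_pi_nhds.2 (this i)
  have hbil : ∀ v w : Fin d → ℂ, Tendsto (fun n => v ⬝ᵥ C n *ᵥ w) atTop (𝓝 (v ⬝ᵥ C₀ *ᵥ w)) := by
    intro v w
    have hc : Continuous fun M : Matrix (Fin d) (Fin d) ℂ => v ⬝ᵥ M *ᵥ w := by fun_prop
    exact (hc.tendsto C₀).comp hCt
  have hlin : ∀ w : Pos d, Tendsto (fun n => cexp (I / ε * (b n ⬝ᵥ cvec w))) atTop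
      (𝓝 (cexp (I / ε * (b₀ ⬝ᵥ cvec w)))) := by
    intro w
    obtain ⟨x, hx, hxw⟩ := (h.and (hshift w)).exists
    have h1 := (Complex.continuous_exp.tendsto _).comp
      ((((hbil (cvec w) (cvec w)).const_mul (1 / 2)).add (hbil (cvec w) (cvec x))).const_mul
        (I / (ε : ℂ)))
    have h2 := (hquot _ _ hx hxw).div h1 (Complex.exp_ne_zero _)
    rw [packet_add_div hκ₀ _ hC₀, mul_div_cancel_left₀ _ (Complex.exp_ne_zero _)] at h2
    refine h2.congr fun n => ?_
    rw [Pi.div_apply, packet_add_div (hκ n) _ (hC n)]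
    exact mul_div_cancel_left₀ _ (Complex.exp_ne_zero _)
  have hbt : Tendsto b atTop (𝓝 b₀) := by
    refine tendsto_pi_nhds.2 fun i => ?_
    have := tendsto_of_exp_smul (θ := fun n => I / ε * b n i) (θ₀ := I / ε * b₀ i) fun s => by
      have := hlin (EuclideanSpace.single i s)
      simp only [cvec_single, dotProduct_single] at this
      convert this using 3 <;> ring
    have h2 := this.const_mul (I / (ε : ℂ))⁻¹
    simpa only [inv_mul_cancel_left₀ hcI] using h2
  refine ⟨?_, hbt, hCt⟩
  obtain ⟨x, hx⟩ := h.exists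
  have hbd : Tendsto (fun n => b n ⬝ᵥ cvec x) atTop (𝓝 (b₀ ⬝ᵥ cvec x)) := by
    have hc : Continuous fun v : Fin d → ℂ => v ⬝ᵥ cvec x := by fun_prop
    exact (hc.tendsto b₀).comp hbt
  have h1 := (Complex.continuous_exp.tendsto _).comp
    ((((hbil (cvec x) (cvec x)).const_mul (1 / 2)).add hbd).const_mul (I / (ε : ℂ)))
  have h2 := hx.div h1 (Complex.exp_ne_zero _)
  rw [packet, mul_div_cancel_right₀ _ (Complex.exp_ne_zero _)] at h2
  exact h2.congr fun n => mul_div_cancel_right₀ _ (Complex.exp_ne_zero _)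

theorem packet_injective (hε : 0 < ε) {κ κ' : ℂ} {b b' : Fin d → ℂ}
    {C C' : Matrix (Fin d) (Fin d) ℂ} (hκ : κ ≠ 0) (hκ' : κ' ≠ 0) (hC : Cᵀ = C) (hC' : C'ᵀ = C')
    (h : packet ε κ b C =ᵐ[volume] packet ε κ' b' C') : κ = κ' ∧ b = b' ∧ C = C' := by
  obtain ⟨h1, h2, h3⟩ := tendsto_parameters_of_ae (κ := fun _ => κ) (b := fun _ => b)
    (C := fun _ => C) hε (fun _ => hκ) hκ' (fun _ => hC) hC' (b₀ := b') (h.mono fun x hx => by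
      rw [hx]; exact tendsto_const_nhds)
  exact ⟨tendsto_nhds_unique tendsto_const_nhds h1, tendsto_nhds_unique tendsto_const_nhds h2,
    tendsto_nhds_unique tendsto_const_nhds h3⟩

/-- The parameters of a continuous curve of wave packets are continuous. -/
theorem isPacketCurve_of_continuousOn (hε : 0 < ε) {J : Set ℝ} {κ : ℝ → ℂ} {b : ℝ → Fin d → ℂ}
    {C : ℝ → Matrix (Fin d) (Fin d) ℂ} {u : ℝ → Hilb d} (hu : ContinuousOn u J)
    (hκ : ∀ t ∈ J, κ t ≠ 0) (hC : ∀ t ∈ J, (C t)ᵀ = C t) (hA : ∀ t ∈ J, ((C t).map im).PosDef)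
    (hp : ∀ t ∈ J, u t =ᵐ[volume] packet ε (κ t) (b t) (C t)) : IsPacketCurve ε J κ b C u := by
  have key : ContinuousOn (fun t => (κ t, b t, C t)) J := by
    intro t ht
    refine tendsto_of_subseq_tendsto fun ns hns => ?_
    obtain ⟨N, hN⟩ := eventually_atTop.1 (hns.eventually eventually_mem_nhdsWithin)
    have hns' : Tendsto (fun n => ns (n + N)) atTop (𝓝[J] t) := hns.comp (tendsto_add_atTop_nat N)
    have hL : Tendsto (fun n => u (ns (n + N))) atTop (𝓝 (u t)) := (hu t ht).tendsto.comp hns'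
    obtain ⟨ms, hms, hae⟩ := (tendstoInMeasure_of_tendsto_Lp hL).exists_seq_tendsto_ae
    have hmem : ∀ n, ns (ms n + N) ∈ J := fun n => hN _ (Nat.le_add_left _ _)
    obtain ⟨h1, h2, h3⟩ := tendsto_parameters_of_ae (κ := fun n => κ (ns (ms n + N)))
      (b := fun n => b (ns (ms n + N))) (C := fun n => C (ns (ms n + N))) hε
      (fun n => hκ _ (hmem n)) (hκ t ht) (fun n => hC _ (hmem n)) (hC t ht) (b₀ := b t) (by
        filter_upwards [hae, hp t ht, ae_all_iff.2 fun n => hp _ (hmem n)] with x hx h h'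
        rw [← h]
        exact hx.congr h')
    exact ⟨fun n => ms n + N, h1.prodMk_nhds (h2.prodMk_nhds h3)⟩
  exact ⟨continuous_fst.comp_continuousOn key,
    (continuous_fst.comp continuous_snd).comp_continuousOn key,
    (continuous_snd.comp continuous_snd).comp_continuousOn key, hA, hp⟩

end ParameterContinuity

/-! ### Coefficients of quadratic multiples of wave packets -/

section Coefficients

variable {J : Set ℝ}

/-- The coefficients of a locally integrable curve with respect to a continuous family of linearly
independent vectors are locally integrable. -/
theorem isLocIntegrable_coeff {H : Type*} [NormedAddCommGroup H] [InnerProductSpace ℂ H]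
    [NormedSpace ℝ H] [IsScalarTower ℝ ℂ H] {K : Type*} [Fintype K] [DecidableEq K]
    (hJ : J.OrdConnected) {e : ℝ → K → H} (he : ∀ k, ContinuousOn (fun t => e t k) J)
    (hli : ∀ t ∈ J, LinearIndependent ℂ (e t)) {f : ℝ → H} (hf : IsLocIntegrable J f)
    {c : ℝ → K → ℂ} (hc : ∀ t ∈ J, f t = ∑ k, c t k • e t k) : IsLocIntegrable J c := by
  have hB : IsBoundedBilinearMap ℝ fun p : H × H => inner ℂ p.1 p.2 := isBoundedBilinearMap_inner
  have hG : ContinuousOn (fun t => Matrix.gram ℂ (e t)) J := by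
    refine continuousOn_pi.2 fun i => continuousOn_pi.2 fun j => ?_
    exact (he i).inner (𝕜 := ℂ) (he j)
  have hu : ∀ t ∈ J, IsUnit (Matrix.gram ℂ (e t)) := fun t ht =>
    (Matrix.isUnit_iff_isUnit_det _).2
      (isUnit_iff_ne_zero.2 (Matrix.det_gram_ne_zero_iff_linearIndependent.2 (hli t ht)))
  have hv : IsLocIntegrable J fun t k => (inner ℂ (e t k) (f t) : ℂ) :=
    IsLocIntegrable.pi fun k => hf.bilin hJ (he k) hB.toContinuousLinearMap.flip
  refine (hv.bilinear hJ (continuousOn_matrix_inv hG hu) (mulVecL ℂ).flip).congr hJ fun t ht => ?_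
  have hv' : (fun k => (inner ℂ (e t k) (f t) : ℂ)) = Matrix.gram ℂ (e t) *ᵥ c t := by
    funext k
    rw [hc t ht, inner_sum]
    refine Finset.sum_congr rfl fun j _ => ?_
    rw [inner_smul_right]
    exact mul_comm _ _
  rw [LinearMap.flip_apply, mulVecL_apply, hv', Matrix.mulVec_mulVec, Matrix.nonsing_inv_mul _
    ((Matrix.isUnit_iff_isUnit_det _).1 (hu t ht)), Matrix.one_mulVec]

variable {d : ℕ} {ε : ℝ}

theorem eq_zero_of_quad_eq_zero {α : ℂ} {β : Fin d → ℂ} {Γ : Matrix (Fin d) (Fin d) ℂ}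
    (hΓ : Γᵀ = Γ) (h : ∀ x : Pos d, quad α β Γ x = 0) : α = 0 ∧ β = 0 ∧ Γ = 0 := by
  have h' : ∀ x : Pos d, α + β ⬝ᵥ cvec x + 1 / 2 * (cvec x ⬝ᵥ Γ *ᵥ cvec x) = 0 := h
  have h0 : cvec (0 : Pos d) = 0 := by funext i; simp [cvec]
  have hα : α = 0 := by simpa [h0] using h' (0 : Pos d)
  have hneg : ∀ x : Pos d, cvec (-x) = -cvec x := fun x => by simpa using cvec_smul (-1) x
  have hform : ∀ x : Pos d, cvec x ⬝ᵥ Γ *ᵥ cvec x = 0 := fun x => by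
    have h1 := h' x
    have h2 := h' (-x)
    rw [hneg, Matrix.mulVec_neg, neg_dotProduct, dotProduct_neg, dotProduct_neg, neg_neg] at h2
    linear_combination h1 + h2 - 2 * hα
  have hΓ0 : Γ = 0 := by
    ext i j
    rw [form_polarization hΓ, hform, hform, hform]; simp
  refine ⟨hα, funext fun i => ?_, hΓ0⟩
  have h1 := h' (EuclideanSpace.single i 1)
  rw [hform, hα] at h1
  simpa [cvec_single] using h1

/-- The vectors `x^α u`, `|α| ≤ 2`, with the pairs `(i, j)` and `(j, i)` of quadratic indices
separated by an auxiliary component. -/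
abbrev Aux (d : ℕ) : Type := WithLp 2 (Hilb d × EuclideanSpace ℂ (Fin d × Fin d))

variable {κ : ℝ → ℂ} {b : ℝ → Fin d → ℂ} {C : ℝ → Matrix (Fin d) (Fin d) ℂ} {u : ℝ → Hilb d}
  {α : ℝ → ℂ} {β : ℝ → Fin d → ℂ} {Γ : ℝ → Matrix (Fin d) (Fin d) ℂ}

/-- Quadratic multiples of wave packets have locally integrable coefficients as soon as they are
locally integrable in `L²`. -/
theorem IsPacketCurve.isLocIntegrable_quad (hε : 0 < ε) (hJ : J.OrdConnected)
    (hu : IsPacketCurve ε J κ b C u) (hκ : ∀ t ∈ J, κ t ≠ 0) (hΓ : ∀ t ∈ J, (Γ t)ᵀ = Γ t)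
    {f : ℝ → Hilb d} (hfi : IsLocIntegrable J f) (hf : ∀ t ∈ J, f t =ᵐ[volume] fun x =>
      quad (α t) (β t) (Γ t) x * packet ε (κ t) (b t) (C t) x) :
    IsLocIntegrable J α ∧ IsLocIntegrable J β ∧ IsLocIntegrable J Γ := by
  have hg := fun i : Fin d => hasTemperateGrowth_coord i
  choose F hF hFe using fun i => hu.exists_mul hε (hg i)
  choose F₂ hF₂ hF₂e using fun i j => hu.exists_mul hε ((hg i).mul (hg j))
  let L₁ : Hilb d →L[ℂ] Aux d :=
    ((WithLp.prodContinuousLinearEquiv 2 ℂ (Hilb d) (EuclideanSpace ℂ (Fin d × Fin d))).symm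
      ).toContinuousLinearMap.comp (ContinuousLinearMap.inl ℂ _ _)
  let L₂ : EuclideanSpace ℂ (Fin d × Fin d) →L[ℂ] Aux d :=
    ((WithLp.prodContinuousLinearEquiv 2 ℂ (Hilb d) (EuclideanSpace ℂ (Fin d × Fin d))).symm
      ).toContinuousLinearMap.comp (ContinuousLinearMap.inr ℂ _ _)
  have hL : ∀ v w, L₁ v + L₂ w = 0 → v = 0 ∧ w = 0 := by
    intro v w h
    have h1 := congrArg WithLp.fst h
    have h2 := congrArg WithLp.snd h
    simpa [L₁, L₂] using And.intro h1 h2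
  let w : Fin d → Fin d → EuclideanSpace ℂ (Fin d × Fin d) := fun i j =>
    EuclideanSpace.single (i, j) 1 - EuclideanSpace.single (j, i) 1
  have hw : ∀ c : Matrix (Fin d) (Fin d) ℂ, ∑ i, ∑ j, (1 / 2 * c i j) • w i j =
      WithLp.toLp 2 fun k => 1 / 2 * (c k.1 k.2 - c k.2 k.1) := by
    intro c
    ext ⟨k, l⟩
    simp only [w, smul_sub, Finset.sum_sub_distrib, PiLp.sub_apply, WithLp.ofLp_sum,
      Finset.sum_apply, PiLp.smul_apply, PiLp.single_apply, Prod.mk.injEq, smul_eq_mul,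
      mul_ite, mul_one, mul_zero, ite_and, Finset.sum_ite_eq, Finset.mem_univ, if_true]
    rw [mul_sub]
    congr 1
    simp [Finset.sum_ite_irrel]
  let e : ℝ → Option (Fin d ⊕ Fin d × Fin d) → Aux d := fun t k => k.elim (L₁ (u t))
    (Sum.elim (fun i => L₁ (F i t)) fun ij => (1 / 2 : ℂ) • (L₁ (F₂ ij.1 ij.2 t) + L₂ (w ij.1 ij.2)))
  have hsum : ∀ t (α : ℂ) (β : Fin d → ℂ) (Γ : Matrix (Fin d) (Fin d) ℂ),
      ∑ k : Option (Fin d ⊕ Fin d × Fin d), (k.elim α (Sum.elim β fun ij => Γ ij.1 ij.2) : ℂ) •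
        e t k = L₁ (α • u t + ∑ i, β i • F i t + ∑ i, ∑ j, (1 / 2 * Γ i j) • F₂ i j t) +
          L₂ (∑ i, ∑ j, (1 / 2 * Γ i j) • w i j) := by
    intro t α β Γ
    rw [Fintype.sum_option, Fintype.sum_sum_type, Fintype.sum_prod_type]
    simp only [e, Option.elim, Sum.elim_inl, Sum.elim_inr, smul_smul, smul_add,
      Finset.sum_add_distrib, map_add, map_sum, map_smul, mul_comm (1 / 2 : ℂ), add_assoc]
  have hc := isLocIntegrable_coeff hJ (e := e) (f := fun t => L₁ (f t)) (c := fun t k =>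
    k.elim (α t) (Sum.elim (β t) fun ij => Γ t ij.1 ij.2)) (fun k => ?_) (fun t ht => ?_)
    (hfi.clm (L₁.restrictScalars ℝ)) fun t ht => ?_
  · refine ⟨hc.linear (LinearMap.proj none), IsLocIntegrable.pi fun i =>
      hc.linear (LinearMap.proj (some (Sum.inl i))), IsLocIntegrable.matrix fun i j =>
      hc.linear (LinearMap.proj (some (Sum.inr (i, j))))⟩
  · rcases k with _ | i | ⟨i, j⟩
    · exact L₁.continuous.comp_continuousOn (hu.continuousOn hε)
    · exact L₁.continuous.comp_continuousOn (hF i)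
    · exact ((L₁.continuous.comp_continuousOn (hF₂ i j)).add continuousOn_const).const_smul
        (1 / 2 : ℂ)
  · refine Fintype.linearIndependent_iff.2 fun c hc => ?_
    have hc' : c = fun k => k.elim (c none) (Sum.elim (fun i => c (some (Sum.inl i))) fun ij =>
        (Matrix.of fun i j => c (some (Sum.inr (i, j)))) ij.1 ij.2) := by
      funext k; rcases k with _ | i | ⟨i, j⟩ <;> rfl
    rw [hc', hsum] at hc
    obtain ⟨h1, h2⟩ := hL _ _ hc
    have hs : (Matrix.of fun i j => c (some (Sum.inr (i, j))))ᵀ =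
        Matrix.of fun i j => c (some (Sum.inr (i, j))) := by
      ext i j
      rw [hw] at h2
      have := congrArg (fun v : EuclideanSpace ℂ (Fin d × Fin d) => v (j, i)) h2
      simpa [sub_eq_zero] using this
    have hz : (fun x => quad (c none) (fun i => c (some (Sum.inl i)))
        (Matrix.of fun i j => c (some (Sum.inr (i, j)))) x) =ᵐ[volume] fun _ => 0 := by
      filter_upwards [coe_quad_combination (u t) (fun i => F i t) (fun i j => F₂ i j t) (c none)
        (fun i => c (some (Sum.inl i))) (Matrix.of fun i j => c (some (Sum.inr (i, j))))
        (hu.coe_ae_eq t ht) (fun i => hFe i t ht) (fun i j => hF₂e i j t ht),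
        Lp.coeFn_zero ℂ 2 (volume : Measure (Pos d))] with x hx hx0
      rw [h1, hx0] at hx
      exact (mul_eq_zero.1 hx.symm).resolve_right (packet_ne_zero (hκ t ht) _ _ _)
    have hz' := (Continuous.ae_eq_iff_eq volume (differentiable_quad _ _ _).continuous
      continuous_const).1 hz
    obtain ⟨r1, r2, r3⟩ := eq_zero_of_quad_eq_zero hs fun x => congrFun hz' x
    intro k
    rcases k with _ | i | ⟨i, j⟩
    · exact r1
    · exact congrFun r2 i
    · exact congrFun (congrFun r3 i) j
  · rw [hsum, hw]
    have : (fun k : Fin d × Fin d => 1 / 2 * (Γ t k.1 k.2 - Γ t k.2 k.1)) = 0 := by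
      funext k
      have := congrFun (congrFun (hΓ t ht) k.1) k.2
      rw [Matrix.transpose_apply] at this
      simp [this]
    rw [this, WithLp.toLp_zero, map_zero, add_zero]
    congr 1
    exact Lp.ext ((hf t ht).trans (coe_quad_combination (u t) (fun i => F i t) (fun i j => F₂ i j t)
      _ _ _ (hu.coe_ae_eq t ht) (fun i => hFe i t ht) (fun i j => hF₂e i j t ht)).symm)

theorem packet_mul_exp (hε : 0 < ε) (κ α : ℂ) (b β : Fin d → ℂ) (C Γ : Matrix (Fin d) (Fin d) ℂ)
    (x : Pos d) : packet ε κ b C x * cexp (quad α β Γ x) =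
      packet ε (κ * cexp α) (b + (ε / I : ℂ) • β) (C + (ε / I : ℂ) • Γ) x := by
  have hε' : (ε : ℂ) ≠ 0 := by exact_mod_cast hε.ne'
  have hc : I / ε * (ε / I) = (1 : ℂ) := by field_simp
  have e : quad α β Γ x = α + β ⬝ᵥ cvec x + 1 / 2 * (cvec x ⬝ᵥ Γ *ᵥ cvec x) := rfl
  rw [packet, packet, mul_assoc, mul_assoc, ← Complex.exp_add, ← Complex.exp_add, e,
    add_dotProduct, Matrix.add_mulVec, dotProduct_add, smul_dotProduct, Matrix.smul_mulVec,
    dotProduct_smul, smul_eq_mul, smul_eq_mul]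
  congr 2
  linear_combination (-(1 / 2 * (cvec x ⬝ᵥ Γ *ᵥ cvec x)) - β ⬝ᵥ cvec x) * hc

/-- A quadratic function as a linear function of its coefficients. -/
def quadL (x : Pos d) : (ℂ × (Fin d → ℂ) × Matrix (Fin d) (Fin d) ℂ) →ₗ[ℝ] ℂ where
  toFun w := quad w.1 w.2.1 w.2.2 x
  map_add' v w := by
    simp only [quad, Prod.fst_add, Prod.snd_add, add_dotProduct, Matrix.add_mulVec, dotProduct_add]
    ring
  map_smul' c w := by
    simp only [quad, Prod.smul_fst, Prod.smul_snd, smul_dotProduct, Matrix.smul_mulVec,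
      dotProduct_smul, RingHom.id_apply, Complex.real_smul]
    ring

/-- The evolution of the slope and the width of a curve of wave packets. -/
theorem IsPacketCurve.isPrimitiveOn_parameters (hε : 0 < ε) (hJ : J.OrdConnected)
    (hu : IsPacketCurve ε J κ b C u) (hκ : ∀ t ∈ J, κ t ≠ 0) (hC : ∀ t ∈ J, (C t)ᵀ = C t)
    (hΓ : ∀ t ∈ J, (Γ t)ᵀ = Γ t) {f : ℝ → Hilb d} (hp : IsPrimitiveOn J f u)
    (hf : ∀ t ∈ J, f t =ᵐ[volume] fun x =>
      quad (α t) (β t) (Γ t) x * packet ε (κ t) (b t) (C t) x) :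
    IsPrimitiveOn J (fun t => (ε / I : ℂ) • β t) b ∧
      IsPrimitiveOn J (fun t => (ε / I : ℂ) • Γ t) C := by
  obtain ⟨hα, hβ, hΓi⟩ := hu.isLocIntegrable_quad hε hJ hκ hΓ hp.isLocIntegrable hf
  let T : ℝ → ℂ × (Fin d → ℂ) × Matrix (Fin d) (Fin d) ℂ := fun t => (α t, β t, Γ t)
  have hT : IsLocIntegrable J T := fun s hs t ht =>
    ⟨(hα s hs t ht).1.prodMk ((hβ s hs t ht).1.prodMk (hΓi s hs t ht).1),
      (hα s hs t ht).2.prodMk ((hβ s hs t ht).2.prodMk (hΓi s hs t ht).2)⟩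
  have hlin : ∀ {E : Type} [NormedAddCommGroup E] [NormedSpace ℝ E] [CompleteSpace E]
      (L : ℂ × (Fin d → ℂ) × Matrix (Fin d) (Fin d) ℂ →ₗ[ℝ] E), ∀ s ∈ J, ∀ t ∈ J,
      ∫ τ in s..t, L (T τ) = L (∫ τ in s..t, T τ) := fun L s hs t ht =>
    L.toContinuousLinearMap.intervalIntegral_comp_comm (hT s hs t ht)
  have hv : ∀ x, IsLocIntegrable J fun t => quad (α t) (β t) (Γ t) x := fun x => hT.linear (quadL x)
  have hpc : ∀ x, ContinuousOn (fun t => packet ε (κ t) (b t) (C t) x) J := fun x =>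
    (continuous_packet_joint ε).comp_continuousOn ((hu.continuousOn_amplitude.prodMk
      (hu.continuousOn_slope.prodMk hu.continuousOn_width)).prodMk (continuousOn_const (c := x)))
  have hvp : ∀ x, IsLocIntegrable J fun t =>
      quad (α t) (β t) (Γ t) x * packet ε (κ t) (b t) (C t) x := fun x =>
    (hv x).bilin hJ (hpc x) (ContinuousLinearMap.mul ℝ ℂ)
  have key : ∀ s ∈ J, ∀ t ∈ J, b t = b s + (ε / I : ℂ) • (∫ τ in s..t, T τ).2.1 ∧
      C t = C s + (ε / I : ℂ) • (∫ τ in s..t, T τ).2.2 := by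
    intro s hs t ht
    obtain ⟨D, hDc, hDd⟩ := TopologicalSpace.exists_countable_dense J
    have hae : ∀ᵐ x, ∀ r ∈ D, packet ε (κ (r : ℝ)) (b r) (C r) x =
        packet ε (κ s) (b s) (C s) x + ∫ τ in s..r, quad (α τ) (β τ) (Γ τ) x *
          packet ε (κ τ) (b τ) (C τ) x := by
      refine (ae_ball_iff hDc).2 fun r _ => ?_
      filter_upwards [hu.integral_ae_eq hε hJ hα hβ hΓi hf hs r.2, hu.coe_ae_eq s hs,
        hu.coe_ae_eq r r.2, Lp.coeFn_sub (u r) (u s)] with x h1 h2 h3 h4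
      rw [← h1, ← (hp s hs r r.2).2, h4, Pi.sub_apply, h2, h3]
      ring
    have hall : packet ε (κ t) (b t) (C t) =ᵐ[volume] fun x => packet ε (κ s) (b s) (C s) x *
        cexp (quad (∫ τ in s..t, T τ).1 (∫ τ in s..t, T τ).2.1 (∫ τ in s..t, T τ).2.2 x) := by
      filter_upwards [hae] with x hx
      have hprim := (hvp x).isPrimitiveOn hJ hs (packet ε (κ s) (b s) (C s) x)
      have hext : (fun r : J => packet ε (κ (r : ℝ)) (b r) (C r) x) = fun r : J =>
          packet ε (κ s) (b s) (C s) x + ∫ τ in s..r, quad (α τ) (β τ) (Γ τ) x *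
            packet ε (κ τ) (b τ) (C τ) x :=
        Continuous.ext_on hDd (continuousOn_iff_continuous_domRestrict.1 (hpc x))
          (continuousOn_iff_continuous_domRestrict.1 (hprim.continuousOn hJ)) fun r hr => hx r hr
      have hprim' := hprim.congr hJ (fun _ _ => rfl) (y' := fun t => packet ε (κ t) (b t) (C t) x)
        fun r hr => (congrFun hext ⟨r, hr⟩).symm
      rw [hprim'.eq_mul_exp hJ (hv x) hs ht]
      congr 2
      exact hlin (quadL x) s hs t ht
    simp only [packet_mul_exp hε] at hall
    have hsym : ((∫ τ in s..t, T τ).2.2)ᵀ = (∫ τ in s..t, T τ).2.2 := by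
      have e1 := hlin (transposeL ℂ ∘ₗ LinearMap.snd ℝ _ _ ∘ₗ LinearMap.snd ℝ _ _) s hs t ht
      have e2 := hlin (LinearMap.snd ℝ _ _ ∘ₗ LinearMap.snd ℝ _ _) s hs t ht
      refine e1.symm.trans (Eq.trans ?_ e2)
      exact intervalIntegral.integral_congr fun τ hτ => hΓ τ (hJ.uIcc_subset hs ht hτ)
    exact (packet_injective hε (hκ t ht) (mul_ne_zero (hκ s hs) (Complex.exp_ne_zero _)) (hC t ht)
      (by rw [Matrix.transpose_add, Matrix.transpose_smul, hC s hs, hsym]) hall).2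
  constructor
  · intro s hs t ht
    refine ⟨hβ.linear ((LinearMap.lsmul ℂ (Fin d → ℂ) (ε / I)).restrictScalars ℝ) s hs t ht, ?_⟩
    rw [intervalIntegral.integral_smul, (key s hs t ht).1, add_sub_cancel_left]
    congr 1
    exact (hlin (LinearMap.fst ℝ _ _ ∘ₗ LinearMap.snd ℝ _ _) s hs t ht).symm
  · intro s hs t ht
    refine ⟨hΓi.linear ((LinearMap.lsmul ℂ (Matrix (Fin d) (Fin d) ℂ) (ε / I)).restrictScalars ℝ)
      s hs t ht, ?_⟩
    rw [intervalIntegral.integral_smul, (key s hs t ht).2, add_sub_cancel_left]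
    congr 1
    exact (hlin (LinearMap.snd ℝ _ _ ∘ₗ LinearMap.snd ℝ _ _) s hs t ht).symm

end Coefficients

/-! ### Time dependence of the averaged Hessian -/

section Measurability

open Filter Topology

variable {d : ℕ} {ε : ℝ} {J : Set ℝ}

theorem measurable_pd {H : ℝ → Phase d → ℝ} (hm : ∀ z, Measurable fun t => H t z)
    (hd : ∀ t, Differentiable ℝ (H t)) (i : Fin d ⊕ Fin d) (z : Phase d) :
    Measurable fun t => pd i (H t) z := by
  refine measurable_of_tendsto_metrizable (f := fun (n : ℕ) t => (n : ℝ) •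
    (H t (z + (n : ℝ)⁻¹ • EuclideanSpace.single i 1) - H t z)) (fun n => ?_) ?_
  · exact ((hm _).sub (hm _)).const_smul (n : ℝ)
  · exact tendsto_pi_nhds.2 fun t =>
      ((hd t z).hasFDerivAt.lim_real (EuclideanSpace.single i 1)).comp tendsto_natCast_atTop_atTop

theorem norm_pd_pd_le {a : Phase d → ℝ} (ha : IsSubquadratic a) (i k : Fin d ⊕ Fin d)
    (z : Phase d) : ‖pd k (pd i a) z‖ ≤ ‖iteratedFDeriv ℝ 2 a z‖ := by
  have hd : DifferentiableAt ℝ (fderiv ℝ a) z := (ha.contDiff_fderiv.differentiable (by simp)) z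
  have h1 : pd k (pd i a) z = fderiv ℝ (fderiv ℝ a) z (EuclideanSpace.single k 1)
      (EuclideanSpace.single i 1) := by
    show fderiv ℝ (fun z => fderiv ℝ a z (EuclideanSpace.single i 1)) z _ = _
    rw [fderiv_clm_apply hd (differentiableAt_const _)]
    simp
  rw [h1, ← norm_iteratedFDeriv_fderiv, norm_iteratedFDeriv_one]
  refine (ContinuousLinearMap.le_opNorm₂ _ _ _).trans ?_
  simp

theorem norm_average_le {a : Phase d → ℝ} {c : ℝ} (ha : ∀ z, ‖a z‖ ≤ c) (Z : Param d) :
    ‖average a Z‖ ≤ ((2 * Real.pi) ^ d)⁻¹ * ((∫ ζ : Phase d, gaussWeight ζ) * c) := by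
  rw [average_eq, norm_mul, Real.norm_of_nonneg (by positivity)]
  refine mul_le_mul_of_nonneg_left ?_ (by positivity)
  rw [← integral_mul_const]
  refine norm_integral_le_of_norm_le ?_ (Eventually.of_forall fun ζ => ?_)
  · exact ((PolyGrowth.const c).integrable (ι := Fin d ⊕ Fin d) (by fun_prop)).congr
      (Eventually.of_forall fun ζ => smul_eq_mul _ _)
  · rw [norm_smul, Real.norm_of_nonneg (gaussWeight_pos ζ).le]
    exact mul_le_mul_of_nonneg_left (ha _) (gaussWeight_pos ζ).le

theorem continuous_phasePoint_joint :
    Continuous fun w : Param d × Phase d => phasePoint w.1 w.2 := by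
  unfold phasePoint; fun_prop

theorem aestronglyMeasurable_average {H : ℝ → Phase d → ℝ} (hm : ∀ z, Measurable fun t => H t z)
    (hc : ∀ t, Continuous (H t)) {Z : ℝ → Param d} {μ : Measure ℝ} [SFinite μ]
    (hZ : AEStronglyMeasurable Z μ) : AEStronglyMeasurable (fun t => average (H t) (Z t)) μ := by
  have hu : Measurable (Function.uncurry fun (z : Phase d) (t : ℝ) => H t z) :=
    measurable_uncurry_of_continuous_of_measurable (fun t => hc t) hm
  have hp : AEMeasurable (fun w : ℝ × Phase d => (phasePoint (Z w.1) w.2, w.1))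
      (μ.prod volume) := by
    have h1 : AEStronglyMeasurable (fun w : ℝ × Phase d => (Z w.1, w.2)) (μ.prod volume) :=
      hZ.comp_fst.prodMk measurable_snd.aestronglyMeasurable
    exact (continuous_phasePoint_joint.comp_aestronglyMeasurable h1).aemeasurable.prodMk
      measurable_fst.aemeasurable
  have h2 : AEStronglyMeasurable (fun w : ℝ × Phase d => gaussWeight w.2 •
      H w.1 (phasePoint (Z w.1) w.2)) (μ.prod volume) :=
    (continuous_gaussWeight.comp continuous_snd).aestronglyMeasurable.smul
      (hu.comp_aemeasurable hp).aestronglyMeasurable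
  simp only [average_eq]
  exact h2.integral_prod_right'.const_mul _

/-- The averaged Hessian along a continuous curve is locally integrable. -/
theorem isLocIntegrable_meanHess {h : ℝ → Phase d → ℝ} (hh : IsAdmissibleSymbol h)
    (hJ : J.OrdConnected) {Z : ℝ → Param d} (hZ : ContinuousOn Z J) :
    IsLocIntegrable J fun t => meanHess (h t) (Z t) := by
  refine IsLocIntegrable.matrix fun i k s hs t ht => ?_
  obtain ⟨C, hC, hb⟩ := hh.subquadratic 2 le_rfl
  have ha := fun t => hh.isSubquadratic t
  have hm : ∀ z, Measurable fun t => pd k (pd i (h t)) z := fun z =>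
    measurable_pd (fun z => measurable_pd hh.measurable (fun t => (ha t).differentiable) i z)
      (fun t => ((ha t).pd i).differentiable) k z
  have hCi : IntervalIntegrable C volume s t :=
    (hC.integrableOn_isCompact isCompact_uIcc).intervalIntegrable
  have hsub : Set.uIoc s t ⊆ J := Set.uIoc_subset_uIcc.trans (hJ.uIcc_subset hs ht)
  rw [intervalIntegrable_iff] at hCi ⊢
  refine Integrable.mono' ((hCi.const_mul (∫ ζ : Phase d, gaussWeight ζ)).const_mul
    ((2 * Real.pi) ^ d)⁻¹) ?_ (Eventually.of_forall fun τ => norm_average_le (fun z =>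
      (norm_pd_pd_le (ha τ) i k z).trans (hb τ z)) _)
  exact aestronglyMeasurable_average hm (fun t => (((ha t).pd i).pd k).differentiable.continuous)
    ((hZ.mono hsub).aestronglyMeasurable measurableSet_uIoc)

theorem average_frame_congr (hε : 0 < ε) {q p : Pos d} {C : Matrix (Fin d) (Fin d) ℂ}
    {R R' : Matrix (Fin d) (Fin d) ℝ} (hR : IsFrame C R) (hR' : IsFrame C R') (a : Phase d → ℝ) :
    average a (frameCoords ε q p C R) = average a (frameCoords ε q p C R') := by
  refine average_congr a rfl ?_ ?_
  · rw [det_scaledWidth_frame hε q p hR]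
    exact isUnit_iff_ne_zero.2 (by positivity)
  · have e : toC R * (toC R)ᴴ = toC R' * (toC R')ᴴ := by
      rw [toC_conjTranspose, toC_conjTranspose, ← toC_mul, ← toC_mul, ← hR.inv, ← hR'.inv]
    simp only [scaledWidth_canonicalCoords, Matrix.transpose_smul, Matrix.smul_mul,
      Matrix.mul_smul, widthY_mul_transpose_congr (C := C) e]

end Measurability

/-! ### Continuous frames and the evolution of the centre -/

section Frame

variable {d : ℕ} {J : Set ℝ}

/-- A curve of widths admits a continuous frame. -/
theorem exists_continuous_frame (hJ : J.OrdConnected) {t₀ : ℝ} (h₀ : t₀ ∈ J)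
    {C Φ : ℝ → Matrix (Fin d) (Fin d) ℂ} (hC : IsPrimitiveOn J (fun t => -Φ t) C)
    (hs : ∀ t ∈ J, (C t)ᵀ = C t) (hΦ : ∀ t ∈ J, (Φ t)ᵀ = Φ t)
    (hA : ∀ t ∈ J, ((C t).map im).PosDef) :
    ∃ R : ℝ → Matrix (Fin d) (Fin d) ℝ, ContinuousOn R J ∧ ∀ t ∈ J, IsFrame (C t) (R t) := by
  obtain ⟨R₀, hR₀⟩ := exists_isFrame (hs t₀ h₀) (hA t₀ h₀)
  let imL : Matrix (Fin d) (Fin d) ℂ →ₗ[ℝ] Matrix (Fin d) (Fin d) ℝ :=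
    { toFun := fun M => M.map im
      map_add' := fun _ _ => by ext; simp
      map_smul' := fun _ _ => by ext; simp }
  have hA' : IsPrimitiveOn J (fun t => -(Φ t).map im) fun t => (C t).map im :=
    (hC.linear imL).congr hJ (fun t _ => map_neg imL _) fun _ _ => rfl
  have hAinv := continuousOn_matrix_inv (hA'.continuousOn hJ) fun t ht => (hA t ht).isUnit
  have hM : IsLocIntegrable J fun t => (1 / 2 : ℝ) • (((C t).map im)⁻¹ * (Φ t).map im) :=
    ((hA'.isLocIntegrable.neg.bilinear hJ hAinv (mulL ℝ).flip).linear
      (LinearMap.lsmul ℝ (Matrix (Fin d) (Fin d) ℝ) (1 / 2))).congr hJ fun t _ => by simp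
  obtain ⟨R, hR0, hR⟩ := exists_linear_solution hJ h₀
    (A := fun t => ContinuousLinearMap.mul ℝ (Matrix (Fin d) (Fin d) ℝ)
      ((1 / 2 : ℝ) • (((C t).map im)⁻¹ * (Φ t).map im)))
    (fun t ht => hM.clm (ContinuousLinearMap.mul ℝ (Matrix (Fin d) (Fin d) ℝ)) t₀ h₀ t ht) R₀
  refine ⟨R, hR.continuousOn hJ, fun t ht => ?_⟩
  have hf : (R t)ᵀ * ((C t).map im * R t) = 1 := by
    have h1 := ((hR.linear (transposeL ℝ)).bilinear (hA'.bilinear hR hJ (mulL ℝ)) hJ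
      (mulL ℝ)).congr hJ (g' := fun _ => 0) (fun τ hτ => ?_) fun _ _ => rfl
    · have h2 := h1.eq_of_zero h₀ ht
      simp only [mulL_apply, transposeL_apply, hR0] at h2
      rw [h2, ← Matrix.mul_assoc, hR₀.factor]
    · have hdet : IsUnit ((C τ).map im).det := (Matrix.isUnit_iff_isUnit_det _).1 (hA τ hτ).isUnit
      have s1 : (((C τ).map im)⁻¹)ᵀ = ((C τ).map im)⁻¹ := by
        rw [Matrix.transpose_nonsing_inv, symm_im (hs τ hτ)]
      have s2 := symm_im (hΦ τ hτ)
      simp only [mulL_apply, transposeL_apply, ContinuousLinearMap.mul_apply',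
        Matrix.transpose_mul, Matrix.transpose_smul, s1, s2, Matrix.smul_mul, Matrix.mul_smul,
        Matrix.mul_assoc, Matrix.mul_add, Matrix.neg_mul, Matrix.mul_neg,
        Matrix.nonsing_inv_mul_cancel_left _ _ hdet, Matrix.mul_nonsing_inv_cancel_left _ _ hdet]
      module
  refine ⟨hs t ht, ?_, by rw [Matrix.mul_assoc]; exact hf⟩
  have := (Matrix.isUnit_iff_isUnit_det _).1 (IsUnit.of_mul_eq_one_right _ hf)
  rw [Matrix.det_mul] at this
  exact isUnit_of_mul_isUnit_right this

theorem im_mulVec_ofReal (C : Matrix (Fin d) (Fin d) ℂ) (v : Fin d → ℝ) (i : Fin d) :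
    ((C *ᵥ fun j => (v j : ℂ)) i).im = (C.map im *ᵥ v) i := by
  simp [Matrix.mulVec, dotProduct]

/-- The evolution of the centre of a wave packet in terms of its slope and width. -/
theorem isPrimitiveOn_center (hJ : J.OrdConnected) {q p : ℝ → Fin d → ℝ} {g k : ℝ → Fin d → ℝ}
    {C Φ : ℝ → Matrix (Fin d) (Fin d) ℂ} (hA : ∀ t ∈ J, ((C t).map im).PosDef)
    (hC : IsPrimitiveOn J (fun t => -Φ t) C)
    (hb : IsPrimitiveOn J (fun t => -((fun i => (k t i : ℂ)) + C t *ᵥ fun i => (g t i : ℂ)) +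
      Φ t *ᵥ fun i => (q t i : ℂ)) fun t => (fun i => (p t i : ℂ)) - C t *ᵥ fun i => (q t i : ℂ)) :
    IsPrimitiveOn J (fun t i => (g t i : ℂ)) (fun t i => (q t i : ℂ)) ∧
      IsPrimitiveOn J (fun t => -fun i => (k t i : ℂ)) (fun t i => (p t i : ℂ)) := by
  let imL : Matrix (Fin d) (Fin d) ℂ →ₗ[ℝ] Matrix (Fin d) (Fin d) ℝ :=
    { toFun := fun M => M.map im
      map_add' := fun _ _ => by ext; simp
      map_smul' := fun _ _ => by ext; simp }
  let imV : (Fin d → ℂ) →ₗ[ℝ] (Fin d → ℝ) :=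
    { toFun := fun v i => -(v i).im
      map_add' := fun _ _ => by ext; simp; ring
      map_smul' := fun _ _ => by ext; simp }
  let reV : (Fin d → ℝ) →ₗ[ℝ] (Fin d → ℂ) :=
    { toFun := fun v i => (v i : ℂ)
      map_add' := fun _ _ => by ext; simp
      map_smul' := fun _ _ => by ext; simp }
  have hA' : IsPrimitiveOn J (fun t => -(Φ t).map im) fun t => (C t).map im :=
    (hC.linear imL).congr hJ (fun t _ => map_neg imL _) fun _ _ => rfl
  have hAq : IsPrimitiveOn J (fun t => (C t).map im *ᵥ g t - (Φ t).map im *ᵥ q t)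
      (fun t => (C t).map im *ᵥ q t) := by
    refine (hb.linear imV).congr hJ (fun t _ => ?_) fun t _ => ?_
    · funext i
      show -((-((fun i => (k t i : ℂ)) + C t *ᵥ fun i => (g t i : ℂ)) +
        Φ t *ᵥ fun i => (q t i : ℂ)) i).im = _
      simp only [Pi.add_apply, Pi.neg_apply, add_im, neg_im, im_mulVec_ofReal, ofReal_im,
        Pi.sub_apply]
      ring
    · funext i
      show -(((fun i => (p t i : ℂ)) - C t *ᵥ fun i => (q t i : ℂ)) i).im = _
      simp only [Pi.sub_apply, sub_im, im_mulVec_ofReal, ofReal_im]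
      ring
  have hq : IsPrimitiveOn J g q := by
    refine ((hA'.matrix_inv hJ fun t ht => (hA t ht).isUnit).bilinear hAq hJ (mulVecL ℝ)).congr hJ
      (fun t ht => ?_) fun t ht => ?_ <;>
    have hdet : IsUnit ((C t).map im).det := (Matrix.isUnit_iff_isUnit_det _).1 (hA t ht).isUnit
    · simp only [mulVecL_apply, Matrix.mulVec_sub, Matrix.mulVec_mulVec, Matrix.mul_neg,
        Matrix.neg_mul, neg_neg, Matrix.mul_assoc, Matrix.nonsing_inv_mul _ hdet, Matrix.mul_one,
        Matrix.one_mulVec]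
      abel
    · simp only [mulVecL_apply, Matrix.mulVec_mulVec, Matrix.nonsing_inv_mul _ hdet,
        Matrix.one_mulVec]
  have hqC := hq.linear reV
  refine ⟨hqC, (hb.add (hC.bilinear hqC hJ (mulVecL ℂ))).congr hJ (fun t _ => ?_) fun t _ => ?_⟩
  · simp only [mulVecL_apply, Matrix.neg_mulVec]
    show -((fun i => (k t i : ℂ)) + C t *ᵥ fun i => (g t i : ℂ)) + Φ t *ᵥ (fun i => (q t i : ℂ)) +
      (-(Φ t *ᵥ fun i => (q t i : ℂ)) + C t *ᵥ fun i => (g t i : ℂ)) = _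
    abel
  · exact sub_add_cancel _ _

end Frame

/-! ### From the variational approximation to Hamilton's equations -/

section Direct

variable {d : ℕ} {ε : ℝ} {J : Set ℝ}

theorem continuousOn_canonicalCoords {q p : ℝ → Pos d} {Q P : ℝ → Matrix (Fin d) (Fin d) ℂ}
    (hq : ContinuousOn (fun t => cvec (q t)) J) (hp : ContinuousOn (fun t => cvec (p t)) J)
    (hQ : ContinuousOn Q J) (hP : ContinuousOn P J) :
    ContinuousOn (fun t => canonicalCoords ε (q t) (p t) (Q t) (P t)) J := by
  have hre : ∀ {q : ℝ → Pos d}, ContinuousOn (fun t => cvec (q t)) J → ∀ i,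
      ContinuousOn (fun t => q t i) J := fun h i =>
    continuous_re.comp_continuousOn (continuousOn_pi.1 h i)
  have hent : ∀ {M : ℝ → Matrix (Fin d) (Fin d) ℂ}, ContinuousOn M J → ∀ i j,
      ContinuousOn (fun t => M t i j) J := fun h i j =>
    continuousOn_pi.1 (continuousOn_pi.1 h i) j
  refine (EuclideanSpace.equiv (Coord d ⊕ Coord d) ℝ).symm.continuous.comp_continuousOn
    (continuousOn_pi.2 ?_)
  rintro ((i | ⟨j, i⟩ | ⟨j, i⟩) | (i | ⟨j, i⟩ | ⟨j, i⟩))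
  · exact hre hq i
  · exact continuousOn_const.mul (continuous_re.comp_continuousOn (hent hQ i j))
  · exact continuousOn_const.mul (continuous_im.comp_continuousOn (hent hQ i j))
  · exact hre hp i
  · exact continuousOn_const.mul (continuous_re.comp_continuousOn (hent hP i j))
  · exact continuousOn_const.mul (continuous_im.comp_continuousOn (hent hP i j))

/-- Variational approximations have Hagedorn parameters that solve Hamilton's equations. -/
theorem exists_hamilton_parameters (hε : 0 < ε) {h : ℝ → Phase d → ℝ} (hh : IsAdmissibleSymbol h)
    (hJ : J.OrdConnected) {t₀ : ℝ} (h₀ : t₀ ∈ J) {u : ℝ → Hilb d}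
    (hu : IsDiracFrenkelSolution ε h J u) {q₀ p₀ : Pos d} {Q₀ P₀ : Matrix (Fin d) (Fin d) ℂ}
    (hu₀ : HasHagedornParameters ε (u t₀) q₀ p₀ Q₀ P₀) :
    ∃ (q p : ℝ → Pos d) (Q P : ℝ → Matrix (Fin d) (Fin d) ℂ),
      q t₀ = q₀ ∧ p t₀ = p₀ ∧ Q t₀ = Q₀ ∧ P t₀ = P₀ ∧
      (∀ t ∈ J, HasHagedornParameters ε (u t) (q t) (p t) (Q t) (P t)) ∧
      IsCaratheodorySolution J (hamiltonField h)
        (fun t => canonicalCoords ε (q t) (p t) (Q t) (P t)) := by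
  have ha := fun t => hh.isSubquadratic t
  have hprim : IsPrimitiveOn J (fun t => diracFrenkelField ε h t (u t)) u := hu.equation
  have hdata : ∀ t, ∃ (q p : Pos d) (C : Matrix (Fin d) (Fin d) ℂ) (ζ : ℂ)
      (R : Matrix (Fin d) (Fin d) ℝ), t ∈ J → IsFrame C R ∧ u t =ᵐ[volume] gaussian ε q p C ζ ∧
        (t = t₀ → q = q₀ ∧ p = p₀ ∧ C = P₀ * Q₀⁻¹) := by
    intro t
    by_cases ht : t ∈ J
    · by_cases ht₀ : t = t₀
      · obtain ⟨ζ, hζ⟩ := hu₀.exists_gaussian hε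
        obtain ⟨R, hR⟩ := hu₀.exists_frame
        exact ⟨q₀, p₀, _, ζ, R, fun _ => ⟨hR, by rw [ht₀]; exact hζ, fun _ => ⟨rfl, rfl, rfl⟩⟩⟩
      · obtain ⟨q, p, C, ζ, hs, hC, hg⟩ := hu.mem_manifold t ht
        obtain ⟨R, hR⟩ := exists_isFrame hs hC
        exact ⟨q, p, C, ζ, R, fun _ => ⟨hR, hg, fun h => absurd h ht₀⟩⟩
    · exact ⟨0, 0, 0, 0, 0, fun h => absurd h ht⟩
  choose q p C ζ R hdat using hdata
  have hR := fun t ht => (hdat t ht).1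
  have hg := fun t ht => (hdat t ht).2.1
  obtain ⟨hq₀, hp₀, hC₀⟩ := (hdat t₀ h₀).2.2 rfl
  have hs : ∀ t ∈ J, (C t)ᵀ = C t := fun t ht => (hR t ht).symm
  have hA : ∀ t ∈ J, ((C t).map im).PosDef := fun t ht => (hR t ht).posDef
  set κ : ℝ → ℂ := fun t => cexp (I / ε * (1 / 2 * (cvec (q t) ⬝ᵥ C t *ᵥ cvec (q t)) -
    cvec (p t) ⬝ᵥ cvec (q t) + ζ t)) with hκdef
  have hκ : ∀ t ∈ J, κ t ≠ 0 := fun t _ => Complex.exp_ne_zero _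
  have hcurve : IsPacketCurve ε J κ (fun t => cvec (p t) - C t *ᵥ cvec (q t)) C u :=
    isPacketCurve_of_continuousOn hε (hprim.continuousOn hJ) hκ hs hA fun t ht => by
      rw [hκdef, ← gaussian_eq_packet ε _ _ (hs t ht)]; exact hg t ht
  set Z : ℝ → Param d := fun t => frameCoords ε (q t) (p t) (C t) (R t) with hZ
  set c : ℂ := (I * (ε : ℂ))⁻¹ with hc
  have hcε : (ε / I : ℂ) * c = -1 := by
    have : (ε : ℂ) ≠ 0 := by exact_mod_cast hε.ne'
    rw [hc, div_mul_eq_mul_div, mul_inv, mul_comm I⁻¹, mul_inv_cancel_left₀ this, inv_I]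
    field_simp
  have hquad : ∀ t x, c * quad (forceConst ε (h t) (Z t) (C t)) (forceGrad (h t) (Z t) (C t))
      (forceHess (h t) (Z t) (C t)) (x - q t) = quad (c * (forceConst ε (h t) (Z t) (C t) -
        forceGrad (h t) (Z t) (C t) ⬝ᵥ cvec (q t) +
          1 / 2 * (cvec (q t) ⬝ᵥ forceHess (h t) (Z t) (C t) *ᵥ cvec (q t))))
        (c • (forceGrad (h t) (Z t) (C t) - forceHess (h t) (Z t) (C t) *ᵥ cvec (q t)))
        (c • forceHess (h t) (Z t) (C t)) x := fun t x => by
    rw [quad_sub_point _ _ (forceHess_transpose (ha t) _ _), mul_quad]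
  obtain ⟨hb, hC⟩ := hcurve.isPrimitiveOn_parameters (α := fun t => c * (forceConst ε (h t) (Z t)
      (C t) - forceGrad (h t) (Z t) (C t) ⬝ᵥ cvec (q t) +
        1 / 2 * (cvec (q t) ⬝ᵥ forceHess (h t) (Z t) (C t) *ᵥ cvec (q t))))
      (β := fun t => c • (forceGrad (h t) (Z t) (C t) -
        forceHess (h t) (Z t) (C t) *ᵥ cvec (q t)))
      (Γ := fun t => c • forceHess (h t) (Z t) (C t)) hε hJ hκ hs (fun t _ => by
    rw [Matrix.transpose_smul, forceHess_transpose (ha t)]) hprim (f := fun t =>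
      diracFrenkelField ε h t (u t)) (fun t ht => by
    refine (Lp.coeFn_smul _ _).trans ?_
    filter_upwards [starProjection_weylOp hε (hR t ht) (hg t ht) (ha t)] with x hx
    rw [Pi.smul_apply, hx, smul_eq_mul, ← mul_assoc]
    exact congrArg₂ (· * ·) (hquad t x) (congrFun (gaussian_eq_packet ε _ _ (hs t ht) _) x))
  have hC' : IsPrimitiveOn J (fun t => -forceHess (h t) (Z t) (C t)) C :=
    hC.congr hJ (fun t _ => by rw [smul_smul, hcε, neg_one_smul]) fun _ _ => rfl
  obtain ⟨hqp, hpp⟩ := isPrimitiveOn_center hJ (q := fun t => q t) (p := fun t => p t)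
    (g := fun t i => meanGrad (h t) (Z t) (Sum.inr i))
    (k := fun t i => meanGrad (h t) (Z t) (Sum.inl i)) hA hC' (hb.congr hJ (fun t ht => by
      rw [smul_smul, hcε, neg_one_smul, forceGrad_eq (hs t ht), neg_sub, sub_eq_neg_add]; rfl)
      fun _ _ => rfl)
  obtain ⟨R', hR'c, hR'⟩ := exists_continuous_frame hJ h₀ hC' hs
    (fun t _ => forceHess_transpose (ha t) _ _) hA
  have hCc := hC'.continuousOn hJ
  have htoC : ContinuousOn (fun t => toC (R' t)) J :=
    (Continuous.matrix_map continuous_id continuous_ofReal).comp_continuousOn hR'c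
  have hK : IsLocIntegrable J fun t => meanHess (h t) (Z t) :=
    (isLocIntegrable_meanHess hh hJ (continuousOn_canonicalCoords (ε := ε) (hqp.continuousOn hJ)
      (hpp.continuousOn hJ) htoC (hCc.mul htoC))).congr hJ fun t ht => by
        ext i j; exact average_frame_congr hε (hR' t ht) (hR t ht) _
  have hW : IsLocIntegrable J fun t => (hessStack (meanHess (h t) (Z t)) (C t)).toRows₂ :=
    (((hK.linear (ofRealL _ _)).bilinear hJ (continuous_stack.comp_continuousOn hCc)
      (mulL ℂ)).linear rows₂L)
  obtain ⟨Q, hQ₀, hQ⟩ := exists_linear_solution hJ h₀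
    (A := fun t => ContinuousLinearMap.mul ℝ (Matrix (Fin d) (Fin d) ℂ)
      ((hessStack (meanHess (h t) (Z t)) (C t)).toRows₂))
    (fun t ht => hW.clm (ContinuousLinearMap.mul ℝ (Matrix (Fin d) (Fin d) ℂ)) t₀ h₀ t ht) Q₀
  have hY := isPrimitiveOn_widthY hJ (K := fun t => meanHess (h t) (Z t)) (hC'.congr hJ
    (fun t ht => by rw [forceHess_eq (hs t ht)]) fun _ _ => rfl) hQ
  have hQ₀u : IsUnit Q₀.det := (Matrix.isUnit_iff_isUnit_det _).1 hu₀.1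
  have hP₀ : C t₀ * Q t₀ = P₀ := by
    rw [hC₀, hQ₀, Matrix.mul_assoc, Matrix.nonsing_inv_mul _ hQ₀u, Matrix.mul_one]
  have hsym : ∀ t ∈ J, (widthY (Q t) (C t * Q t))ᵀ * Omega (Fin d) * widthY (Q t) (C t * Q t) =
      Omega (Fin d) := fun t ht => by
    rw [symplectic_form_conserved hJ (fun τ _ => meanHess_transpose (ha τ) _) hY h₀ ht, hP₀, hQ₀]
    exact hu₀.symplectic
  have hCQ : ∀ t ∈ J, C t * Q t * (Q t)⁻¹ = C t := fun t ht =>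
    Matrix.mul_nonsing_inv_cancel_right _ _
      ((Matrix.isUnit_iff_isUnit_det _).1 (width_of_symplectic (hsym t ht)).1)
  have hav : ∀ t ∈ J, ∀ a : Phase d → ℝ, average a (Z t) =
      average a (canonicalCoords ε (q t) (p t) (Q t) (C t * Q t)) := fun t ht a => by
    have := average_frame (q := q t) (p := p t) hε (hsym t ht) (R := R t)
      (by rw [hCQ t ht]; exact hR t ht) a
    rwa [hCQ t ht] at this
  have hgrad : ∀ t ∈ J, meanGrad (h t) (Z t) =
      meanGrad (h t) (canonicalCoords ε (q t) (p t) (Q t) (C t * Q t)) := fun t ht =>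
    funext fun i => hav t ht _
  have hhess : ∀ t ∈ J, meanHess (h t) (Z t) =
      meanHess (h t) (canonicalCoords ε (q t) (p t) (Q t) (C t * Q t)) := fun t ht => by
    ext i j; exact hav t ht _
  refine ⟨q, p, Q, fun t => C t * Q t, hq₀, hp₀, hQ₀, hP₀, fun t ht => ?_, ?_⟩
  · refine hasHagedornParameters_of_gaussian hε (hsym t ht) (ζ := ζ t) ?_ ?_
    · rw [hCQ t ht]; exact hg t ht
    · rw [norm_conserved hε hJ ha hu.mem_manifold hu.equation h₀ ht]
      exact hu₀.norm_eq_one hε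
  · refine (isCaratheodorySolution_canonical_iff hε ha hJ rfl).2 ⟨?_, ?_, ?_⟩
    · exact hqp.congr hJ (fun t ht => by rw [hgrad t ht]) fun _ _ => rfl
    · exact hpp.congr hJ (fun t ht => by rw [hgrad t ht]) fun _ _ => rfl
    · exact hY.congr hJ (fun t ht => by rw [hhess t ht]) fun _ _ => rfl

end Direct

end GaussianWavePacket

end

open GaussianWavePacket in
theorem mainTheorem6 (d : ℕ) (ε : ℝ) (hε : 0 < ε) (h : ℝ → Phase d → ℝ)
    (hh : IsAdmissibleSymbol h) :
    -- the averaged Hamiltonian is a well-defined differentiable function of the coordinates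
    (∀ t : ℝ, (∀ Z : Param d, Integrable (averageIntegrand (h t) Z) volume) ∧
      Differentiable ℝ (average (h t))) ∧
    -- it is the energy expectation value of the wave packet
    (∀ (t : ℝ) (u : Hilb d) (q p : Pos d) (Q P : Matrix (Fin d) (Fin d) ℂ),
      HasHagedornParameters ε u q p Q P →
        u ∈ weylDomain ε (h t) ∧
          inner ℂ u (weylOp ε (h t) u) =
            ((average (h t) (canonicalCoords ε q p Q P) : ℝ) : ℂ)) ∧
    ∀ I : Set ℝ, I.OrdConnected → ∀ t₀ ∈ I,
      -- the parameters of a variational Gaussian approximation obey Hamilton's equations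
      (∀ u : ℝ → Hilb d, IsDiracFrenkelSolution ε h I u →
        ∀ (q₀ p₀ : Pos d) (Q₀ P₀ : Matrix (Fin d) (Fin d) ℂ),
          HasHagedornParameters ε (u t₀) q₀ p₀ Q₀ P₀ →
          ∃ (q p : ℝ → Pos d) (Q P : ℝ → Matrix (Fin d) (Fin d) ℂ),
            q t₀ = q₀ ∧ p t₀ = p₀ ∧ Q t₀ = Q₀ ∧ P t₀ = P₀ ∧
            (∀ t ∈ I, HasHagedornParameters ε (u t) (q t) (p t) (Q t) (P t)) ∧
            IsCaratheodorySolution I (hamiltonField h)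
              (fun t => canonicalCoords ε (q t) (p t) (Q t) (P t))) ∧
      -- conversely, solutions of Hamilton's equations give variational approximations
      (∀ (q p : ℝ → Pos d) (Q P : ℝ → Matrix (Fin d) (Fin d) ℂ),
        IsCaratheodorySolution I (hamiltonField h)
          (fun t => canonicalCoords ε (q t) (p t) (Q t) (P t)) →
        (∀ t ∈ I, IntervalIntegrable
          (fun τ => average (h τ) (canonicalCoords ε (q τ) (p τ) (Q τ) (P τ))) volume t₀ t) →
        ∀ u₀ : Hilb d, HasHagedornParameters ε u₀ (q t₀) (p t₀) (Q t₀) (P t₀) →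
          ∃ u : ℝ → Hilb d, u t₀ = u₀ ∧ IsDiracFrenkelSolution ε h I u ∧
            ∀ t ∈ I, HasHagedornParameters ε (u t) (q t) (p t) (Q t) (P t)) := by
  have ha := fun t => hh.isSubquadratic t
  refine ⟨fun t => ⟨fun Z => ?_, differentiable_average (ha t)⟩,
    fun t u q p Q P hu => hu.energy hε (ha t), fun J hJ t₀ h₀ => ⟨?_, ?_⟩⟩
  · rw [show averageIntegrand (h t) Z = fun ζ => gaussWeight ζ • h t (phasePoint Z ζ) from
      funext (averageIntegrand_eq (h t) Z)]
    exact (ha t).integrable Z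
  · intro u hu q₀ p₀ Q₀ P₀ hu₀
    exact exists_hamilton_parameters hε hh hJ h₀ hu hu₀
  · intro q p Q P hZ hint u₀ hu₀
    exact exists_isDiracFrenkelSolution hε ha hJ h₀ hZ hint hu₀
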